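/- Let $d\ge 1$ be a squarefree integer, $k=\mathbb{Q}(\sqrt{-d})$ with ring of integers $\mathfrak{o}$, $F$ a quaternion algebra over $\mathbb{Q}$, and $M\supset F$ an extension of $F$ to a quaternion algebra over $k$ (so $M\cong k\otimes_{\mathbb{Q}}F$). For a prime $p$ put $k_p=\mathbb{Q}_p\otimes_{\mathbb{Q}} k$, $\mathfrak{o}_p=\mathbb{Z}_p\mathfrak{o}\subset k_p$, $F_p=\mathbb{Q}_p\otimes_{\mathbb{Q}} F$ and $M_p=\mathbb{Q}_p\otimes_{\mathbb{Q}} M\cong k_p\otimes_k M$. An $F_p$-order is a $\mathbb{Z}_p$-order in $F_p$, an $M_p$-order is an $\mathfrak{o}_p$-order in $M_p$; maximal orders are those maximal under inclusion. Let $\Sigma_k(F)$ be the product of the primes that are split in $k$ and at which $F$ is ramified. Let $p$ be a prime with $p\nmid\Sigma_k(F)$. Let $\mathfrak{F}_p$ be a maximal $F_p$-order, $\mathfrak{O}_p\subset\mathfrak{F}_p$ an order isomorphic to $\mathfrak{o}_p$, and $\mathfrak{G}_p$ an $F_p$-order with $\mathfrak{O}_p\subset\mathfrak{G}_p\subset\mathfrak{F}_p$.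 Let $C(\mathfrak{G}_p)$ be the number of $M_p$-maximal orders $\mathfrak{N}_p$ with $F_p\cap\mathfrak{N}_p=\mathfrak{G}_p$. Say that $F_p$ splits if $F_p\cong M_2(\mathbb{Q}_p)$. (i) If $p$ is split in $k$, then $C(\mathfrak{G}_p)=1$ for $\mathfrak{G}_p=\mathfrak{F}_p$, and $C(\mathfrak{G}_p)=2$ for $\mathfrak{G}_p\ne\mathfrak{F}_p$. (ii) If $p$ is inert in $k$, then $C(\mathfrak{G}_p)=1$ if $F_p$ splits and $\mathfrak{G}_p=\mathfrak{F}_p$, and $C(\mathfrak{G}_p)=2$ if $F_p$ does not split or $\mathfrak{G}_p\ne\mathfrak{F}_p$. (iii) If $p$ is ramified in $k$, then $C(\mathfrak{G}_p)=1$ for $\mathfrak{G}_p=\mathfrak{F}_p$. For $\mathfrak{G}_p\ne\mathfrak{F}_p$ the index $[\mathfrak{F}_p:\mathfrak{G}_p]$ equals $p^r$ for some $r\ge 1$, and $C(\mathfrak{G}_p)$ is as follows. For $p\ne 2$: $$\begin{array}{c|ccc} r & 1 & 2 & \ge 3\\ \hline F_p \text{ splits} & 1 & p-1 & 2p\\ F_p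 \text{ does not split} & p+1 & 2p & 2p\end{array}$$ For $p=2$ (where $d\equiv 1$ or $2 \pmod 4$): $$\begin{array}{l|ccccccc} r & 1 & 2 & 3 & 4 & 5 & 6 & \ge 7\\ \hline d\equiv 1\ (4),\ F_2 \text{ splits} & 1&1&2&4&8&8&8\\ d\equiv 1\ (4),\ F_2 \text{ does not split} & 3&2&4&8&8&8&8\\ d\equiv 2\ (4),\ F_2 \text{ splits} & 1&1&2&4&4&8&16\\ d\equiv 2\ (4),\ F_2 \text{ does not split} & 3&2&4&4&8&16&16\end{array}$$ -/

import Mathlib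

open scoped TensorProduct

namespace QuatEmb

/-- `A` is a quaternion algebra over the field `K` (of characteristic not `2`):
it has a basis `1, i, j, ij` with `i² = a`, `j² = b`, `ij = -ji`, for some nonzero `a, b` in `K`. -/
def IsQuaternionAlgebra (K A : Type*) [Field K] [Ring A] [Algebra K A] : Prop :=
  ∃ a b : K, a ≠ 0 ∧ b ≠ 0 ∧ Nonempty (A ≃ₐ[K] QuaternionAlgebra K a 0 b)

/-- The `p`-component `A_p = ℚ_p ⊗_ℚ A` of a `ℚ`-algebra `A`. For a `k`-algebra `M` this is the
same as `k_p ⊗_k M`, since `k_p = ℚ_p ⊗_ℚ k`. -/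
abbrev Comp (p : ℕ) [Fact p.Prime] (A : Type*) [Ring A] [Algebra ℚ A] : Type _ :=
  ℚ_[p] ⊗[ℚ] A

section Orders

variable (p : ℕ) [Fact p.Prime]

/-- The map `A_p → B_p` induced by a homomorphism `A → B` of `ℚ`-algebras. -/
noncomputable def compMap {A B : Type*} [Ring A] [Algebra ℚ A] [Ring B] [Algebra ℚ B]
    (f : A →ₐ[ℚ] B) : Comp p A →ₐ[ℤ_[p]] Comp p B :=
  (Algebra.TensorProduct.map (AlgHom.id ℚ_[p] ℚ_[p]) f).restrictScalars ℤ_[p]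

/-- A `ℤ_p`-order in `A_p`: a (unital) `ℤ_p`-subalgebra that is a finitely generated `ℤ_p`-module
and spans `A_p` over `ℚ_p`. -/
structure IsOrder {A : Type*} [Ring A] [Algebra ℚ A] (G : Subalgebra ℤ_[p] (Comp p A)) : Prop where
  fg : (Subalgebra.toSubmodule G).FG
  span_eq_top : Submodule.span ℚ_[p] (G : Set (Comp p A)) = ⊤

/-- A maximal `ℤ_p`-order in `A_p`. -/
def IsMaximalOrder {A : Type*} [Ring A] [Algebra ℚ A] (G : Subalgebra ℤ_[p] (Comp p A)) : Prop :=
  Maximal (IsOrder p) G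

/-- `𝔬_p = ℤ_p 𝔬 ⊆ k_p`, where `𝔬` is the ring of integers of `k`. -/
noncomputable def integersAt (k : Type*) [Field k] [NumberField k] :
    Subalgebra ℤ_[p] (Comp p k) :=
  Algebra.adjoin ℤ_[p]
    (Set.range fun a : NumberField.RingOfIntegers k => (1 : ℚ_[p]) ⊗ₜ[ℚ] (a : k))

/-- An `M_p`-order, for a `k`-algebra `M`, is an `𝔬_p`-order in `M_p`. As `𝔬_p` is a finitely
generated `ℤ_p`-module, this is the same as a `ℤ_p`-order in `M_p` that contains (the image of)
`𝔬_p`. -/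
structure IsOrderOver (k : Type*) [Field k] [NumberField k] {M : Type*} [Ring M] [Algebra ℚ M]
    [Algebra k M] [IsScalarTower ℚ k M] (N : Subalgebra ℤ_[p] (Comp p M)) : Prop where
  isOrder : IsOrder p N
  integers_le : (integersAt p k).map (compMap p (IsScalarTower.toAlgHom ℚ k M)) ≤ N

/-- An `M_p`-maximal order: a maximal `𝔬_p`-order in `M_p`. -/
def IsMaximalOrderOver (k : Type*) [Field k] [NumberField k] {M : Type*} [Ring M] [Algebra ℚ M]
    [Algebra k M] [IsScalarTower ℚ k M] (N : Subalgebra ℤ_[p] (Comp p M)) : Prop :=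
  Maximal (IsOrderOver p k) N

/-- The number `C(𝔊_p)` of `M_p`-maximal orders `𝔑_p` with `F_p ∩ 𝔑_p = 𝔊_p`, where `F` is embedded
in `M` by `ι`. -/
noncomputable def embeddingCount (k : Type*) [Field k] [NumberField k] {F M : Type*}
    [Ring F] [Algebra ℚ F] [Ring M] [Algebra ℚ M] [Algebra k M] [IsScalarTower ℚ k M]
    (ι : F →ₐ[ℚ] M) (G : Subalgebra ℤ_[p] (Comp p F)) : ℕ∞ :=
  Set.encard {N : Subalgebra ℤ_[p] (Comp p M) |
    IsMaximalOrderOver p k N ∧ N.comap (compMap p ι) = G}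

/-- The index `[H : G]` of additive groups, for `G ⊆ H`. -/
noncomputable def orderIndex {A : Type*} [Ring A] [Algebra ℚ A]
    (H G : Subalgebra ℤ_[p] (Comp p A)) : ℕ :=
  (Subalgebra.toSubmodule G).toAddSubgroup.relIndex (Subalgebra.toSubmodule H).toAddSubgroup

/-- `F` splits at `p`, i.e. `F_p ≅ M₂(ℚ_p)`. A quaternion algebra that does not split at `p` is
ramified at `p`. -/
def SplitsAt (F : Type*) [Ring F] [Algebra ℚ F] : Prop :=
  Nonempty (Comp p F ≃ₐ[ℚ_[p]] Matrix (Fin 2) (Fin 2) ℚ_[p])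

end Orders

section Primes

variable (p : ℕ) (k : Type*) [Field k] [NumberField k]

/-- The ideal `p𝔬` of the ring of integers `𝔬` of `k`. -/
def primeIdeal : Ideal (NumberField.RingOfIntegers k) :=
  Ideal.span {(p : NumberField.RingOfIntegers k)}

/-- `p` is split in the quadratic field `k`. -/
def IsSplitPrime : Prop :=
  ∃ P Q : Ideal (NumberField.RingOfIntegers k),
    P.IsPrime ∧ Q.IsPrime ∧ P ≠ Q ∧ primeIdeal p k = P * Q

/-- `p` is inert in the quadratic field `k`. -/
def IsInertPrime : Prop := (primeIdeal p k).IsPrime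

/-- `p` is ramified in the quadratic field `k`. -/
def IsRamifiedPrime : Prop :=
  ∃ P : Ideal (NumberField.RingOfIntegers k), P.IsPrime ∧ primeIdeal p k = P ^ 2

/-- `p ∣ Σ_k(F)`, where `Σ_k(F)` is the product of the primes at which `F` is ramified and that
are split in `k`: the prime `p` is one of the factors. -/
def DvdSigma [Fact p.Prime] (F : Type*) [Ring F] [Algebra ℚ F] : Prop :=
  ¬ SplitsAt p F ∧ IsSplitPrime p k

end Primes

/-! Tables for a prime ramified in `k`; the argument `r` is the exponent in `[𝔉_p : 𝔊_p] = p ^ r`.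
Only the values for `r ≥ 1` are used. -/

/-- `p ≠ 2`, `F` split at `p`. -/
def tableOddSplit (p : ℕ) : ℕ → ℕ
  | 0 => 1
  | 1 => 1
  | 2 => p - 1
  | _ => 2 * p

/-- `p ≠ 2`, `F` ramified at `p`. -/
def tableOddRamified (p : ℕ) : ℕ → ℕ
  | 0 => 1
  | 1 => p + 1
  | _ => 2 * p

/-- `p = 2`, `d ≡ 1 (mod 4)`, `F` split at `2`. -/
def tableTwoOneSplit : ℕ → ℕ
  | 0 => 1
  | 1 => 1
  | 2 => 1
  | 3 => 2
  | 4 => 4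
  | _ => 8

/-- `p = 2`, `d ≡ 1 (mod 4)`, `F` ramified at `2`. -/
def tableTwoOneRamified : ℕ → ℕ
  | 0 => 1
  | 1 => 3
  | 2 => 2
  | 3 => 4
  | _ => 8

/-- `p = 2`, `d ≡ 2 (mod 4)`, `F` split at `2`. -/
def tableTwoTwoSplit : ℕ → ℕ
  | 0 => 1
  | 1 => 1
  | 2 => 1
  | 3 => 2
  | 4 => 4
  | 5 => 4
  | 6 => 8
  | _ => 16

/-- `p = 2`, `d ≡ 2 (mod 4)`, `F` ramified at `2`. -/
def tableTwoTwoRamified : ℕ → ℕ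
  | 0 => 1
  | 1 => 3
  | 2 => 2
  | 3 => 4
  | 4 => 4
  | 5 => 8
  | _ => 16

end QuatEmb

set_option linter.unusedSectionVars false


/-! Suppose first that k_p = K is a field, with integers O, uniformizer ϖ, valuation v and
conjugation z ↦ z̄. The order 𝔒_p puts a copy of K into F_p, so F_p is a cyclic algebra K + jK with
j² = b, where b matters only up to norms from K. Moreover F_p splits exactly when b is a norm
(`nonempty_equiv_matrix_iff`). Accordingly M_p = M₂(K), in which F_p consists of the matrices with
rows (α, b γ̄) and (γ, ᾱ) (`exists_matrix_equiv`). The maximal O-orders of M₂(K) are the stabilizers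
of lattices. Up to scaling a lattice has a basis (ϖ^n, 0), (u, 1), with n an integer and u a class
modulo ϖ^n (`IsUniformizer.maximal_iff`, `IsUniformizer.vertexOrder_eq_iff`).

The stabilizer with parameters (n, u) contains the copy of O if and only if (ω - ω̄)u ∈ ϖ^n O. It
then meets F_p in the elements with γ ∈ ϖ^m O and α - uγ ∈ O, where m = max(-n, n - v(b - N(u)))
(`cyclicMatrix_mem_vertexOrder`). Conversely an order of F_p containing 𝔒_p is determined by this
level m and by one class modulo O (`IsCyclicOrder.le_of_hasLevel`). What remains is to count pairs
(n, u).

If K is unramified, ω - ω̄ is a unit and one may take u = 0. The equation max(-n, n - v(b)) = m has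
the solutions n = -m and n = m + v(b), which coincide only when 2m = -v(b). Here b is normalized to
be 1 in the split case and of valuation 1 otherwise.

If K is ramified, let δ = v(ω - ω̄). This is 1 for odd p, and for p = 2 it is 2 or 3 according as d
≡ 1 or 2 modulo 4. Normalize b to be 1 in the split case and a suitable unit otherwise. For e ≤ δ -
1, the congruence N(u) ≡ b mod ϖ^(2e) is equivalent to u ≡ 1 mod ϖ^e. Hence above the minimal level
m₀ (-δ if F_p splits, 1 - δ if not) an order is determined by its level, and its index in the
maximal order is p^(m - m₀). Elements of ℚ_p have even valuation in K, which forces n = 2i - m. In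
the regular range each i ≥ 1 contributes a shell of p^i - p^(i-1) classes of u, and i = 0
contributes one class. For m > δ there is one further term p^δ at i = m, and the sum telescopes to
2p^δ. The irregular small entries of the tables come from the threshold e = δ. In the nonsplit case
no norm is that close to b. In the split case with p = 2, a norm that is close to 1 at e = δ - 1 is
already close at e = δ. In the split case with p odd, exactly the two classes u ≡ ±1 have norm ≡ 1.

If p splits in k, then M_p = M₂(ℚ_p)² with F_p = M₂(ℚ_p) embedded diagonally. An order containing
𝔒_p contains the diagonal idempotents, hence is given by two exponents r, s, and it is the
intersection of the two stabilizers n = -r and n = s. Only the order of this pair is free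
(`encard_pairs`).

The global input is an integral basis 1, w with w² = c + tw. The factorization of p𝔬 becomes
congruence conditions on c and t: no root modulo p, an Eisenstein polynomial after a shift of w, or
two distinct roots modulo p. -/

namespace LocalOrders

open scoped Matrix

/-! ### Discrete valuation rings described by a uniformizer, and their fractional ideals. -/

section Uniformizer

variable {p : ℕ} [Fact p.Prime] {K : Type*} [Field K] [Algebra ℤ_[p] K]

/-- `O` is a discrete valuation ring with fraction field `K` and uniformizer `ϖ`, finitely generated
as a `ℤ_[p]`-module. -/
structure IsUniformizer (O : Subalgebra ℤ_[p] K) (ϖ : K) : Prop where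
  mem : ϖ ∈ O
  inv_notMem : ϖ⁻¹ ∉ O
  exists_unit : ∀ x : K, x ≠ 0 → ∃ n : ℤ, x * ϖ ^ (-n) ∈ O ∧ (x * ϖ ^ (-n))⁻¹ ∈ O
  fg : (Subalgebra.toSubmodule O).FG
  p_mem : (p : K) * ϖ⁻¹ ∈ O

/-- The fractional ideal `ϖ ^ n O`. -/
def fracIdeal (O : Subalgebra ℤ_[p] K) (ϖ : K) (n : ℤ) : Submodule ℤ_[p] K where
  carrier := {x | x * ϖ ^ (-n) ∈ O}
  add_mem' := by
    intro x y hx hy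
    simp only [Set.mem_ofPred_eq, add_mul] at *
    exact O.add_mem hx hy
  zero_mem' := by simp
  smul_mem' := by
    intro c x hx
    simp only [Set.mem_ofPred_eq, smul_mul_assoc] at *
    exact O.smul_mem hx c

variable {O : Subalgebra ℤ_[p] K} {ϖ : K}

theorem mem_fracIdeal {n : ℤ} {x : K} : x ∈ fracIdeal O ϖ n ↔ x * ϖ ^ (-n) ∈ O := Iff.rfl

@[simp]
theorem mem_fracIdeal_zero {x : K} : x ∈ fracIdeal O ϖ 0 ↔ x ∈ O := by
  simp [mem_fracIdeal]

/-- `x` has valuation exactly `n`. -/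
def HasVal (O : Subalgebra ℤ_[p] K) (ϖ x : K) (n : ℤ) : Prop :=
  x ≠ 0 ∧ x ∈ fracIdeal O ϖ n ∧ x⁻¹ ∈ fracIdeal O ϖ (-n)

namespace IsUniformizer

variable (h : IsUniformizer O ϖ)

include h

theorem ne_zero : ϖ ≠ 0 := by
  rintro rfl
  exact h.inv_notMem (by simp)

theorem zpow_mem {n : ℤ} (hn : 0 ≤ n) : ϖ ^ n ∈ O := by
  lift n to ℕ using hn
  simpa using O.pow_mem h.mem n

theorem zpow_mem_iff {n : ℤ} : ϖ ^ n ∈ O ↔ 0 ≤ n := by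
  refine ⟨fun hn => ?_, h.zpow_mem⟩
  by_contra! hlt
  apply h.inv_notMem
  have : ϖ⁻¹ = ϖ ^ n * ϖ ^ (-n - 1) := by
    rw [← zpow_add₀ h.ne_zero, ← zpow_neg_one]; congr 1; ring
  rw [this]
  exact O.mul_mem hn (h.zpow_mem (by omega))

theorem mul_mem {m n : ℤ} {x y : K} (hx : x ∈ fracIdeal O ϖ m) (hy : y ∈ fracIdeal O ϖ n) :
    x * y ∈ fracIdeal O ϖ (m + n) := by
  rw [mem_fracIdeal] at *
  have : x * y * ϖ ^ (-(m + n)) = (x * ϖ ^ (-m)) * (y * ϖ ^ (-n)) := by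
    rw [neg_add, zpow_add₀ h.ne_zero]; ring
  rw [this]
  exact O.mul_mem hx hy

theorem zpow_mem_fracIdeal {m n : ℤ} : ϖ ^ n ∈ fracIdeal O ϖ m ↔ m ≤ n := by
  rw [mem_fracIdeal, ← zpow_add₀ h.ne_zero, h.zpow_mem_iff]
  omega

theorem anti {m n : ℤ} (hmn : m ≤ n) {x : K} (hx : x ∈ fracIdeal O ϖ n) :
    x ∈ fracIdeal O ϖ m := by
  rw [mem_fracIdeal] at *
  have : x * ϖ ^ (-m) = x * ϖ ^ (-n) * ϖ ^ (n - m) := by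
    rw [mul_assoc, ← zpow_add₀ h.ne_zero]; congr 2; ring
  rw [this]
  exact O.mul_mem hx (h.zpow_mem (by omega))

theorem int_mul_mem {m : ℤ} {x y : K} (hx : x ∈ O) (hy : y ∈ fracIdeal O ϖ m) :
    x * y ∈ fracIdeal O ϖ m := by
  simpa using h.mul_mem (m := 0) (by simpa using hx) hy

theorem exists_hasVal {x : K} (hx : x ≠ 0) : ∃ n, HasVal O ϖ x n := by
  obtain ⟨n, h1, h2⟩ := h.exists_unit x hx
  refine ⟨n, hx, h1, ?_⟩
  rw [mem_fracIdeal]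
  rw [mul_inv, ← zpow_neg] at h2
  exact h2

theorem hasVal_zpow (n : ℤ) : HasVal O ϖ (ϖ ^ n) n := by
  refine ⟨zpow_ne_zero _ h.ne_zero, h.zpow_mem_fracIdeal.2 le_rfl, ?_⟩
  rw [← zpow_neg]
  exact h.zpow_mem_fracIdeal.2 le_rfl

theorem mul_mem_iff {n m : ℤ} {x y : K} (hx : HasVal O ϖ x n) :
    x * y ∈ fracIdeal O ϖ m ↔ y ∈ fracIdeal O ϖ (m - n) := by
  constructor
  · intro hxy
    have := h.mul_mem hx.2.2 hxy
    rw [← mul_assoc, inv_mul_cancel₀ hx.1, one_mul] at this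
    rwa [sub_eq_neg_add]
  · intro hy
    simpa using h.mul_mem hx.2.1 hy

theorem mem_iff {n m : ℤ} {x : K} (hx : HasVal O ϖ x n) : x ∈ fracIdeal O ϖ m ↔ m ≤ n := by
  have := h.mul_mem_iff (y := 1) (m := m) hx
  rw [mul_one] at this
  rw [this, ← zpow_zero ϖ, h.zpow_mem_fracIdeal]
  omega

theorem exists_mem (x : K) : ∃ n, x ∈ fracIdeal O ϖ n := by
  by_cases hx : x = 0
  · exact ⟨0, by simp [hx]⟩
  · obtain ⟨n, hn⟩ := h.exists_hasVal hx
    exact ⟨n, hn.2.1⟩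

/-- A nonzero bounded set that is closed under addition and multiplication by `O` is a fractional
ideal. -/
theorem exists_eq_fracIdeal (S : AddSubgroup K) (hO : ∀ a ∈ O, ∀ x ∈ S, a * x ∈ S)
    (hne : ∃ x ∈ S, x ≠ 0) {t : ℤ} (hb : ∀ x ∈ S, x ∈ fracIdeal O ϖ t) :
    ∃ s, ∀ x, x ∈ S ↔ x ∈ fracIdeal O ϖ s := by
  have hex : ∃ z : ℤ, ∃ x ∈ S, HasVal O ϖ x z := by
    obtain ⟨x, hx, hx0⟩ := hne
    obtain ⟨n, hn⟩ := h.exists_hasVal hx0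
    exact ⟨n, x, hx, hn⟩
  -- An element of least valuation generates; the bound `hb` makes the least valuation exist.
  obtain ⟨s, ⟨x, hxS, hxs⟩, hmin⟩ := Int.exists_least_of_bdd
    (P := fun z => ∃ x ∈ S, HasVal O ϖ x z)
    ⟨t, fun z ⟨x, hx, hz⟩ => (h.mem_iff hz).1 (hb x hx)⟩ hex
  refine ⟨s, fun y => ⟨fun hy => ?_, fun hy => ?_⟩⟩
  · by_cases hy0 : y = 0
    · simp [hy0]
    · obtain ⟨n, hn⟩ := h.exists_hasVal hy0
      exact (h.mem_iff hn).2 (hmin n ⟨y, hy, hn⟩)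
  · have : y = (y * x⁻¹) * x := by rw [inv_mul_cancel_right₀ hxs.1]
    rw [this]
    refine hO _ ?_ _ hxS
    have := h.mul_mem hy hxs.2.2
    simpa using this

theorem exists_le_fracIdeal_of_fg {V : Submodule ℤ_[p] K} (hV : V.FG) :
    ∃ t, V ≤ fracIdeal O ϖ t := by
  obtain ⟨S, rfl⟩ := hV
  choose f hf using h.exists_mem
  obtain ⟨t, ht⟩ := S.finite_toSet.image f |>.bddBelow
  refine ⟨t, Submodule.span_le.2 fun x hx => h.anti (ht ⟨x, hx, rfl⟩) (hf x)⟩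

theorem p_pow_mem (x : K) : ∃ N : ℕ, (p : K) ^ N * x ∈ O := by
  obtain ⟨n, hn⟩ := h.exists_mem x
  refine ⟨(-n).toNat, ?_⟩
  have h1 : (p : K) ∈ fracIdeal O ϖ 1 := by simpa [mem_fracIdeal] using h.p_mem
  have h2 : ∀ N : ℕ, (p : K) ^ N ∈ fracIdeal O ϖ N := by
    intro N
    induction N with
    | zero => simp
    | succ N ih => rw [pow_succ]; exact_mod_cast h.mul_mem ih h1
  have := h.anti (m := 0) (by omega) (h.mul_mem (h2 (-n).toNat) hn)
  simpa using this

end IsUniformizer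

end Uniformizer

/-! ### Lattices in K² and their stabilizers. -/

section Vertex

variable {p : ℕ} [Fact p.Prime] {K : Type*} [Field K] [Algebra ℤ_[p] K]
variable {O : Subalgebra ℤ_[p] K} {ϖ : K}

/-- The matrix of the basis `(ϖ ^ n, 0)`, `(u, 1)` of a lattice in `K²`. -/
def latticeMatrix (ϖ : K) (n : ℤ) (u : K) : Matrix (Fin 2) (Fin 2) K := !![ϖ ^ n, u; 0, 1]

/-- The inverse of `latticeMatrix`. -/
def latticeMatrixInv (ϖ : K) (n : ℤ) (u : K) : Matrix (Fin 2) (Fin 2) K :=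
  !![ϖ ^ (-n), -u * ϖ ^ (-n); 0, 1]

theorem latticeMatrix_mul_inv (hϖ : ϖ ≠ 0) (n : ℤ) (u : K) :
    latticeMatrix ϖ n u * latticeMatrixInv ϖ n u = 1 := by
  have h1 : ϖ ^ n * ϖ ^ (-n) = 1 := by rw [← zpow_add₀ hϖ]; simp
  rw [latticeMatrix, latticeMatrixInv, Matrix.mul_fin_two, Matrix.one_fin_two]
  congr 1
  simp only [h1]
  ext i j
  fin_cases i <;> fin_cases j <;> simp [-zpow_neg]
  linear_combination (-u) * h1

theorem latticeMatrixInv_mul (hϖ : ϖ ≠ 0) (n : ℤ) (u : K) :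
    latticeMatrixInv ϖ n u * latticeMatrix ϖ n u = 1 :=
  mul_eq_one_comm.1 (latticeMatrix_mul_inv hϖ n u)

/-- The stabilizer of the lattice with basis `(ϖ ^ n, 0)`, `(u, 1)`. -/
def vertexOrder (O : Subalgebra ℤ_[p] K) (ϖ : K) (hϖ : ϖ ≠ 0) (n : ℤ) (u : K) :
    Subalgebra ℤ_[p] (Matrix (Fin 2) (Fin 2) K) where
  carrier := {X | ∀ i j, (latticeMatrixInv ϖ n u * X * latticeMatrix ϖ n u) i j ∈ O}
  mul_mem' := by
    intro X Y hX hY i j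
    have : latticeMatrixInv ϖ n u * (X * Y) * latticeMatrix ϖ n u =
        (latticeMatrixInv ϖ n u * X * latticeMatrix ϖ n u) *
        (latticeMatrixInv ϖ n u * Y * latticeMatrix ϖ n u) := by
      calc _ = latticeMatrixInv ϖ n u * X * 1 * Y * latticeMatrix ϖ n u := by
            simp only [Matrix.mul_assoc, Matrix.one_mul]
        _ = _ := by
            rw [← latticeMatrix_mul_inv hϖ n u]; simp only [Matrix.mul_assoc]
    rw [this, Matrix.mul_apply]
    exact O.sum_mem fun l _ => O.mul_mem (hX i l) (hY l j)
  add_mem' := by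
    intro X Y hX hY i j
    rw [Matrix.mul_add, Matrix.add_mul, Matrix.add_apply]
    exact O.add_mem (hX i j) (hY i j)
  algebraMap_mem' := by
    intro r i j
    rw [Algebra.algebraMap_eq_smul_one, Matrix.mul_smul, Matrix.smul_mul, Matrix.mul_one,
      latticeMatrixInv_mul hϖ, Matrix.smul_apply, Matrix.one_apply]
    refine O.smul_mem ?_ r
    split_ifs
    exacts [O.one_mem, O.zero_mem]

theorem mem_vertexOrder_iff_conj {hϖ : ϖ ≠ 0} {n : ℤ} {u : K} {X : Matrix (Fin 2) (Fin 2) K} :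
    X ∈ vertexOrder O ϖ hϖ n u ↔
      ∀ i j, (latticeMatrixInv ϖ n u * X * latticeMatrix ϖ n u) i j ∈ O := Iff.rfl

theorem latticeMatrix_conj (hϖ : ϖ ≠ 0) (n : ℤ) (u x y z w : K) :
    latticeMatrixInv ϖ n u * !![x, y; z, w] * latticeMatrix ϖ n u =
      !![x - u * z, (y + x * u - u ^ 2 * z - u * w) * ϖ ^ (-n); z * ϖ ^ n, z * u + w] := by
  have h1 : ϖ ^ n * ϖ ^ (-n) = 1 := by rw [← zpow_add₀ hϖ]; simp
  rw [latticeMatrix, latticeMatrixInv, Matrix.mul_fin_two, Matrix.mul_fin_two]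
  ext i j
  fin_cases i <;> fin_cases j <;> simp [-zpow_neg]
  · linear_combination (x - u * z) * h1
  · ring

theorem mem_vertexOrder {hϖ : ϖ ≠ 0} {n : ℤ} {u x y z w : K} :
    !![x, y; z, w] ∈ vertexOrder O ϖ hϖ n u ↔ x - u * z ∈ O ∧ z * u + w ∈ O ∧
      z ∈ fracIdeal O ϖ (-n) ∧ y + x * u - u ^ 2 * z - u * w ∈ fracIdeal O ϖ n := by
  rw [mem_vertexOrder_iff_conj, latticeMatrix_conj hϖ]
  simp [Fin.forall_fin_two, mem_fracIdeal]
  tauto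

/-- The right-hand side is symmetric in the two stabilizers, so an inclusion between them is already
an equality. This is what makes them maximal. -/
theorem IsUniformizer.vertexOrder_le_iff (h : IsUniformizer O ϖ) {n n' : ℤ} {u u' : K} :
    vertexOrder O ϖ h.ne_zero n u ≤ vertexOrder O ϖ h.ne_zero n' u' ↔
      n = n' ∧ u - u' ∈ fracIdeal O ϖ n := by
  constructor
  · intro hle
    -- `h1` and `h2` are the conjugates of the matrix units E₁₂ and E₂₁ by `latticeMatrix`. Their
    -- off-diagonal entries give n' ≤ n and n ≤ n', and a diagonal entry of the second then compares
    -- u with u'.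
    have h1 : !![0, ϖ ^ n; 0, 0] ∈ vertexOrder O ϖ h.ne_zero n u := by
      rw [mem_vertexOrder]; simp [h.zpow_mem_fracIdeal, -zpow_neg]
    have h2 : !![u * ϖ ^ (-n), -u ^ 2 * ϖ ^ (-n); ϖ ^ (-n), -u * ϖ ^ (-n)] ∈
        vertexOrder O ϖ h.ne_zero n u := by
      rw [mem_vertexOrder]
      refine ⟨by simp, ?_, h.zpow_mem_fracIdeal.2 le_rfl, ?_⟩
      · convert O.zero_mem using 1; ring
      · convert Submodule.zero_mem _ using 1; ring
    have h1' := hle h1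
    have h2' := hle h2
    rw [mem_vertexOrder] at h1' h2'
    have a1 := h1'.2.2.2
    have a2 := h2'.2.2.1
    simp only [zero_mul, add_zero, mul_zero, sub_zero, h.zpow_mem_fracIdeal] at a1 a2
    have e : n = n' := by omega
    refine ⟨e, ?_⟩
    rw [mem_fracIdeal]
    convert h2'.1 using 1
    ring
  · rintro ⟨rfl, hu⟩ X hX
    rw [Matrix.eta_fin_two X] at hX ⊢
    rw [mem_vertexOrder] at *
    obtain ⟨a1, a2, a3, a4⟩ := hX
    generalize X 0 0 = x at *
    generalize X 0 1 = y at *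
    generalize X 1 0 = z at *
    generalize X 1 1 = w at *
    have b1 : (u - u') * z ∈ O := by simpa using h.mul_mem hu a3
    refine ⟨?_, ?_, a3, ?_⟩
    · convert O.add_mem a1 b1 using 1; ring
    · convert O.sub_mem a2 b1 using 1; ring
    · have b2 := h.int_mul_mem (O.sub_mem a1 a2) hu
      have b3 := h.int_mul_mem b1 hu
      convert Submodule.sub_mem _ (Submodule.sub_mem _ a4 b2) b3 using 1
      ring

theorem IsUniformizer.vertexOrder_eq_iff (h : IsUniformizer O ϖ) {n n' : ℤ} {u u' : K} :
    vertexOrder O ϖ h.ne_zero n u = vertexOrder O ϖ h.ne_zero n' u' ↔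
      n = n' ∧ u - u' ∈ fracIdeal O ϖ n := by
  refine ⟨fun e => h.vertexOrder_le_iff.1 e.le, fun e => le_antisymm (h.vertexOrder_le_iff.2 e) ?_⟩
  obtain ⟨rfl, hu⟩ := e
  exact h.vertexOrder_le_iff.2 ⟨rfl, by rw [← neg_sub]; exact Submodule.neg_mem _ hu⟩

/-- Conjugation embeds the stabilizer into O⁴, and submodules of finitely generated ℤ_p-modules are
finitely generated. -/
theorem IsUniformizer.fg_vertexOrder (h : IsUniformizer O ϖ) (n : ℤ) (u : K) :
    (Subalgebra.toSubmodule (vertexOrder O ϖ h.ne_zero n u)).FG := by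
  have : Module.Finite ℤ_[p] O := Module.Finite.iff_fg.2 h.fg
  rw [← Module.Finite.iff_fg]
  let f : (Subalgebra.toSubmodule (vertexOrder O ϖ h.ne_zero n u)) →ₗ[ℤ_[p]]
      (Fin 2 → Fin 2 → O) :=
    { toFun := fun X i j => ⟨_, X.2 i j⟩
      map_add' := by
        intro X Y
        ext i j
        simp [Matrix.mul_add, Matrix.add_mul]
      map_smul' := by
        intro r X
        ext i j
        simp }
  refine Module.Finite.of_injective f fun X Y hXY => ?_
  have h1 : latticeMatrixInv ϖ n u * X.1 * latticeMatrix ϖ n u =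
      latticeMatrixInv ϖ n u * Y.1 * latticeMatrix ϖ n u := by
    ext i j
    exact congrArg Subtype.val (congrFun (congrFun hXY i) j)
  have key : ∀ Z : Matrix (Fin 2) (Fin 2) K, latticeMatrix ϖ n u *
      (latticeMatrixInv ϖ n u * Z * latticeMatrix ϖ n u) * latticeMatrixInv ϖ n u = Z := by
    intro Z
    calc _ = (latticeMatrix ϖ n u * latticeMatrixInv ϖ n u) * Z *
          (latticeMatrix ϖ n u * latticeMatrixInv ϖ n u) := by simp only [Matrix.mul_assoc]
      _ = Z := by rw [latticeMatrix_mul_inv h.ne_zero]; simp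
  apply Subtype.ext
  rw [← key X.1, h1, key]

/-- Every bounded submonoid of `M₂(K)` stabilizes a lattice. -/
theorem IsUniformizer.exists_le_vertexOrder (h : IsUniformizer O ϖ)
    (S : Submonoid (Matrix (Fin 2) (Fin 2) K)) {t : ℤ}
    (hS : ∀ X ∈ S, ∀ i j, X i j ∈ fracIdeal O ϖ t) :
    ∃ n u, ∀ X ∈ S, X ∈ vertexOrder O ϖ h.ne_zero n u := by
  -- The vectors that all of S carries into O². Since 1 ∈ S, L lies in O²; since the entries of S
  -- are bounded, L contains ϖ^(-t) O². Being a monoid, S preserves L.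
  let L : AddSubgroup (Fin 2 → K) :=
    { carrier := {w | ∀ X ∈ S, ∀ i, (X *ᵥ w) i ∈ O}
      add_mem' := by
        intro a b ha hb X hX i
        rw [Matrix.mulVec_add]
        exact O.add_mem (ha X hX i) (hb X hX i)
      zero_mem' := by
        intro X hX i
        simp
      neg_mem' := by
        intro a ha X hX i
        rw [Matrix.mulVec_neg]
        exact O.neg_mem (ha X hX i) }
  have hL : ∀ w, w ∈ L ↔ ∀ X ∈ S, ∀ i, (X *ᵥ w) i ∈ O := fun w => Iff.rfl
  have hsmul : ∀ a ∈ O, ∀ w ∈ L, a • w ∈ L := by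
    intro a ha w hw X hX i
    rw [Matrix.mulVec_smul]
    exact O.mul_mem ha (hw X hX i)
  have hstab : ∀ X ∈ S, ∀ w ∈ L, X *ᵥ w ∈ L := by
    intro X hX w hw Y hY i
    rw [Matrix.mulVec_mulVec]
    exact hw _ (S.mul_mem hY hX) i
  have hint : ∀ w ∈ L, ∀ i, w i ∈ O := by
    intro w hw i
    simpa using hw 1 S.one_mem i
  have hbig : ∀ w : Fin 2 → K, (∀ i, w i ∈ fracIdeal O ϖ (-t)) → w ∈ L := by
    intro w hw X hX i
    rw [Matrix.mulVec, dotProduct]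
    refine O.sum_mem fun j _ => ?_
    simpa using h.mul_mem (hS X hX i j) (hw j)
  -- A triangular basis of L: ϖ^l generates its intersection with the first axis, and ϖ^s below
  -- generates its projection to the second.
  obtain ⟨l, hl⟩ := h.exists_eq_fracIdeal (t := 0)
    (L.comap (AddMonoidHom.single (fun _ : Fin 2 => K) 0))
    (by
      intro a ha x hx
      have := hsmul a ha _ hx
      simp only [AddSubgroup.mem_comap, AddMonoidHom.single_apply] at *
      rwa [← smul_eq_mul, Pi.single_smul])
    ⟨ϖ ^ (-t), by
      apply hbig
      intro i
      fin_cases i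
      · simp [h.zpow_mem_fracIdeal, -zpow_neg]
      · simp, zpow_ne_zero _ h.ne_zero⟩
    (by
      intro x hx
      have := hint _ hx 0
      simpa using this)
  obtain ⟨s, hs⟩ := h.exists_eq_fracIdeal (t := 0)
    (L.map (Pi.evalAddMonoidHom (fun _ : Fin 2 => K) 1))
    (by
      rintro a ha x ⟨w, hw, rfl⟩
      exact ⟨a • w, hsmul a ha w hw, by simp⟩)
    ⟨ϖ ^ (-t), ⟨![0, ϖ ^ (-t)], by
      apply hbig
      intro i
      fin_cases i
      · simp
      · simp [h.zpow_mem_fracIdeal, -zpow_neg], by simp⟩, zpow_ne_zero _ h.ne_zero⟩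
    (by
      rintro x ⟨w, hw, rfl⟩
      have := hint _ hw 1
      simpa using this)
  obtain ⟨w, hw, hws⟩ := (hs (ϖ ^ s)).2 (h.zpow_mem_fracIdeal.2 le_rfl)
  have hw1 : w 1 = ϖ ^ s := hws
  have hcol0 : ![ϖ ^ l, 0] ∈ L := by
    have := (hl (ϖ ^ l)).2 (h.zpow_mem_fracIdeal.2 le_rfl)
    rw [AddSubgroup.mem_comap] at this
    convert this using 1
    ext i
    fin_cases i <;> simp
  have hLmem : ∀ v ∈ L, v 1 * ϖ ^ (-s) ∈ O ∧ (v 0 - v 1 * ϖ ^ (-s) * w 0) * ϖ ^ (-l) ∈ O := by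
    intro v hv
    have h1 : v 1 * ϖ ^ (-s) ∈ O := (hs (v 1)).1 ⟨v, hv, rfl⟩
    refine ⟨h1, ?_⟩
    have h2 : v - (v 1 * ϖ ^ (-s)) • w ∈ L := L.sub_mem hv (hsmul _ h1 _ hw)
    refine (hl _).1 ?_
    rw [AddSubgroup.mem_comap]
    convert h2 using 1
    ext i
    fin_cases i
    · simp
    · have h3 : ϖ ^ (-s) * ϖ ^ s = 1 := by rw [← zpow_add₀ h.ne_zero]; simp
      simp [hw1, mul_assoc]
      rw [inv_mul_cancel₀ (zpow_ne_zero _ h.ne_zero)]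
      simp
  -- L has basis (ϖ^l, 0), (w 0, ϖ^s). Dividing by ϖ^s brings it to the normal form without changing
  -- the stabilizer.
  refine ⟨l - s, w 0 * ϖ ^ (-s), fun X hX => ?_⟩
  have c0 := hLmem _ (hstab X hX _ hcol0)
  have c1 := hLmem _ (hstab X hX _ hw)
  rw [Matrix.eta_fin_two X] at c0 c1 ⊢
  generalize X 0 0 = x at *
  generalize X 0 1 = y at *
  generalize X 1 0 = z at *
  generalize X 1 1 = v at *
  simp only [Matrix.mulVec, dotProduct, Fin.sum_univ_two] at c0 c1
  simp [hw1] at c0 c1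
  rw [mem_vertexOrder]
  have hϖ := h.ne_zero
  have es : ϖ ^ s * (ϖ ^ s)⁻¹ = 1 := mul_inv_cancel₀ (zpow_ne_zero _ hϖ)
  have el : ϖ ^ l * (ϖ ^ l)⁻¹ = 1 := mul_inv_cancel₀ (zpow_ne_zero _ hϖ)
  simp only [mem_fracIdeal, neg_sub, zpow_sub₀ hϖ, zpow_neg, div_eq_mul_inv]
  refine ⟨?_, ?_, ?_, ?_⟩
  · convert c0.2 using 1
    linear_combination (-(x - w 0 * (ϖ ^ s)⁻¹ * z)) * el
  · convert c1.1 using 1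
    linear_combination (-v) * es
  · convert c0.1 using 1
    ring
  · convert c1.2 using 1
    linear_combination ((ϖ ^ l)⁻¹ * (x * w 0 - w 0 ^ 2 * (ϖ ^ s)⁻¹ * z)) * es

end Vertex

end LocalOrders

namespace LocalOrders

open scoped Matrix

/-! ### Orders over ℤ_p in ℚ_p-algebras. -/

section LatticeOrder

variable {p : ℕ} [Fact p.Prime]
variable {A : Type*} [Ring A] [Algebra ℚ_[p] A] [Algebra ℤ_[p] A] [IsScalarTower ℤ_[p] ℚ_[p] A]
variable {B : Type*} [Ring B] [Algebra ℚ_[p] B] [Algebra ℤ_[p] B] [IsScalarTower ℤ_[p] ℚ_[p] B]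

/-- A `ℤ_[p]`-order in a `ℚ_[p]`-algebra. -/
structure IsLatticeOrder (G : Subalgebra ℤ_[p] A) : Prop where
  fg : (Subalgebra.toSubmodule G).FG
  span_eq_top : Submodule.span ℚ_[p] (G : Set A) = ⊤

theorem exists_p_pow_mul_eq (c : ℚ_[p]) : ∃ (N : ℕ) (z : ℤ_[p]), (p : ℚ_[p]) ^ N * c = z := by
  obtain ⟨N, hN⟩ := pow_unbounded_of_one_lt ‖c‖
    (show (1 : ℝ) < p from by exact_mod_cast (Fact.out : p.Prime).one_lt)
  have hp : (0 : ℝ) < p := by exact_mod_cast (Fact.out : p.Prime).pos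
  refine ⟨N, ⟨(p : ℚ_[p]) ^ N * c, ?_⟩, rfl⟩
  rw [norm_mul, norm_pow, Padic.norm_p, inv_pow, inv_mul_le_iff₀ (by positivity), mul_one]
  exact hN.le

theorem p_pow_smul_mem_of_le {G : Subalgebra ℤ_[p] A} {N M : ℕ} (hNM : N ≤ M) {x : A}
    (h : (p : ℤ_[p]) ^ N • x ∈ G) : (p : ℤ_[p]) ^ M • x ∈ G := by
  obtain ⟨d, rfl⟩ := Nat.exists_eq_add_of_le hNM
  rw [add_comm, pow_add, mul_smul]
  exact G.smul_mem h _

/-- Spanning over ℚ_p becomes a statement about clearing denominators, which passes easily to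
preimages, images and products. -/
theorem span_eq_top_iff {G : Subalgebra ℤ_[p] A} :
    Submodule.span ℚ_[p] (G : Set A) = ⊤ ↔ ∀ x, ∃ N : ℕ, (p : ℤ_[p]) ^ N • x ∈ G := by
  have hp : (p : ℚ_[p]) ≠ 0 := by exact_mod_cast (Fact.out : p.Prime).ne_zero
  have hcast : ∀ (N : ℕ) (x : A), (p : ℤ_[p]) ^ N • x = (p : ℚ_[p]) ^ N • x := by
    intro N x
    rw [← algebraMap_smul ℚ_[p] ((p : ℤ_[p]) ^ N) x]
    simp
  constructor
  · intro h x
    have hx : x ∈ Submodule.span ℚ_[p] (G : Set A) := by rw [h]; trivial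
    induction hx using Submodule.span_induction with
    | mem x hx => exact ⟨0, by simpa using hx⟩
    | zero => exact ⟨0, by simp⟩
    | add x y _ _ hx hy =>
      obtain ⟨N, hN⟩ := hx
      obtain ⟨M, hM⟩ := hy
      refine ⟨max N M, ?_⟩
      rw [smul_add]
      exact G.add_mem (p_pow_smul_mem_of_le (le_max_left _ _) hN)
        (p_pow_smul_mem_of_le (le_max_right _ _) hM)
    | smul c x _ hx =>
      obtain ⟨N, hN⟩ := hx
      obtain ⟨M, z, hz⟩ := exists_p_pow_mul_eq c
      refine ⟨M + N, ?_⟩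
      have : (p : ℤ_[p]) ^ (M + N) • c • x = z • (p : ℤ_[p]) ^ N • x := by
        rw [hcast, hcast, ← algebraMap_smul ℚ_[p] z, smul_smul, smul_smul]
        congr 1
        change _ = (z : ℚ_[p]) * _
        rw [← hz]; ring
      rw [this]
      exact G.smul_mem hN z
  · intro h
    rw [eq_top_iff]
    intro x _
    obtain ⟨N, hN⟩ := h x
    have : x = ((p : ℚ_[p]) ^ N)⁻¹ • ((p : ℤ_[p]) ^ N • x) := by
      rw [hcast, smul_smul, inv_mul_cancel₀ (pow_ne_zero _ hp), one_smul]
    rw [this]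
    exact Submodule.smul_mem _ _ (Submodule.subset_span hN)

theorem IsLatticeOrder.comap {N : Subalgebra ℤ_[p] B} (hN : IsLatticeOrder N)
    (φ : A →ₐ[ℤ_[p]] B) (hφ : Function.Injective φ) : IsLatticeOrder (N.comap φ) := by
  constructor
  · have : Module.Finite ℤ_[p] (Subalgebra.toSubmodule N) := Module.Finite.iff_fg.2 hN.fg
    rw [← Module.Finite.iff_fg]
    let f : (Subalgebra.toSubmodule (N.comap φ)) →ₗ[ℤ_[p]] (Subalgebra.toSubmodule N) :=
      φ.toLinearMap.restrict fun x hx => hx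
    refine Module.Finite.of_injective f fun x y hxy => Subtype.ext (hφ ?_)
    exact congrArg Subtype.val hxy
  · rw [span_eq_top_iff]
    intro x
    obtain ⟨M, hM⟩ := span_eq_top_iff.1 hN.span_eq_top (φ x)
    exact ⟨M, by rw [Subalgebra.mem_comap, map_smul]; exact hM⟩

theorem isLatticeOrder_comap_iff {N : Subalgebra ℤ_[p] B} (e : A ≃ₐ[ℤ_[p]] B) :
    IsLatticeOrder (N.comap e.toAlgHom) ↔ IsLatticeOrder N := by
  refine ⟨fun h => ?_, fun h => h.comap _ e.injective⟩
  have := h.comap e.symm.toAlgHom e.symm.injective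
  convert this
  ext x
  simp

end LatticeOrder

/-! ### Maximal orders of M₂(K) are the stabilizers of lattices. -/

section Maximal

variable {p : ℕ} [Fact p.Prime] {K : Type*} [Field K] [Algebra ℚ_[p] K] [Algebra ℤ_[p] K]
  [IsScalarTower ℤ_[p] ℚ_[p] K]
variable {O : Subalgebra ℤ_[p] K} {ϖ : K}

/-- An `O`-order in `M₂(K)`. -/
structure IsMatrixOrder (O : Subalgebra ℤ_[p] K)
    (N : Subalgebra ℤ_[p] (Matrix (Fin 2) (Fin 2) K)) : Prop where
  isLatticeOrder : IsLatticeOrder N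
  scalar_mem : ∀ a ∈ O, Matrix.scalar (Fin 2) a ∈ N

theorem IsUniformizer.exists_le_vertexOrder_of_fg (h : IsUniformizer O ϖ)
    {A : Type*} [Ring A] [Algebra ℤ_[p] A] (φ : A →ₐ[ℤ_[p]] Matrix (Fin 2) (Fin 2) K)
    {G : Subalgebra ℤ_[p] A} (hG : (Subalgebra.toSubmodule G).FG) :
    ∃ n u, G ≤ (vertexOrder O ϖ h.ne_zero n u).comap φ := by
  have h1 : ∀ i j, ∃ t, ∀ x ∈ G, φ x i j ∈ fracIdeal O ϖ t := by
    intro i j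
    let f : A →ₗ[ℤ_[p]] K := (Matrix.entryLinearMap ℤ_[p] K i j).comp φ.toLinearMap
    obtain ⟨t, ht⟩ := h.exists_le_fracIdeal_of_fg (hG.map f)
    exact ⟨t, fun x hx => ht ⟨x, hx, rfl⟩⟩
  choose t ht using h1
  obtain ⟨n, u, hnu⟩ := h.exists_le_vertexOrder (G.toSubmonoid.map φ.toMonoidHom)
    (t := min (min (t 0 0) (t 0 1)) (min (t 1 0) (t 1 1))) (by
      rintro _ ⟨x, hx, rfl⟩ i j
      refine h.anti ?_ (ht i j x hx)
      fin_cases i <;> fin_cases j <;> simp)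
  exact ⟨n, u, fun x hx => hnu _ ⟨x, hx, rfl⟩⟩

theorem IsUniformizer.isMatrixOrder_vertexOrder (h : IsUniformizer O ϖ) (n : ℤ) (u : K) :
    IsMatrixOrder O (vertexOrder O ϖ h.ne_zero n u) := by
  refine ⟨⟨h.fg_vertexOrder n u, span_eq_top_iff.2 fun X => ?_⟩, fun a ha => ?_⟩
  · have h1 : ∀ i j, ∃ N : ℕ, ∀ M ≥ N,
        (p : K) ^ M * (latticeMatrixInv ϖ n u * X * latticeMatrix ϖ n u) i j ∈ O := by
      intro i j
      obtain ⟨N, hN⟩ := h.p_pow_mem ((latticeMatrixInv ϖ n u * X * latticeMatrix ϖ n u) i j)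
      refine ⟨N, fun M hM => ?_⟩
      obtain ⟨d, rfl⟩ := Nat.exists_eq_add_of_le hM
      rw [add_comm, pow_add, mul_assoc]
      exact O.mul_mem (O.pow_mem (O.natCast_mem p) _) hN
    choose N hN using h1
    refine ⟨N 0 0 + N 0 1 + N 1 0 + N 1 1, fun i j => ?_⟩
    rw [Matrix.mul_smul, Matrix.smul_mul, Matrix.smul_apply, Algebra.smul_def, map_pow, map_natCast]
    apply hN
    fin_cases i <;> fin_cases j <;> simp <;> omega
  · have : Matrix.scalar (Fin 2) a = !![a, 0; 0, a] := by
      ext i j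
      fin_cases i <;> fin_cases j <;> simp
    rw [this, mem_vertexOrder]
    refine ⟨by simpa, by simpa, by simp, ?_⟩
    convert Submodule.zero_mem _ using 1
    ring

/-- Every order is a bounded monoid, hence lies in a stabilizer, and the stabilizers are orders that
are pairwise incomparable. -/
theorem IsUniformizer.maximal_iff (h : IsUniformizer O ϖ)
    {N : Subalgebra ℤ_[p] (Matrix (Fin 2) (Fin 2) K)} :
    Maximal (IsMatrixOrder O) N ↔ ∃ n u, N = vertexOrder O ϖ h.ne_zero n u := by
  constructor
  · intro hN
    obtain ⟨n, u, hle⟩ := h.exists_le_vertexOrder_of_fg (AlgHom.id _ _) hN.1.isLatticeOrder.fg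
    exact ⟨n, u, le_antisymm hle (hN.2 (h.isMatrixOrder_vertexOrder n u) hle)⟩
  · rintro ⟨n, u, rfl⟩
    refine ⟨h.isMatrixOrder_vertexOrder n u, fun N' hN' hle => ?_⟩
    obtain ⟨n', u', hle'⟩ := h.exists_le_vertexOrder_of_fg (AlgHom.id _ _) hN'.isLatticeOrder.fg
    have h1 := h.vertexOrder_le_iff.1 (hle.trans hle')
    rw [h.vertexOrder_eq_iff.2 h1]
    exact hle'

/-- The number of vertex orders whose preimage under `φ` is `G`. -/
noncomputable def vertexCount (O : Subalgebra ℤ_[p] K) (ϖ : K) (hϖ : ϖ ≠ 0)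
    {A : Type*} [Ring A] [Algebra ℤ_[p] A]
    (φ : A →ₐ[ℤ_[p]] Matrix (Fin 2) (Fin 2) K) (G : Subalgebra ℤ_[p] A) : ℕ∞ :=
  Set.encard {N | (∃ n u, N = vertexOrder O ϖ hϖ n u) ∧ N.comap φ = G}

end Maximal

/-! ### Transport of maximal orders and of the count along isomorphisms. -/

section Transport

open QuatEmb

variable {p : ℕ} [Fact p.Prime] {K : Type*} [Field K] [Algebra ℚ_[p] K] [Algebra ℤ_[p] K]
  [IsScalarTower ℤ_[p] ℚ_[p] K]

theorem isOrder_iff_isLatticeOrder {A : Type*} [Ring A] [Algebra ℚ A]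
    {G : Subalgebra ℤ_[p] (Comp p A)} : IsOrder p G ↔ IsLatticeOrder G :=
  ⟨fun h => ⟨h.1, h.2⟩, fun h => ⟨h.1, h.2⟩⟩

/-- Maximal elements correspond under pulling back along an isomorphism. -/
theorem maximal_comap_iff {R A B : Type*} [CommRing R] [Ring A] [Algebra R A] [Ring B] [Algebra R B]
    (e : A ≃ₐ[R] B) {P : Subalgebra R A → Prop} {Q : Subalgebra R B → Prop}
    (hPQ : ∀ N, P (N.comap e.toAlgHom) ↔ Q N) (N : Subalgebra R B) :
    Maximal P (N.comap e.toAlgHom) ↔ Maximal Q N := by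
  have hsurj : ∀ N' : Subalgebra R A, N' = (N'.comap e.symm.toAlgHom).comap e.toAlgHom := by
    intro N'
    ext x
    simp
  have hle : ∀ N₁ N₂ : Subalgebra R B, N₁.comap e.toAlgHom ≤ N₂.comap e.toAlgHom ↔ N₁ ≤ N₂ := by
    intro N₁ N₂
    refine ⟨fun h x hx => ?_, fun h x hx => h hx⟩
    have := @h (e.symm x) (by simpa using hx)
    simpa using this
  constructor
  · rintro ⟨h1, h2⟩
    refine ⟨(hPQ N).1 h1, fun N' hN' hNN' => ?_⟩
    exact (hle _ _).1 (h2 ((hPQ N').2 hN') ((hle _ _).2 hNN'))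
  · rintro ⟨h1, h2⟩
    refine ⟨(hPQ N).2 h1, fun N' hN' hNN' => ?_⟩
    rw [hsurj N'] at hN' hNN' ⊢
    exact (hle _ _).2 (h2 ((hPQ _).1 hN') ((hle _ _).1 hNN'))

/-- The count may be made in any model B of M_p, once the notion of 𝔬_p-order has been translated
into a property Q of subalgebras of B. -/
theorem embeddingCount_eq_encard (k : Type*) [Field k] [NumberField k] {F M : Type*}
    [Ring F] [Algebra ℚ F] [Ring M] [Algebra ℚ M] [Algebra k M] [IsScalarTower ℚ k M]
    (ι : F →ₐ[ℚ] M) {B : Type*} [Ring B] [Algebra ℤ_[p] B]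
    (e : Comp p M ≃ₐ[ℤ_[p]] B) {Q : Subalgebra ℤ_[p] B → Prop}
    (hQ : ∀ N, IsOrderOver p k (N.comap e.toAlgHom) ↔ Q N) (G : Subalgebra ℤ_[p] (Comp p F)) :
    embeddingCount p k ι G =
      Set.encard {N | Maximal Q N ∧ N.comap (e.toAlgHom.comp (compMap p ι)) = G} := by
  have hinj : Function.Injective
      (fun N : Subalgebra ℤ_[p] B => N.comap e.toAlgHom) := by
    intro N₁ N₂ h
    ext x
    have := SetLike.ext_iff.1 h (e.symm x)
    simpa using this
  rw [embeddingCount, ← hinj.encard_image]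
  congr 1
  ext N
  simp only [Set.mem_ofPred_eq, Set.mem_image]
  constructor
  · rintro ⟨h1, h2⟩
    have hN : N = (N.comap e.symm.toAlgHom).comap e.toAlgHom := by ext x; simp
    refine ⟨N.comap e.symm.toAlgHom, ⟨?_, ?_⟩, hN.symm⟩
    · rw [IsMaximalOrderOver, hN] at h1
      exact (maximal_comap_iff e hQ _).1 h1
    · rw [← h2]
      ext x
      simp
  · rintro ⟨N', ⟨h1, h2⟩, rfl⟩
    exact ⟨(maximal_comap_iff e hQ _).2 h1, h2⟩

end Transport

end LocalOrders

namespace LocalOrders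

open QuadraticAlgebra hiding norm_neg norm_one norm_natCast norm_star norm_zero

/-! ### Quadratic extensions of ℚ_p and their rings ℤ_p[ω]. -/

section Quadratic

variable {p : ℕ} [Fact p.Prime] {c t : ℚ_[p]}

/-- The `ℤ_[p]`-subalgebra `ℤ_[p] + ℤ_[p] ω` of `ℚ_[p][ω]`, where `ω² = c + t ω` with integral `c`
and `t`. -/
def quadInt (hc : ‖c‖ ≤ 1) (ht : ‖t‖ ≤ 1) : Subalgebra ℤ_[p] (QuadraticAlgebra ℚ_[p] c t) where
  carrier := {z | ‖z.re‖ ≤ 1 ∧ ‖z.im‖ ≤ 1}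
  mul_mem' := by
    rintro z w ⟨h1, h2⟩ ⟨h3, h4⟩
    have key : ∀ a b : ℚ_[p], ‖a‖ ≤ 1 → ‖b‖ ≤ 1 → ‖a * b‖ ≤ 1 := fun a b ha hb => by
      rw [norm_mul]; exact mul_le_one₀ ha (norm_nonneg _) hb
    have key2 : ∀ a b : ℚ_[p], ‖a‖ ≤ 1 → ‖b‖ ≤ 1 → ‖a + b‖ ≤ 1 := fun a b ha hb =>
      (Padic.nonarchimedean a b).trans (max_le ha hb)
    refine ⟨?_, ?_⟩
    · rw [re_mul]
      exact key2 _ _ (key _ _ h1 h3) (key _ _ (key _ _ hc h2) h4)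
    · rw [im_mul]
      exact key2 _ _ (key2 _ _ (key _ _ h1 h4) (key _ _ h2 h3)) (key _ _ (key _ _ ht h2) h4)
  add_mem' := by
    rintro z w ⟨h1, h2⟩ ⟨h3, h4⟩
    exact ⟨(Padic.nonarchimedean _ _).trans (max_le h1 h3),
      (Padic.nonarchimedean _ _).trans (max_le h2 h4)⟩
  algebraMap_mem' := by
    intro r
    exact ⟨r.2, by change ‖(0 : ℚ_[p])‖ ≤ 1; simp⟩

variable {hc : ‖c‖ ≤ 1} {ht : ‖t‖ ≤ 1}

theorem mem_quadInt {z : QuadraticAlgebra ℚ_[p] c t} :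
    z ∈ quadInt hc ht ↔ ‖z.re‖ ≤ 1 ∧ ‖z.im‖ ≤ 1 := Iff.rfl

theorem fg_quadInt : (Subalgebra.toSubmodule (quadInt hc ht)).FG := by
  refine Submodule.fg_def.2 ⟨({1, omega} : Set (QuadraticAlgebra ℚ_[p] c t)), Set.toFinite _, ?_⟩
  apply le_antisymm
  · rw [Submodule.span_le]
    intro z hz
    rcases hz with rfl | rfl
    · exact (quadInt hc ht).one_mem
    · exact ⟨by simp, by simp⟩
  · rintro z ⟨h1, h2⟩
    let x : ℤ_[p] := ⟨z.re, h1⟩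
    let y : ℤ_[p] := ⟨z.im, h2⟩
    have : z = x • (1 : QuadraticAlgebra ℚ_[p] c t) +
        y • (omega : QuadraticAlgebra ℚ_[p] c t) := by
      ext
      · change z.re = z.re * 1 + z.im * 0; simp
      · change z.im = z.re * 0 + z.im * 1; simp
    rw [this]
    exact Submodule.add_mem _ (Submodule.smul_mem _ _ (Submodule.subset_span (by simp)))
      (Submodule.smul_mem _ _ (Submodule.subset_span (by simp)))

theorem star_mem_quadInt {z : QuadraticAlgebra ℚ_[p] c t} (hz : z ∈ quadInt hc ht) :
    star z ∈ quadInt hc ht := by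
  refine ⟨(Padic.nonarchimedean _ _).trans (max_le hz.1 ?_), by simpa using hz.2⟩
  rw [norm_mul]
  exact mul_le_one₀ ht (norm_nonneg _) hz.2

theorem quadNorm_star_eq (z : QuadraticAlgebra ℚ_[p] c t) : ‖(star z).norm‖ = ‖z.norm‖ := by
  rw [QuadraticAlgebra.norm_star]

variable [hf : Fact (∀ r : ℚ_[p], r ^ 2 ≠ c + t * r)]

theorem quadNorm_zpow (z : QuadraticAlgebra ℚ_[p] c t) (n : ℤ) :
    (z ^ n).norm = z.norm ^ n :=
  map_zpow₀ ({ QuadraticAlgebra.norm (R := ℚ_[p]) (a := c) (b := t) with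
    map_zero' := QuadraticAlgebra.norm_zero } : QuadraticAlgebra ℚ_[p] c t →*₀ ℚ_[p]) z n

theorem quadNorm_inv (z : QuadraticAlgebra ℚ_[p] c t) : (z⁻¹).norm = z.norm⁻¹ := by
  simpa using quadNorm_zpow z (-1)

theorem quadNorm_ne_zero {z : QuadraticAlgebra ℚ_[p] c t} (hz : z ≠ 0) : z.norm ≠ 0 := by
  intro h
  have h1 : z * z⁻¹ = 1 := mul_inv_cancel₀ hz
  have h2 := congrArg QuadraticAlgebra.norm h1
  rw [map_mul, h, zero_mul, map_one] at h2
  exact zero_ne_one h2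

/-- A criterion for `quadInt` to be a discrete valuation ring, in terms of the norm. -/
theorem isUniformizer_quadInt {ϖ : QuadraticAlgebra ℚ_[p] c t} (hϖ : ϖ ≠ 0)
    (hmem : ∀ z, z ∈ quadInt hc ht ↔ ‖z.norm‖ ≤ 1) (h1 : ‖ϖ.norm‖ < 1)
    (hval : ∀ z : QuadraticAlgebra ℚ_[p] c t, z ≠ 0 → ∃ n : ℤ, ‖z.norm‖ = ‖ϖ.norm‖ ^ n)
    (hp : ‖(p : ℚ_[p])‖ ^ 2 ≤ ‖ϖ.norm‖) : IsUniformizer (quadInt hc ht) ϖ := by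
  have hpos : 0 < ‖ϖ.norm‖ := norm_pos_iff.2 (quadNorm_ne_zero hϖ)
  refine ⟨?_, ?_, ?_, fg_quadInt, ?_⟩
  · rw [hmem]; exact h1.le
  · rw [hmem, quadNorm_inv, norm_inv, not_le]
    exact (one_lt_inv₀ hpos).2 h1
  · intro z hz
    obtain ⟨n, hn⟩ := hval z hz
    have h2 : ‖(z * ϖ ^ (-n)).norm‖ = 1 := by
      rw [map_mul, quadNorm_zpow, norm_mul, norm_zpow, hn, ← zpow_add₀ hpos.ne']
      simp
    refine ⟨n, (hmem _).2 h2.le, (hmem _).2 ?_⟩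
    rw [quadNorm_inv, norm_inv, h2, inv_one]
  · rw [hmem, map_mul, QuadraticAlgebra.norm_natCast, quadNorm_inv, norm_mul, norm_inv, norm_pow]
    rw [mul_inv_le_iff₀ hpos, one_mul]
    exact hp

theorem mem_fracIdeal_iff_norm_le {ϖ : QuadraticAlgebra ℚ_[p] c t} (hϖ : ϖ ≠ 0)
    (hmem : ∀ z, z ∈ quadInt hc ht ↔ ‖z.norm‖ ≤ 1) {n : ℤ} {z : QuadraticAlgebra ℚ_[p] c t} :
    z ∈ fracIdeal (quadInt hc ht) ϖ n ↔ ‖z.norm‖ ≤ ‖ϖ.norm‖ ^ n := by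
  have hpos : 0 < ‖ϖ.norm‖ := norm_pos_iff.2 (quadNorm_ne_zero hϖ)
  rw [mem_fracIdeal, hmem, map_mul, quadNorm_zpow, norm_mul, norm_zpow, zpow_neg,
    mul_inv_le_iff₀ (by positivity), one_mul]

end Quadratic

/-! ### Consequences of the discreteness of the p-adic norm. -/

section Padic

variable {p : ℕ} [Fact p.Prime]

theorem padic_norm_lt_iff {x y : ℚ_[p]} (hy : y ≠ 0) : ‖x‖ < ‖y‖ ↔ ‖x‖ ≤ (p : ℝ)⁻¹ * ‖y‖ := by
  have hp : (1 : ℝ) < p := by exact_mod_cast (Fact.out : p.Prime).one_lt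
  have hp0 : (0 : ℝ) < p := by linarith
  rw [Padic.norm_eq_zpow_neg_valuation hy, Padic.norm_lt_pow_iff_norm_le_pow_sub_one,
    sub_eq_add_neg, zpow_add₀ hp0.ne', zpow_neg_one, mul_comm]

/-- A norm above 1 is at least p, and then its square exceeds p. -/
theorem padic_norm_le_one_of_sq_le {y : ℚ_[p]} (h : (p : ℝ)⁻¹ * ‖y‖ ^ 2 ≤ 1) : ‖y‖ ≤ 1 := by
  have hp : (1 : ℝ) < p := by exact_mod_cast (Fact.out : p.Prime).one_lt
  by_contra! hlt
  have hy : y ≠ 0 := by rintro rfl; simp at hlt; linarith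
  have h1 : ‖(1 : ℚ_[p])‖ < ‖y‖ := by simpa using hlt
  rw [padic_norm_lt_iff hy, norm_one] at h1
  have h2 : ‖y‖ ^ 2 * (p : ℝ)⁻¹ = ‖y‖ * ((p : ℝ)⁻¹ * ‖y‖) := by ring
  nlinarith

theorem norm_add_eq_of_lt {x y : ℚ_[p]} (h : ‖y‖ < ‖x‖) : ‖x + y‖ = ‖x‖ := by
  rw [Padic.add_eq_max_of_ne h.ne', max_eq_left h.le]

end Padic

/-! ### Quadratic extensions given by an Eisenstein polynomial. -/

section Ramified

variable {p : ℕ} [Fact p.Prime] {c t : ℚ_[p]}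

/-- In N(x + yω) = x² + txy - cy² the terms x² and cy² have valuations of different parity, and the
mixed term is strictly smaller than the larger of them (unless everything is 0). So no cancellation
can occur. -/
theorem norm_quadNorm_of_eisenstein (hc : ‖c‖ = (p : ℝ)⁻¹) (ht : ‖t‖ ≤ (p : ℝ)⁻¹)
    (z : QuadraticAlgebra ℚ_[p] c t) :
    ‖z.norm‖ = max (‖z.re‖ ^ 2) ((p : ℝ)⁻¹ * ‖z.im‖ ^ 2) := by
  have hp : (1 : ℝ) < p := by exact_mod_cast (Fact.out : p.Prime).one_lt
  have hp1 : (p : ℝ)⁻¹ < 1 := inv_lt_one_of_one_lt₀ hp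
  have hp0 : 0 < (p : ℝ)⁻¹ := by positivity
  set q := (p : ℝ)⁻¹ with hq
  rw [norm_def]
  rcases le_or_gt ‖z.im‖ ‖z.re‖ with h | h
  · by_cases hz : z.re = 0
    · have : z.im = 0 := by rw [hz] at h; simpa using h
      simp [hz, this]
    have hz' : 0 < ‖z.re‖ := norm_pos_iff.2 hz
    have e : z.re * z.re + t * z.re * z.im - c * z.im * z.im =
        z.re ^ 2 + (t * z.re * z.im + -(c * z.im * z.im)) := by ring
    have h1 : ‖t * z.re * z.im + -(c * z.im * z.im)‖ ≤ q * ‖z.re‖ ^ 2 := by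
      refine (Padic.nonarchimedean _ _).trans (max_le ?_ ?_)
      · rw [norm_mul, norm_mul, sq, mul_assoc]
        gcongr
      · rw [norm_neg, norm_mul, norm_mul, hc, sq, mul_assoc]
        gcongr
    have h2 : q * ‖z.re‖ ^ 2 < ‖z.re‖ ^ 2 := by nlinarith [pow_pos hz' 2]
    rw [e, norm_add_eq_of_lt (by rw [norm_pow]; exact h1.trans_lt h2), norm_pow, max_eq_left]
    have : ‖z.im‖ ^ 2 ≤ ‖z.re‖ ^ 2 := by gcongr
    nlinarith
  · have hz : z.im ≠ 0 := by
      intro h0; rw [h0, _root_.norm_zero] at h; exact absurd h (not_lt.2 (norm_nonneg _))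
    have hz' : 0 < ‖z.im‖ := norm_pos_iff.2 hz
    rw [padic_norm_lt_iff hz, ← hq] at h
    have e : z.re * z.re + t * z.re * z.im - c * z.im * z.im =
        -(c * z.im ^ 2) + (z.re ^ 2 + t * z.re * z.im) := by ring
    have h0 : ‖z.re‖ ^ 2 ≤ q ^ 2 * ‖z.im‖ ^ 2 := by
      rw [← mul_pow]; gcongr
    have h1 : ‖z.re ^ 2 + t * z.re * z.im‖ ≤ q ^ 2 * ‖z.im‖ ^ 2 := by
      refine (Padic.nonarchimedean _ _).trans (max_le ?_ ?_)
      · rwa [norm_pow]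
      · rw [norm_mul, norm_mul]
        calc ‖t‖ * ‖z.re‖ * ‖z.im‖ ≤ q * (q * ‖z.im‖) * ‖z.im‖ := by gcongr
          _ = _ := by ring
    have h2 : q ^ 2 * ‖z.im‖ ^ 2 < q * ‖z.im‖ ^ 2 := by
      have := pow_pos hz' 2
      nlinarith [mul_pos hp0 this]
    have h3 : ‖-(c * z.im ^ 2)‖ = q * ‖z.im‖ ^ 2 := by rw [norm_neg, norm_mul, norm_pow, hc]
    rw [e, norm_add_eq_of_lt (by rw [h3]; exact h1.trans_lt h2), h3, max_eq_right]
    exact h0.trans h2.le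

theorem no_root_of_eisenstein (hc : ‖c‖ = (p : ℝ)⁻¹) (ht : ‖t‖ ≤ (p : ℝ)⁻¹) (r : ℚ_[p]) :
    r ^ 2 ≠ c + t * r := by
  intro h
  have hp : (1 : ℝ) < p := by exact_mod_cast (Fact.out : p.Prime).one_lt
  have hp0 : 0 < (p : ℝ)⁻¹ := by positivity
  have h1 := norm_quadNorm_of_eisenstein hc ht ⟨-r, 1⟩
  have h2 : (⟨-r, 1⟩ : QuadraticAlgebra ℚ_[p] c t).norm = 0 := by
    rw [norm_def]; linear_combination h
  rw [h2, _root_.norm_zero] at h1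
  have h3 : (p : ℝ)⁻¹ * ‖(1 : ℚ_[p])‖ ^ 2 ≤ 0 := by
    rw [h1]; exact le_max_right _ _
  rw [norm_one] at h3
  linarith

theorem mem_quadInt_iff_of_eisenstein (hc : ‖c‖ = (p : ℝ)⁻¹) (ht : ‖t‖ ≤ (p : ℝ)⁻¹)
    {hc1 : ‖c‖ ≤ 1} {ht1 : ‖t‖ ≤ 1}
    (z : QuadraticAlgebra ℚ_[p] c t) : z ∈ quadInt hc1 ht1 ↔ ‖z.norm‖ ≤ 1 := by
  have hp : (1 : ℝ) < p := by exact_mod_cast (Fact.out : p.Prime).one_lt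
  have hp1 : (p : ℝ)⁻¹ < 1 := inv_lt_one_of_one_lt₀ hp
  have hp0 : 0 < (p : ℝ)⁻¹ := by positivity
  rw [mem_quadInt, norm_quadNorm_of_eisenstein hc ht, max_le_iff, sq_le_one_iff₀ (norm_nonneg _)]
  refine and_congr_right fun _ => ⟨fun h => ?_, padic_norm_le_one_of_sq_le⟩
  have : ‖z.im‖ ^ 2 ≤ 1 := pow_le_one₀ (norm_nonneg _) h
  nlinarith

theorem norm_quadNorm_omega : ‖(omega : QuadraticAlgebra ℚ_[p] c t).norm‖ = ‖c‖ := by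
  rw [norm_def]; simp

theorem isUniformizer_of_eisenstein [Fact (∀ r : ℚ_[p], r ^ 2 ≠ c + t * r)]
    (hc : ‖c‖ = (p : ℝ)⁻¹) (ht : ‖t‖ ≤ (p : ℝ)⁻¹) {hc1 : ‖c‖ ≤ 1} {ht1 : ‖t‖ ≤ 1} :
    IsUniformizer (quadInt hc1 ht1) (omega : QuadraticAlgebra ℚ_[p] c t) := by
  have hp : (1 : ℝ) < p := by exact_mod_cast (Fact.out : p.Prime).one_lt
  have hp1 : (p : ℝ)⁻¹ < 1 := inv_lt_one_of_one_lt₀ hp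
  have hp0 : 0 < (p : ℝ)⁻¹ := by positivity
  refine isUniformizer_quadInt ?_ (mem_quadInt_iff_of_eisenstein hc ht) ?_ ?_ ?_
  · intro h
    have := congrArg QuadraticAlgebra.im h
    simp at this
  · rw [norm_quadNorm_omega, hc]; exact hp1
  · intro z hz
    refine ⟨(z.norm).valuation, ?_⟩
    rw [Padic.norm_eq_zpow_neg_valuation (quadNorm_ne_zero hz), norm_quadNorm_omega, hc, zpow_neg,
      inv_zpow]
  · rw [norm_quadNorm_omega, hc, Padic.norm_p]
    nlinarith

theorem mem_fracIdeal_iff_of_eisenstein [Fact (∀ r : ℚ_[p], r ^ 2 ≠ c + t * r)]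
    (hc : ‖c‖ = (p : ℝ)⁻¹) (ht : ‖t‖ ≤ (p : ℝ)⁻¹) {hc1 : ‖c‖ ≤ 1} {ht1 : ‖t‖ ≤ 1} {n : ℤ}
    {z : QuadraticAlgebra ℚ_[p] c t} :
    z ∈ fracIdeal (quadInt hc1 ht1) omega n ↔ ‖z.norm‖ ≤ (p : ℝ) ^ (-n) := by
  rw [mem_fracIdeal_iff_norm_le (isUniformizer_of_eisenstein hc ht (hc1 := hc1) (ht1 := ht1)).ne_zero
    (mem_quadInt_iff_of_eisenstein hc ht), norm_quadNorm_omega, hc, zpow_neg, inv_zpow]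

end Ramified

/-! ### Quadratic extensions given by a polynomial without roots modulo p. -/

section Inert

variable {p : ℕ} [Fact p.Prime] {c t : ℚ_[p]}

/-- If |x| ≤ |y| and y ≠ 0, then N(x + yω) is y² times the value of X² - tX - c at the integral
point -x/y, a unit by `hroot`. If |x| > |y|, then x² dominates. -/
theorem norm_quadNorm_of_inert (hc : ‖c‖ ≤ 1) (ht : ‖t‖ ≤ 1)
    (hroot : ∀ r : ℚ_[p], ‖r‖ ≤ 1 → ‖r ^ 2 - t * r - c‖ = 1)
    (z : QuadraticAlgebra ℚ_[p] c t) : ‖z.norm‖ = max ‖z.re‖ ‖z.im‖ ^ 2 := by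
  have hp : (1 : ℝ) < p := by exact_mod_cast (Fact.out : p.Prime).one_lt
  rw [norm_def]
  rcases le_or_gt ‖z.re‖ ‖z.im‖ with h | h
  · by_cases hz : z.im = 0
    · have : z.re = 0 := by rw [hz] at h; simpa using h
      simp [hz, this]
    have e : z.re * z.re + t * z.re * z.im - c * z.im * z.im =
        z.im ^ 2 * ((-(z.re / z.im)) ^ 2 - t * (-(z.re / z.im)) - c) := by field_simp; ring
    rw [e, norm_mul, hroot, max_eq_right h, norm_pow, mul_one]
    rw [norm_neg, norm_div]
    exact div_le_one_of_le₀ h (norm_nonneg _)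
  · have hz' : 0 < ‖z.re‖ := (norm_nonneg _).trans_lt h
    have e : z.re * z.re + t * z.re * z.im - c * z.im * z.im =
        z.re ^ 2 + (t * z.re * z.im + -(c * z.im * z.im)) := by ring
    have h1 : ‖t * z.re * z.im + -(c * z.im * z.im)‖ ≤ ‖z.re‖ * ‖z.im‖ := by
      refine (Padic.nonarchimedean _ _).trans (max_le ?_ ?_)
      · rw [norm_mul, norm_mul]
        calc ‖t‖ * ‖z.re‖ * ‖z.im‖ ≤ 1 * ‖z.re‖ * ‖z.im‖ := by gcongr
          _ = _ := by ring
      · rw [norm_neg, norm_mul, norm_mul]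
        calc ‖c‖ * ‖z.im‖ * ‖z.im‖ ≤ 1 * ‖z.re‖ * ‖z.im‖ := by gcongr
          _ = _ := by ring
    have h2 : ‖z.re‖ * ‖z.im‖ < ‖z.re‖ ^ 2 := by nlinarith
    rw [e, norm_add_eq_of_lt (by rw [norm_pow]; exact h1.trans_lt h2), norm_pow, max_eq_left h.le]

theorem no_root_of_inert (hc : ‖c‖ ≤ 1) (ht : ‖t‖ ≤ 1)
    (hroot : ∀ r : ℚ_[p], ‖r‖ ≤ 1 → ‖r ^ 2 - t * r - c‖ = 1) (r : ℚ_[p]) :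
    r ^ 2 ≠ c + t * r := by
  intro h
  have h1 := norm_quadNorm_of_inert hc ht hroot ⟨-r, 1⟩
  have h2 : (⟨-r, 1⟩ : QuadraticAlgebra ℚ_[p] c t).norm = 0 := by
    rw [norm_def]; linear_combination h
  rw [h2, _root_.norm_zero] at h1
  have h3 : (1 : ℝ) ≤ max ‖-r‖ ‖(1 : ℚ_[p])‖ := by
    rw [norm_one]; exact le_max_right _ _
  have h4 : (1 : ℝ) ≤ max ‖-r‖ ‖(1 : ℚ_[p])‖ ^ 2 := one_le_pow₀ h3
  simp only at h1
  linarith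

theorem mem_quadInt_iff_of_inert (hc : ‖c‖ ≤ 1) (ht : ‖t‖ ≤ 1)
    (hroot : ∀ r : ℚ_[p], ‖r‖ ≤ 1 → ‖r ^ 2 - t * r - c‖ = 1)
    (z : QuadraticAlgebra ℚ_[p] c t) : z ∈ quadInt hc ht ↔ ‖z.norm‖ ≤ 1 := by
  rw [mem_quadInt, norm_quadNorm_of_inert hc ht hroot,
    sq_le_one_iff₀ ((norm_nonneg _).trans (le_max_left _ _)), max_le_iff]

theorem isUniformizer_of_inert [Fact (∀ r : ℚ_[p], r ^ 2 ≠ c + t * r)] (hc : ‖c‖ ≤ 1)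
    (ht : ‖t‖ ≤ 1) (hroot : ∀ r : ℚ_[p], ‖r‖ ≤ 1 → ‖r ^ 2 - t * r - c‖ = 1) :
    IsUniformizer (quadInt hc ht) (p : QuadraticAlgebra ℚ_[p] c t) := by
  have hp : (1 : ℝ) < p := by exact_mod_cast (Fact.out : p.Prime).one_lt
  have hp1 : (p : ℝ)⁻¹ < 1 := inv_lt_one_of_one_lt₀ hp
  have hp0 : 0 < (p : ℝ)⁻¹ := by positivity
  refine isUniformizer_quadInt ?_ (mem_quadInt_iff_of_inert hc ht hroot) ?_ ?_ ?_
  · exact_mod_cast (Fact.out : p.Prime).ne_zero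
  · rw [QuadraticAlgebra.norm_natCast, norm_pow, Padic.norm_p]
    exact pow_lt_one₀ hp0.le hp1 (by norm_num)
  · intro z hz
    have h1 : ∃ x : ℚ_[p], x ≠ 0 ∧ max ‖z.re‖ ‖z.im‖ = ‖x‖ := by
      have hne : z.re ≠ 0 ∨ z.im ≠ 0 := by
        by_contra! h
        exact hz (QuadraticAlgebra.ext h.1 h.2)
      have hpos : 0 < max ‖z.re‖ ‖z.im‖ := by
        rcases hne with h | h
        · exact lt_max_of_lt_left (norm_pos_iff.2 h)
        · exact lt_max_of_lt_right (norm_pos_iff.2 h)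
      rcases max_choice ‖z.re‖ ‖z.im‖ with h | h
      · exact ⟨z.re, norm_pos_iff.1 (h ▸ hpos), h⟩
      · exact ⟨z.im, norm_pos_iff.1 (h ▸ hpos), h⟩
    obtain ⟨x, hx, hx'⟩ := h1
    refine ⟨x.valuation, ?_⟩
    rw [norm_quadNorm_of_inert hc ht hroot, hx', Padic.norm_eq_zpow_neg_valuation hx, QuadraticAlgebra.norm_natCast,
      norm_pow, Padic.norm_p, zpow_neg, ← inv_zpow, ← zpow_natCast, ← zpow_natCast, ← zpow_mul,
      ← zpow_mul, mul_comm]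
  · rw [QuadraticAlgebra.norm_natCast, norm_pow]

end Inert

end LocalOrders

namespace LocalOrders

open QuadraticAlgebra hiding norm_neg norm_one norm_natCast norm_star norm_zero
open scoped Matrix

/-! ### Orders of a cyclic algebra and the lattices stable under them. -/

section Cyclic

variable {p : ℕ} [Fact p.Prime] {c t : ℚ_[p]}

/-- The matrix of `α + j γ` in the representation of the cyclic algebra with `j² = b`. -/
noncomputable def cyclicMatrix (b : ℚ_[p]) (α γ : QuadraticAlgebra ℚ_[p] c t) :
    Matrix (Fin 2) (Fin 2) (QuadraticAlgebra ℚ_[p] c t) :=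
  !![α, algebraMap _ _ b * star γ; γ, star α]

theorem star_algebraMap (q : ℚ_[p]) :
    star (algebraMap ℚ_[p] (QuadraticAlgebra ℚ_[p] c t) q) = algebraMap _ _ q := by
  ext <;> simp

theorem cyclicMatrix_add (b : ℚ_[p]) (α γ α' γ' : QuadraticAlgebra ℚ_[p] c t) :
    cyclicMatrix b (α + α') (γ + γ') = cyclicMatrix b α γ + cyclicMatrix b α' γ' := by
  refine Matrix.ext fun i j => ?_
  fin_cases i <;> fin_cases j <;> simp [cyclicMatrix, mul_add]

theorem cyclicMatrix_mul (b : ℚ_[p]) (a α γ : QuadraticAlgebra ℚ_[p] c t) :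
    cyclicMatrix b a 0 * cyclicMatrix b α γ = cyclicMatrix b (a * α) (star a * γ) := by
  rw [cyclicMatrix, cyclicMatrix, cyclicMatrix, Matrix.mul_fin_two]
  refine Matrix.ext fun i j => ?_
  fin_cases i <;> fin_cases j <;> simp only [Fin.zero_eta, Fin.mk_one, Matrix.of_apply,
    Matrix.cons_val', Matrix.cons_val_zero, Matrix.cons_val_one, Matrix.cons_val_fin_one, star_mul,
    star_star, star_zero] <;> ring

theorem cyclicMatrix_injective {b : ℚ_[p]} {α γ α' γ' : QuadraticAlgebra ℚ_[p] c t}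
    (h : cyclicMatrix b α γ = cyclicMatrix b α' γ') : α = α' ∧ γ = γ' := by
  have h0 := congrFun (congrFun h 0) 0
  have h1 := congrFun (congrFun h 1) 0
  simp [cyclicMatrix] at h0 h1
  exact ⟨h0, h1⟩

variable {A : Type*} [Ring A] [Algebra ℤ_[p] A]

/-- `φ` identifies `A` with a cyclic algebra, in its standard matrix representation. -/
structure IsCyclicRep
    (φ : A →ₐ[ℤ_[p]] Matrix (Fin 2) (Fin 2) (QuadraticAlgebra ℚ_[p] c t)) (b : ℚ_[p]) : Prop where
  injective : Function.Injective φ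
  exists_eq : ∀ x, ∃ α γ, φ x = cyclicMatrix b α γ
  surj : ∀ α γ, ∃ x, φ x = cyclicMatrix b α γ

/-- `G` contains the element with coordinates `α`, `γ`. -/
def HasCoords (φ : A →ₐ[ℤ_[p]] Matrix (Fin 2) (Fin 2) (QuadraticAlgebra ℚ_[p] c t)) (b : ℚ_[p])
    (G : Subalgebra ℤ_[p] A) (α γ : QuadraticAlgebra ℚ_[p] c t) : Prop :=
  ∃ x ∈ G, φ x = cyclicMatrix b α γ

variable {φ : A →ₐ[ℤ_[p]] Matrix (Fin 2) (Fin 2) (QuadraticAlgebra ℚ_[p] c t)} {b : ℚ_[p]}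

namespace IsCyclicRep

variable (hφ : IsCyclicRep φ b)

include hφ

theorem le_iff {G H : Subalgebra ℤ_[p] A} :
    G ≤ H ↔ ∀ α γ, HasCoords φ b G α γ → HasCoords φ b H α γ := by
  constructor
  · rintro h α γ ⟨x, hx, e⟩
    exact ⟨x, h hx, e⟩
  · intro h x hx
    obtain ⟨α, γ, e⟩ := hφ.exists_eq x
    obtain ⟨y, hy, e'⟩ := h α γ ⟨x, hx, e⟩
    rwa [hφ.injective (e.trans e'.symm)]

theorem hasCoords_comap {N : Subalgebra ℤ_[p] (Matrix (Fin 2) (Fin 2) (QuadraticAlgebra ℚ_[p] c t))}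
    {α γ : QuadraticAlgebra ℚ_[p] c t} :
    HasCoords φ b (N.comap φ) α γ ↔ cyclicMatrix b α γ ∈ N := by
  constructor
  · rintro ⟨x, hx, e⟩
    rw [← e]; exact hx
  · intro h
    obtain ⟨x, e⟩ := hφ.surj α γ
    exact ⟨x, by rw [Subalgebra.mem_comap, e]; exact h, e⟩

end IsCyclicRep

theorem HasCoords.add {G : Subalgebra ℤ_[p] A} {α γ α' γ' : QuadraticAlgebra ℚ_[p] c t}
    (h1 : HasCoords φ b G α γ) (h2 : HasCoords φ b G α' γ') :
    HasCoords φ b G (α + α') (γ + γ') := by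
  obtain ⟨x, hx, e⟩ := h1
  obtain ⟨y, hy, e'⟩ := h2
  exact ⟨x + y, G.add_mem hx hy, by rw [map_add, e, e', cyclicMatrix_add]⟩

theorem HasCoords.mul {G : Subalgebra ℤ_[p] A} {a α γ : QuadraticAlgebra ℚ_[p] c t}
    (h1 : HasCoords φ b G a 0) (h2 : HasCoords φ b G α γ) :
    HasCoords φ b G (a * α) (star a * γ) := by
  obtain ⟨x, hx, e⟩ := h1
  obtain ⟨y, hy, e'⟩ := h2
  exact ⟨x * y, G.mul_mem hx hy, by rw [map_mul, e, e', cyclicMatrix_mul]⟩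

variable {hc : ‖c‖ ≤ 1} {ht : ‖t‖ ≤ 1} {ϖ : QuadraticAlgebra ℚ_[p] c t}
variable [hf : Fact (∀ r : ℚ_[p], r ^ 2 ≠ c + t * r)]

theorem star_mem_fracIdeal (hϖ : ϖ ≠ 0) (hmem : ∀ z, z ∈ quadInt hc ht ↔ ‖z.norm‖ ≤ 1) {n : ℤ}
    {z : QuadraticAlgebra ℚ_[p] c t} :
    star z ∈ fracIdeal (quadInt hc ht) ϖ n ↔ z ∈ fracIdeal (quadInt hc ht) ϖ n := by
  rw [mem_fracIdeal_iff_norm_le hϖ hmem, mem_fracIdeal_iff_norm_le hϖ hmem, quadNorm_star_eq]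

theorem algebraMap_im_mem {z : QuadraticAlgebra ℚ_[p] c t} (hz : z ∈ quadInt hc ht) :
    algebraMap ℚ_[p] (QuadraticAlgebra ℚ_[p] c t) z.im ∈ quadInt hc ht :=
  ⟨hz.2, by simp⟩

theorem sub_star_eq (z : QuadraticAlgebra ℚ_[p] c t) :
    z - star z = algebraMap ℚ_[p] _ z.im * (omega - star omega) := by
  rw [sub_star, Algebra.smul_def]

/-- For diag(a, ā) only the upper right entry (a - ā)u matters. It is an integral multiple of (ω -
ω̄)u, so testing a = ω suffices. -/
theorem cyclicMatrix_mem_vertexOrder_zero (h : IsUniformizer (quadInt hc ht) ϖ)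
    {n : ℤ} {u : QuadraticAlgebra ℚ_[p] c t} :
    (∀ a ∈ quadInt hc ht, cyclicMatrix b a 0 ∈ vertexOrder (quadInt hc ht) ϖ h.ne_zero n u) ↔
      (omega - star omega) * u ∈ fracIdeal (quadInt hc ht) ϖ n := by
  constructor
  · intro H
    have := H omega ⟨by simp, by simp⟩
    rw [cyclicMatrix, mem_vertexOrder] at this
    convert this.2.2.2 using 1
    simp
    ring
  · intro H a ha
    rw [cyclicMatrix, mem_vertexOrder]
    refine ⟨by simpa, by simpa using star_mem_quadInt ha, by simp, ?_⟩
    have h1 := h.int_mul_mem (algebraMap_im_mem ha) H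
    convert h1 using 1
    rw [← mul_assoc, ← sub_star_eq]
    simp
    ring

/-- The central computation. Under `hu` the lower right entry is integral as soon as α - uγ is, and
the upper right entry can be replaced by (b - N(u))γ. So for fixed (n, u) the admissible γ form a
fractional ideal, and α is uγ up to O. -/
theorem cyclicMatrix_mem_vertexOrder (h : IsUniformizer (quadInt hc ht) ϖ)
    (hmem : ∀ z, z ∈ quadInt hc ht ↔ ‖z.norm‖ ≤ 1) {n : ℤ} {u : QuadraticAlgebra ℚ_[p] c t}
    (hu : (omega - star omega) * u ∈ fracIdeal (quadInt hc ht) ϖ n)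
    {α γ : QuadraticAlgebra ℚ_[p] c t} :
    cyclicMatrix b α γ ∈ vertexOrder (quadInt hc ht) ϖ h.ne_zero n u ↔
      α - u * γ ∈ quadInt hc ht ∧ γ ∈ fracIdeal (quadInt hc ht) ϖ (-n) ∧
        algebraMap ℚ_[p] _ (b - u.norm) * γ ∈ fracIdeal (quadInt hc ht) ϖ n := by
  have hΔ : (omega - star omega : QuadraticAlgebra ℚ_[p] c t) ≠ 0 := by
    intro h0
    have h1 := congrArg QuadraticAlgebra.re h0
    have h2 := congrArg QuadraticAlgebra.im h0
    simp at h1 h2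
  rw [cyclicMatrix, mem_vertexOrder]
  -- The first three terms of z = α - uγ in (z - z̄)u + (b - N(u))γ̄; by `hu` and the integrality of
  -- z the part (z - z̄)u lies in ϖ^n O.
  have e4 : algebraMap ℚ_[p] _ b * star γ + α * u - u ^ 2 * γ - u * star α =
      algebraMap ℚ_[p] (QuadraticAlgebra ℚ_[p] c t) (b - u.norm) * star γ +
      algebraMap ℚ_[p] _ (α - u * γ).im * ((omega - star omega) * u) := by
    rw [← mul_assoc, ← sub_star_eq, map_sub, algebraMap_norm_eq_mul_star, star_sub, star_mul]
    ring
  have hstar : algebraMap ℚ_[p] (QuadraticAlgebra ℚ_[p] c t) (b - u.norm) * star γ ∈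
      fracIdeal (quadInt hc ht) ϖ n ↔ algebraMap ℚ_[p] _ (b - u.norm) * γ ∈
      fracIdeal (quadInt hc ht) ϖ n := by
    rw [← star_mem_fracIdeal h.ne_zero hmem, star_mul, star_star, star_algebraMap, mul_comm]
  constructor
  · rintro ⟨h1, -, h3, h4⟩
    refine ⟨h1, h3, hstar.1 ?_⟩
    rw [e4] at h4
    have h5 := h.int_mul_mem (algebraMap_im_mem h1) hu
    convert Submodule.sub_mem _ h4 h5 using 1
    ring
  · rintro ⟨h1, h3, h4⟩
    refine ⟨h1, ?_, h3, ?_⟩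
    · have h5 : (omega - star omega) * u * γ ∈ quadInt hc ht := by
        simpa using h.mul_mem hu h3
      -- The trace of uγ is integral because (ω - ω̄)uγ is: elements of the inverse different have
      -- integral trace.
      have h6 : γ * u + star (γ * u) =
          algebraMap ℚ_[p] _ ((omega - star omega) * u * γ).im := by
        apply mul_right_cancel₀ hΔ
        rw [← sub_star_eq]
        simp only [star_mul, star_sub, star_star]
        ring
      have h7 := (quadInt hc ht).add_mem (algebraMap_im_mem h5) (star_mem_quadInt h1)
      rw [← h6] at h7
      convert h7 using 1
      simp only [star_mul, star_sub]
      ring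
    · rw [e4]
      exact Submodule.add_mem _ (hstar.2 h4) (h.int_mul_mem (algebraMap_im_mem h1) hu)

/-- The second coordinates of the elements of `G` form the fractional ideal `ϖ ^ m O`. -/
def HasLevel (O : Subalgebra ℤ_[p] (QuadraticAlgebra ℚ_[p] c t)) (ϖ : QuadraticAlgebra ℚ_[p] c t)
    (φ : A →ₐ[ℤ_[p]] Matrix (Fin 2) (Fin 2) (QuadraticAlgebra ℚ_[p] c t)) (b : ℚ_[p])
    (G : Subalgebra ℤ_[p] A) (m : ℤ) : Prop :=
  ∀ γ, (∃ α, HasCoords φ b G α γ) ↔ γ ∈ fracIdeal O ϖ m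

theorem HasLevel.unique (h : IsUniformizer (quadInt hc ht) ϖ) {G : Subalgebra ℤ_[p] A} {m m' : ℤ}
    (h1 : HasLevel (quadInt hc ht) ϖ φ b G m) (h2 : HasLevel (quadInt hc ht) ϖ φ b G m') :
    m = m' := by
  have a1 := (h2 _).1 ((h1 (ϖ ^ m)).2 (h.zpow_mem_fracIdeal.2 le_rfl))
  have a2 := (h1 _).1 ((h2 (ϖ ^ m')).2 (h.zpow_mem_fracIdeal.2 le_rfl))
  rw [h.zpow_mem_fracIdeal] at a1 a2
  omega

/-- `G` is finitely generated, contains the standard copy of `O`, and is not contained in the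
field generated by it. -/
structure IsCyclicOrder (O : Subalgebra ℤ_[p] (QuadraticAlgebra ℚ_[p] c t))
    (φ : A →ₐ[ℤ_[p]] Matrix (Fin 2) (Fin 2) (QuadraticAlgebra ℚ_[p] c t)) (b : ℚ_[p])
    (G : Subalgebra ℤ_[p] A) : Prop where
  fg : (Subalgebra.toSubmodule G).FG
  coords_zero : ∀ a ∈ O, HasCoords φ b G a 0
  exists_ne_zero : ∃ α γ, γ ≠ 0 ∧ HasCoords φ b G α γ

/-- Any lattice stable under G is stable under the copy of O in G, which gives the condition on (ω -
ω̄)u. -/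
theorem IsCyclicOrder.exists_vertex (h : IsUniformizer (quadInt hc ht) ϖ)
    {G : Subalgebra ℤ_[p] A} (hG : IsCyclicOrder (quadInt hc ht) φ b G) :
    ∃ n u, (omega - star omega) * u ∈ fracIdeal (quadInt hc ht) ϖ n ∧
      G ≤ (vertexOrder (quadInt hc ht) ϖ h.ne_zero n u).comap φ := by
  obtain ⟨n, u, hle⟩ := h.exists_le_vertexOrder_of_fg φ hG.fg
  refine ⟨n, u, ?_, hle⟩
  rw [← cyclicMatrix_mem_vertexOrder_zero (b := b) h]
  intro a ha
  obtain ⟨x, hx, e⟩ := hG.coords_zero a ha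
  rw [← e]
  exact hle hx

theorem IsCyclicOrder.hasCoords_zero_iff (h : IsUniformizer (quadInt hc ht) ϖ)
    (hmem : ∀ z, z ∈ quadInt hc ht ↔ ‖z.norm‖ ≤ 1)
    {G : Subalgebra ℤ_[p] A} (hG : IsCyclicOrder (quadInt hc ht) φ b G)
    {a : QuadraticAlgebra ℚ_[p] c t} : HasCoords φ b G a 0 ↔ a ∈ quadInt hc ht := by
  refine ⟨?_, hG.coords_zero a⟩
  rintro ⟨x, hx, e⟩
  obtain ⟨n, u, hu, hle⟩ := hG.exists_vertex h
  have h1 := hle hx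
  rw [Subalgebra.mem_comap, e, cyclicMatrix_mem_vertexOrder h hmem hu] at h1
  simpa using h1.1

/-- The second coordinates are stable under O, by left multiplication with conjugates, and are
bounded by ϖ^(-n) for any stable lattice (n, u). -/
theorem IsCyclicOrder.exists_hasLevel (h : IsUniformizer (quadInt hc ht) ϖ)
    (hmem : ∀ z, z ∈ quadInt hc ht ↔ ‖z.norm‖ ≤ 1)
    {G : Subalgebra ℤ_[p] A} (hG : IsCyclicOrder (quadInt hc ht) φ b G) :
    ∃ m, HasLevel (quadInt hc ht) ϖ φ b G m := by
  obtain ⟨n, u, hu, hle⟩ := hG.exists_vertex h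
  let S : AddSubgroup (QuadraticAlgebra ℚ_[p] c t) :=
    { carrier := {γ | ∃ α, HasCoords φ b G α γ}
      add_mem' := by
        rintro γ γ' ⟨α, hα⟩ ⟨α', hα'⟩
        exact ⟨_, hα.add hα'⟩
      zero_mem' := ⟨0, hG.coords_zero 0 (Subalgebra.zero_mem _)⟩
      neg_mem' := by
        rintro γ ⟨α, hα⟩
        have := (hG.coords_zero (-1) (Subalgebra.neg_mem _ (Subalgebra.one_mem _))).mul hα
        exact ⟨_, by simpa using this⟩ }
  obtain ⟨m, hm⟩ := h.exists_eq_fracIdeal S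
    (by
      rintro a ha γ ⟨α, hα⟩
      have := (hG.coords_zero (star a) (star_mem_quadInt ha)).mul hα
      exact ⟨_, by simpa using this⟩)
    (by
      obtain ⟨α, γ, hne, hαγ⟩ := hG.exists_ne_zero
      exact ⟨γ, ⟨α, hαγ⟩, hne⟩)
    (t := -n) (by
      rintro γ ⟨α, x, hx, e⟩
      have h1 := hle hx
      rw [Subalgebra.mem_comap, e, cyclicMatrix_mem_vertexOrder h hmem hu] at h1
      exact h1.2.1)
  exact ⟨m, hm⟩

/-- G is the sum of O and the O-multiples of a single element with second coordinate ϖ^m. So only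
the class modulo O of the first coordinate of that element has to be compared. -/
theorem IsCyclicOrder.le_of_hasLevel (hφ : IsCyclicRep φ b) (h : IsUniformizer (quadInt hc ht) ϖ)
    (hmem : ∀ z, z ∈ quadInt hc ht ↔ ‖z.norm‖ ≤ 1)
    {G H : Subalgebra ℤ_[p] A} (hG : IsCyclicOrder (quadInt hc ht) φ b G)
    (hH : IsCyclicOrder (quadInt hc ht) φ b H) {m : ℤ} (hGm : HasLevel (quadInt hc ht) ϖ φ b G m)
    {α α' : QuadraticAlgebra ℚ_[p] c t} (hα : HasCoords φ b G α (ϖ ^ m))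
    (hα' : HasCoords φ b H α' (ϖ ^ m)) (hsub : α - α' ∈ quadInt hc ht) : G ≤ H := by
  rw [hφ.le_iff]
  intro α₁ γ₁ h1
  have h2 := (hGm γ₁).1 ⟨α₁, h1⟩
  rw [mem_fracIdeal] at h2
  set a := star (γ₁ * ϖ ^ (-m)) with ha
  have ha' : a ∈ quadInt hc ht := star_mem_quadInt h2
  have hγ : star a * ϖ ^ m = γ₁ := by
    rw [ha, star_star, mul_assoc, ← zpow_add₀ h.ne_zero]; simp
  have h3 := (hG.coords_zero (-a) (Subalgebra.neg_mem _ ha')).mul hα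
  have h4 := h1.add h3
  have h5 : γ₁ + star (-a) * ϖ ^ m = 0 := by rw [star_neg, neg_mul, hγ]; ring
  rw [h5, hG.hasCoords_zero_iff h hmem] at h4
  have h6 := (hH.coords_zero a ha').mul hα'
  rw [hγ] at h6
  have h7 : α₁ - a * α' ∈ quadInt hc ht := by
    convert Subalgebra.add_mem _ h4 (Subalgebra.mul_mem _ ha' hsub) using 1
    ring
  have h8 := (hH.coords_zero _ h7).add h6
  convert h8 using 1 <;> ring

/-- The index of an order in a larger one is read off from the levels. -/
theorem relIndex_of_hasLevel (hφ : IsCyclicRep φ b) (h : IsUniformizer (quadInt hc ht) ϖ)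
    (hmem : ∀ z, z ∈ quadInt hc ht ↔ ‖z.norm‖ ≤ 1)
    {G H : Subalgebra ℤ_[p] A} (hG : IsCyclicOrder (quadInt hc ht) φ b G)
    (hH : IsCyclicOrder (quadInt hc ht) φ b H) (hle : G ≤ H) {m m' : ℤ}
    (hGm : HasLevel (quadInt hc ht) ϖ φ b G m) (hHm : HasLevel (quadInt hc ht) ϖ φ b H m') :
    (Subalgebra.toSubmodule G).toAddSubgroup.relIndex (Subalgebra.toSubmodule H).toAddSubgroup =
      (fracIdeal (quadInt hc ht) ϖ m).toAddSubgroup.relIndex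
        (fracIdeal (quadInt hc ht) ϖ m').toAddSubgroup := by
  -- Projection to the second coordinate; on both orders its kernel is the same copy of O, so it
  -- preserves the index.
  let f : A →+ QuadraticAlgebra ℚ_[p] c t :=
    (Matrix.entryAddMonoidHom _ 1 0).comp φ.toRingHom.toAddMonoidHom
  have hfx : ∀ x α γ, φ x = cyclicMatrix b α γ → f x = γ := by
    intro x α γ e
    change φ x 1 0 = γ
    rw [e]; rfl
  have e1 : (Subalgebra.toSubmodule H).toAddSubgroup.map f =
      (fracIdeal (quadInt hc ht) ϖ m').toAddSubgroup := by
    ext γ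
    rw [Submodule.mem_toAddSubgroup, ← hHm γ]
    constructor
    · rintro ⟨x, hx, rfl⟩
      obtain ⟨α, γ, e⟩ := hφ.exists_eq x
      exact ⟨α, x, hx, by rw [hfx x α γ e]; exact e⟩
    · rintro ⟨α, x, hx, e⟩
      exact ⟨x, hx, hfx x α γ e⟩
  have e2 : (Subalgebra.toSubmodule G).toAddSubgroup =
      (fracIdeal (quadInt hc ht) ϖ m).toAddSubgroup.comap f ⊓
        (Subalgebra.toSubmodule H).toAddSubgroup := by
    ext x
    rw [AddSubgroup.mem_inf, AddSubgroup.mem_comap, Submodule.mem_toAddSubgroup,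
      Submodule.mem_toAddSubgroup, Submodule.mem_toAddSubgroup]
    obtain ⟨α, γ, e⟩ := hφ.exists_eq x
    rw [hfx x α γ e, ← hGm γ]
    constructor
    · intro hx
      exact ⟨⟨α, x, hx, e⟩, hle hx⟩
    · rintro ⟨⟨α', y, hy, e'⟩, hx⟩
      have hsub : φ (x - y) = cyclicMatrix b (α - α') 0 := by
        have := cyclicMatrix_add b (α - α') 0 α' γ
        rw [sub_add_cancel, zero_add] at this
        rw [map_sub, e, e', this, add_sub_cancel_right]
      have h1 : HasCoords φ b H (α - α') 0 := ⟨x - y, Subalgebra.sub_mem _ hx (hle hy), hsub⟩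
      rw [hH.hasCoords_zero_iff h hmem] at h1
      obtain ⟨z, hz, e''⟩ := hG.coords_zero _ h1
      have : x = z + y := by
        rw [← sub_eq_iff_eq_add]; exact hφ.injective (hsub.trans e''.symm)
      rw [this]
      exact G.add_mem hz hy
  rw [e2, AddSubgroup.inf_relIndex_right, AddSubgroup.relIndex_comap, e1]

end Cyclic

end LocalOrders

namespace LocalOrders

open QuadraticAlgebra hiding norm_neg norm_one norm_natCast norm_star norm_zero
open scoped Matrix

/-! ### Levels of orders in the ramified case. -/

section Ramified

variable {p : ℕ} [Fact p.Prime] {c t : ℚ_[p]} {hc : ‖c‖ ≤ 1} {ht : ‖t‖ ≤ 1}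
  {ϖ : QuadraticAlgebra ℚ_[p] c t} [hf : Fact (∀ r : ℚ_[p], r ^ 2 ≠ c + t * r)]
  {b : ℚ_[p]} {δ m₀ : ℤ}

/-- Data on a ramified quadratic extension with different of valuation `δ`, on a unit `b` of the base
and on the elements of the extension with norm close to `b`. -/
structure RamifiedData (hc : ‖c‖ ≤ 1) (ht : ‖t‖ ≤ 1) (ϖ : QuadraticAlgebra ℚ_[p] c t) (b : ℚ_[p])
    (δ m₀ : ℤ) : Prop where
  unif : IsUniformizer (quadInt hc ht) ϖ
  mem_iff : ∀ z, z ∈ quadInt hc ht ↔ ‖z.norm‖ ≤ 1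
  hasVal_diff : HasVal (quadInt hc ht) ϖ (omega - star omega) δ
  one_le : 1 ≤ δ
  b_notMem : algebraMap ℚ_[p] _ b ∉ fracIdeal (quadInt hc ht) ϖ 1
  parity : ∀ (q : ℚ_[p]) (e : ℤ), algebraMap ℚ_[p] _ q ∈ fracIdeal (quadInt hc ht) ϖ (2 * e - 1) →
    algebraMap ℚ_[p] _ q ∈ fracIdeal (quadInt hc ht) ϖ (2 * e)
  norm_close_iff : ∀ e ≤ δ - 1, ∀ u : QuadraticAlgebra ℚ_[p] c t,
    algebraMap ℚ_[p] _ (b - u.norm) ∈ fracIdeal (quadInt hc ht) ϖ (2 * e) ↔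
      u - 1 ∈ fracIdeal (quadInt hc ht) ϖ e
  -- The first alternative serves the split algebra, where b = 1; the second serves the division
  -- algebra, where b stays away from all norms.
  minLevel : (m₀ = -δ ∧ algebraMap ℚ_[p] _ (b - 1) ∈ fracIdeal (quadInt hc ht) ϖ (2 * δ)) ∨
    (m₀ = 1 - δ ∧ ∀ u : QuadraticAlgebra ℚ_[p] c t,
      algebraMap ℚ_[p] _ (b - u.norm) ∉ fracIdeal (quadInt hc ht) ϖ (2 * δ))

variable {A : Type*} [Ring A] [Algebra ℤ_[p] A]
variable {φ : A →ₐ[ℤ_[p]] Matrix (Fin 2) (Fin 2) (QuadraticAlgebra ℚ_[p] c t)}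

namespace RamifiedData

variable (D : RamifiedData hc ht ϖ b δ m₀)

include D

theorem diff_mul_mem_iff {n : ℤ} {u : QuadraticAlgebra ℚ_[p] c t} :
    (omega - star omega) * u ∈ fracIdeal (quadInt hc ht) ϖ n ↔
      u ∈ fracIdeal (quadInt hc ht) ϖ (n - δ) :=
  D.unif.mul_mem_iff D.hasVal_diff

theorem norm_mem {u : QuadraticAlgebra ℚ_[p] c t} {n : ℤ}
    (hu : u ∈ fracIdeal (quadInt hc ht) ϖ n) :
    algebraMap ℚ_[p] _ u.norm ∈ fracIdeal (quadInt hc ht) ϖ (2 * n) := by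
  rw [algebraMap_norm_eq_mul_star, two_mul]
  exact D.unif.mul_mem hu ((star_mem_fracIdeal D.unif.ne_zero D.mem_iff).2 hu)

/-- If the norm of a nonunit is close to `b`, the error is a unit. -/
theorem notMem_of_mem_one {u : QuadraticAlgebra ℚ_[p] c t}
    (hu : u ∈ fracIdeal (quadInt hc ht) ϖ 1) :
    algebraMap ℚ_[p] _ (b - u.norm) ∉ fracIdeal (quadInt hc ht) ϖ 1 := by
  intro h
  apply D.b_notMem
  have h1 := D.unif.anti (show (1 : ℤ) ≤ 2 * 1 by norm_num) (D.norm_mem hu)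
  have := Submodule.add_mem _ h h1
  rwa [← map_add, sub_add_cancel] at this

theorem one_close {e : ℤ} (he : e ≤ -m₀) :
    algebraMap ℚ_[p] _ (b - 1) ∈ fracIdeal (quadInt hc ht) ϖ (2 * e) := by
  rcases D.minLevel with ⟨h1, h2⟩ | ⟨h1, h2⟩
  · exact D.unif.anti (by omega) h2
  · have := (D.norm_close_iff e (by omega) 1).2 (by simp)
    simpa using this

theorem minLevel_bounds : -δ ≤ m₀ ∧ m₀ ≤ 1 - δ := by
  rcases D.minLevel with ⟨h1, -⟩ | ⟨h1, -⟩ <;> omega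

theorem hasCoords_comap (hφ : IsCyclicRep φ b) {n : ℤ} {u α γ : QuadraticAlgebra ℚ_[p] c t}
    (hu : u ∈ fracIdeal (quadInt hc ht) ϖ (n - δ)) :
    HasCoords φ b ((vertexOrder (quadInt hc ht) ϖ D.unif.ne_zero n u).comap φ) α γ ↔
      α - u * γ ∈ quadInt hc ht ∧ γ ∈ fracIdeal (quadInt hc ht) ϖ (-n) ∧
        algebraMap ℚ_[p] _ (b - u.norm) * γ ∈ fracIdeal (quadInt hc ht) ϖ n := by
  rw [hφ.hasCoords_comap, cyclicMatrix_mem_vertexOrder D.unif D.mem_iff (D.diff_mul_mem_iff.2 hu)]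

/-- The level is max(-n, n - v(b - N(u))). It is spelled out by memberships because b - N(u) may
vanish. -/
theorem hasLevel_comap_iff (hφ : IsCyclicRep φ b) {n m : ℤ} {u : QuadraticAlgebra ℚ_[p] c t}
    (hu : u ∈ fracIdeal (quadInt hc ht) ϖ (n - δ)) :
    HasLevel (quadInt hc ht) ϖ φ b
        ((vertexOrder (quadInt hc ht) ϖ D.unif.ne_zero n u).comap φ) m ↔
      -n ≤ m ∧ algebraMap ℚ_[p] _ (b - u.norm) ∈ fracIdeal (quadInt hc ht) ϖ (n - m) ∧
        (n = -m ∨ algebraMap ℚ_[p] _ (b - u.norm) ∉ fracIdeal (quadInt hc ht) ϖ (n - m + 1)) := by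
  have key : ∀ l, (ϖ ^ l ∈ fracIdeal (quadInt hc ht) ϖ (-n) ∧
      algebraMap ℚ_[p] _ (b - u.norm) * ϖ ^ l ∈ fracIdeal (quadInt hc ht) ϖ n) ↔
      -n ≤ l ∧ algebraMap ℚ_[p] _ (b - u.norm) ∈ fracIdeal (quadInt hc ht) ϖ (n - l) := by
    intro l
    rw [mul_comm, D.unif.mul_mem_iff (D.unif.hasVal_zpow l), D.unif.zpow_mem_fracIdeal]
  have hex : ∀ γ, (∃ α, HasCoords φ b
      ((vertexOrder (quadInt hc ht) ϖ D.unif.ne_zero n u).comap φ) α γ) ↔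
      γ ∈ fracIdeal (quadInt hc ht) ϖ (-n) ∧
        algebraMap ℚ_[p] _ (b - u.norm) * γ ∈ fracIdeal (quadInt hc ht) ϖ n := by
    intro γ
    constructor
    · rintro ⟨α, hα⟩
      exact ((D.hasCoords_comap hφ hu).1 hα).2
    · intro h
      exact ⟨u * γ, (D.hasCoords_comap hφ hu).2 ⟨by simp, h⟩⟩
  simp only [HasLevel, hex]
  constructor
  · intro h
    obtain ⟨h1, h2⟩ := (key m).1 ((h _).2 (D.unif.zpow_mem_fracIdeal.2 le_rfl))
    refine ⟨h1, h2, ?_⟩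
    by_contra! hcon
    have h3 := (h (ϖ ^ (m - 1))).1 ((key _).2 ⟨by omega, by convert hcon.2 using 2; ring⟩)
    rw [D.unif.zpow_mem_fracIdeal] at h3
    omega
  · rintro ⟨h1, h2, h3⟩ γ
    constructor
    · rintro ⟨h4, h5⟩
      by_cases hγ : γ = 0
      · simp [hγ]
      obtain ⟨l, hl⟩ := D.unif.exists_hasVal hγ
      rw [D.unif.mem_iff hl] at h4 ⊢
      rw [mul_comm, D.unif.mul_mem_iff hl] at h5
      by_contra! hlt
      rcases h3 with h3 | h3
      · omega
      · exact h3 (D.unif.anti (by omega) h5)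
    · intro h4
      refine ⟨D.unif.anti h1 h4, ?_⟩
      have := D.unif.mul_mem h2 h4
      simpa using this

/-- In the split alternative, a level below -δ, or level -δ with n ≠ δ, would make u and b - N(u)
both nonunits although b is a unit. In the other alternative it would put a norm within ϖ^(2δ) of b,
parity improving 2δ - 1 to 2δ. -/
theorem bounds {n m : ℤ} {u : QuadraticAlgebra ℚ_[p] c t}
    (hu : u ∈ fracIdeal (quadInt hc ht) ϖ (n - δ)) (hn : -n ≤ m)
    (hq : algebraMap ℚ_[p] _ (b - u.norm) ∈ fracIdeal (quadInt hc ht) ϖ (n - m)) :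
    m₀ ≤ m ∧ (m = m₀ → n = -m₀) ∧
      algebraMap ℚ_[p] _ (b - u.norm) ∈ fracIdeal (quadInt hc ht) ϖ (2 * (-m)) := by
  have h1 := D.one_le
  have hq' : algebraMap ℚ_[p] _ (b - u.norm) ∈ fracIdeal (quadInt hc ht) ϖ (2 * (-m)) :=
    D.unif.anti (by omega) hq
  rcases D.minLevel with ⟨h2, h3⟩ | ⟨h2, h3⟩
  · have h4 : m ≤ -δ → n = δ := by
      intro hm
      by_contra hne
      exact D.notMem_of_mem_one (D.unif.anti (by omega) hu) (D.unif.anti (by omega) hq)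
    refine ⟨?_, ?_, hq'⟩
    · by_contra! hlt
      have := h4 (by omega)
      omega
    · intro hm
      rw [h4 (by omega), h2]; ring
  · refine ⟨?_, ?_, hq'⟩
    · by_contra! hlt
      exact h3 u (D.unif.anti (by omega) hq')
    · intro hm
      by_contra hne
      exact h3 u (D.parity _ _ (D.unif.anti (by omega) hq))

/-- Every order of level `m` lies in a vertex order with controlled parameters. -/
theorem exists_vertex (hφ : IsCyclicRep φ b) {G : Subalgebra ℤ_[p] A}
    (hG : IsCyclicOrder (quadInt hc ht) φ b G) {m : ℤ} (hm : HasLevel (quadInt hc ht) ϖ φ b G m) :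
    ∃ n u, u ∈ fracIdeal (quadInt hc ht) ϖ (n - δ) ∧
      G ≤ (vertexOrder (quadInt hc ht) ϖ D.unif.ne_zero n u).comap φ ∧ -n ≤ m ∧
      algebraMap ℚ_[p] _ (b - u.norm) ∈ fracIdeal (quadInt hc ht) ϖ (n - m) := by
  obtain ⟨n, u, hu, hle⟩ := hG.exists_vertex D.unif
  rw [D.diff_mul_mem_iff] at hu
  obtain ⟨α, hα⟩ := (hm (ϖ ^ m)).2 (D.unif.zpow_mem_fracIdeal.2 le_rfl)
  have h1 := (D.hasCoords_comap hφ hu).1 (hφ.le_iff.1 hle _ _ hα)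
  rw [mul_comm (algebraMap _ _ _), D.unif.mul_mem_iff (D.unif.hasVal_zpow m),
    D.unif.zpow_mem_fracIdeal] at h1
  exact ⟨n, u, hu, hle, h1.2.1, h1.2.2⟩

theorem minLevel_le (hφ : IsCyclicRep φ b) {G : Subalgebra ℤ_[p] A}
    (hG : IsCyclicOrder (quadInt hc ht) φ b G) {m : ℤ} (hm : HasLevel (quadInt hc ht) ϖ φ b G m) :
    m₀ ≤ m := by
  obtain ⟨n, u, hu, -, h1, h2⟩ := D.exists_vertex hφ hG hm
  exact (D.bounds hu h1 h2).1

theorem isCyclicOrder_comap (hφ : IsCyclicRep φ b)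
    (hfg : ∀ n u, (Subalgebra.toSubmodule
      ((vertexOrder (quadInt hc ht) ϖ D.unif.ne_zero n u).comap φ)).FG)
    {n m : ℤ} {u : QuadraticAlgebra ℚ_[p] c t} (hu : u ∈ fracIdeal (quadInt hc ht) ϖ (n - δ))
    (hm : HasLevel (quadInt hc ht) ϖ φ b
      ((vertexOrder (quadInt hc ht) ϖ D.unif.ne_zero n u).comap φ) m) :
    IsCyclicOrder (quadInt hc ht) φ b
      ((vertexOrder (quadInt hc ht) ϖ D.unif.ne_zero n u).comap φ) := by
  refine ⟨hfg n u, fun a ha => ?_, ?_⟩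
  · rw [D.hasCoords_comap hφ hu]
    simpa using ha
  · obtain ⟨α, hα⟩ := (hm (ϖ ^ m)).2 (D.unif.zpow_mem_fracIdeal.2 le_rfl)
    exact ⟨α, ϖ ^ m, zpow_ne_zero _ D.unif.ne_zero, hα⟩

theorem one_mem_of_le {m : ℤ} (hm : m₀ ≤ m) :
    (1 : QuadraticAlgebra ℚ_[p] c t) ∈ fracIdeal (quadInt hc ht) ϖ (-m - δ) := by
  have := D.minLevel_bounds
  rw [← zpow_zero ϖ, D.unif.zpow_mem_fracIdeal]
  omega

theorem hasLevel_standard (hφ : IsCyclicRep φ b) {m : ℤ} (hm : m₀ ≤ m) :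
    HasLevel (quadInt hc ht) ϖ φ b
      ((vertexOrder (quadInt hc ht) ϖ D.unif.ne_zero (-m) 1).comap φ) m := by
  rw [D.hasLevel_comap_iff hφ (D.one_mem_of_le hm)]
  refine ⟨by omega, ?_, Or.inl rfl⟩
  have := D.one_close (e := -m) (by omega)
  rw [map_one]
  convert this using 2
  ring

/-- Orders of non-minimal level are determined by their level. -/
theorem eq_standard (hφ : IsCyclicRep φ b)
    (hfg : ∀ n u, (Subalgebra.toSubmodule
      ((vertexOrder (quadInt hc ht) ϖ D.unif.ne_zero n u).comap φ)).FG)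
    {G : Subalgebra ℤ_[p] A} (hG : IsCyclicOrder (quadInt hc ht) φ b G) {m : ℤ}
    (hm : HasLevel (quadInt hc ht) ϖ φ b G m) (hlt : m₀ < m) :
    G = (vertexOrder (quadInt hc ht) ϖ D.unif.ne_zero (-m) 1).comap φ := by
  have hb := D.minLevel_bounds
  obtain ⟨n, u, hu, hle, h1, h2⟩ := D.exists_vertex hφ hG hm
  -- Here m > m₀ is used: it gives -m ≤ δ - 1, the range in which closeness of N(u) to b means u ≡ 1
  -- mod ϖ^(-m). Multiplied by ϖ^m, this leaves no freedom in α modulo O.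
  have h3 := (D.norm_close_iff (-m) (by omega) u).1 (D.bounds hu h1 h2).2.2
  obtain ⟨α, hα⟩ := (hm (ϖ ^ m)).2 (D.unif.zpow_mem_fracIdeal.2 le_rfl)
  have h4 := ((D.hasCoords_comap hφ hu).1 (hφ.le_iff.1 hle _ _ hα)).1
  have hs := D.hasLevel_standard hφ hlt.le
  have hso := D.isCyclicOrder_comap hφ hfg (D.one_mem_of_le hlt.le) hs
  have hsc : HasCoords φ b ((vertexOrder (quadInt hc ht) ϖ D.unif.ne_zero (-m) 1).comap φ)
      (ϖ ^ m) (ϖ ^ m) := by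
    obtain ⟨α', hα'⟩ := (hs (ϖ ^ m)).2 (D.unif.zpow_mem_fracIdeal.2 le_rfl)
    have h5 := ((D.hasCoords_comap hφ (D.one_mem_of_le hlt.le)).1 hα').2
    exact (D.hasCoords_comap hφ (D.one_mem_of_le hlt.le)).2 ⟨by simp, h5⟩
  have hsub : α - ϖ ^ m ∈ quadInt hc ht := by
    have h6 := D.unif.mul_mem h3 (D.unif.zpow_mem_fracIdeal (n := m).2 le_rfl)
    rw [neg_add_cancel, mem_fracIdeal_zero] at h6
    convert Subalgebra.add_mem _ h4 h6 using 1
    ring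
  apply le_antisymm
  · exact hG.le_of_hasLevel hφ D.unif D.mem_iff hso hm hα hsc hsub
  · refine hso.le_of_hasLevel hφ D.unif D.mem_iff hG hs hsc hα ?_
    rw [← neg_sub]
    exact Subalgebra.neg_mem _ hsub

/-- An order of level m > m₀ is the standard one of its level, and that lies in the standard order
of level m₀; maximality would make the two levels equal. -/
theorem hasLevel_of_maximal (hφ : IsCyclicRep φ b)
    (hfg : ∀ n u, (Subalgebra.toSubmodule
      ((vertexOrder (quadInt hc ht) ϖ D.unif.ne_zero n u).comap φ)).FG)
    {G : Subalgebra ℤ_[p] A} (hG : IsCyclicOrder (quadInt hc ht) φ b G)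
    (hmax : ∀ n u, G ≤ (vertexOrder (quadInt hc ht) ϖ D.unif.ne_zero n u).comap φ →
      G = (vertexOrder (quadInt hc ht) ϖ D.unif.ne_zero n u).comap φ) :
    HasLevel (quadInt hc ht) ϖ φ b G m₀ := by
  obtain ⟨m, hm⟩ := hG.exists_hasLevel D.unif D.mem_iff
  rcases (D.minLevel_le hφ hG hm).eq_or_lt with h | hlt
  · rwa [h]
  exfalso
  have h1 := D.eq_standard hφ hfg hG hm hlt
  have h2 : G ≤ (vertexOrder (quadInt hc ht) ϖ D.unif.ne_zero (-m₀) 1).comap φ := by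
    rw [h1, hφ.le_iff]
    intro α γ
    rw [D.hasCoords_comap hφ (D.one_mem_of_le hlt.le), D.hasCoords_comap hφ
      (D.one_mem_of_le le_rfl)]
    rintro ⟨a1, a2, -⟩
    have a3 : γ ∈ fracIdeal (quadInt hc ht) ϖ (-(-m₀)) := D.unif.anti (by omega) a2
    refine ⟨a1, a3, ?_⟩
    have := D.unif.mul_mem (D.one_close (e := -m₀) le_rfl) a3
    rw [map_one]
    convert this using 2
    ring
  have h3 := hmax _ _ h2
  have h4 := D.hasLevel_standard hφ le_rfl
  rw [← h3] at h4
  have := HasLevel.unique D.unif hm h4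
  omega

/-- At the minimal level n must be -m₀, and the element of G with second coordinate ϖ^m₀ fixes u
modulo ϖ^(-m₀) = ϖ^n. So the stabilizer is unique. -/
theorem vertexCount_maximal (hφ : IsCyclicRep φ b)
    (hfg : ∀ n u, (Subalgebra.toSubmodule
      ((vertexOrder (quadInt hc ht) ϖ D.unif.ne_zero n u).comap φ)).FG)
    {G : Subalgebra ℤ_[p] A} (hG : IsCyclicOrder (quadInt hc ht) φ b G)
    (hmax : ∀ n u, G ≤ (vertexOrder (quadInt hc ht) ϖ D.unif.ne_zero n u).comap φ →
      G = (vertexOrder (quadInt hc ht) ϖ D.unif.ne_zero n u).comap φ) :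
    vertexCount (quadInt hc ht) ϖ D.unif.ne_zero φ G = 1 := by
  have hm := D.hasLevel_of_maximal hφ hfg hG hmax
  obtain ⟨α, hα⟩ := (hm (ϖ ^ m₀)).2 (D.unif.zpow_mem_fracIdeal.2 le_rfl)
  have key : ∀ n u, G = (vertexOrder (quadInt hc ht) ϖ D.unif.ne_zero n u).comap φ →
      n = -m₀ ∧ α - u * ϖ ^ m₀ ∈ quadInt hc ht := by
    intro n u h
    have h0 : (omega - star omega) * u ∈ fracIdeal (quadInt hc ht) ϖ n := by
      rw [← cyclicMatrix_mem_vertexOrder_zero (b := b) D.unif]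
      intro a ha
      rw [← hφ.hasCoords_comap, ← h]
      exact hG.coords_zero a ha
    rw [D.diff_mul_mem_iff] at h0
    rw [h, D.hasCoords_comap hφ h0] at hα
    have h1 := hm
    rw [h, D.hasLevel_comap_iff hφ h0] at h1
    exact ⟨(D.bounds h0 h1.1 h1.2.1).2.1 rfl, hα.1⟩
  obtain ⟨n, u, -, hle, -⟩ := D.exists_vertex hφ hG hm
  have hv := hmax n u hle
  rw [vertexCount, Set.encard_eq_one]
  refine ⟨vertexOrder (quadInt hc ht) ϖ D.unif.ne_zero n u, ?_⟩
  ext N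
  simp only [Set.mem_ofPred_eq, Set.mem_singleton_iff]
  constructor
  · rintro ⟨⟨n', u', rfl⟩, h⟩
    obtain ⟨h1, h2⟩ := key n' u' h.symm
    obtain ⟨h3, h4⟩ := key n u hv
    rw [D.unif.vertexOrder_eq_iff]
    refine ⟨by omega, ?_⟩
    have h5 := Subalgebra.sub_mem _ h4 h2
    have h6 : ϖ ^ m₀ * (u' - u) ∈ fracIdeal (quadInt hc ht) ϖ 0 := by
      rw [mem_fracIdeal_zero]
      convert h5 using 1
      ring
    rw [D.unif.mul_mem_iff (D.unif.hasVal_zpow m₀)] at h6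
    rw [h1]
    simpa using h6
  · rintro rfl
    exact ⟨⟨n, u, rfl⟩, hv.symm⟩

/-- Above the minimal level an order is determined by its level, so comparing orders reduces to
`hasLevel_comap_iff`. -/
theorem comap_eq_iff (hφ : IsCyclicRep φ b)
    (hfg : ∀ n u, (Subalgebra.toSubmodule
      ((vertexOrder (quadInt hc ht) ϖ D.unif.ne_zero n u).comap φ)).FG)
    {G : Subalgebra ℤ_[p] A} (hG : IsCyclicOrder (quadInt hc ht) φ b G) {m : ℤ}
    (hm : HasLevel (quadInt hc ht) ϖ φ b G m) (hlt : m₀ < m) {n : ℤ}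
    {u : QuadraticAlgebra ℚ_[p] c t} :
    (vertexOrder (quadInt hc ht) ϖ D.unif.ne_zero n u).comap φ = G ↔
      u ∈ fracIdeal (quadInt hc ht) ϖ (n - δ) ∧ -n ≤ m ∧
      algebraMap ℚ_[p] _ (b - u.norm) ∈ fracIdeal (quadInt hc ht) ϖ (n - m) ∧
        (n = -m ∨ algebraMap ℚ_[p] _ (b - u.norm) ∉ fracIdeal (quadInt hc ht) ϖ (n - m + 1)) := by
  constructor
  · intro h
    have h0 : (omega - star omega) * u ∈ fracIdeal (quadInt hc ht) ϖ n := by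
      rw [← cyclicMatrix_mem_vertexOrder_zero (b := b) D.unif]
      intro a ha
      rw [← hφ.hasCoords_comap, h]
      exact hG.coords_zero a ha
    rw [D.diff_mul_mem_iff] at h0
    exact ⟨h0, (D.hasLevel_comap_iff hφ h0).1 (h ▸ hm)⟩
  · rintro ⟨h0, h1⟩
    have h2 := (D.hasLevel_comap_iff hφ h0).2 h1
    rw [D.eq_standard hφ hfg hG hm hlt]
    exact D.eq_standard hφ hfg (D.isCyclicOrder_comap hφ hfg h0 h2) h2 hlt

end RamifiedData

/-- The parameters `u` for which the vertex order with parameters `2 i - m` and `u` has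
level `m`. -/
def levelSet (hc : ‖c‖ ≤ 1) (ht : ‖t‖ ≤ 1) (ϖ : QuadraticAlgebra ℚ_[p] c t) (b : ℚ_[p])
    (δ m : ℤ) (i : ℕ) :
    Set (QuadraticAlgebra ℚ_[p] c t) :=
  {u | u ∈ fracIdeal (quadInt hc ht) ϖ (2 * i - m - δ) ∧
    algebraMap ℚ_[p] _ (b - u.norm) ∈ fracIdeal (quadInt hc ht) ϖ (2 * (i - m)) ∧
      (i = 0 ∨ algebraMap ℚ_[p] _ (b - u.norm) ∉ fracIdeal (quadInt hc ht) ϖ (2 * (i - m + 1)))}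

theorem RamifiedData.vertexCount_eq_sum (D : RamifiedData hc ht ϖ b δ m₀) (hφ : IsCyclicRep φ b)
    (hfg : ∀ n u, (Subalgebra.toSubmodule
      ((vertexOrder (quadInt hc ht) ϖ D.unif.ne_zero n u).comap φ)).FG)
    {G : Subalgebra ℤ_[p] A} (hG : IsCyclicOrder (quadInt hc ht) φ b G) {m : ℤ}
    (hm : HasLevel (quadInt hc ht) ϖ φ b G m) (hlt : m₀ < m) (s : Finset ℕ)
    (hs : ∀ i ∉ s, levelSet hc ht ϖ b δ m i = ∅) :
    vertexCount (quadInt hc ht) ϖ D.unif.ne_zero φ G =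
      ∑ i ∈ s, (vertexOrder (quadInt hc ht) ϖ D.unif.ne_zero (2 * i - m) ''
        levelSet hc ht ϖ b δ m i).encard := by
  rw [← finsum_mem_coe_finset, ← Set.Finite.encard_biUnion (Finset.finite_toSet s), vertexCount]
  · congr 1
    ext N
    simp only [Set.mem_ofPred_eq, Set.mem_iUnion, Finset.mem_coe, Set.mem_image, exists_prop]
    constructor
    · rintro ⟨⟨n, u, rfl⟩, h⟩
      rw [D.comap_eq_iff hφ hfg hG hm hlt] at h
      obtain ⟨h1, h2, h3, h4⟩ := h
      -- Either n = -m, or n - m is the exact valuation of b - N(u), which is even as that of an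
      -- element of ℚ_p. In both cases n + m is even.
      obtain ⟨i, hi⟩ : ∃ i : ℕ, n = 2 * i - m := by
        rcases Int.even_or_odd' (n + m) with ⟨i, hi | hi⟩
        · exact ⟨i.toNat, by omega⟩
        · exfalso
          rcases h4 with h4 | h4
          · omega
          · apply h4
            have := D.parity _ (i - m + 1) (by convert h3 using 2; omega)
            convert this using 2
            omega
      subst hi
      have hmem : u ∈ levelSet hc ht ϖ b δ m i := by
        refine ⟨h1, by convert h3 using 2; ring, ?_⟩
        rcases h4 with h4 | h4
        · left; omega
        · right
          intro h5
          exact h4 (D.unif.anti (by omega) h5)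
      refine ⟨i, ?_, u, hmem, rfl⟩
      by_contra hi
      rw [hs i hi] at hmem
      exact hmem
    · rintro ⟨i, -, u, ⟨h1, h2, h3⟩, rfl⟩
      refine ⟨⟨_, _, rfl⟩, (D.comap_eq_iff hφ hfg hG hm hlt).2
        ⟨h1, by omega, by convert h2 using 2; ring, ?_⟩⟩
      rcases h3 with h3 | h3
      · left; simp [h3]
      · right
        intro h4
        apply h3
        apply D.parity
        convert h4 using 2
        ring
  · intro i _ j _ hij
    rw [Function.onFun, Set.disjoint_left]
    rintro _ ⟨u, -, rfl⟩ ⟨u', -, h⟩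
    have := (D.unif.vertexOrder_eq_iff.1 h).1
    apply hij
    omega

end Ramified

end LocalOrders

namespace LocalOrders

open QuadraticAlgebra hiding norm_neg norm_one norm_natCast norm_star norm_zero
open scoped Matrix

/-! ### Counting classes of u. -/

section Count

/-- On a coset of L the fibres of f are classes modulo H, so f induces an injection on L/(H ∩ L). -/
theorem encard_image_addSubgroup {G X : Type*} [AddCommGroup G] (f : G → X) (H L : AddSubgroup G)
    (u₀ : G) (hf : ∀ x y, f x = f y ↔ x - y ∈ H) (hfin : H.relIndex L ≠ 0) :
    (f '' {u | u - u₀ ∈ L}).encard = H.relIndex L := by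
  have e : f '' {u | u - u₀ ∈ L} = Set.range (fun x : L ⧸ H.addSubgroupOf L =>
      Quotient.liftOn' x (fun y : L => f (u₀ + y)) (by
        intro a b hab
        rw [QuotientAddGroup.leftRel_apply, AddSubgroup.mem_addSubgroupOf] at hab
        rw [eq_comm, hf]
        convert hab using 1
        simp
        abel)) := by
    ext x
    constructor
    · rintro ⟨u, hu, rfl⟩
      exact ⟨Quotient.mk'' ⟨u - u₀, hu⟩, by simp⟩
    · rintro ⟨y, rfl⟩
      induction y using Quotient.inductionOn' with
      | h y => exact ⟨u₀ + y, by simp, rfl⟩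
  rw [e, ← Set.image_univ, Set.InjOn.encard_image, Set.encard_univ, ENat.card]
  · have : Finite (L ⧸ H.addSubgroupOf L) := by
      rw [← AddSubgroup.index_ne_zero_iff_finite]; exact hfin
    rw [← Nat.cast_card]
    rw [AddSubgroup.relIndex, AddSubgroup.index]
    simp
  · apply Function.Injective.injOn
    intro a b
    induction a using Quotient.inductionOn' with
    | h a =>
      induction b using Quotient.inductionOn' with
      | h b =>
        intro hab
        simp only [Quotient.liftOn'_mk''] at hab
        rw [eq_comm, hf] at hab
        apply Quotient.sound'
        rw [QuotientAddGroup.leftRel_apply, AddSubgroup.mem_addSubgroupOf]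
        convert hab using 1
        simp
        abel

variable {p : ℕ} [Fact p.Prime] {K : Type*} [Field K] [Algebra ℤ_[p] K]
  {O : Subalgebra ℤ_[p] K} {ϖ : K}

theorem IsUniformizer.relIndex_fracIdeal (h : IsUniformizer O ϖ) {q : ℕ}
    (hq : (fracIdeal O ϖ 1).toAddSubgroup.relIndex (fracIdeal O ϖ 0).toAddSubgroup = q)
    (a : ℤ) (i : ℕ) : (fracIdeal O ϖ (a + i)).toAddSubgroup.relIndex
      (fracIdeal O ϖ a).toAddSubgroup = q ^ i := by
  have step : ∀ a : ℤ, (fracIdeal O ϖ (a + 1)).toAddSubgroup.relIndex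
      (fracIdeal O ϖ a).toAddSubgroup = q := by
    intro a
    have hmap : ∀ k : ℤ, (fracIdeal O ϖ k).toAddSubgroup.map (AddMonoidHom.mulLeft (ϖ ^ a)) =
        (fracIdeal O ϖ (a + k)).toAddSubgroup := by
      intro k
      ext x
      rw [AddSubgroup.mem_map]
      constructor
      · rintro ⟨y, hy, rfl⟩
        exact h.mul_mem (h.zpow_mem_fracIdeal.2 le_rfl) hy
      · intro hx
        refine ⟨ϖ ^ (-a) * x, ?_, ?_⟩
        · rw [Submodule.mem_toAddSubgroup, h.mul_mem_iff (h.hasVal_zpow _)]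
          rw [sub_neg_eq_add, add_comm]
          exact hx
        · simp [h.ne_zero, zpow_ne_zero]
    rw [← hmap, ← add_zero a, ← hmap, add_zero, AddSubgroup.relIndex_map_map_of_injective, hq]
    intro x y hxy
    exact mul_left_cancel₀ (zpow_ne_zero _ h.ne_zero) hxy
  induction i with
  | zero => simp
  | succ i ih =>
    rw [pow_succ', ← ih, ← AddSubgroup.relIndex_mul_relIndex _ (fracIdeal O ϖ (a + i)).toAddSubgroup
      _ (fun x hx => h.anti (by push_cast; omega) hx) (fun x hx => h.anti (by omega) hx)]
    congr 1
    rw [← step (a + i)]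
    congr 3
    push_cast
    ring

theorem IsUniformizer.encard_vertexOrder_image (h : IsUniformizer O ϖ)
    (hq : (fracIdeal O ϖ 1).toAddSubgroup.relIndex (fracIdeal O ϖ 0).toAddSubgroup = p)
    (n a : ℤ) (i : ℕ) (hn : n = a + i) (u₀ : K) :
    (vertexOrder O ϖ h.ne_zero n '' {u | u - u₀ ∈ fracIdeal O ϖ a}).encard = ((p ^ i : ℕ) : ℕ∞) := by
  subst hn
  have := encard_image_addSubgroup (vertexOrder O ϖ h.ne_zero (a + i))
    (fracIdeal O ϖ (a + i)).toAddSubgroup (fracIdeal O ϖ a).toAddSubgroup u₀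
    (fun x y => by rw [h.vertexOrder_eq_iff]; simp)
    (by rw [h.relIndex_fracIdeal hq]; exact pow_ne_zero _ (Fact.out : p.Prime).ne_zero)
  rw [h.relIndex_fracIdeal hq] at this
  exact this

theorem IsUniformizer.vertexOrder_image_sdiff (h : IsUniformizer O ϖ) {n : ℤ} {S T : Set K}
    (hT : ∀ u v, u - v ∈ fracIdeal O ϖ n → u ∈ T → v ∈ T) :
    vertexOrder O ϖ h.ne_zero n '' (S \ T) =
      vertexOrder O ϖ h.ne_zero n '' S \ vertexOrder O ϖ h.ne_zero n '' T := by
  ext N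
  constructor
  · rintro ⟨u, ⟨hu, hu'⟩, rfl⟩
    refine ⟨⟨u, hu, rfl⟩, ?_⟩
    rintro ⟨v, hv, e⟩
    exact hu' (hT v u (h.vertexOrder_eq_iff.1 e).2 hv)
  · rintro ⟨⟨u, hu, rfl⟩, hN⟩
    exact ⟨u, ⟨hu, fun hu' => hN ⟨u, hu', rfl⟩⟩, rfl⟩

theorem IsUniformizer.encard_vertexOrder_image_sdiff (h : IsUniformizer O ϖ)
    (hq : (fracIdeal O ϖ 1).toAddSubgroup.relIndex (fracIdeal O ϖ 0).toAddSubgroup = p)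
    (n a : ℤ) (i : ℕ) (hi : 1 ≤ i) (hn : n = a + i) (u₀ : K) :
    (vertexOrder O ϖ h.ne_zero n '' ({u | u - u₀ ∈ fracIdeal O ϖ a} \
      {u | u - u₀ ∈ fracIdeal O ϖ (a + 1)})).encard = ((p ^ i - p ^ (i - 1) : ℕ) : ℕ∞) := by
  rw [h.vertexOrder_image_sdiff, Set.encard_sdiff, h.encard_vertexOrder_image hq n a i hn,
    h.encard_vertexOrder_image hq n (a + 1) (i - 1) (by omega), ENat.natCast_sub]
  · rintro _ ⟨u, hu, rfl⟩
    exact ⟨u, h.anti (by omega) hu, rfl⟩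
  · apply Set.finite_of_encard_eq_coe
    exact h.encard_vertexOrder_image hq n (a + 1) (i - 1) (by omega) u₀
  · intro u v huv hu
    have := Submodule.sub_mem _ hu (h.anti (by omega) huv : u - v ∈ fracIdeal O ϖ (a + 1))
    simpa using this

end Count

/-! ### The contribution of each i at a given level. -/

section LevelSet

variable {p : ℕ} [Fact p.Prime] {c t : ℚ_[p]} {hc : ‖c‖ ≤ 1} {ht : ‖t‖ ≤ 1}
  {ϖ : QuadraticAlgebra ℚ_[p] c t} [hf : Fact (∀ r : ℚ_[p], r ^ 2 ≠ c + t * r)]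
  {b : ℚ_[p]} {δ m₀ : ℤ}

namespace RamifiedData

variable (D : RamifiedData hc ht ϖ b δ m₀)
  (hq : (fracIdeal (quadInt hc ht) ϖ 1).toAddSubgroup.relIndex
    (fracIdeal (quadInt hc ht) ϖ 0).toAddSubgroup = p)

include D

theorem one_mem_fracIdeal {a : ℤ} (ha : a ≤ 0) :
    (1 : QuadraticAlgebra ℚ_[p] c t) ∈ fracIdeal (quadInt hc ht) ϖ a := by
  rw [← zpow_zero ϖ, D.unif.zpow_mem_fracIdeal]; exact ha

theorem mem_of_sub_one_mem {a a' : ℤ} (ha : a' ≤ 0) (haa : a' ≤ a) {u : QuadraticAlgebra ℚ_[p] c t}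
    (hu : u - 1 ∈ fracIdeal (quadInt hc ht) ϖ a) : u ∈ fracIdeal (quadInt hc ht) ϖ a' := by
  have := Submodule.add_mem _ (D.unif.anti haa hu) (D.one_mem_fracIdeal ha)
  simpa using this

/-- A parameter u would be a nonunit with b - N(u) a nonunit, against b being a unit. -/
theorem levelSet_eq_empty {m : ℤ} {i : ℕ} (h1 : 1 ≤ i - m) (h2 : δ < 2 * i - m) :
    levelSet hc ht ϖ b δ m i = ∅ := by
  rw [Set.eq_empty_iff_forall_notMem]
  rintro u ⟨hu, hu', -⟩
  exact D.notMem_of_mem_one (D.unif.anti (by omega) hu) (D.unif.anti (by omega) hu')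

/-- The first condition already puts u, hence u - 1, into ϖ^(i-m+1), an exponent ≤ 0, so b - N(u) is
closer to 0 than the last condition permits. -/
theorem levelSet_eq_empty' {m : ℤ} {i : ℕ} (h1 : (i : ℤ) < m) (h2 : δ < i) :
    levelSet hc ht ϖ b δ m i = ∅ := by
  have := D.one_le
  rw [Set.eq_empty_iff_forall_notMem]
  rintro u ⟨hu, -, hu'⟩
  rcases hu' with hu' | hu'
  · omega
  · apply hu'
    rw [D.norm_close_iff _ (by omega)]
    exact Submodule.sub_mem _ (D.unif.anti (by omega) hu) (D.one_mem_fracIdeal (by omega))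

include hq

theorem encard_levelSet_zero {m : ℤ} (hm : m₀ < m) :
    (vertexOrder (quadInt hc ht) ϖ D.unif.ne_zero (2 * (0 : ℕ) - m) ''
      levelSet hc ht ϖ b δ m 0).encard = ((1 : ℕ) : ℕ∞) := by
  have hb := D.minLevel_bounds
  have e : levelSet hc ht ϖ b δ m 0 = {u | u - 1 ∈ fracIdeal (quadInt hc ht) ϖ (-m)} := by
    ext u
    have h1 := D.norm_close_iff (-m) (by omega) u
    simp only [levelSet, Set.mem_ofPred_eq, Nat.cast_zero, mul_zero, zero_sub, true_or, and_true, h1]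
    exact ⟨fun h => h.2, fun h => ⟨D.mem_of_sub_one_mem (by omega) (by have := D.one_le; omega) h, h⟩⟩
  rw [e, D.unif.encard_vertexOrder_image hq _ (-m) 0 (by simp)]
  simp

/-- In this range both conditions on b - N(u) translate into conditions on u - 1, whose valuation
must be exactly i - m, and the bound on u itself is automatic. What is counted is a shell modulo
ϖ^(2i-m). -/
theorem encard_levelSet {m : ℤ} {i : ℕ} (hi : 1 ≤ i) (h1 : i - m ≤ δ - 2) (h2 : i ≤ δ)
    (h3 : 2 * i - m ≤ δ ∨ i ≤ m) :
    (vertexOrder (quadInt hc ht) ϖ D.unif.ne_zero (2 * i - m) ''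
      levelSet hc ht ϖ b δ m i).encard = ((p ^ i - p ^ (i - 1) : ℕ) : ℕ∞) := by
  have e : levelSet hc ht ϖ b δ m i = {u | u - 1 ∈ fracIdeal (quadInt hc ht) ϖ (i - m)} \
      {u | u - 1 ∈ fracIdeal (quadInt hc ht) ϖ (i - m + 1)} := by
    ext u
    have h4 := D.norm_close_iff (i - m) (by omega) u
    have h5 := D.norm_close_iff (i - m + 1) (by omega) u
    simp only [levelSet, Set.mem_ofPred_eq, h4, h5, Set.mem_sdiff]
    constructor
    · rintro ⟨-, h6, h7⟩
      exact ⟨h6, h7.resolve_left (by omega)⟩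
    · rintro ⟨h6, h7⟩
      exact ⟨D.mem_of_sub_one_mem (by omega) (by omega) h6, h6, Or.inr h7⟩
  rw [e]
  exact D.unif.encard_vertexOrder_image_sdiff hq _ _ i hi (by ring) 1

/-- Here u ∈ ϖ^(m-δ) is a nonunit, so b - N(u) is automatically a unit, which is what is required.
There remain all classes of ϖ^(m-δ) modulo ϖ^m. -/
theorem encard_levelSet_far {m : ℤ} {i : ℕ} (him : (i : ℤ) = m) (h : δ < i) {d : ℕ} (hd : δ = d) :
    (vertexOrder (quadInt hc ht) ϖ D.unif.ne_zero (2 * i - m) ''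
      levelSet hc ht ϖ b δ m i).encard = ((p ^ d : ℕ) : ℕ∞) := by
  have hδ := D.one_le
  have e : levelSet hc ht ϖ b δ m i = {u | u - 0 ∈ fracIdeal (quadInt hc ht) ϖ (m - δ)} := by
    ext u
    have h4 := D.norm_close_iff (i - m) (by omega) u
    simp only [levelSet, Set.mem_ofPred_eq, h4, sub_zero]
    constructor
    · rintro ⟨h5, -⟩
      convert h5 using 2
      omega
    · intro h5
      refine ⟨by convert h5 using 2; omega, ?_, Or.inr fun h6 => ?_⟩
      · exact Submodule.sub_mem _ (D.unif.anti (by omega) h5) (D.one_mem_fracIdeal (by omega))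
      · exact D.notMem_of_mem_one (D.unif.anti (by omega) h5) (D.unif.anti (by omega) h6)
  rw [e]
  exact D.unif.encard_vertexOrder_image hq _ _ d (by omega) 0

/-- The excluded inner part of the shell would need N(u) within ϖ^(2δ) of b, which `hns` forbids. So
nothing is removed, and the count is p instead of p - 1. -/
theorem encard_levelSet_nonsplit
    (hns : ∀ u : QuadraticAlgebra ℚ_[p] c t,
      algebraMap ℚ_[p] _ (b - u.norm) ∉ fracIdeal (quadInt hc ht) ϖ (2 * δ)) :
    (vertexOrder (quadInt hc ht) ϖ D.unif.ne_zero (2 * (1 : ℕ) - (2 - δ)) ''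
      levelSet hc ht ϖ b δ (2 - δ) 1).encard = ((p : ℕ) : ℕ∞) := by
  have hδ := D.one_le
  have e : levelSet hc ht ϖ b δ (2 - δ) 1 =
      {u | u - 1 ∈ fracIdeal (quadInt hc ht) ϖ (δ - 1)} := by
    ext u
    have h4 := D.norm_close_iff (δ - 1) (by omega) u
    have e1 : (2 : ℤ) * ((1 : ℕ) - (2 - δ)) = 2 * (δ - 1) := by push_cast; ring
    have e2 : (2 : ℤ) * ((1 : ℕ) - (2 - δ) + 1) = 2 * δ := by push_cast; ring
    simp only [levelSet, Set.mem_ofPred_eq, e1, e2, h4]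
    refine ⟨fun h => h.2.1, fun h => ⟨D.mem_of_sub_one_mem ?_ ?_ h, h, Or.inr (hns u)⟩⟩
    · push_cast; omega
    · push_cast; omega
  rw [e, D.unif.encard_vertexOrder_image hq _ (δ - 1) 1 (by push_cast; ring), pow_one]

end RamifiedData

end LevelSet

end LocalOrders

namespace LocalOrders

open QuadraticAlgebra hiding norm_neg norm_one norm_natCast norm_star norm_zero
open QuatEmb

/-! ### Summation over i: the tables for odd p. -/

section RamifiedCount

variable {p : ℕ} [Fact p.Prime] {c t : ℚ_[p]} {hc : ‖c‖ ≤ 1} {ht : ‖t‖ ≤ 1}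
  {ϖ : QuadraticAlgebra ℚ_[p] c t} [hf : Fact (∀ r : ℚ_[p], r ^ 2 ≠ c + t * r)]
  {b : ℚ_[p]} {m₀ : ℤ} {d : ℕ}

/-- The number of vertex orders with parameter `2 i - m` and level `m`. -/
noncomputable def levelCount (hc : ‖c‖ ≤ 1) (ht : ‖t‖ ≤ 1) (ϖ : QuadraticAlgebra ℚ_[p] c t)
    (hϖ : ϖ ≠ 0) (b : ℚ_[p]) (δ m : ℤ) (i : ℕ) : ℕ∞ :=
  (vertexOrder (quadInt hc ht) ϖ hϖ (2 * i - m) '' levelSet hc ht ϖ b δ m i).encard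

/-- The number of all vertex orders of level `m`, with `d` the valuation of the different. -/
noncomputable def totalCount (hc : ‖c‖ ≤ 1) (ht : ‖t‖ ≤ 1) (ϖ : QuadraticAlgebra ℚ_[p] c t)
    (hϖ : ϖ ≠ 0) (b : ℚ_[p]) (d : ℕ) (m : ℤ) : ℕ∞ :=
  ∑ i ∈ insert m.toNat (Finset.range (d + 1)), levelCount hc ht ϖ hϖ b d m i

namespace RamifiedData

variable (D : RamifiedData hc ht ϖ b d m₀)
  (hq : (fracIdeal (quadInt hc ht) ϖ 1).toAddSubgroup.relIndex
    (fracIdeal (quadInt hc ht) ϖ 0).toAddSubgroup = p)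

include D

theorem vertexCount_eq_totalCount {A : Type*} [Ring A] [Algebra ℤ_[p] A]
    {φ : A →ₐ[ℤ_[p]] Matrix (Fin 2) (Fin 2) (QuadraticAlgebra ℚ_[p] c t)} (hφ : IsCyclicRep φ b)
    (hfg : ∀ n u, (Subalgebra.toSubmodule
      ((vertexOrder (quadInt hc ht) ϖ D.unif.ne_zero n u).comap φ)).FG)
    {G : Subalgebra ℤ_[p] A} (hG : IsCyclicOrder (quadInt hc ht) φ b G) {m : ℤ}
    (hm : HasLevel (quadInt hc ht) ϖ φ b G m) (hlt : m₀ < m) :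
    vertexCount (quadInt hc ht) ϖ D.unif.ne_zero φ G =
      totalCount hc ht ϖ D.unif.ne_zero b d m := by
  refine D.vertexCount_eq_sum hφ hfg hG hm hlt _ fun i hi => ?_
  simp only [Finset.mem_insert, Finset.mem_range, not_or] at hi
  have h1 := D.one_le
  rcases lt_or_ge (i : ℤ) m with h | h
  · exact D.levelSet_eq_empty' h (by omega)
  · exact D.levelSet_eq_empty (by omega) (by omega)

theorem levelCount_empty {m : ℤ} {i : ℕ} (h1 : 1 ≤ i - m) (h2 : d < 2 * i - m) :
    levelCount hc ht ϖ D.unif.ne_zero b d m i = 0 := by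
  rw [levelCount, D.levelSet_eq_empty h1 h2]
  simp

theorem totalCount_of_le {m : ℤ} (hm : m ≤ d) : totalCount hc ht ϖ D.unif.ne_zero b d m =
    ∑ i ∈ Finset.range (d + 1), levelCount hc ht ϖ D.unif.ne_zero b d m i := by
  rw [totalCount, Finset.insert_eq_of_mem]
  rw [Finset.mem_range]
  omega

include hq

theorem levelCount_zero {m : ℤ} (hm : m₀ < m) : levelCount hc ht ϖ D.unif.ne_zero b d m 0 = 1 :=
  D.encard_levelSet_zero hq hm

theorem levelCount_eq {m : ℤ} {i : ℕ} (hi : 1 ≤ i) (h1 : i - m ≤ d - 2) (h2 : i ≤ d)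
    (h3 : 2 * i - m ≤ d ∨ i ≤ m) :
    levelCount hc ht ϖ D.unif.ne_zero b d m i = ((p ^ i - p ^ (i - 1) : ℕ) : ℕ∞) :=
  D.encard_levelSet hq hi h1 (by omega) h3

/-- The terms for i = 0, …, d telescope to p^d, and i = m contributes another p^d. -/
theorem totalCount_of_gt {m : ℤ} (hm : d < m) :
    totalCount hc ht ϖ D.unif.ne_zero b d m = ((2 * p ^ d : ℕ) : ℕ∞) := by
  have h1 := D.one_le
  have hb := D.minLevel_bounds
  rw [totalCount, Finset.sum_insert (by rw [Finset.mem_range]; omega), Finset.sum_range_succ',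
    D.levelCount_zero hq (by omega)]
  have e1 : levelCount hc ht ϖ D.unif.ne_zero b d m m.toNat = ((p ^ d : ℕ) : ℕ∞) :=
    D.encard_levelSet_far hq (by omega) (by omega) rfl
  have e2 : ∀ i ∈ Finset.range d, levelCount hc ht ϖ D.unif.ne_zero b d m (i + 1) =
      ((p ^ (i + 1) - p ^ i : ℕ) : ℕ∞) := by
    intro i hi
    rw [Finset.mem_range] at hi
    exact D.levelCount_eq hq (by omega) (by push_cast; omega) (by omega) (by push_cast; omega)
  rw [e1, Finset.sum_congr rfl e2, ← Nat.cast_sum, Finset.sum_range_tsub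
    (fun a b hab => Nat.pow_le_pow_right (Fact.out : p.Prime).pos hab)]
  have : 1 ≤ p ^ d := Nat.one_le_pow _ _ (Fact.out : p.Prime).pos
  rw [← Nat.cast_one, ← Nat.cast_add, ← Nat.cast_add]
  congr 1
  simp
  omega

theorem levelCount_nonsplit
    (hns : ∀ u : QuadraticAlgebra ℚ_[p] c t,
      algebraMap ℚ_[p] _ (b - u.norm) ∉ fracIdeal (quadInt hc ht) ϖ (2 * d)) {m : ℤ}
    (hm : m = 2 - d) : levelCount hc ht ϖ D.unif.ne_zero b d m 1 = (p : ℕ∞) := by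
  subst hm
  exact D.encard_levelSet_nonsplit hq hns

end RamifiedData

theorem tableOddRamified_eq (D : RamifiedData hc ht ϖ b (1 : ℕ) 0)
    (hq : (fracIdeal (quadInt hc ht) ϖ 1).toAddSubgroup.relIndex
      (fracIdeal (quadInt hc ht) ϖ 0).toAddSubgroup = p)
    (hns : ∀ u : QuadraticAlgebra ℚ_[p] c t,
      algebraMap ℚ_[p] _ (b - u.norm) ∉ fracIdeal (quadInt hc ht) ϖ (2 * (1 : ℕ)))
    {r : ℕ} (hr : 1 ≤ r) :
    totalCount hc ht ϖ D.unif.ne_zero b 1 (0 + r) = (tableOddRamified p r : ℕ∞) := by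
  match r, hr with
  | 1, _ =>
    rw [D.totalCount_of_le (by norm_num), Finset.sum_range_succ, Finset.sum_range_one,
      D.levelCount_zero hq (by norm_num), D.levelCount_nonsplit hq hns (by norm_num), add_comm]
    simp [tableOddRamified]
  | r + 2, _ =>
    rw [D.totalCount_of_gt hq (by push_cast; omega)]
    simp [tableOddRamified]

/-- The level is m = r - 1. For r = 1 only i = 0 contributes; for r = 2 the term i = 1 adds the p -
2 of `hsp`; from r = 3 on the level exceeds the different exponent 1. -/
theorem tableOddSplit_eq (D : RamifiedData hc ht ϖ b (1 : ℕ) (-1))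
    (hq : (fracIdeal (quadInt hc ht) ϖ 1).toAddSubgroup.relIndex
      (fracIdeal (quadInt hc ht) ϖ 0).toAddSubgroup = p) (hp : p ≠ 2)
    (hsp : levelCount hc ht ϖ D.unif.ne_zero b (1 : ℕ) 1 1 = ((p - 2 : ℕ) : ℕ∞))
    {r : ℕ} (hr : 1 ≤ r) :
    totalCount hc ht ϖ D.unif.ne_zero b 1 (-1 + r) = (tableOddSplit p r : ℕ∞) := by
  have h2 : 2 < p := lt_of_le_of_ne (Fact.out : p.Prime).two_le hp.symm
  match r, hr with
  | 1, _ =>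
    rw [D.totalCount_of_le (by norm_num), Finset.sum_range_succ, Finset.sum_range_one,
      D.levelCount_zero hq (by norm_num), D.levelCount_empty (by norm_num) (by norm_num)]
    simp [tableOddSplit]
  | 2, _ =>
    have e : (-1 + (2 : ℕ) : ℤ) = 1 := by norm_num
    rw [D.totalCount_of_le (by norm_num), Finset.sum_range_succ, Finset.sum_range_one,
      D.levelCount_zero hq (by norm_num), e, hsp,
      ← Nat.cast_one (R := ℕ∞), ← Nat.cast_add]
    congr 1
    simp [tableOddSplit]
    omega
  | r + 3, _ =>
    rw [D.totalCount_of_gt hq (by push_cast; omega)]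
    simp [tableOddSplit]

end RamifiedCount

/-! ### Summation over i: the tables for p = 2. -/

section Two

variable {c t : ℚ_[2]} {hc : ‖c‖ ≤ 1} {ht : ‖t‖ ≤ 1}
  {ϖ : QuadraticAlgebra ℚ_[2] c t} [hf : Fact (∀ r : ℚ_[2], r ^ 2 ≠ c + t * r)]
  {b : ℚ_[2]}

/-- The distance of b from norms skips the value 2(d - 1) by `hsp`, and i = 1 at this level asks for
exactly that value. -/
theorem levelCount_split {m₀ : ℤ} {d : ℕ} (D : RamifiedData hc ht ϖ b d m₀)
    (hsp : ∀ u : QuadraticAlgebra ℚ_[2] c t,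
      algebraMap ℚ_[2] _ (b - u.norm) ∈ fracIdeal (quadInt hc ht) ϖ (2 * (d - 1)) →
      algebraMap ℚ_[2] _ (b - u.norm) ∈ fracIdeal (quadInt hc ht) ϖ (2 * d)) {m : ℤ}
    (hm : m = 2 - d) : levelCount hc ht ϖ D.unif.ne_zero b d m 1 = 0 := by
  subst hm
  have : levelSet hc ht ϖ b d (2 - d) 1 = ∅ := by
    rw [Set.eq_empty_iff_forall_notMem]
    rintro u ⟨-, h1, h2⟩
    refine h2.resolve_left (by norm_num) ?_
    have := hsp u (by convert h1 using 2; push_cast; ring)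
    convert this using 2
    push_cast
    ring
  rw [levelCount, this]
  simp

/-- With m = r - 2 ≤ 2, the terms i = 0, 1, 2 are 1, 1, 2 as long as 2i - m ≤ 2 and 0 beyond. The
one exception is r = 2, i = 1, where `hsp` makes the term vanish. -/
theorem tableTwoOneSplit_eq (D : RamifiedData hc ht ϖ b (2 : ℕ) (-2))
    (hq : (fracIdeal (quadInt hc ht) ϖ 1).toAddSubgroup.relIndex
      (fracIdeal (quadInt hc ht) ϖ 0).toAddSubgroup = 2)
    (hsp : ∀ u : QuadraticAlgebra ℚ_[2] c t,
      algebraMap ℚ_[2] _ (b - u.norm) ∈ fracIdeal (quadInt hc ht) ϖ (2 * ((2 : ℕ) - 1)) →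
      algebraMap ℚ_[2] _ (b - u.norm) ∈ fracIdeal (quadInt hc ht) ϖ (2 * (2 : ℕ)))
    {r : ℕ} (hr : 1 ≤ r) :
    totalCount hc ht ϖ D.unif.ne_zero b 2 (-2 + r) = (tableTwoOneSplit r : ℕ∞) := by
  match r, hr with
  | 1, _ =>
    rw [D.totalCount_of_le (by norm_num), Finset.sum_range_succ, Finset.sum_range_succ,
      Finset.sum_range_one, D.levelCount_zero hq (by norm_num),
      D.levelCount_empty (by norm_num) (by norm_num),
      D.levelCount_empty (by norm_num) (by norm_num)]
    simp [tableTwoOneSplit]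
  | 2, _ =>
    rw [D.totalCount_of_le (by norm_num), Finset.sum_range_succ, Finset.sum_range_succ,
      Finset.sum_range_one, D.levelCount_zero hq (by norm_num),
      levelCount_split D hsp (by norm_num),
      D.levelCount_empty (by norm_num) (by norm_num)]
    simp [tableTwoOneSplit]
  | 3, _ =>
    rw [D.totalCount_of_le (by norm_num), Finset.sum_range_succ, Finset.sum_range_succ,
      Finset.sum_range_one, D.levelCount_zero hq (by norm_num),
      D.levelCount_eq hq (by norm_num) (by norm_num) (by norm_num) (by norm_num),
      D.levelCount_empty (by norm_num) (by norm_num)]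
    norm_num [tableTwoOneSplit]
  | 4, _ =>
    rw [D.totalCount_of_le (by norm_num), Finset.sum_range_succ, Finset.sum_range_succ,
      Finset.sum_range_one, D.levelCount_zero hq (by norm_num),
      D.levelCount_eq hq (by norm_num) (by norm_num) (by norm_num) (by norm_num),
      D.levelCount_eq hq (by norm_num) (by norm_num) (by norm_num) (by norm_num)]
    norm_num [tableTwoOneSplit]
  | r + 5, _ =>
    rw [D.totalCount_of_gt hq (by push_cast; omega)]
    simp [tableTwoOneSplit]

theorem tableTwoOneRamified_eq (D : RamifiedData hc ht ϖ b (2 : ℕ) (-1))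
    (hq : (fracIdeal (quadInt hc ht) ϖ 1).toAddSubgroup.relIndex
      (fracIdeal (quadInt hc ht) ϖ 0).toAddSubgroup = 2)
    (hns : ∀ u : QuadraticAlgebra ℚ_[2] c t,
      algebraMap ℚ_[2] _ (b - u.norm) ∉ fracIdeal (quadInt hc ht) ϖ (2 * (2 : ℕ)))
    {r : ℕ} (hr : 1 ≤ r) :
    totalCount hc ht ϖ D.unif.ne_zero b 2 (-1 + r) = (tableTwoOneRamified r : ℕ∞) := by
  match r, hr with
  | 1, _ =>
    rw [D.totalCount_of_le (by norm_num), Finset.sum_range_succ, Finset.sum_range_succ,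
      Finset.sum_range_one, D.levelCount_zero hq (by norm_num),
      D.levelCount_nonsplit hq hns (by norm_num),
      D.levelCount_empty (by norm_num) (by norm_num)]
    norm_num [tableTwoOneRamified]
  | 2, _ =>
    rw [D.totalCount_of_le (by norm_num), Finset.sum_range_succ, Finset.sum_range_succ,
      Finset.sum_range_one, D.levelCount_zero hq (by norm_num),
      D.levelCount_eq hq (by norm_num) (by norm_num) (by norm_num) (by norm_num),
      D.levelCount_empty (by norm_num) (by norm_num)]
    norm_num [tableTwoOneRamified]
  | 3, _ =>
    rw [D.totalCount_of_le (by norm_num), Finset.sum_range_succ, Finset.sum_range_succ,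
      Finset.sum_range_one, D.levelCount_zero hq (by norm_num),
      D.levelCount_eq hq (by norm_num) (by norm_num) (by norm_num) (by norm_num),
      D.levelCount_eq hq (by norm_num) (by norm_num) (by norm_num) (by norm_num)]
    norm_num [tableTwoOneRamified]
  | r + 4, _ =>
    rw [D.totalCount_of_gt hq (by push_cast; omega)]
    simp [tableTwoOneRamified]

/-- With m = r - 3 ≤ 3, the terms i = 0, …, 3 are 1, 1, 2, 4 as long as 2i - m ≤ 3 and 0 beyond,
except that r = 2, i = 1 vanishes. The row r = 5 repeats r = 4 because i = 3 enters only at r = 6.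
-/
theorem tableTwoTwoSplit_eq (D : RamifiedData hc ht ϖ b (3 : ℕ) (-3))
    (hq : (fracIdeal (quadInt hc ht) ϖ 1).toAddSubgroup.relIndex
      (fracIdeal (quadInt hc ht) ϖ 0).toAddSubgroup = 2)
    (hsp : ∀ u : QuadraticAlgebra ℚ_[2] c t,
      algebraMap ℚ_[2] _ (b - u.norm) ∈ fracIdeal (quadInt hc ht) ϖ (2 * ((3 : ℕ) - 1)) →
      algebraMap ℚ_[2] _ (b - u.norm) ∈ fracIdeal (quadInt hc ht) ϖ (2 * (3 : ℕ)))
    {r : ℕ} (hr : 1 ≤ r) :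
    totalCount hc ht ϖ D.unif.ne_zero b 3 (-3 + r) = (tableTwoTwoSplit r : ℕ∞) := by
  match r, hr with
  | 1, _ =>
    rw [D.totalCount_of_le (by norm_num), Finset.sum_range_succ, Finset.sum_range_succ,
      Finset.sum_range_succ, Finset.sum_range_one, D.levelCount_zero hq (by norm_num),
      D.levelCount_empty (by norm_num) (by norm_num),
      D.levelCount_empty (by norm_num) (by norm_num),
      D.levelCount_empty (by norm_num) (by norm_num)]
    simp [tableTwoTwoSplit]
  | 2, _ =>
    rw [D.totalCount_of_le (by norm_num), Finset.sum_range_succ, Finset.sum_range_succ,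
      Finset.sum_range_succ, Finset.sum_range_one, D.levelCount_zero hq (by norm_num),
      levelCount_split D hsp (by norm_num),
      D.levelCount_empty (by norm_num) (by norm_num),
      D.levelCount_empty (by norm_num) (by norm_num)]
    simp [tableTwoTwoSplit]
  | 3, _ =>
    rw [D.totalCount_of_le (by norm_num), Finset.sum_range_succ, Finset.sum_range_succ,
      Finset.sum_range_succ, Finset.sum_range_one, D.levelCount_zero hq (by norm_num),
      D.levelCount_eq hq (by norm_num) (by norm_num) (by norm_num) (by norm_num),
      D.levelCount_empty (by norm_num) (by norm_num),
      D.levelCount_empty (by norm_num) (by norm_num)]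
    norm_num [tableTwoTwoSplit]
  | 4, _ =>
    rw [D.totalCount_of_le (by norm_num), Finset.sum_range_succ, Finset.sum_range_succ,
      Finset.sum_range_succ, Finset.sum_range_one, D.levelCount_zero hq (by norm_num),
      D.levelCount_eq hq (by norm_num) (by norm_num) (by norm_num) (by norm_num),
      D.levelCount_eq hq (by norm_num) (by norm_num) (by norm_num) (by norm_num),
      D.levelCount_empty (by norm_num) (by norm_num)]
    norm_num [tableTwoTwoSplit]
  | 5, _ =>
    rw [D.totalCount_of_le (by norm_num), Finset.sum_range_succ, Finset.sum_range_succ,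
      Finset.sum_range_succ, Finset.sum_range_one, D.levelCount_zero hq (by norm_num),
      D.levelCount_eq hq (by norm_num) (by norm_num) (by norm_num) (by norm_num),
      D.levelCount_eq hq (by norm_num) (by norm_num) (by norm_num) (by norm_num),
      D.levelCount_empty (by norm_num) (by norm_num)]
    norm_num [tableTwoTwoSplit]
  | 6, _ =>
    rw [D.totalCount_of_le (by norm_num), Finset.sum_range_succ, Finset.sum_range_succ,
      Finset.sum_range_succ, Finset.sum_range_one, D.levelCount_zero hq (by norm_num),
      D.levelCount_eq hq (by norm_num) (by norm_num) (by norm_num) (by norm_num),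
      D.levelCount_eq hq (by norm_num) (by norm_num) (by norm_num) (by norm_num),
      D.levelCount_eq hq (by norm_num) (by norm_num) (by norm_num) (by norm_num)]
    norm_num [tableTwoTwoSplit]
  | r + 7, _ =>
    rw [D.totalCount_of_gt hq (by push_cast; omega)]
    simp [tableTwoTwoSplit]

/-- The rows are those of the split case moved by one, since now m = r - 2. The only exceptional
term is r = 1, i = 1, which is 2 by `hns`. -/
theorem tableTwoTwoRamified_eq (D : RamifiedData hc ht ϖ b (3 : ℕ) (-2))
    (hq : (fracIdeal (quadInt hc ht) ϖ 1).toAddSubgroup.relIndex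
      (fracIdeal (quadInt hc ht) ϖ 0).toAddSubgroup = 2)
    (hns : ∀ u : QuadraticAlgebra ℚ_[2] c t,
      algebraMap ℚ_[2] _ (b - u.norm) ∉ fracIdeal (quadInt hc ht) ϖ (2 * (3 : ℕ)))
    {r : ℕ} (hr : 1 ≤ r) :
    totalCount hc ht ϖ D.unif.ne_zero b 3 (-2 + r) = (tableTwoTwoRamified r : ℕ∞) := by
  match r, hr with
  | 1, _ =>
    rw [D.totalCount_of_le (by norm_num), Finset.sum_range_succ, Finset.sum_range_succ,
      Finset.sum_range_succ, Finset.sum_range_one, D.levelCount_zero hq (by norm_num),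
      D.levelCount_nonsplit hq hns (by norm_num),
      D.levelCount_empty (by norm_num) (by norm_num),
      D.levelCount_empty (by norm_num) (by norm_num)]
    norm_num [tableTwoTwoRamified]
  | 2, _ =>
    rw [D.totalCount_of_le (by norm_num), Finset.sum_range_succ, Finset.sum_range_succ,
      Finset.sum_range_succ, Finset.sum_range_one, D.levelCount_zero hq (by norm_num),
      D.levelCount_eq hq (by norm_num) (by norm_num) (by norm_num) (by norm_num),
      D.levelCount_empty (by norm_num) (by norm_num),
      D.levelCount_empty (by norm_num) (by norm_num)]
    norm_num [tableTwoTwoRamified]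
  | 3, _ =>
    rw [D.totalCount_of_le (by norm_num), Finset.sum_range_succ, Finset.sum_range_succ,
      Finset.sum_range_succ, Finset.sum_range_one, D.levelCount_zero hq (by norm_num),
      D.levelCount_eq hq (by norm_num) (by norm_num) (by norm_num) (by norm_num),
      D.levelCount_eq hq (by norm_num) (by norm_num) (by norm_num) (by norm_num),
      D.levelCount_empty (by norm_num) (by norm_num)]
    norm_num [tableTwoTwoRamified]
  | 4, _ =>
    rw [D.totalCount_of_le (by norm_num), Finset.sum_range_succ, Finset.sum_range_succ,
      Finset.sum_range_succ, Finset.sum_range_one, D.levelCount_zero hq (by norm_num),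
      D.levelCount_eq hq (by norm_num) (by norm_num) (by norm_num) (by norm_num),
      D.levelCount_eq hq (by norm_num) (by norm_num) (by norm_num) (by norm_num),
      D.levelCount_empty (by norm_num) (by norm_num)]
    norm_num [tableTwoTwoRamified]
  | 5, _ =>
    rw [D.totalCount_of_le (by norm_num), Finset.sum_range_succ, Finset.sum_range_succ,
      Finset.sum_range_succ, Finset.sum_range_one, D.levelCount_zero hq (by norm_num),
      D.levelCount_eq hq (by norm_num) (by norm_num) (by norm_num) (by norm_num),
      D.levelCount_eq hq (by norm_num) (by norm_num) (by norm_num) (by norm_num),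
      D.levelCount_eq hq (by norm_num) (by norm_num) (by norm_num) (by norm_num)]
    norm_num [tableTwoTwoRamified]
  | r + 6, _ =>
    rw [D.totalCount_of_gt hq (by push_cast; omega)]
    simp [tableTwoTwoRamified]

end Two

end LocalOrders

namespace LocalOrders

open QuadraticAlgebra hiding norm_neg norm_one norm_natCast norm_star norm_zero

/-! ### Squares and units in ℚ_p, in particular in ℚ₂. -/

section PadicHelp

variable {p : ℕ} [Fact p.Prime]

theorem padic_norm_add_le {x y : ℚ_[p]} {r : ℝ} (hx : ‖x‖ ≤ r) (hy : ‖y‖ ≤ r) : ‖x + y‖ ≤ r :=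
  (Padic.nonarchimedean x y).trans (max_le hx hy)

theorem padic_norm_sub_le {x y : ℚ_[p]} {r : ℝ} (hx : ‖x‖ ≤ r) (hy : ‖y‖ ≤ r) : ‖x - y‖ ≤ r := by
  rw [sub_eq_add_neg]
  exact padic_norm_add_le hx (by rwa [norm_neg])

theorem padic_norm_lt_one_iff {x : ℚ_[p]} : ‖x‖ < 1 ↔ ‖x‖ ≤ (p : ℝ)⁻¹ := by
  have := padic_norm_lt_iff (x := x) (one_ne_zero : (1 : ℚ_[p]) ≠ 0)
  rwa [norm_one, mul_one] at this

/-- Hensel's lemma for X² - x at 1, where the derivative is 2. -/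
theorem exists_sq_of_norm_sub_one_lt {x : ℚ_[p]} (h : ‖x - 1‖ < ‖(2 : ℚ_[p])‖ ^ 2) :
    ∃ s : ℚ_[p], s ^ 2 = x := by
  have h2 : ‖(2 : ℚ_[p])‖ ≤ 1 := by
    have := Padic.norm_int_le_one (p := p) 2
    exact_mod_cast this
  have hx : ‖x‖ ≤ 1 := by
    have h3 : ‖x - 1‖ ≤ 1 := h.le.trans (pow_le_one₀ (norm_nonneg _) h2)
    have := padic_norm_add_le h3 (norm_one (α := ℚ_[p])).le
    simpa using this
  let z : ℤ_[p] := ⟨x, hx⟩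
  obtain ⟨s, hs, -⟩ := hensels_lemma (F := (Polynomial.X ^ 2 - Polynomial.C z : Polynomial ℤ_[p]))
    (a := (1 : ℤ_[p])) (by
      have e1 : ‖(1 : ℤ_[p]) - z‖ = ‖x - 1‖ := by
        rw [← norm_neg, neg_sub]; rfl
      have e2 : ‖(2 : ℤ_[p])‖ = ‖(2 : ℚ_[p])‖ := by
        rw [PadicInt.norm_def]; norm_cast
      simp
      rw [e1, one_add_one_eq_two, e2]
      exact h)
  refine ⟨s, ?_⟩
  have h3 : s ^ 2 - z = 0 := by simpa using hs
  have h4 := congrArg (fun y : ℤ_[p] => (y : ℚ_[p])) (sub_eq_zero.1 h3)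
  simpa using h4

theorem padic_two_norm_sub_one {x : ℚ_[2]} (hx : ‖x‖ = 1) : ‖x - 1‖ ≤ (2 : ℝ)⁻¹ := by
  let z : ℤ_[2] := ⟨x, hx.le⟩
  obtain ⟨n, hn, hz⟩ := PadicInt.exists_mem_range (p := 2) z
  rw [IsLocalRing.mem_maximalIdeal, PadicInt.mem_nonunits] at hz
  have h1 : ‖x - n‖ < 1 := by
    have : ‖z - n‖ = ‖x - n‖ := by rw [PadicInt.norm_def]; push_cast; rfl
    rwa [this] at hz
  interval_cases n
  · simp at h1
    linarith
  · rw [padic_norm_lt_one_iff] at h1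
    simpa using h1

/-- The residue field has two elements, so the unit x/y is 1 modulo 2. Most dyadic gains of a factor
2 below come from this. -/
theorem padic_two_norm_sub {x y : ℚ_[2]} (h : ‖x‖ = ‖y‖) : ‖x - y‖ ≤ (2 : ℝ)⁻¹ * ‖y‖ := by
  by_cases hy : y = 0
  · subst hy
    simp at h
    simp [h]
  have h1 : ‖x / y‖ = 1 := by
    rw [norm_div, h, div_self (norm_ne_zero_iff.2 hy)]
  have h2 := padic_two_norm_sub_one h1
  have e : x - y = (x / y - 1) * y := by field_simp
  rw [e, norm_mul]
  gcongr

theorem padic_two_norm_two : ‖(2 : ℚ_[2])‖ = (2 : ℝ)⁻¹ := by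
  have := Padic.norm_p (p := 2)
  exact_mod_cast this

end PadicHelp

/-! ### Valuation and residue field of an Eisenstein extension. -/

section Index

variable {p : ℕ} [Fact p.Prime] {c t : ℚ_[p]} {hc1 : ‖c‖ ≤ 1} {ht1 : ‖t‖ ≤ 1}
  [hf : Fact (∀ r : ℚ_[p], r ^ 2 ≠ c + t * r)]

theorem algebraMap_mem_iff_of_eisenstein (hc : ‖c‖ = (p : ℝ)⁻¹) (ht : ‖t‖ ≤ (p : ℝ)⁻¹) {q : ℚ_[p]}
    {e : ℤ} : algebraMap ℚ_[p] _ q ∈ fracIdeal (quadInt hc1 ht1) omega (2 * e) ↔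
      ‖q‖ ≤ (p : ℝ) ^ (-e) := by
  have hp : (0 : ℝ) < p := by exact_mod_cast (Fact.out : p.Prime).pos
  rw [mem_fracIdeal_iff_of_eisenstein hc ht, QuadraticAlgebra.norm_algebraMap, norm_pow]
  have : (p : ℝ) ^ (-(2 * e)) = ((p : ℝ) ^ (-e)) ^ 2 := by
    rw [← zpow_natCast, ← zpow_mul]; congr 1; push_cast; ring
  rw [this]
  exact pow_le_pow_iff_left₀ (norm_nonneg _) (by positivity) (by norm_num)

theorem parity_of_eisenstein (hc : ‖c‖ = (p : ℝ)⁻¹) (ht : ‖t‖ ≤ (p : ℝ)⁻¹) {q : ℚ_[p]}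
    {e : ℤ} (h : algebraMap ℚ_[p] _ q ∈ fracIdeal (quadInt hc1 ht1) omega (2 * e - 1)) :
    algebraMap ℚ_[p] _ q ∈ fracIdeal (quadInt hc1 ht1) omega (2 * e) := by
  have hp : (0 : ℝ) < p := by exact_mod_cast (Fact.out : p.Prime).pos
  rw [algebraMap_mem_iff_of_eisenstein hc ht]
  rw [mem_fracIdeal_iff_of_eisenstein hc ht, QuadraticAlgebra.norm_algebraMap, norm_pow] at h
  have h1 : ‖q * (p : ℚ_[p]) ^ (-e)‖ ≤ 1 := by
    apply padic_norm_le_one_of_sq_le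
    rw [norm_mul, Padic.norm_p_zpow, neg_neg, mul_pow]
    have e1 : (p : ℝ) ^ (-(2 * e - 1)) = p * (((p : ℝ) ^ e) ^ 2)⁻¹ := by
      rw [← zpow_natCast, ← zpow_mul, ← zpow_neg, ← zpow_one_add₀ hp.ne']
      congr 1; push_cast; ring
    rw [e1] at h
    have h2 : (0 : ℝ) < (p : ℝ) ^ e := by positivity
    calc (p : ℝ)⁻¹ * (‖q‖ ^ 2 * ((p : ℝ) ^ e) ^ 2)
        ≤ (p : ℝ)⁻¹ * ((p * (((p : ℝ) ^ e) ^ 2)⁻¹) * ((p : ℝ) ^ e) ^ 2) := by gcongr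
      _ = 1 := by field_simp
  rw [norm_mul, Padic.norm_p_zpow, neg_neg] at h1
  rw [zpow_neg, ← one_div, le_div_iff₀ (by positivity)]
  exact h1

theorem hasVal_of_eisenstein (hc : ‖c‖ = (p : ℝ)⁻¹) (ht : ‖t‖ ≤ (p : ℝ)⁻¹)
    {z : QuadraticAlgebra ℚ_[p] c t} {n : ℤ} (h : ‖z.norm‖ = (p : ℝ) ^ (-n)) :
    HasVal (quadInt hc1 ht1) omega z n := by
  have hp : (0 : ℝ) < p := by exact_mod_cast (Fact.out : p.Prime).pos
  refine ⟨?_, ?_, ?_⟩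
  · rintro rfl
    simp at h
    exact (zpow_ne_zero n hp.ne') h.symm
  · rw [mem_fracIdeal_iff_of_eisenstein hc ht, h]
  · rw [mem_fracIdeal_iff_of_eisenstein hc ht, quadNorm_inv, norm_inv, h, zpow_neg, inv_inv, neg_neg]

/-- An integral x + yω lies in ωO exactly when p divides x, so the quotient is ℤ_p/p. -/
theorem relIndex_of_eisenstein (hc : ‖c‖ = (p : ℝ)⁻¹) (ht : ‖t‖ ≤ (p : ℝ)⁻¹) :
    (fracIdeal (quadInt hc1 ht1) omega 1).toAddSubgroup.relIndex
      (fracIdeal (quadInt hc1 ht1) omega 0).toAddSubgroup = p := by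
  have hp : (0 : ℝ) < p := by exact_mod_cast (Fact.out : p.Prime).pos
  have hp1 : (1 : ℝ) < p := by exact_mod_cast (Fact.out : p.Prime).one_lt
  let H : AddSubgroup ℚ_[p] :=
    { carrier := {x | ‖x‖ < 1}
      add_mem' := fun {x y} hx hy => (Padic.nonarchimedean x y).trans_lt (max_lt hx hy)
      zero_mem' := by simp
      neg_mem' := fun {x} hx => by
        change ‖-x‖ < 1
        rw [norm_neg]; exact hx }
  have hH : ∀ x, x ∈ H ↔ ‖x‖ < 1 := fun x => Iff.rfl
  let f : QuadraticAlgebra ℚ_[p] c t →+ ℚ_[p] := (reₗ (a := c) (b := t)).toAddMonoidHom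
  have hfx : ∀ z, f z = z.re := fun z => rfl
  let g : ℤ_[p] →+ ℚ_[p] := PadicInt.Coe.ringHom.toAddMonoidHom
  have hgx : ∀ z, g z = (z : ℚ_[p]) := fun z => rfl
  have e1 : (fracIdeal (quadInt hc1 ht1) omega 1).toAddSubgroup =
      H.comap f ⊓ (fracIdeal (quadInt hc1 ht1) omega 0).toAddSubgroup := by
    ext z
    rw [AddSubgroup.mem_inf, AddSubgroup.mem_comap, Submodule.mem_toAddSubgroup,
      Submodule.mem_toAddSubgroup, mem_fracIdeal_zero, mem_quadInt,
      mem_fracIdeal_iff_of_eisenstein hc ht, norm_quadNorm_of_eisenstein hc ht, max_le_iff, hH, hfx,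
      zpow_neg_one]
    have h1 : (p : ℝ)⁻¹ * ‖z.im‖ ^ 2 ≤ (p : ℝ)⁻¹ ↔ ‖z.im‖ ≤ 1 := by
      rw [mul_le_iff_le_one_right (by positivity), sq_le_one_iff₀ (norm_nonneg _)]
    have h2 : ‖z.re‖ ^ 2 ≤ (p : ℝ)⁻¹ ↔ ‖z.re‖ < 1 := by
      constructor
      · intro h
        rw [← sq_lt_one_iff₀ (norm_nonneg _)]
        exact h.trans_lt (inv_lt_one_of_one_lt₀ hp1)
      · intro h
        have h3 := padic_norm_lt_one_iff.1 h
        nlinarith [norm_nonneg z.re]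
    rw [h1, h2]
    exact ⟨fun h => ⟨h.1, h.1.le, h.2⟩, fun h => ⟨h.1, h.2.2⟩⟩
  have e2 : (fracIdeal (quadInt hc1 ht1) omega 0).toAddSubgroup.map f = g.range := by
    ext x
    constructor
    · rintro ⟨z, hz, rfl⟩
      have : z ∈ quadInt hc1 ht1 := by simpa using hz
      exact ⟨⟨z.re, this.1⟩, rfl⟩
    · rintro ⟨y, rfl⟩
      refine ⟨⟨y, 0⟩, ?_, rfl⟩
      have : (⟨y, 0⟩ : QuadraticAlgebra ℚ_[p] c t) ∈ quadInt hc1 ht1 := ⟨y.2, by simp⟩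
      simpa using this
  rw [e1, AddSubgroup.inf_relIndex_right, AddSubgroup.relIndex_comap, e2, ← AddSubgroup.index_comap]
  have e3 : H.comap g = (PadicInt.toZMod (p := p)).toAddMonoidHom.ker := by
    ext z
    rw [AddSubgroup.mem_comap, hH, hgx, AddMonoidHom.mem_ker]
    change _ ↔ PadicInt.toZMod z = 0
    rw [← RingHom.mem_ker, PadicInt.ker_toZMod, IsLocalRing.mem_maximalIdeal, PadicInt.mem_nonunits]
    rfl
  rw [e3, AddSubgroup.index_ker]
  have e4 : (PadicInt.toZMod (p := p)).toAddMonoidHom.range = ⊤ := by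
    rw [AddMonoidHom.range_eq_top]
    exact ZMod.ringHom_surjective (PadicInt.toZMod (p := p))
  rw [e4]
  simp

end Index

end LocalOrders

namespace LocalOrders

open QuadraticAlgebra hiding norm_neg norm_one norm_natCast norm_star norm_zero norm_algebraMap
open QuatEmb

/-! ### Ramified data from an Eisenstein polynomial. -/

section Eisenstein

variable {p : ℕ} [Fact p.Prime] {c t b : ℚ_[p]} {hc1 : ‖c‖ ≤ 1} {ht1 : ‖t‖ ≤ 1}
  [hf : Fact (∀ r : ℚ_[p], r ^ 2 ≠ c + t * r)]

theorem norm_quadNorm_le_iff (hc : ‖c‖ = (p : ℝ)⁻¹) (ht : ‖t‖ ≤ (p : ℝ)⁻¹) {r : ℝ}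
    {z : QuadraticAlgebra ℚ_[p] c t} :
    ‖z.norm‖ ≤ r ↔ ‖z.re‖ ^ 2 ≤ r ∧ (p : ℝ)⁻¹ * ‖z.im‖ ^ 2 ≤ r := by
  rw [norm_quadNorm_of_eisenstein hc ht, max_le_iff]

theorem norm_im_le_one (hc : ‖c‖ = (p : ℝ)⁻¹) (ht : ‖t‖ ≤ (p : ℝ)⁻¹)
    {z : QuadraticAlgebra ℚ_[p] c t} (hz : ‖z.norm‖ ≤ 1) : ‖z.re‖ ≤ 1 ∧ ‖z.im‖ ≤ 1 := by
  rw [norm_quadNorm_le_iff hc ht] at hz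
  exact ⟨(sq_le_one_iff₀ (norm_nonneg _)).1 hz.1, padic_norm_le_one_of_sq_le hz.2⟩

theorem norm_sub_norm_le_of_one_le (hc : ‖c‖ = (p : ℝ)⁻¹) (ht : ‖t‖ ≤ (p : ℝ)⁻¹) (hb : ‖b‖ = 1)
    {r : ℝ} (hr : 1 ≤ r) {u : QuadraticAlgebra ℚ_[p] c t} :
    ‖b - u.norm‖ ≤ r ↔ ‖(u - 1).norm‖ ≤ r := by
  have e1 : ‖b - u.norm‖ ≤ r ↔ ‖u.norm‖ ≤ r := by
    constructor
    · intro h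
      have := padic_norm_sub_le (hb.le.trans hr) h
      simpa using this
    · exact padic_norm_sub_le (hb.le.trans hr)
  have key : ∀ x : ℚ_[p], ‖x‖ ^ 2 ≤ r → ‖x - 1‖ ^ 2 ≤ r := by
    intro x hx
    rcases le_total ‖x‖ 1 with h | h
    · refine le_trans (pow_le_one₀ (norm_nonneg _) (padic_norm_sub_le h ?_)) hr
      simp
    · refine le_trans (pow_le_pow_left₀ (norm_nonneg _) (padic_norm_sub_le le_rfl ?_) 2) hx
      simpa using h
  rw [e1, norm_quadNorm_le_iff hc ht, norm_quadNorm_le_iff hc ht]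
  simp only [re_sub, im_sub, re_one, im_one, sub_zero]
  refine and_congr_left fun _ => ⟨key _, fun h => ?_⟩
  have h1 : ‖-(u.re - 1)‖ ^ 2 ≤ r := by rwa [norm_neg]
  have h2 := key _ h1
  rwa [show -(u.re - 1) - 1 = -u.re by ring, norm_neg] at h2

/-- δ is read off from t² + 4c = -N(ω - ω̄). Only 1 ≤ e ≤ δ - 1 has to be checked in `hclose`, as
for e ≤ 0 both closeness conditions just bound u. -/
theorem ramifiedData_of_eisenstein (hc : ‖c‖ = (p : ℝ)⁻¹) (ht : ‖t‖ ≤ (p : ℝ)⁻¹) {δ m₀ : ℤ}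
    (hδ : ‖t ^ 2 + 4 * c‖ = (p : ℝ) ^ (-δ)) (hδ1 : 1 ≤ δ) (hb : ‖b‖ = 1)
    (hclose : ∀ e : ℤ, 1 ≤ e → e ≤ δ - 1 → ∀ u : QuadraticAlgebra ℚ_[p] c t,
      ‖b - u.norm‖ ≤ (p : ℝ) ^ (-e) ↔ ‖(u - 1).norm‖ ≤ (p : ℝ) ^ (-e))
    (hm : (m₀ = -δ ∧ ‖b - 1‖ ≤ (p : ℝ) ^ (-δ)) ∨
      (m₀ = 1 - δ ∧ ∀ u : QuadraticAlgebra ℚ_[p] c t, ¬ ‖b - u.norm‖ ≤ (p : ℝ) ^ (-δ))) :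
    RamifiedData hc1 ht1 omega b δ m₀ where
  unif := isUniformizer_of_eisenstein hc ht
  mem_iff := mem_quadInt_iff_of_eisenstein hc ht
  hasVal_diff := by
    apply hasVal_of_eisenstein hc ht
    rw [← hδ, ← norm_neg]
    congr 1
    simp [QuadraticAlgebra.norm_def]
    ring
  one_le := hδ1
  b_notMem h := by
    have := parity_of_eisenstein hc ht (e := 1) (by simpa using h)
    rw [algebraMap_mem_iff_of_eisenstein hc ht, hb] at this
    have hp1 : (1 : ℝ) < p := by exact_mod_cast (Fact.out : p.Prime).one_lt
    have := inv_lt_one_of_one_lt₀ hp1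
    simp only [zpow_neg, zpow_one] at *
    linarith
  parity q e := parity_of_eisenstein hc ht
  norm_close_iff e he u := by
    rw [algebraMap_mem_iff_of_eisenstein hc ht, mem_fracIdeal_iff_of_eisenstein hc ht]
    rcases le_or_gt e 0 with h | h
    · apply norm_sub_norm_le_of_one_le hc ht hb
      apply one_le_zpow₀
      · exact_mod_cast (Fact.out : p.Prime).one_lt.le
      · omega
    · exact hclose e (by omega) he u
  minLevel := by
    simpa only [algebraMap_mem_iff_of_eisenstein hc ht] using hm

/-- If N(u) were within r of b, then b/N(u) would be within r of 1, hence a norm, and b would be a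
norm too. -/
theorem norm_sub_norm_gt_of_not_norm {r : ℝ} (hr : r < 1) (hb : ‖b‖ = 1)
    (hnorm : ∀ x : ℚ_[p], ‖x - 1‖ ≤ r → ∃ z : QuadraticAlgebra ℚ_[p] c t, z.norm = x)
    (hb' : ∀ z : QuadraticAlgebra ℚ_[p] c t, z.norm ≠ b) (u : QuadraticAlgebra ℚ_[p] c t) :
    ¬ ‖b - u.norm‖ ≤ r := by
  intro h
  have hu : ‖u.norm‖ = 1 := by
    have : ‖b + -(b - u.norm)‖ = ‖b‖ := norm_add_eq_of_lt (by rw [norm_neg, hb]; linarith)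
    rwa [neg_sub, add_sub_cancel, hb] at this
  have hu0 : u.norm ≠ 0 := by rw [← norm_ne_zero_iff, hu]; exact one_ne_zero
  obtain ⟨z, hz⟩ := hnorm (b / u.norm) (by
    rw [div_sub_one hu0, norm_div, hu, div_one]; exact h)
  refine hb' (z * u) ?_
  rw [map_mul, hz, div_mul_cancel₀ _ hu0]

theorem exists_norm_eq_of_sq (s : ℚ_[p]) : ∃ z : QuadraticAlgebra ℚ_[p] c t, z.norm = s ^ 2 :=
  ⟨algebraMap _ _ s, QuadraticAlgebra.norm_algebraMap s⟩

/-- N(ω) = -c has valuation 1, so a power of ω turns any b into a unit. -/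
theorem exists_zpow_norm_eq_one (hc : ‖c‖ = (p : ℝ)⁻¹) (hb : b ≠ 0) :
    ∃ z : QuadraticAlgebra ℚ_[p] c t, z ≠ 0 ∧ ‖b * z.norm‖ = 1 := by
  have hp : (p : ℝ) ≠ 0 := by exact_mod_cast (Fact.out : p.Prime).ne_zero
  have h0 : (omega : QuadraticAlgebra ℚ_[p] c t) ≠ 0 := by
    intro h
    have := congrArg QuadraticAlgebra.im h
    simp at this
  refine ⟨omega ^ (-b.valuation), zpow_ne_zero _ h0, ?_⟩
  rw [norm_mul, quadNorm_zpow, norm_zpow, norm_quadNorm_omega, hc, Padic.norm_eq_zpow_neg_valuation hb,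
    inv_zpow, zpow_neg, inv_inv, inv_mul_cancel₀ (zpow_ne_zero _ hp)]

end Eisenstein

/-! ### Odd p: different exponent 1. -/

section Odd

variable {p : ℕ} [Fact p.Prime] {c t b : ℚ_[p]} {hc1 : ‖c‖ ≤ 1} {ht1 : ‖t‖ ≤ 1}
  [hf : Fact (∀ r : ℚ_[p], r ^ 2 ≠ c + t * r)]

theorem padic_norm_two (hp : p ≠ 2) : ‖(2 : ℚ_[p])‖ = 1 := by
  have := (Padic.norm_natCast_eq_one_iff (p := p) (n := 2)).2
    ((Nat.coprime_primes Fact.out Nat.prime_two).2 hp)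
  exact_mod_cast this

theorem norm_disc_of_odd (hp : p ≠ 2) (hc : ‖c‖ = (p : ℝ)⁻¹) (ht : ‖t‖ ≤ (p : ℝ)⁻¹) :
    ‖t ^ 2 + 4 * c‖ = (p : ℝ) ^ (-(1 : ℕ) : ℤ) := by
  have hp1 : (1 : ℝ) < p := by exact_mod_cast (Fact.out : p.Prime).one_lt
  have h1 := inv_lt_one_of_one_lt₀ hp1
  have h4 : ‖4 * c‖ = (p : ℝ)⁻¹ := by
    rw [show (4 : ℚ_[p]) = 2 ^ 2 by norm_num, norm_mul, norm_pow, padic_norm_two hp, hc]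
    simp
  rw [add_comm, norm_add_eq_of_lt, h4]
  · simp
  · rw [h4, norm_pow]
    have : (0 : ℝ) < (p : ℝ)⁻¹ := by positivity
    nlinarith [norm_nonneg t]

theorem exists_norm_eq_of_odd (hp : p ≠ 2) (x : ℚ_[p]) (hx : ‖x - 1‖ ≤ (p : ℝ)⁻¹) :
    ∃ z : QuadraticAlgebra ℚ_[p] c t, z.norm = x := by
  have hp1 : (1 : ℝ) < p := by exact_mod_cast (Fact.out : p.Prime).one_lt
  obtain ⟨s, rfl⟩ := exists_sq_of_norm_sub_one_lt (p := p) (x := x) (by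
    rw [padic_norm_two hp]
    have := inv_lt_one_of_one_lt₀ hp1
    linarith)
  exact exists_norm_eq_of_sq s

theorem ramifiedData_odd_split (hp : p ≠ 2) (hc : ‖c‖ = (p : ℝ)⁻¹) (ht : ‖t‖ ≤ (p : ℝ)⁻¹) :
    RamifiedData hc1 ht1 omega 1 (1 : ℕ) (-1) :=
  ramifiedData_of_eisenstein hc ht (norm_disc_of_odd hp hc ht) (by simp) (by simp)
    (fun e h1 h2 => by push_cast at h2; omega) (Or.inl ⟨by simp, by simp⟩)

theorem ramifiedData_odd_nonsplit (hp : p ≠ 2) (hc : ‖c‖ = (p : ℝ)⁻¹) (ht : ‖t‖ ≤ (p : ℝ)⁻¹)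
    (hb : ‖b‖ = 1) (hb' : ∀ z : QuadraticAlgebra ℚ_[p] c t, z.norm ≠ b) :
    RamifiedData hc1 ht1 omega b (1 : ℕ) 0 ∧ ∀ u : QuadraticAlgebra ℚ_[p] c t,
      algebraMap ℚ_[p] _ (b - u.norm) ∉ fracIdeal (quadInt hc1 ht1) omega (2 * (1 : ℕ)) := by
  have hp1 : (1 : ℝ) < p := by exact_mod_cast (Fact.out : p.Prime).one_lt
  have key : ∀ u : QuadraticAlgebra ℚ_[p] c t, ¬ ‖b - u.norm‖ ≤ (p : ℝ) ^ (-(1 : ℕ) : ℤ) := by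
    intro u
    refine norm_sub_norm_gt_of_not_norm ?_ hb (fun x hx => exists_norm_eq_of_odd hp x ?_) hb' u
    · simpa using inv_lt_one_of_one_lt₀ hp1
    · simpa using hx
  refine ⟨ramifiedData_of_eisenstein hc ht (norm_disc_of_odd hp hc ht) (by simp) hb
    (fun e h1 h2 => by push_cast at h2; omega) (Or.inr ⟨by simp, key⟩), fun u => ?_⟩
  rw [algebraMap_mem_iff_of_eisenstein hc ht]
  exact key u

/-- For integral u the norm is (re u)² modulo p, so N(u) ≢ 1 leaves all classes of O/ϖ except ±1,
which are distinct because p is odd. -/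
theorem levelCount_odd_split (hp : p ≠ 2) (hc : ‖c‖ = (p : ℝ)⁻¹) (ht : ‖t‖ ≤ (p : ℝ)⁻¹)
    (hϖ : (omega : QuadraticAlgebra ℚ_[p] c t) ≠ 0) :
    levelCount hc1 ht1 omega hϖ 1 (1 : ℕ) 1 1 = ((p - 2 : ℕ) : ℕ∞) := by
  have hp1 : (1 : ℝ) < p := by exact_mod_cast (Fact.out : p.Prime).one_lt
  have hp0 : (0 : ℝ) < (p : ℝ)⁻¹ := by positivity
  have hp2 := inv_lt_one_of_one_lt₀ hp1
  have U : IsUniformizer (quadInt hc1 ht1) omega := isUniformizer_of_eisenstein hc ht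
  have hq := relIndex_of_eisenstein (hc1 := hc1) (ht1 := ht1) hc ht
  have hsq : ∀ x : ℚ_[p], ‖x‖ ^ 2 ≤ (p : ℝ)⁻¹ ↔ ‖x‖ < 1 := by
    intro x
    constructor
    · intro h
      rw [← sq_lt_one_iff₀ (norm_nonneg _)]
      linarith
    · intro h
      have := padic_norm_lt_one_iff.1 h
      nlinarith [norm_nonneg x]
  have h1 : ∀ (q : ℚ_[p]) (u : QuadraticAlgebra ℚ_[p] c t), ‖u.im‖ ≤ 1 →
      (u - algebraMap _ _ q ∈ fracIdeal (quadInt hc1 ht1) omega 1 ↔ ‖u.re - q‖ < 1) := by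
    intro q u hu
    rw [mem_fracIdeal_iff_of_eisenstein hc ht, norm_quadNorm_le_iff hc ht]
    simp only [re_sub, im_sub, algebraMap_re, algebraMap_im, sub_zero, zpow_neg, zpow_one]
    rw [hsq]
    refine and_iff_left ?_
    have := pow_le_one₀ (n := 2) (norm_nonneg _) hu
    nlinarith
  have e : levelSet hc1 ht1 omega 1 (1 : ℕ) 1 1 =
      {u | u - 0 ∈ fracIdeal (quadInt hc1 ht1) omega 0} \
      ({u | u - algebraMap ℚ_[p] _ 1 ∈ fracIdeal (quadInt hc1 ht1) omega 1} ∪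
        {u | u - algebraMap ℚ_[p] _ (-1) ∈ fracIdeal (quadInt hc1 ht1) omega 1}) := by
    ext u
    have e1 : (2 * (1 : ℕ) - 1 - (1 : ℕ) : ℤ) = 0 := by norm_num
    have e2 : (2 * ((1 : ℕ) - 1) : ℤ) = 2 * 0 := by norm_num
    have e3 : (2 * ((1 : ℕ) - 1 + 1) : ℤ) = 2 * 1 := by norm_num
    simp only [levelSet, Set.mem_ofPred_eq, e1, e2, e3, sub_zero, Set.mem_sdiff, Set.mem_union,
      algebraMap_mem_iff_of_eisenstein hc ht]
    constructor
    · rintro ⟨h2, -, h3⟩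
      refine ⟨h2, fun h4 => (h3.resolve_left one_ne_zero) ?_⟩
      rw [mem_fracIdeal_zero, mem_quadInt] at h2
      rw [h1 _ _ h2.2, h1 _ _ h2.2] at h4
      have e4 : 1 - u.norm = -((u.re - 1) * (u.re - -1)) - (t * u.re * u.im - c * u.im * u.im) := by
        rw [QuadraticAlgebra.norm_def]; ring
      rw [e4]
      simp only [zpow_neg, zpow_one]
      refine padic_norm_sub_le ?_ (padic_norm_sub_le ?_ ?_)
      · rw [norm_neg, norm_mul]
        have h5 : ‖u.re - 1‖ ≤ 1 := padic_norm_sub_le h2.1 (by simp)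
        have h6 : ‖u.re - -1‖ ≤ 1 := padic_norm_sub_le h2.1 (by simp)
        rcases h4 with h4 | h4 <;> rw [padic_norm_lt_one_iff] at h4 <;>
          nlinarith [norm_nonneg (u.re - 1), norm_nonneg (u.re - -1)]
      · rw [norm_mul, norm_mul]
        have := mul_le_one₀ h2.1 (norm_nonneg _) h2.2
        nlinarith [norm_nonneg t, mul_nonneg (norm_nonneg u.re) (norm_nonneg u.im)]
      · rw [norm_mul, norm_mul, hc]
        have := mul_le_one₀ h2.2 (norm_nonneg _) h2.2
        nlinarith
    · rintro ⟨h2, h3⟩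
      have h2' := h2
      rw [mem_fracIdeal_zero, mem_quadInt] at h2
      rw [h1 _ _ h2.2, h1 _ _ h2.2, not_or, not_lt, not_lt] at h3
      have h4 : ‖u.norm‖ ≤ 1 := by
        rwa [mem_fracIdeal_zero, mem_quadInt_iff_of_eisenstein hc ht] at h2'
      refine ⟨h2', ?_, Or.inr fun h5 => ?_⟩
      · simpa using padic_norm_sub_le (by simp) h4
      · have e4 : (u.re - 1) * (u.re - -1) = -(1 - u.norm) -
            (t * u.re * u.im - c * u.im * u.im) := by
          rw [QuadraticAlgebra.norm_def]; ring
        have h6 : ‖(u.re - 1) * (u.re - -1)‖ ≤ (p : ℝ)⁻¹ := by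
          rw [e4]
          refine padic_norm_sub_le (by rw [norm_neg]; simpa using h5) (padic_norm_sub_le ?_ ?_)
          · rw [norm_mul, norm_mul]
            have := mul_le_one₀ h2.1 (norm_nonneg _) h2.2
            nlinarith [norm_nonneg t, mul_nonneg (norm_nonneg u.re) (norm_nonneg u.im)]
          · rw [norm_mul, norm_mul, hc]
            have := mul_le_one₀ h2.2 (norm_nonneg _) h2.2
            nlinarith
        rw [norm_mul] at h6
        nlinarith [h3.1, h3.2]
  have hn : (2 * (1 : ℕ) - 1 : ℤ) = 1 := by norm_num
  rw [levelCount, e, hn, U.vertexOrder_image_sdiff, Set.image_union, Set.encard_sdiff,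
    U.encard_vertexOrder_image hq 1 0 1 (by norm_num), Set.encard_union_eq,
    U.encard_vertexOrder_image hq 1 1 0 (by norm_num),
    U.encard_vertexOrder_image hq 1 1 0 (by norm_num), pow_one, pow_zero, ← Nat.cast_add,
    ENat.natCast_sub]
  · rfl
  · rw [Set.disjoint_left]
    rintro _ ⟨u, hu, rfl⟩ ⟨v, hv, huv⟩
    have h2 := (U.vertexOrder_eq_iff.1 huv).2
    have h3 := Submodule.sub_mem _ hu (Submodule.sub_mem _ hv h2)
    have e5 : u - algebraMap ℚ_[p] (QuadraticAlgebra ℚ_[p] c t) 1 -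
        (v - algebraMap ℚ_[p] _ (-1) - (v - u)) = 0 - algebraMap ℚ_[p] _ 2 := by
      rw [show (2 : ℚ_[p]) = 1 - (-1) by norm_num, map_sub]; ring
    rw [e5, h1 _ _ (by simp), re_zero, zero_sub, norm_neg, padic_norm_two hp] at h3
    exact lt_irrefl _ h3
  · rw [← Set.image_union]
    apply Set.image_mono
    have h01 : ∀ q : ℚ_[p], ‖q‖ ≤ 1 → algebraMap ℚ_[p] _ q ∈ fracIdeal (quadInt hc1 ht1) omega 0 := by
      intro q hq
      rw [mem_fracIdeal_zero]
      exact ⟨hq, by simp⟩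
    rintro u (hu | hu)
    · have := Submodule.add_mem _ (U.anti zero_le_one hu) (h01 1 (by simp))
      simpa using this
    · have := Submodule.add_mem _ (U.anti zero_le_one hu) (h01 (-1) (by simp))
      simpa using this
  · apply Set.Finite.union
    · exact Set.finite_of_encard_eq_coe (U.encard_vertexOrder_image hq 1 1 0 (by norm_num) _)
    · exact Set.finite_of_encard_eq_coe (U.encard_vertexOrder_image hq 1 1 0 (by norm_num) _)
  · rintro u v huv (hu | hu)
    · left
      have := Submodule.sub_mem _ hu huv
      simpa using this
    · right
      have := Submodule.sub_mem _ hu huv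
      simpa [add_comm] using this

end Odd

end LocalOrders

namespace LocalOrders

open QuadraticAlgebra hiding norm_neg norm_one norm_natCast norm_star norm_zero norm_algebraMap
open QuatEmb

/-! ### p = 2: norms close to 1, for different exponents 2 and 3. -/

section Dyadic

variable {c t b : ℚ_[2]} {hc1 : ‖c‖ ≤ 1} {ht1 : ‖t‖ ≤ 1}
  [hf : Fact (∀ r : ℚ_[2], r ^ 2 ≠ c + t * r)]

/-- The bracket is the trace of u - 1. Comparing N(u) - 1 with N(u - 1) thus amounts to bounding
this trace. -/
theorem norm_sub_one_eq (u : QuadraticAlgebra ℚ_[2] c t) :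
    (u - 1).norm = (u.norm - 1) - (2 * (u.re - 1) + t * u.im) := by
  simp [QuadraticAlgebra.norm_def]
  ring

theorem padic_two_norm_four : ‖(4 : ℚ_[2])‖ = (4 : ℝ)⁻¹ := by
  rw [show (4 : ℚ_[2]) = 2 * 2 by norm_num, norm_mul, padic_two_norm_two]
  norm_num

theorem padic_two_norm_add {x y : ℚ_[2]} (h : ‖x‖ = ‖y‖) : ‖x + y‖ ≤ (2 : ℝ)⁻¹ * ‖y‖ := by
  have := padic_two_norm_sub (x := x) (y := -y) (by rwa [norm_neg])
  rwa [sub_neg_eq_add, norm_neg] at this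

theorem padic_two_norm_lt_iff {x : ℚ_[2]} {r : ℝ} {n : ℤ} (hr : r = (2 : ℝ) ^ n) :
    ‖x‖ < r ↔ ‖x‖ ≤ 2⁻¹ * r := by
  have h1 : ‖(2 : ℚ_[2]) ^ (-n)‖ = r := by
    rw [norm_zpow, padic_two_norm_two, inv_zpow, zpow_neg, inv_inv, hr]
  have h2 := padic_norm_lt_iff (p := 2) (x := x) (y := (2 : ℚ_[2]) ^ (-n))
    (zpow_ne_zero _ two_ne_zero)
  rw [h1] at h2
  exact_mod_cast h2

theorem norm_sub_norm_iff {r : ℝ} (hb : ‖b - 1‖ ≤ r) {x : ℚ_[2]} : ‖b - x‖ ≤ r ↔ ‖x - 1‖ ≤ r := by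
  constructor
  · intro h
    have := padic_norm_sub_le hb h
    rwa [show b - 1 - (b - x) = x - 1 by ring] at this
  · intro h
    have := padic_norm_sub_le hb h
    rwa [show b - 1 - (x - 1) = b - x by ring] at this

theorem integral_of_close (hc : ‖c‖ = (2 : ℝ)⁻¹) (ht : ‖t‖ ≤ (2 : ℝ)⁻¹)
    {u : QuadraticAlgebra ℚ_[2] c t} (h : ‖u.norm - 1‖ ≤ 1 ∨ ‖(u - 1).norm‖ ≤ 1) :
    ‖u.re - 1‖ ≤ 1 ∧ ‖u.im‖ ≤ 1 := by
  have hc' : ‖c‖ = ((2 : ℕ) : ℝ)⁻¹ := by exact_mod_cast hc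
  have ht' : ‖t‖ ≤ ((2 : ℕ) : ℝ)⁻¹ := by exact_mod_cast ht
  rcases h with h | h
  · have h1 : ‖u.norm‖ ≤ 1 := by simpa using padic_norm_add_le h (norm_one (α := ℚ_[2])).le
    have h2 := norm_im_le_one hc' ht' h1
    exact ⟨padic_norm_sub_le h2.1 (by simp), h2.2⟩
  · simpa using norm_im_le_one hc' ht' h

theorem norm_close_half (hc : ‖c‖ = (2 : ℝ)⁻¹) (ht : ‖t‖ ≤ (2 : ℝ)⁻¹)
    {u : QuadraticAlgebra ℚ_[2] c t} : ‖u.norm - 1‖ ≤ (2 : ℝ)⁻¹ ↔ ‖(u - 1).norm‖ ≤ (2 : ℝ)⁻¹ := by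
  have key : ‖u.re - 1‖ ≤ 1 ∧ ‖u.im‖ ≤ 1 → ‖2 * (u.re - 1) + t * u.im‖ ≤ (2 : ℝ)⁻¹ := by
    rintro ⟨h1, h2⟩
    apply padic_norm_add_le
    · rw [norm_mul, padic_two_norm_two]
      linarith
    · rw [norm_mul]
      nlinarith [norm_nonneg t]
  have e := norm_sub_one_eq u
  constructor
  · intro h
    rw [e]
    exact padic_norm_sub_le h (key (integral_of_close hc ht (Or.inl (h.trans (by norm_num)))))
  · intro h
    rw [eq_sub_iff_add_eq] at e
    rw [← e]
    exact padic_norm_add_le h (key (integral_of_close hc ht (Or.inr (h.trans (by norm_num)))))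

theorem half_of_close (hc : ‖c‖ = (2 : ℝ)⁻¹) (ht : ‖t‖ ≤ (2 : ℝ)⁻¹)
    {u : QuadraticAlgebra ℚ_[2] c t} (h : ‖(u - 1).norm‖ ≤ (2 : ℝ)⁻¹) :
    ‖u.re - 1‖ ≤ 2⁻¹ ∧ ‖u.im‖ ≤ 1 := by
  have hc' : ‖c‖ = ((2 : ℕ) : ℝ)⁻¹ := by exact_mod_cast hc
  have ht' : ‖t‖ ≤ ((2 : ℕ) : ℝ)⁻¹ := by exact_mod_cast ht
  have h1 := (integral_of_close hc ht (Or.inr (h.trans (by norm_num)))).2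
  rw [norm_quadNorm_le_iff hc' ht'] at h
  refine ⟨?_, h1⟩
  have h2 : ‖u.re - 1‖ < 1 := by
    have h3 := h.1
    simp only [re_sub, re_one] at h3
    rw [← sq_lt_one_iff₀ (norm_nonneg _)]
    linarith
  rw [padic_norm_lt_one_iff] at h2
  exact_mod_cast h2

/-- Once u ≡ 1 mod ϖ, the real part of u - 1 is even, and with 4 ∣ t the trace of u - 1 is divisible
by 4. -/
theorem norm_close_quarter (hc : ‖c‖ = (2 : ℝ)⁻¹) (ht : ‖t‖ ≤ (4 : ℝ)⁻¹)
    {u : QuadraticAlgebra ℚ_[2] c t} : ‖u.norm - 1‖ ≤ (4 : ℝ)⁻¹ ↔ ‖(u - 1).norm‖ ≤ (4 : ℝ)⁻¹ := by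
  have ht2 : ‖t‖ ≤ (2 : ℝ)⁻¹ := ht.trans (by norm_num)
  have key : ‖(u - 1).norm‖ ≤ (2 : ℝ)⁻¹ → ‖2 * (u.re - 1) + t * u.im‖ ≤ (4 : ℝ)⁻¹ := by
    intro h
    obtain ⟨h1, h2⟩ := half_of_close hc ht2 h
    apply padic_norm_add_le
    · rw [norm_mul, padic_two_norm_two]
      linarith
    · rw [norm_mul]
      nlinarith [norm_nonneg t]
  have e := norm_sub_one_eq u
  constructor
  · intro h
    rw [e]
    exact padic_norm_sub_le h (key ((norm_close_half hc ht2).1 (h.trans (by norm_num))))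
  · intro h
    rw [eq_sub_iff_add_eq] at e
    rw [← e]
    exact padic_norm_add_le h (key (h.trans (by norm_num)))

/-- With y = im u, the critical term is y(t - cy). If y is even, both factors are even. If y is a
unit, t and cy have the same norm 1/2, so their difference is divisible by 4. -/
theorem norm_close_gap_half (hc : ‖c‖ = (2 : ℝ)⁻¹) (ht : ‖t‖ = (2 : ℝ)⁻¹)
    {u : QuadraticAlgebra ℚ_[2] c t} (h : ‖u.norm - 1‖ ≤ (2 : ℝ)⁻¹) :
    ‖u.norm - 1‖ ≤ (4 : ℝ)⁻¹ := by
  obtain ⟨h1, h2⟩ := half_of_close hc ht.le ((norm_close_half hc ht.le).1 h)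
  have e : u.norm - 1 = (u.re - 1) * (u.re - 1) + 2 * (u.re - 1) + t * (u.re - 1) * u.im +
      2 * u.im * (t - c * u.im) - u.im * (t - c * u.im) := by
    rw [QuadraticAlgebra.norm_def]
    ring
  have h3 : ‖u.im * (t - c * u.im)‖ ≤ (4 : ℝ)⁻¹ := by
    rw [norm_mul]
    rcases h2.lt_or_eq with h4 | h4
    · rw [padic_norm_lt_one_iff] at h4
      have h5 : ‖t - c * u.im‖ ≤ 2⁻¹ := by
        apply padic_norm_sub_le ht.le
        rw [norm_mul]
        nlinarith [norm_nonneg c]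
      push_cast at h4
      nlinarith [norm_nonneg u.im]
    · have := padic_two_norm_sub (x := t) (y := c * u.im) (by rw [norm_mul, hc, ht, h4, mul_one])
      rw [norm_mul, hc, h4] at this
      rw [h4]
      linarith
  rw [e]
  refine padic_norm_sub_le (padic_norm_add_le (padic_norm_add_le (padic_norm_add_le ?_ ?_) ?_) ?_) h3
  · rw [norm_mul]
    nlinarith [norm_nonneg (u.re - 1)]
  · rw [norm_mul, padic_two_norm_two]
    linarith
  · rw [norm_mul, norm_mul, ht]
    have := mul_le_mul h1 h2 (norm_nonneg _) (by norm_num)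
    nlinarith
  · rw [mul_assoc, norm_mul, padic_two_norm_two]
    linarith [norm_nonneg (u.im * (t - c * u.im))]

/-- Here re u - 1 and im u are even, so re u - 1 and re u + 1 are consecutive even numbers and their
product is divisible by 8; the other terms are so as well. -/
theorem norm_close_gap_quarter (hc : ‖c‖ = (2 : ℝ)⁻¹) (ht : ‖t‖ ≤ (4 : ℝ)⁻¹)
    {u : QuadraticAlgebra ℚ_[2] c t} (h : ‖u.norm - 1‖ ≤ (4 : ℝ)⁻¹) :
    ‖u.norm - 1‖ ≤ (8 : ℝ)⁻¹ := by
  have hc' : ‖c‖ = ((2 : ℕ) : ℝ)⁻¹ := by exact_mod_cast hc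
  have ht' : ‖t‖ ≤ ((2 : ℕ) : ℝ)⁻¹ := by
    push_cast; exact ht.trans (by norm_num)
  have h0 := (norm_close_quarter hc ht).1 h
  obtain ⟨h1, -⟩ := half_of_close hc (ht.trans (by norm_num)) (h0.trans (by norm_num))
  have h2 : ‖u.im‖ ≤ 2⁻¹ := by
    rw [norm_quadNorm_le_iff hc' ht'] at h0
    have h3 := h0.2
    simp only [im_sub, im_one, sub_zero] at h3
    push_cast at h3
    have h4 : ‖u.im‖ < 1 := by
      rw [← sq_lt_one_iff₀ (norm_nonneg _)]
      linarith
    rw [padic_norm_lt_one_iff] at h4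
    exact_mod_cast h4
  have e : u.norm - 1 = (u.re - 1) * ((u.re - 1) + 2) + t * (u.re - 1) * u.im +
      t * u.im - c * u.im * u.im := by
    rw [QuadraticAlgebra.norm_def]
    ring
  rw [e]
  refine padic_norm_sub_le (padic_norm_add_le (padic_norm_add_le ?_ ?_) ?_) ?_
  · rw [norm_mul]
    rcases h1.lt_or_eq with h4 | h4
    · rw [padic_two_norm_lt_iff (n := -1) (by norm_num)] at h4
      have h5 : ‖u.re - 1 + 2‖ ≤ 2⁻¹ := padic_norm_add_le h1 padic_two_norm_two.le
      nlinarith [norm_nonneg (u.re - 1), norm_nonneg (u.re - 1 + 2)]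
    · have := padic_two_norm_add (x := u.re - 1) (y := 2) (by rw [h4, padic_two_norm_two])
      rw [padic_two_norm_two] at this
      rw [h4]
      linarith
  · rw [norm_mul, norm_mul]
    have h3 := mul_le_mul h1 h2 (norm_nonneg _) (by norm_num)
    nlinarith [norm_nonneg t, mul_nonneg (norm_nonneg (u.re - 1)) (norm_nonneg u.im)]
  · rw [norm_mul]
    nlinarith [norm_nonneg t, norm_nonneg u.im]
  · rw [norm_mul, norm_mul, hc]
    nlinarith [norm_nonneg u.im]

theorem norm_disc_half (hc : ‖c‖ = (2 : ℝ)⁻¹) (ht : ‖t‖ = (2 : ℝ)⁻¹) :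
    ‖t ^ 2 + 4 * c‖ = (4 : ℝ)⁻¹ := by
  rw [norm_add_eq_of_lt, norm_pow, ht]
  · norm_num
  · rw [norm_pow, norm_mul, padic_two_norm_four, ht, hc]
    norm_num

theorem norm_disc_quarter (hc : ‖c‖ = (2 : ℝ)⁻¹) (ht : ‖t‖ ≤ (4 : ℝ)⁻¹) :
    ‖t ^ 2 + 4 * c‖ = (8 : ℝ)⁻¹ := by
  rw [add_comm, norm_add_eq_of_lt, norm_mul, padic_two_norm_four, hc]
  · norm_num
  · rw [norm_pow, norm_mul, padic_two_norm_four, hc]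
    nlinarith [norm_nonneg t]

theorem exists_norm_eq_of_eighth (x : ℚ_[2]) (hx : ‖x - 1‖ ≤ (8 : ℝ)⁻¹) :
    ∃ z : QuadraticAlgebra ℚ_[2] c t, z.norm = x := by
  obtain ⟨s, rfl⟩ := exists_sq_of_norm_sub_one_lt (p := 2) (x := x) (by
    rw [padic_two_norm_two]
    norm_num
    linarith)
  exact exists_norm_eq_of_sq s

theorem exists_norm_eq_of_quarter (hc : ‖c‖ = (2 : ℝ)⁻¹) (ht : ‖t‖ = (2 : ℝ)⁻¹) (x : ℚ_[2])
    (hx : ‖x - 1‖ ≤ (4 : ℝ)⁻¹) : ∃ z : QuadraticAlgebra ℚ_[2] c t, z.norm = x := by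
  rcases hx.lt_or_eq with h | h
  · rw [padic_two_norm_lt_iff (n := -2) (by norm_num)] at h
    exact exists_norm_eq_of_eighth x (h.trans (by norm_num))
  -- N(v) = 1 - (t² + 4c) lies at distance exactly 1/4 from 1, like x. Dividing x by it gives
  -- distance at most 1/8, where every element is a square.
  · let v : QuadraticAlgebra ℚ_[2] c t := ⟨1 - t, 2⟩
    have hv : v.norm = 1 - (t ^ 2 + 4 * c) := by
      simp only [v, QuadraticAlgebra.norm_def]
      ring
    have hd := norm_disc_half hc ht
    have hv1 : ‖v.norm‖ = 1 := by
      rw [hv, sub_eq_add_neg, norm_add_eq_of_lt, norm_one]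
      rw [norm_neg, hd, norm_one]
      norm_num
    have hv0 : v.norm ≠ 0 := by rw [← norm_ne_zero_iff, hv1]; exact one_ne_zero
    obtain ⟨z, hz⟩ := exists_norm_eq_of_eighth (c := c) (t := t) (x / v.norm) (by
      rw [div_sub_one hv0, norm_div, hv1, div_one, hv,
        show x - (1 - (t ^ 2 + 4 * c)) = (x - 1) + (t ^ 2 + 4 * c) by ring]
      have := padic_two_norm_add (x := x - 1) (y := t ^ 2 + 4 * c) (by rw [h, hd])
      rw [hd] at this
      linarith)
    exact ⟨z * v, by rw [map_mul, hz, div_mul_cancel₀ _ hv0]⟩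

theorem ramifiedData_half_split (hc : ‖c‖ = (2 : ℝ)⁻¹) (ht : ‖t‖ = (2 : ℝ)⁻¹) :
    RamifiedData hc1 ht1 omega 1 (2 : ℕ) (-2) ∧ ∀ u : QuadraticAlgebra ℚ_[2] c t,
      algebraMap ℚ_[2] _ (1 - u.norm) ∈ fracIdeal (quadInt hc1 ht1) omega (2 * ((2 : ℕ) - 1)) →
      algebraMap ℚ_[2] _ (1 - u.norm) ∈ fracIdeal (quadInt hc1 ht1) omega (2 * (2 : ℕ)) := by
  have hc' : ‖c‖ = ((2 : ℕ) : ℝ)⁻¹ := by exact_mod_cast hc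
  have ht' : ‖t‖ ≤ ((2 : ℕ) : ℝ)⁻¹ := by exact_mod_cast ht.le
  refine ⟨ramifiedData_of_eisenstein hc' ht' ?_ (by simp) (by simp) (fun e h1 h2 u => ?_)
    (Or.inl ⟨by simp, by simp⟩), fun u => ?_⟩
  · rw [norm_disc_half hc ht]; norm_num
  · obtain rfl : e = 1 := by push_cast at h2; omega
    rw [norm_sub_rev]
    simpa using norm_close_half hc ht.le
  · rw [algebraMap_mem_iff_of_eisenstein hc' ht', algebraMap_mem_iff_of_eisenstein hc' ht',
      norm_sub_rev]
    intro h
    have h2 := norm_close_gap_half hc ht (u := u) (by norm_num at h; linarith)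
    norm_num at h2 ⊢
    exact h2

theorem ramifiedData_half_nonsplit (hc : ‖c‖ = (2 : ℝ)⁻¹) (ht : ‖t‖ = (2 : ℝ)⁻¹)
    (hb : ‖b‖ = 1) (hb' : ∀ z : QuadraticAlgebra ℚ_[2] c t, z.norm ≠ b) :
    RamifiedData hc1 ht1 omega b (2 : ℕ) (-1) ∧ ∀ u : QuadraticAlgebra ℚ_[2] c t,
      algebraMap ℚ_[2] _ (b - u.norm) ∉ fracIdeal (quadInt hc1 ht1) omega (2 * (2 : ℕ)) := by
  have hc' : ‖c‖ = ((2 : ℕ) : ℝ)⁻¹ := by exact_mod_cast hc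
  have ht' : ‖t‖ ≤ ((2 : ℕ) : ℝ)⁻¹ := by exact_mod_cast ht.le
  have e4 : ((2 : ℕ) : ℝ) ^ (-(2 : ℕ) : ℤ) = (4 : ℝ)⁻¹ := by norm_num
  have key : ∀ u : QuadraticAlgebra ℚ_[2] c t,
      ¬ ‖b - u.norm‖ ≤ ((2 : ℕ) : ℝ) ^ (-(2 : ℕ) : ℤ) := by
    intro u
    rw [e4]
    exact norm_sub_norm_gt_of_not_norm (by norm_num) hb (exists_norm_eq_of_quarter hc ht) hb' u
  refine ⟨ramifiedData_of_eisenstein hc' ht' ?_ (by simp) hb (fun e h1 h2 u => ?_)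
    (Or.inr ⟨by norm_num, key⟩), fun u => ?_⟩
  · rw [norm_disc_half hc ht, e4]
  · obtain rfl : e = 1 := by push_cast at h2; omega
    rw [norm_sub_norm_iff (by simpa using padic_two_norm_sub_one hb)]
    simpa using norm_close_half hc ht.le
  · rw [algebraMap_mem_iff_of_eisenstein hc' ht']
    exact key u

theorem ramifiedData_quarter_split (hc : ‖c‖ = (2 : ℝ)⁻¹) (ht : ‖t‖ ≤ (4 : ℝ)⁻¹) :
    RamifiedData hc1 ht1 omega 1 (3 : ℕ) (-3) ∧ ∀ u : QuadraticAlgebra ℚ_[2] c t,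
      algebraMap ℚ_[2] _ (1 - u.norm) ∈ fracIdeal (quadInt hc1 ht1) omega (2 * ((3 : ℕ) - 1)) →
      algebraMap ℚ_[2] _ (1 - u.norm) ∈ fracIdeal (quadInt hc1 ht1) omega (2 * (3 : ℕ)) := by
  have hc' : ‖c‖ = ((2 : ℕ) : ℝ)⁻¹ := by exact_mod_cast hc
  have ht2 : ‖t‖ ≤ (2 : ℝ)⁻¹ := ht.trans (by norm_num)
  have ht' : ‖t‖ ≤ ((2 : ℕ) : ℝ)⁻¹ := by exact_mod_cast ht2
  refine ⟨ramifiedData_of_eisenstein hc' ht' ?_ (by simp) (by simp) (fun e h1 h2 u => ?_)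
    (Or.inl ⟨by simp, by simp⟩), fun u => ?_⟩
  · rw [norm_disc_quarter hc ht]; norm_num
  · rw [norm_sub_rev]
    obtain rfl | rfl : e = 1 ∨ e = 2 := by push_cast at h2; omega
    · simpa using norm_close_half hc ht2
    · have e4 : ((2 : ℕ) : ℝ) ^ (-2 : ℤ) = (4 : ℝ)⁻¹ := by norm_num
      rw [e4]
      exact norm_close_quarter hc ht
  · rw [algebraMap_mem_iff_of_eisenstein hc' ht', algebraMap_mem_iff_of_eisenstein hc' ht',
      norm_sub_rev]
    intro h
    have h2 := norm_close_gap_quarter hc ht (u := u) (by norm_num at h; linarith)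
    norm_num at h2 ⊢
    exact h2

theorem ramifiedData_quarter_nonsplit (hc : ‖c‖ = (2 : ℝ)⁻¹) (ht : ‖t‖ ≤ (4 : ℝ)⁻¹)
    (hb : ‖b - 1‖ ≤ (4 : ℝ)⁻¹) (hb' : ∀ z : QuadraticAlgebra ℚ_[2] c t, z.norm ≠ b) :
    RamifiedData hc1 ht1 omega b (3 : ℕ) (-2) ∧ ∀ u : QuadraticAlgebra ℚ_[2] c t,
      algebraMap ℚ_[2] _ (b - u.norm) ∉ fracIdeal (quadInt hc1 ht1) omega (2 * (3 : ℕ)) := by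
  have hc' : ‖c‖ = ((2 : ℕ) : ℝ)⁻¹ := by exact_mod_cast hc
  have ht2 : ‖t‖ ≤ (2 : ℝ)⁻¹ := ht.trans (by norm_num)
  have ht' : ‖t‖ ≤ ((2 : ℕ) : ℝ)⁻¹ := by exact_mod_cast ht2
  have hb1 : ‖b‖ = 1 := by
    have : ‖1 + (b - 1)‖ = ‖(1 : ℚ_[2])‖ := norm_add_eq_of_lt (by rw [norm_one]; linarith)
    simpa using this
  have e8 : ((2 : ℕ) : ℝ) ^ (-(3 : ℕ) : ℤ) = (8 : ℝ)⁻¹ := by norm_num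
  have key : ∀ u : QuadraticAlgebra ℚ_[2] c t,
      ¬ ‖b - u.norm‖ ≤ ((2 : ℕ) : ℝ) ^ (-(3 : ℕ) : ℤ) := by
    intro u
    rw [e8]
    exact norm_sub_norm_gt_of_not_norm (by norm_num) hb1 exists_norm_eq_of_eighth hb' u
  refine ⟨ramifiedData_of_eisenstein hc' ht' ?_ (by simp) hb1 (fun e h1 h2 u => ?_)
    (Or.inr ⟨by norm_num, key⟩), fun u => ?_⟩
  · rw [norm_disc_quarter hc ht, e8]
  · obtain rfl | rfl : e = 1 ∨ e = 2 := by push_cast at h2; omega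
    · rw [norm_sub_norm_iff (by simpa using padic_two_norm_sub_one hb1)]
      simpa using norm_close_half hc ht2
    · have e4 : ((2 : ℕ) : ℝ) ^ (-2 : ℤ) = (4 : ℝ)⁻¹ := by norm_num
      rw [e4, norm_sub_norm_iff hb]
      exact norm_close_quarter hc ht
  · rw [algebraMap_mem_iff_of_eisenstein hc' ht']
    exact key u

/-- For different exponent 3 a unit b is not enough: `norm_close_iff` at e = 2 needs b ≡ 1 mod 4. -/
theorem exists_norm_mul_sub_one_le (hc : ‖c‖ = (2 : ℝ)⁻¹) (ht : ‖t‖ ≤ (4 : ℝ)⁻¹) (hb : b ≠ 0) :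
    ∃ z : QuadraticAlgebra ℚ_[2] c t, z ≠ 0 ∧ ‖b * z.norm - 1‖ ≤ (4 : ℝ)⁻¹ := by
  have hc' : ‖c‖ = ((2 : ℕ) : ℝ)⁻¹ := by exact_mod_cast hc
  obtain ⟨z, hz0, hz⟩ := exists_zpow_norm_eq_one (p := 2) (t := t) hc' hb
  have h1 := padic_two_norm_sub_one hz
  rcases h1.lt_or_eq with h | h
  · rw [padic_two_norm_lt_iff (n := -1) (by norm_num)] at h
    exact ⟨z, hz0, h.trans (by norm_num)⟩
  -- N(1 + ω) = 1 + t - c is at distance exactly 1/2 from 1, so it repairs a unit that is 3 modulo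
  -- 4.
  · let v : QuadraticAlgebra ℚ_[2] c t := ⟨1, 1⟩
    have hv : v.norm = 1 + (t - c) := by
      simp only [v, QuadraticAlgebra.norm_def]
      ring
    have htc : ‖t - c‖ = 2⁻¹ := by
      rw [← norm_neg, neg_sub, sub_eq_add_neg, norm_add_eq_of_lt, hc]
      rw [norm_neg, hc]
      exact ht.trans_lt (by norm_num)
    have hv0 : v ≠ 0 := by
      intro h
      have := congrArg QuadraticAlgebra.im h
      simp [v] at this
    refine ⟨z * v, mul_ne_zero hz0 hv0, ?_⟩
    rw [map_mul, hv, show b * (z.norm * (1 + (t - c))) - 1 =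
      (b * z.norm - 1) + b * z.norm * (t - c) by ring]
    have e1 : ‖b * z.norm * (t - c)‖ = 2⁻¹ := by rw [norm_mul, hz, htc, one_mul]
    have := padic_two_norm_add (x := b * z.norm - 1) (y := b * z.norm * (t - c)) (by rw [h, e1])
    rw [e1] at this
    linarith

end Dyadic

end LocalOrders

namespace LocalOrders

open QuadraticAlgebra hiding norm_neg norm_one norm_natCast norm_star norm_zero norm_algebraMap
open QuatEmb

/-! ### The count in the unramified case. -/

section Unramified

variable {p : ℕ} [Fact p.Prime] {c t : ℚ_[p]} {hc : ‖c‖ ≤ 1} {ht : ‖t‖ ≤ 1}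
  {ϖ : QuadraticAlgebra ℚ_[p] c t} [hf : Fact (∀ r : ℚ_[p], r ^ 2 ≠ c + t * r)]
  {b : ℚ_[p]} {v : ℤ}

/-- Data on an unramified quadratic extension and on an element `b` of valuation `v` of the base. -/
structure UnramifiedData (hc : ‖c‖ ≤ 1) (ht : ‖t‖ ≤ 1) (ϖ : QuadraticAlgebra ℚ_[p] c t) (b : ℚ_[p])
    (v : ℤ) : Prop where
  unif : IsUniformizer (quadInt hc ht) ϖ
  mem_iff : ∀ z, z ∈ quadInt hc ht ↔ ‖z.norm‖ ≤ 1
  hasVal_diff : HasVal (quadInt hc ht) ϖ (omega - star omega) 0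
  hasVal_b : HasVal (quadInt hc ht) ϖ (algebraMap ℚ_[p] _ b) v

variable {A : Type*} [Ring A] [Algebra ℤ_[p] A]
variable {φ : A →ₐ[ℤ_[p]] Matrix (Fin 2) (Fin 2) (QuadraticAlgebra ℚ_[p] c t)}

namespace UnramifiedData

variable (D : UnramifiedData hc ht ϖ b v)

include D

theorem hasCoords_comap (hφ : IsCyclicRep φ b) {n : ℤ} {α γ : QuadraticAlgebra ℚ_[p] c t} :
    HasCoords φ b ((vertexOrder (quadInt hc ht) ϖ D.unif.ne_zero n 0).comap φ) α γ ↔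
      α ∈ quadInt hc ht ∧ γ ∈ fracIdeal (quadInt hc ht) ϖ (max (-n) (n - v)) := by
  rw [hφ.hasCoords_comap, cyclicMatrix_mem_vertexOrder D.unif D.mem_iff (by simp), QuadraticAlgebra.norm_zero,
    sub_zero, D.unif.mul_mem_iff D.hasVal_b, zero_mul, sub_zero]
  refine and_congr_right fun _ => ⟨fun h => ?_, fun h => ?_⟩
  · rcases max_choice (-n) (n - v) with e | e <;> rw [e]
    exacts [h.1, h.2]
  · exact ⟨D.unif.anti (le_max_left _ _) h, D.unif.anti (le_max_right _ _) h⟩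

/-- ω - ω̄ is a unit, so (ω - ω̄)u ∈ ϖ^n O says u ≡ 0 mod ϖ^n. Only n remains as a parameter. -/
theorem mem_of_coords_zero {n : ℤ} {u : QuadraticAlgebra ℚ_[p] c t} {G : Subalgebra ℤ_[p] A}
    (hG : IsCyclicOrder (quadInt hc ht) φ b G)
    (hle : G ≤ (vertexOrder (quadInt hc ht) ϖ D.unif.ne_zero n u).comap φ) :
    vertexOrder (quadInt hc ht) ϖ D.unif.ne_zero n u =
      vertexOrder (quadInt hc ht) ϖ D.unif.ne_zero n 0 := by
  have h0 : (omega - star omega) * u ∈ fracIdeal (quadInt hc ht) ϖ n := by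
    rw [← cyclicMatrix_mem_vertexOrder_zero (b := b) D.unif]
    intro a ha
    obtain ⟨x, hx, e⟩ := hG.coords_zero a ha
    rw [← e]
    exact hle hx
  rw [D.unif.mul_mem_iff D.hasVal_diff, sub_zero] at h0
  rw [D.unif.vertexOrder_eq_iff]
  exact ⟨rfl, by simpa using h0⟩

theorem hasCoords_iff (hφ : IsCyclicRep φ b) {G : Subalgebra ℤ_[p] A}
    (hG : IsCyclicOrder (quadInt hc ht) φ b G) :
    ∃ m, -v ≤ 2 * m ∧ ∀ α γ, HasCoords φ b G α γ ↔
      α ∈ quadInt hc ht ∧ γ ∈ fracIdeal (quadInt hc ht) ϖ m := by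
  obtain ⟨m, hm⟩ := hG.exists_hasLevel D.unif D.mem_iff
  obtain ⟨n, u, -, hle⟩ := hG.exists_vertex D.unif
  rw [D.mem_of_coords_zero hG hle] at hle
  have hle' := hφ.le_iff.1 hle
  refine ⟨m, ?_, fun α γ => ⟨fun h => ?_, fun h => ?_⟩⟩
  · obtain ⟨α, hα⟩ := (hm (ϖ ^ m)).2 (D.unif.zpow_mem_fracIdeal.2 le_rfl)
    have h1 := ((D.hasCoords_comap hφ).1 (hle' _ _ hα)).2
    rw [D.unif.zpow_mem_fracIdeal, max_le_iff] at h1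
    omega
  · exact ⟨((D.hasCoords_comap hφ).1 (hle' _ _ h)).1, (hm γ).1 ⟨α, h⟩⟩
  · obtain ⟨α', hα'⟩ := (hm γ).2 h.2
    have h1 := ((D.hasCoords_comap hφ).1 (hle' _ _ hα')).1
    have h2 := (hG.coords_zero (α - α') (Subalgebra.sub_mem _ h.1 h1)).add hα'
    simpa using h2

theorem comap_eq_iff (hφ : IsCyclicRep φ b) {G : Subalgebra ℤ_[p] A} {m : ℤ}
    (hm : ∀ α γ, HasCoords φ b G α γ ↔
      α ∈ quadInt hc ht ∧ γ ∈ fracIdeal (quadInt hc ht) ϖ m) {n : ℤ} :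
    (vertexOrder (quadInt hc ht) ϖ D.unif.ne_zero n 0).comap φ = G ↔ max (-n) (n - v) = m := by
  constructor
  · rintro rfl
    have h1 : ∀ γ, γ ∈ fracIdeal (quadInt hc ht) ϖ (max (-n) (n - v)) ↔
        γ ∈ fracIdeal (quadInt hc ht) ϖ m := by
      intro γ
      have := (hm 0 γ).symm.trans (D.hasCoords_comap hφ)
      simpa using this.symm
    have h2 := (h1 (ϖ ^ m)).2 (D.unif.zpow_mem_fracIdeal.2 le_rfl)
    have h3 := (h1 (ϖ ^ max (-n) (n - v))).1 (D.unif.zpow_mem_fracIdeal.2 le_rfl)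
    rw [D.unif.zpow_mem_fracIdeal] at h2 h3
    exact le_antisymm h2 h3
  · rintro rfl
    apply le_antisymm <;> rw [hφ.le_iff] <;> intro α γ h
    · rwa [hm, ← D.hasCoords_comap hφ]
    · rwa [hm, ← D.hasCoords_comap hφ] at h

/-- max(-n, n - v) = m has the solutions n = -m and n = m + v, which agree exactly when 2m = -v. -/
theorem vertexCount_eq (hφ : IsCyclicRep φ b) {G : Subalgebra ℤ_[p] A}
    (hG : IsCyclicOrder (quadInt hc ht) φ b G) {m : ℤ} (hvm : -v ≤ 2 * m)
    (hm : ∀ α γ, HasCoords φ b G α γ ↔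
      α ∈ quadInt hc ht ∧ γ ∈ fracIdeal (quadInt hc ht) ϖ m) :
    vertexCount (quadInt hc ht) ϖ D.unif.ne_zero φ G = if 2 * m = -v then 1 else 2 := by
  have e : {N | (∃ n u, N = vertexOrder (quadInt hc ht) ϖ D.unif.ne_zero n u) ∧ N.comap φ = G} =
      {vertexOrder (quadInt hc ht) ϖ D.unif.ne_zero (-m) 0,
        vertexOrder (quadInt hc ht) ϖ D.unif.ne_zero (m + v) 0} := by
    ext N
    simp only [Set.mem_ofPred_eq, Set.mem_insert_iff, Set.mem_singleton_iff]
    constructor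
    · rintro ⟨⟨n, u, rfl⟩, h⟩
      have h0 := D.mem_of_coords_zero hG h.ge
      rw [h0] at h ⊢
      rw [D.comap_eq_iff hφ hm] at h
      rcases max_choice (-n) (n - v) with h1 | h1 <;> rw [h1] at h
      · left; rw [← h, neg_neg]
      · right; rw [← h, sub_add_cancel]
    · rintro (rfl | rfl)
      · exact ⟨⟨_, _, rfl⟩, (D.comap_eq_iff hφ hm).2 (by omega)⟩
      · exact ⟨⟨_, _, rfl⟩, (D.comap_eq_iff hφ hm).2 (by omega)⟩
  rw [vertexCount, e]
  split_ifs with h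
  · rw [show m + v = -m by omega, Set.pair_eq_singleton, Set.encard_singleton]
  · rw [Set.encard_pair]
    intro h1
    have := (D.unif.vertexOrder_eq_iff.1 h1).1
    omega

theorem vertexCount_of_odd (hφ : IsCyclicRep φ b) {G : Subalgebra ℤ_[p] A}
    (hG : IsCyclicOrder (quadInt hc ht) φ b G) (hv : ∀ m, v ≠ 2 * m) :
    vertexCount (quadInt hc ht) ϖ D.unif.ne_zero φ G = 2 := by
  obtain ⟨m, h1, h2⟩ := D.hasCoords_iff hφ hG
  rw [D.vertexCount_eq hφ hG h1 h2, if_neg]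
  intro h
  exact hv (-m) (by omega)

theorem vertexCount_of_maximal (hφ : IsCyclicRep φ b) {G : Subalgebra ℤ_[p] A}
    (hG : IsCyclicOrder (quadInt hc ht) φ b G) (hv : v = 0)
    (hmax : ∀ n u, G ≤ (vertexOrder (quadInt hc ht) ϖ D.unif.ne_zero n u).comap φ →
      G = (vertexOrder (quadInt hc ht) ϖ D.unif.ne_zero n u).comap φ) :
    vertexCount (quadInt hc ht) ϖ D.unif.ne_zero φ G = 1 := by
  subst hv
  obtain ⟨m, h1, h2⟩ := D.hasCoords_iff hφ hG
  rw [D.vertexCount_eq hφ hG h1 h2, if_pos]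
  have h3 : G ≤ (vertexOrder (quadInt hc ht) ϖ D.unif.ne_zero 0 0).comap φ := by
    rw [hφ.le_iff]
    intro α γ h
    rw [h2] at h
    rw [D.hasCoords_comap hφ]
    exact ⟨h.1, D.unif.anti (by simp; omega) h.2⟩
  have := (D.comap_eq_iff hφ h2).1 (hmax _ _ h3).symm
  simp at this
  omega

/-- 2m = -v is the smallest exponent allowed, so a proper suborder cannot attain it. -/
theorem vertexCount_of_lt (hφ : IsCyclicRep φ b) {G H : Subalgebra ℤ_[p] A}
    (hG : IsCyclicOrder (quadInt hc ht) φ b G) (hH : IsCyclicOrder (quadInt hc ht) φ b H)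
    (hlt : G < H) : vertexCount (quadInt hc ht) ϖ D.unif.ne_zero φ G = 2 := by
  obtain ⟨m, h1, h2⟩ := D.hasCoords_iff hφ hG
  obtain ⟨m', h1', h2'⟩ := D.hasCoords_iff hφ hH
  rw [D.vertexCount_eq hφ hG h1 h2, if_neg]
  intro h
  refine hlt.not_ge ?_
  rw [hφ.le_iff]
  intro α γ h3
  rw [h2'] at h3
  rw [h2]
  exact ⟨h3.1, D.unif.anti (by omega) h3.2⟩

end UnramifiedData

end Unramified

/-! ### Units are norms in the inert case. -/

section Inert

variable {p : ℕ} [Fact p.Prime] {c t : ℚ_[p]} {hc : ‖c‖ ≤ 1} {ht : ‖t‖ ≤ 1} {b : ℚ_[p]}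

/-- For p = 2 an even t is impossible: c would be odd, and X² - tX - c would vanish at 1 modulo 2.
For odd p the discriminant is -4 times the value at t/2. -/
theorem norm_disc_of_inert (hc : ‖c‖ ≤ 1) (ht : ‖t‖ ≤ 1)
    (hroot : ∀ r : ℚ_[p], ‖r‖ ≤ 1 → ‖r ^ 2 - t * r - c‖ = 1) : ‖t ^ 2 + 4 * c‖ = 1 := by
  rcases eq_or_ne p 2 with rfl | hp
  · have ht1 : ‖t‖ = 1 := by
      by_contra hne
      have h1 := padic_norm_lt_one_iff.1 (lt_of_le_of_ne ht hne)
      have h2 := hroot 0 (by simp)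
      have h3 := hroot 1 (by simp)
      have h4 : ‖c‖ = 1 := by simpa using h2
      have h5 := padic_two_norm_sub_one h4
      push_cast at h1
      have h6 := padic_norm_sub_le (x := -(c - 1)) (y := t) (by rwa [norm_neg]) h1
      rw [show -(c - 1) - t = 1 ^ 2 - t * 1 - c by ring, h3] at h6
      norm_num at h6
    rw [norm_add_eq_of_lt, norm_pow, ht1, one_pow]
    rw [norm_mul, padic_two_norm_four, norm_pow, ht1]
    nlinarith [norm_nonneg c]
  · have h1 := hroot (t / 2) (by rw [norm_div, padic_norm_two hp, div_one]; exact ht)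
    have e : t ^ 2 + 4 * c = -(2 ^ 2) * ((t / 2) ^ 2 - t * (t / 2) - c) := by ring
    rw [e, norm_mul, h1, norm_neg, norm_pow, padic_norm_two hp]
    norm_num

/-- For p = 2 one solves N(x + ω) = q by Hensel's lemma at x = 0, where the derivative t is a unit.
For odd p the form X² - DY², with D the discriminant, represents 4q modulo p; the remaining factor
is 1 modulo p, hence a square. -/
theorem exists_norm_eq_of_inert (hc : ‖c‖ ≤ 1) (ht : ‖t‖ ≤ 1)
    (hroot : ∀ r : ℚ_[p], ‖r‖ ≤ 1 → ‖r ^ 2 - t * r - c‖ = 1) {q : ℚ_[p]} (hq : ‖q‖ = 1) :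
    ∃ z : QuadraticAlgebra ℚ_[p] c t, z.norm = q := by
  have hD := norm_disc_of_inert hc ht hroot
  rcases eq_or_ne p 2 with rfl | hp
  · have ht1 : ‖t‖ = 1 := by
      by_contra hne
      have h1 := padic_norm_lt_one_iff.1 (lt_of_le_of_ne ht hne)
      push_cast at h1
      have h2 : ‖t ^ 2 + 4 * c‖ ≤ 4⁻¹ := by
        apply padic_norm_add_le
        · rw [norm_pow]
          nlinarith [norm_nonneg t]
        · rw [norm_mul, padic_two_norm_four]
          linarith
      rw [hD] at h2
      norm_num at h2
    have hc1 : ‖c‖ = 1 := by simpa using hroot 0 (by simp)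
    let c' : ℤ_[2] := ⟨c, hc⟩
    let t' : ℤ_[2] := ⟨t, ht⟩
    let q' : ℤ_[2] := ⟨q, hq.le⟩
    obtain ⟨x, hx, -⟩ := hensels_lemma (F := (Polynomial.X ^ 2 +
      Polynomial.C t' * Polynomial.X - Polynomial.C (c' + q') : Polynomial ℤ_[2]))
      (a := (0 : ℤ_[2])) (by
        have e1 : ‖-q' + -c'‖ = ‖c + q‖ := by
          rw [← norm_neg, neg_add, neg_neg, neg_neg, add_comm]
          rfl
        have e2 : ‖t'‖ = ‖t‖ := rfl
        have h := padic_two_norm_add (x := c) (y := q) (by rw [hc1, hq])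
        simp [-map_add]
        rw [e1, e2, ht1]
        rw [hq] at h
        linarith)
    have h4 : x ^ 2 + t' * x - (c' + q') = 0 := by simpa [-map_add] using hx
    have h5 := congrArg (fun y : ℤ_[2] => (y : ℚ_[2])) (sub_eq_zero.1 h4)
    have h6 : (x : ℚ_[2]) ^ 2 + t * x = c + q := by simpa using h5
    refine ⟨⟨x, 1⟩, ?_⟩
    rw [QuadraticAlgebra.norm_def]
    linear_combination h6
  · let D : ℤ_[p] := ⟨t ^ 2 + 4 * c, hD.le⟩
    let q' : ℤ_[p] := ⟨q, hq.le⟩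
    have hDu : PadicInt.toZMod D ≠ 0 := by
      intro h
      rw [← RingHom.mem_ker, PadicInt.ker_toZMod, IsLocalRing.mem_maximalIdeal,
        PadicInt.mem_nonunits] at h
      have : ‖D‖ = 1 := hD
      linarith
    obtain ⟨a, d, had⟩ := FiniteField.exists_root_sum_quadratic (R := ZMod p)
      (f := Polynomial.X ^ 2) (g := Polynomial.C (-PadicInt.toZMod D) * Polynomial.X ^ 2 +
        Polynomial.C 0 * Polynomial.X + Polynomial.C (-(4 * PadicInt.toZMod q')))
      (by simp) (Polynomial.degree_quadratic (neg_ne_zero.2 hDu)) (by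
        rw [ZMod.card]
        have := (Fact.out : p.Prime).eq_two_or_odd
        omega)
    obtain ⟨X, rfl⟩ := ZMod.ringHom_surjective (PadicInt.toZMod (p := p)) a
    obtain ⟨Y, rfl⟩ := ZMod.ringHom_surjective (PadicInt.toZMod (p := p)) d
    have h1 : X ^ 2 - D * Y ^ 2 - 4 * q' ∈ RingHom.ker (PadicInt.toZMod (p := p)) := by
      rw [RingHom.mem_ker]
      simp only [Polynomial.eval_add, Polynomial.eval_mul, Polynomial.eval_pow, Polynomial.eval_X,
        Polynomial.eval_C] at had
      rw [← had]
      simp only [map_sub, map_mul, map_pow, map_ofNat]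
      ring
    rw [PadicInt.ker_toZMod, IsLocalRing.mem_maximalIdeal, PadicInt.mem_nonunits] at h1
    have h2 : ‖(X : ℚ_[p]) ^ 2 - (t ^ 2 + 4 * c) * Y ^ 2 - 4 * q‖ < 1 := by
      have e : ((X ^ 2 - D * Y ^ 2 - 4 * q' : ℤ_[p]) : ℚ_[p]) =
          (X : ℚ_[p]) ^ 2 - (t ^ 2 + 4 * c) * Y ^ 2 - 4 * q := by
        push_cast
        rfl
      rwa [PadicInt.norm_def, e] at h1
    let w : QuadraticAlgebra ℚ_[p] c t := ⟨(X - t * Y) / 2, Y⟩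
    have hw : w.norm - q = ((X : ℚ_[p]) ^ 2 - (t ^ 2 + 4 * c) * Y ^ 2 - 4 * q) / 2 ^ 2 := by
      simp only [w, QuadraticAlgebra.norm_def]
      ring
    have h3 : ‖w.norm - q‖ < 1 := by
      rw [hw, norm_div, norm_pow, padic_norm_two hp, one_pow, div_one]
      exact h2
    have h4 : ‖w.norm‖ = 1 := by
      have := norm_add_eq_of_lt (x := q) (y := w.norm - q) (by rw [hq]; exact h3)
      rwa [add_sub_cancel, hq] at this
    have h5 : w.norm ≠ 0 := by rw [← norm_ne_zero_iff, h4]; exact one_ne_zero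
    obtain ⟨s, hs⟩ := exists_sq_of_norm_sub_one_lt (p := p) (x := q / w.norm) (by
      rw [padic_norm_two hp, div_sub_one h5, norm_div, h4, div_one, norm_sub_rev, one_pow]
      exact h3)
    have : Fact (∀ r : ℚ_[p], r ^ 2 ≠ c + t * r) := ⟨no_root_of_inert hc ht hroot⟩
    obtain ⟨z, hz⟩ := exists_norm_eq_of_sq (c := c) (t := t) s
    exact ⟨z * w, by rw [map_mul, hz, hs, div_mul_cancel₀ _ h5]⟩

variable [hf : Fact (∀ r : ℚ_[p], r ^ 2 ≠ c + t * r)]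

theorem hasVal_of_inert (hroot : ∀ r : ℚ_[p], ‖r‖ ≤ 1 → ‖r ^ 2 - t * r - c‖ = 1)
    {z : QuadraticAlgebra ℚ_[p] c t} {n : ℤ} (h : ‖z.norm‖ = ((p : ℝ)⁻¹ ^ 2) ^ n) :
    HasVal (quadInt hc ht) (p : QuadraticAlgebra ℚ_[p] c t) z n := by
  have hp : (0 : ℝ) < p := by exact_mod_cast (Fact.out : p.Prime).pos
  have U : IsUniformizer (quadInt hc ht) (p : QuadraticAlgebra ℚ_[p] c t) :=
    isUniformizer_of_inert hc ht hroot
  have e : ‖(p : QuadraticAlgebra ℚ_[p] c t).norm‖ = (p : ℝ)⁻¹ ^ 2 := by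
    rw [QuadraticAlgebra.norm_natCast, norm_pow, Padic.norm_p]
  have hm := mem_quadInt_iff_of_inert hc ht hroot
  refine ⟨?_, ?_, ?_⟩
  · rintro rfl
    simp only [QuadraticAlgebra.norm_zero, _root_.norm_zero] at h
    exact (zpow_ne_zero n (by positivity : ((p : ℝ)⁻¹ ^ 2) ≠ 0)) h.symm
  · rw [mem_fracIdeal_iff_norm_le U.ne_zero hm, h, e]
  · rw [mem_fracIdeal_iff_norm_le U.ne_zero hm, quadNorm_inv, norm_inv, h, e, ← zpow_neg]

theorem unramifiedData_of_inert (hroot : ∀ r : ℚ_[p], ‖r‖ ≤ 1 → ‖r ^ 2 - t * r - c‖ = 1) {v : ℤ}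
    (hb : ‖b‖ = (p : ℝ)⁻¹ ^ v) : UnramifiedData hc ht (p : QuadraticAlgebra ℚ_[p] c t) b v where
  unif := isUniformizer_of_inert hc ht hroot
  mem_iff := mem_quadInt_iff_of_inert hc ht hroot
  hasVal_diff := by
    apply hasVal_of_inert hroot
    rw [zpow_zero, ← norm_disc_of_inert hc ht hroot, ← norm_neg]
    congr 1
    simp [QuadraticAlgebra.norm_def]
    ring
  hasVal_b := by
    apply hasVal_of_inert hroot
    rw [QuadraticAlgebra.norm_algebraMap, norm_pow, hb, ← zpow_natCast, ← zpow_natCast, ← zpow_mul,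
      ← zpow_mul, mul_comm]

/-- If b had even valuation, a power of p would scale it to a unit, hence to a norm. So the
valuation is odd and can be scaled to 1. -/
theorem exists_norm_mul_eq_of_inert (hc : ‖c‖ ≤ 1) (ht : ‖t‖ ≤ 1)
    (hroot : ∀ r : ℚ_[p], ‖r‖ ≤ 1 → ‖r ^ 2 - t * r - c‖ = 1)
    (hb : b ≠ 0) (hb' : ∀ z : QuadraticAlgebra ℚ_[p] c t, z.norm ≠ b) :
    ∃ z : QuadraticAlgebra ℚ_[p] c t, z ≠ 0 ∧ ‖b * z.norm‖ = (p : ℝ)⁻¹ ^ (1 : ℤ) := by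
  have hp : (p : ℝ) ≠ 0 := by exact_mod_cast (Fact.out : p.Prime).ne_zero
  have hp' : (p : QuadraticAlgebra ℚ_[p] c t) ≠ 0 := by exact_mod_cast (Fact.out : p.Prime).ne_zero
  have key : ∀ k : ℤ, ‖b * ((p : QuadraticAlgebra ℚ_[p] c t) ^ k).norm‖ =
      (p : ℝ)⁻¹ ^ (b.valuation + 2 * k) := by
    intro k
    rw [norm_mul, quadNorm_zpow, norm_zpow, QuadraticAlgebra.norm_natCast, norm_pow, Padic.norm_p,
      Padic.norm_eq_zpow_neg_valuation hb, zpow_neg, ← inv_zpow, zpow_add₀ (inv_ne_zero hp), zpow_mul]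
    rfl
  rcases Int.even_or_odd' b.valuation with ⟨k, hk | hk⟩
  · exfalso
    have h1 := key (-k)
    rw [hk, show 2 * k + 2 * -k = 0 by ring, zpow_zero] at h1
    obtain ⟨z, hz⟩ := exists_norm_eq_of_inert hc ht hroot h1
    have hne := quadNorm_ne_zero (zpow_ne_zero (-k) hp')
    refine hb' (z * ((p : QuadraticAlgebra ℚ_[p] c t) ^ (-k))⁻¹) ?_
    rw [map_mul, hz, quadNorm_inv, mul_inv_cancel_right₀ hne]
  · refine ⟨(p : QuadraticAlgebra ℚ_[p] c t) ^ (-k), zpow_ne_zero _ hp', ?_⟩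
    rw [key, hk]
    congr 1
    ring

end Inert

end LocalOrders

namespace LocalOrders

open QuatEmb

/-! ### Quaternion algebras as cyclic algebras. -/

section Quaternion

open QuaternionAlgebra

/-- Extension of scalars for a quaternion basis. -/
def basisExtendScalars {R A : Type*} (S : Type*) [CommRing R] [CommRing S] [Algebra R S] [Ring A]
    [Algebra R A] [Algebra S A] [IsScalarTower R S A] {c₁ c₂ c₃ : R} (q : Basis A c₁ c₂ c₃) :
    Basis A (algebraMap R S c₁) (algebraMap R S c₂) (algebraMap R S c₃) where
  i := q.i
  j := q.j
  k := q.k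
  i_mul_i := by simp only [algebraMap_smul]; exact q.i_mul_i
  j_mul_j := by simp only [algebraMap_smul]; exact q.j_mul_j
  i_mul_j := q.i_mul_j
  j_mul_i := by simp only [algebraMap_smul]; exact q.j_mul_i

variable {E : Type*} [Field E] {A : Type*} [Ring A] [Algebra E A] {c t b : E}

/-- Simplicity by hand. The element 2i - t has square t² + 4c and anticommutes with j, so
conjugating by it separates the two components of a kernel element; the component along j is moved
into E[i] by multiplying with j. `key` then shows that no nonzero element of E[i] is killed. -/
theorem quaternionHom_injective [Nontrivial A] (h2 : (2 : E) ≠ 0) (hD : t ^ 2 + 4 * c ≠ 0)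
    (hb : b ≠ 0) (f : QuaternionAlgebra E c t b →ₐ[E] A) : Function.Injective f := by
  have key : ∀ y₀ y₁ : E, f ⟨y₀, y₁, 0, 0⟩ = 0 → y₀ = 0 ∧ y₁ = 0 := by
    intro y₀ y₁ h
    have e1 : (⟨-t, 2, 0, 0⟩ : QuaternionAlgebra E c t b) *
        (b • (⟨y₀, y₁, 0, 0⟩ : QuaternionAlgebra E c t b) -
          ⟨0, 0, 1, 0⟩ * ⟨y₀, y₁, 0, 0⟩ * ⟨0, 0, 1, 0⟩) =
        algebraMap E _ (b * y₁ * (t ^ 2 + 4 * c)) := by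
      ext <;> simp [QuaternionAlgebra.algebraMap_eq] <;> ring
    have e2 := congrArg f e1
    rw [map_mul, map_sub, map_smul, map_mul, map_mul, h] at e2
    simp only [smul_zero, mul_zero, zero_mul, sub_zero] at e2
    rw [f.commutes, eq_comm, map_eq_zero_iff _ (algebraMap E A).injective] at e2
    have h1 : y₁ = 0 := by
      simpa [hb, hD] using e2
    subst h1
    refine ⟨?_, rfl⟩
    have e3 : (⟨y₀, 0, 0, 0⟩ : QuaternionAlgebra E c t b) = algebraMap E _ y₀ := by
      rw [QuaternionAlgebra.algebraMap_eq]
    rwa [e3, f.commutes, map_eq_zero_iff _ (algebraMap E A).injective] at h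
  rw [injective_iff_map_eq_zero]
  intro x hx
  have hD2 : 2 * (t ^ 2 + 4 * c) ≠ 0 := mul_ne_zero h2 hD
  have e1 : (⟨x.re, x.imI, 0, 0⟩ : QuaternionAlgebra E c t b) =
      (2 * (t ^ 2 + 4 * c))⁻¹ • ((t ^ 2 + 4 * c) • x + ⟨-t, 2, 0, 0⟩ * x * ⟨-t, 2, 0, 0⟩) := by
    rw [eq_inv_smul_iff₀ hD2]
    ext <;> simp <;> ring
  have e2 : (⟨b * x.imJ, b * x.imK, 0, 0⟩ : QuaternionAlgebra E c t b) =
      (2 * (t ^ 2 + 4 * c))⁻¹ • (((t ^ 2 + 4 * c) • x - ⟨-t, 2, 0, 0⟩ * x * ⟨-t, 2, 0, 0⟩) *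
        ⟨0, 0, 1, 0⟩) := by
    rw [eq_inv_smul_iff₀ hD2]
    ext <;> simp <;> ring
  have h1 := key x.re x.imI (by
    rw [e1, map_smul, map_add, map_smul, map_mul, map_mul, hx]; simp)
  have h3 := key (b * x.imJ) (b * x.imK) (by
    rw [e2, map_smul, map_mul, map_sub, map_smul, map_mul, map_mul, hx]; simp)
  simp only [mul_eq_zero, hb, false_or] at h3
  exact QuaternionAlgebra.ext h1.1 h1.2 h3.1 h3.2

theorem basis_liftHom_bijective (h2 : (2 : E) ≠ 0) (hD : t ^ 2 + 4 * c ≠ 0)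
    (hb : b ≠ 0) (hA : Module.finrank E A = 4) (q : Basis A c t b) :
    Function.Bijective q.liftHom := by
  have : Nontrivial A := by
    by_contra h
    rw [not_nontrivial_iff_subsingleton] at h
    rw [Module.finrank_zero_of_subsingleton] at hA
    omega
  have : FiniteDimensional E A := Module.finite_of_finrank_pos (by omega)
  have hinj := quaternionHom_injective h2 hD hb q.liftHom
  refine ⟨hinj, ?_⟩
  exact (LinearMap.injective_iff_surjective_of_finrank_eq_finrank (f := q.liftHom.toLinearMap)
    (by rw [QuaternionAlgebra.finrank_eq_four, hA])).1 hinj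

/-- The isomorphism given by a quaternion basis of a four-dimensional algebra. -/
noncomputable def basisEquiv (h2 : (2 : E) ≠ 0) (hD : t ^ 2 + 4 * c ≠ 0)
    (hb : b ≠ 0) (hA : Module.finrank E A = 4) (q : Basis A c t b) :
    QuaternionAlgebra E c t b ≃ₐ[E] A :=
  AlgEquiv.ofBijective q.liftHom (basis_liftHom_bijective h2 hD hb hA q)

theorem basisEquiv_apply (h2 : (2 : E) ≠ 0) (hD : t ^ 2 + 4 * c ≠ 0)
    (hb : b ≠ 0) (hA : Module.finrank E A = 4) (q : Basis A c t b)
    (x : QuaternionAlgebra E c t b) : basisEquiv h2 hD hb hA q x = q.lift x := rfl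

theorem lift_self_i (q : Basis A c t b) : q.lift (⟨0, 1, 0, 0⟩ : QuaternionAlgebra E c t b) = q.i := by
  simp [Basis.lift]

theorem lift_self_j (q : Basis A c t b) : q.lift (⟨0, 0, 1, 0⟩ : QuaternionAlgebra E c t b) = q.j := by
  simp [Basis.lift]

theorem finrank_of_isQuaternionAlgebra (h : IsQuaternionAlgebra E A) : Module.finrank E A = 4 := by
  obtain ⟨a, b, -, -, ⟨e⟩⟩ := h
  rw [e.toLinearEquiv.finrank_eq, QuaternionAlgebra.finrank_eq_four]

theorem isQuaternionAlgebra_of_basis (h2 : (2 : E) ≠ 0) {a : E} (ha : a ≠ 0)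
    (hb : b ≠ 0) (hA : Module.finrank E A = 4) (q : Basis A a 0 b) : IsQuaternionAlgebra E A :=
  ⟨a, b, ha, hb, ⟨(basisEquiv h2 (by
    have h4 : (4 : E) ≠ 0 := by
      rw [show (4 : E) = 2 * 2 by norm_num]; exact mul_ne_zero h2 h2
    simpa using ⟨h4, ha⟩) hb hA q).symm⟩⟩

/-- A quaternion algebra over the subfield `E` of `E'` determines the homomorphisms of its
extension to a quaternion algebra over `E'`. -/
theorem exists_extension {E' : Type*} [Field E'] [Algebra E E'] (h2 : (2 : E') ≠ 0)
    (hA : IsQuaternionAlgebra E A)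
    {M : Type*} [Ring M] [Algebra E M] [Algebra E' M] [IsScalarTower E E' M]
    (hM : IsQuaternionAlgebra E' M) (ι : A →ₐ[E] M)
    {B : Type*} [Ring B] [Algebra E B] [Algebra E' B] [IsScalarTower E E' B] (f : A →ₐ[E] B) :
    ∃ Ψ : M →ₐ[E'] B, ∀ x, Ψ (ι x) = f x := by
  have hdim := finrank_of_isQuaternionAlgebra hM
  obtain ⟨a, b, ha, hb, ⟨ε⟩⟩ := hA
  let q : Basis A a 0 b := (Basis.self E).compHom ε.symm.toAlgHom
  let qM := basisExtendScalars E' (q.compHom ι)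
  let qB := basisExtendScalars E' (q.compHom f)
  have h4 : (4 : E') ≠ 0 := by
    rw [show (4 : E') = 2 * 2 by norm_num]; exact mul_ne_zero h2 h2
  have ha' : algebraMap E E' a ≠ 0 := (map_ne_zero _).2 ha
  have hb' : algebraMap E E' b ≠ 0 := (map_ne_zero _).2 hb
  let e := basisEquiv h2 (by simpa using ⟨h4, ha⟩) hb' hdim qM
  have hi : e.symm (ι q.i) = ⟨0, 1, 0, 0⟩ := by
    rw [AlgEquiv.symm_apply_eq, basisEquiv_apply, lift_self_i]
    rfl
  have hj : e.symm (ι q.j) = ⟨0, 0, 1, 0⟩ := by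
    rw [AlgEquiv.symm_apply_eq, basisEquiv_apply, lift_self_j]
    rfl
  let Ψ : M →ₐ[E'] B := qB.liftHom.comp e.symm.toAlgHom
  refine ⟨Ψ, ?_⟩
  have h1 : ((Ψ.restrictScalars E).comp ι).comp ε.symm.toAlgHom = f.comp ε.symm.toAlgHom := by
    apply QuaternionAlgebra.hom_ext
    · change qB.lift (e.symm (ι q.i)) = f q.i
      rw [hi, lift_self_i]
      rfl
    · change qB.lift (e.symm (ι q.j)) = f q.j
      rw [hj, lift_self_j]
      rfl
  intro x
  have := DFunLike.congr_fun h1 (ε x)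
  simpa using this

/-- A pure quaternion orthogonal to the pure part of θ conjugates θ to t - θ; one with nonzero
square is needed. -/
theorem exists_conj (h2 : (2 : E) ≠ 0) {a : E} (ha : a ≠ 0) (hb : b ≠ 0)
    {θ : QuaternionAlgebra E a 0 b} (hθ : θ * θ = c • 1 + t • θ)
    (hns : ∀ r : E, θ ≠ algebraMap E _ r) (hD : t ^ 2 + 4 * c ≠ 0) :
    ∃ (y : QuaternionAlgebra E a 0 b) (β : E), β ≠ 0 ∧ y * y = β • 1 ∧ y * θ = t • y - θ * y := by
  have h4 : (4 : E) ≠ 0 := by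
    rw [show (4 : E) = 2 * 2 by norm_num]; exact mul_ne_zero h2 h2
  obtain ⟨x₀, x₁, x₂, x₃⟩ := θ
  have hre := congrArg QuaternionAlgebra.re hθ
  have hI := congrArg QuaternionAlgebra.imI hθ
  have hJ := congrArg QuaternionAlgebra.imJ hθ
  have hK := congrArg QuaternionAlgebra.imK hθ
  simp at hre hI hJ hK
  have hx : 2 * x₀ = t := by
    by_contra hne
    have hne' : 2 * x₀ - t ≠ 0 := sub_ne_zero.2 hne
    have h1 : x₁ = 0 := (mul_eq_zero.1 (show (2 * x₀ - t) * x₁ = 0 by linear_combination hI)).resolve_left hne'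
    have h2 : x₂ = 0 := (mul_eq_zero.1 (show (2 * x₀ - t) * x₂ = 0 by linear_combination hJ)).resolve_left hne'
    have h3 : x₃ = 0 := (mul_eq_zero.1 (show (2 * x₀ - t) * x₃ = 0 by linear_combination hK)).resolve_left hne'
    exact hns x₀ (by rw [QuaternionAlgebra.algebraMap_eq, h1, h2, h3])
  have hdisc : t ^ 2 + 4 * c = 4 * (a * x₁ ^ 2 + b * x₂ ^ 2 - a * b * x₃ ^ 2) := by
    rw [← hx] at hre ⊢
    linear_combination -4 * hre
  have key : ∀ y₁ y₂ y₃ : E, a * x₁ * y₁ + b * x₂ * y₂ - a * b * x₃ * y₃ = 0 →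
      (⟨0, y₁, y₂, y₃⟩ : QuaternionAlgebra E a 0 b) * ⟨0, y₁, y₂, y₃⟩ =
        (a * y₁ ^ 2 + b * y₂ ^ 2 - a * b * y₃ ^ 2) • 1 ∧
      (⟨0, y₁, y₂, y₃⟩ : QuaternionAlgebra E a 0 b) * ⟨x₀, x₁, x₂, x₃⟩ =
        t • ⟨0, y₁, y₂, y₃⟩ - ⟨x₀, x₁, x₂, x₃⟩ * ⟨0, y₁, y₂, y₃⟩ := by
    intro y₁ y₂ y₃ hy
    constructor
    · ext <;> simp <;> ring
    · rw [← hx]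
      ext
      · simp
        linear_combination 2 * hy
      all_goals simp; ring
  by_contra! hcon
  have h1 := fun y₁ y₂ y₃ hy => by_contra fun hne =>
    hcon _ _ hne (key y₁ y₂ y₃ hy).1 (key y₁ y₂ y₃ hy).2
  -- Three vectors orthogonal to (x₁, x₂, x₃), each with one vanishing coordinate. If all were
  -- isotropic, the discriminant of θ would be 0.
  have k1 := h1 0 (a * x₃) x₂ (by ring)
  have k2 := h1 (b * x₃) 0 x₁ (by ring)
  have k3 := h1 (b * x₂) (-(a * x₁)) 0 (by ring)
  have hab : a * b ≠ 0 := mul_ne_zero ha hb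
  have l1 : a * x₃ ^ 2 = x₂ ^ 2 := by
    apply mul_left_cancel₀ hab
    linear_combination k1
  have l2 : b * x₃ ^ 2 = x₁ ^ 2 := by
    apply mul_left_cancel₀ hab
    linear_combination k2
  have l3 : a * x₁ ^ 2 + b * x₂ ^ 2 = 0 := by
    apply mul_left_cancel₀ hab
    linear_combination k3
  have l4 : x₃ ^ 2 = 0 := by
    have : (2 * (a * b)) * x₃ ^ 2 = 0 := by linear_combination a * l2 + b * l1 + l3
    exact (mul_eq_zero.1 this).resolve_left (mul_ne_zero h2 hab)
  apply hD
  rw [hdisc, l3, l4]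
  ring

/-- Replacing j by zj multiplies its square by N(z) and leaves i fixed. This is the freedom used to
normalize b. -/
theorem exists_scaled (h2 : (2 : E) ≠ 0) (hD : t ^ 2 + 4 * c ≠ 0) (hb : b ≠ 0)
    {z : QuadraticAlgebra E c t} (hz : z.norm ≠ 0) :
    ∃ ε : QuaternionAlgebra E c t (b * z.norm) ≃ₐ[E] QuaternionAlgebra E c t b,
      ε ⟨0, 1, 0, 0⟩ = ⟨0, 1, 0, 0⟩ := by
  let q : Basis (QuaternionAlgebra E c t b) c t (b * z.norm) :=
    { i := ⟨0, 1, 0, 0⟩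
      j := ⟨0, 0, z.re, z.im⟩
      k := ⟨0, 1, 0, 0⟩ * ⟨0, 0, z.re, z.im⟩
      i_mul_i := by ext <;> simp
      j_mul_j := by
        ext <;> simp [QuadraticAlgebra.norm_def]
        all_goals ring
      i_mul_j := rfl
      j_mul_i := by ext <;> simp }
  refine ⟨basisEquiv h2 hD (mul_ne_zero hb hz) (QuaternionAlgebra.finrank_eq_four _ _ _) q, ?_⟩
  rw [basisEquiv_apply, lift_self_i]

theorem exists_cyclic_equiv (h2 : (2 : E) ≠ 0) (hA : IsQuaternionAlgebra E A)
    {θ : A} (hθ : θ * θ = c • 1 + t • θ) (hns : ∀ r : E, θ ≠ algebraMap E _ r)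
    (hD : t ^ 2 + 4 * c ≠ 0) :
    ∃ β : E, β ≠ 0 ∧ ∀ z : QuadraticAlgebra E c t, z.norm ≠ 0 →
      ∃ ε : A ≃ₐ[E] QuaternionAlgebra E c t (β * z.norm), ε θ = ⟨0, 1, 0, 0⟩ := by
  have hdim := finrank_of_isQuaternionAlgebra hA
  obtain ⟨a, b, ha, hb, ⟨e⟩⟩ := hA
  obtain ⟨y, β, hβ, hy, hyθ⟩ := exists_conj (θ := e θ) (c := c) (t := t) h2 ha hb
    (by rw [← map_mul, hθ, map_add, map_smul, map_smul, map_one])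
    (fun r h => hns r (e.injective (by rw [h, e.commutes]))) hD
  let q : Basis A c t β :=
    { i := θ
      j := e.symm y
      k := θ * e.symm y
      i_mul_i := hθ
      j_mul_j := by rw [← map_mul, hy, map_smul, map_one]
      i_mul_j := rfl
      j_mul_i := by
        apply e.injective
        rw [map_mul, map_sub, map_smul, map_mul, e.apply_symm_apply, hyθ] }
  refine ⟨β, hβ, fun z hz => ?_⟩
  obtain ⟨ε, hε⟩ := exists_scaled (b := β) h2 hD hβ hz
  refine ⟨(basisEquiv h2 hD hβ hdim q).symm.trans ε.symm, ?_⟩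
  rw [AlgEquiv.trans_apply, AlgEquiv.symm_apply_eq, hε, AlgEquiv.symm_apply_eq, basisEquiv_apply,
    lift_self_i]

theorem isQuaternionAlgebra_comp (p : ℕ) [Fact p.Prime] {F : Type*} [Ring F] [Algebra ℚ F]
    (hF : IsQuaternionAlgebra ℚ F) : IsQuaternionAlgebra ℚ_[p] (Comp p F) := by
  have hdim := finrank_of_isQuaternionAlgebra hF
  obtain ⟨a, b, ha, hb, ⟨ε⟩⟩ := hF
  let q : Basis (Comp p F) a 0 b := ((Basis.self ℚ).compHom ε.symm.toAlgHom).compHom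
    Algebra.TensorProduct.includeRight
  have q' := basisExtendScalars ℚ_[p] q
  rw [map_zero] at q'
  exact isQuaternionAlgebra_of_basis two_ne_zero ((map_ne_zero _).2 ha) ((map_ne_zero _).2 hb)
    (by rw [Module.finrank_baseChange, hdim]) q'

end Quaternion

end LocalOrders

namespace LocalOrders

open QuadraticAlgebra hiding norm_neg norm_one norm_natCast norm_star norm_zero norm_algebraMap
open QuatEmb
open scoped Matrix

/-! ### The matrix representation of a cyclic algebra. -/

section Representation

variable {p : ℕ} [Fact p.Prime] {c t b : ℚ_[p]}

/-- The representation of a cyclic algebra by `2 × 2`-matrices. -/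
noncomputable def cyclicHom (c t b : ℚ_[p]) : QuaternionAlgebra ℚ_[p] c t b →ₐ[ℚ_[p]]
    Matrix (Fin 2) (Fin 2) (QuadraticAlgebra ℚ_[p] c t) :=
  QuaternionAlgebra.Basis.liftHom
    { i := cyclicMatrix b omega 0
      j := cyclicMatrix b 0 1
      k := cyclicMatrix b omega 0 * cyclicMatrix b 0 1
      i_mul_i := by
        refine Matrix.ext fun i j => ?_
        fin_cases i <;> fin_cases j <;> ext <;> simp [cyclicMatrix] <;> ring
      j_mul_j := by
        refine Matrix.ext fun i j => ?_
        fin_cases i <;> fin_cases j <;> ext <;> simp [cyclicMatrix]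
      i_mul_j := rfl
      j_mul_i := by
        refine Matrix.ext fun i j => ?_
        fin_cases i <;> fin_cases j <;> ext <;> simp [cyclicMatrix, mul_comm] }

theorem cyclicHom_apply (x : QuaternionAlgebra ℚ_[p] c t b) :
    cyclicHom c t b x = cyclicMatrix b ⟨x.re, x.imI⟩ (star ⟨x.imJ, x.imK⟩) := by
  refine Matrix.ext fun i j => ?_
  rw [cyclicHom, QuaternionAlgebra.Basis.liftHom_apply, QuaternionAlgebra.Basis.lift]
  fin_cases i <;> fin_cases j <;> ext <;> simp [cyclicMatrix, Matrix.algebraMap_eq_diagonal, mul_comm]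

theorem isCyclicRep_cyclicHom {A : Type*} [Ring A] [Algebra ℚ_[p] A] [Algebra ℤ_[p] A]
    [IsScalarTower ℤ_[p] ℚ_[p] A] (f : A ≃ₐ[ℚ_[p]] QuaternionAlgebra ℚ_[p] c t b) :
    IsCyclicRep (((cyclicHom c t b).comp f.toAlgHom).restrictScalars ℤ_[p]) b := by
  refine ⟨fun x y hxy => ?_, fun x => ⟨_, _, cyclicHom_apply (f x)⟩, fun α γ => ?_⟩
  · have h : cyclicHom c t b (f x) = cyclicHom c t b (f y) := hxy
    rw [cyclicHom_apply, cyclicHom_apply] at h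
    obtain ⟨h1, h2⟩ := cyclicMatrix_injective h
    rw [star_inj] at h2
    apply f.injective
    have := QuadraticAlgebra.ext_iff.1 h1
    have := QuadraticAlgebra.ext_iff.1 h2
    apply QuaternionAlgebra.ext <;> simp_all
  · refine ⟨f.symm ⟨α.re, α.im, (star γ).re, (star γ).im⟩, ?_⟩
    change cyclicHom c t b (f _) = _
    rw [f.apply_symm_apply, cyclicHom_apply]
    change cyclicMatrix b α (star (star γ)) = _
    rw [star_star]

theorem scalar_fin_two {R : Type*} [CommRing R] (z : R) :
    Matrix.scalar (Fin 2) z = !![z, 0; 0, z] := by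
  refine Matrix.ext fun i j => ?_
  fin_cases i <;> fin_cases j <;> simp

/-- The cyclic algebra and the scalars together generate M₂(K): (ω - ω̄)(diag(ω, ω̄) - ω̄) is t² +
4c times the idempotent E₁₁, and E₁₁ with the matrix of j gives all matrix units. -/
theorem mem_of_scalar_mem (hb : b ≠ 0) (hD : t ^ 2 + 4 * c ≠ 0)
    {R : Subalgebra ℚ_[p] (Matrix (Fin 2) (Fin 2) (QuadraticAlgebra ℚ_[p] c t))}
    (h1 : Matrix.scalar (Fin 2) omega ∈ R) (h2 : ∀ α γ, cyclicMatrix b α γ ∈ R)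
    (X : Matrix (Fin 2) (Fin 2) (QuadraticAlgebra ℚ_[p] c t)) : X ∈ R := by
  have hs : ∀ z : QuadraticAlgebra ℚ_[p] c t, Matrix.scalar (Fin 2) z ∈ R := by
    intro z
    have e : Matrix.scalar (Fin 2) z = z.re • 1 + z.im • Matrix.scalar (Fin 2) omega := by
      refine Matrix.ext fun i j => ?_
      fin_cases i <;> fin_cases j <;> ext <;> simp
    rw [e]
    exact R.add_mem (R.smul_mem R.one_mem _) (R.smul_mem h1 _)
  have e1 : Matrix.scalar (Fin 2) (1 : QuadraticAlgebra ℚ_[p] c t) = 1 := map_one _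
  have hE : !![1, 0; 0, 0] ∈ R := by
    have e : (!![1, 0; 0, 0] : Matrix (Fin 2) (Fin 2) (QuadraticAlgebra ℚ_[p] c t)) =
        (t ^ 2 + 4 * c)⁻¹ • (Matrix.scalar (Fin 2) (omega - star omega) *
          (cyclicMatrix b omega 0 - Matrix.scalar (Fin 2) (star omega))) := by
      rw [eq_inv_smul_iff₀ hD, scalar_fin_two, scalar_fin_two]
      refine Matrix.ext fun i j => ?_
      fin_cases i <;> fin_cases j <;> ext <;> simp [cyclicMatrix]
      all_goals ring
    rw [e]
    exact R.smul_mem (R.mul_mem (hs _) (R.sub_mem (h2 _ _) (hs _))) _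
  have hJ := h2 0 1
  have e : X = Matrix.scalar (Fin 2) (X 0 0) * !![1, 0; 0, 0] +
      Matrix.scalar (Fin 2) (X 1 1) * (1 - !![1, 0; 0, 0]) +
      Matrix.scalar (Fin 2) (X 1 0) * ((1 - !![1, 0; 0, 0]) * cyclicMatrix b 0 1) +
      Matrix.scalar (Fin 2) (algebraMap _ _ b⁻¹ * X 0 1) * (!![1, 0; 0, 0] * cyclicMatrix b 0 1) := by
    have hbb : algebraMap ℚ_[p] (QuadraticAlgebra ℚ_[p] c t) b⁻¹ * X 0 1 *
        algebraMap ℚ_[p] _ b = X 0 1 := by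
      rw [mul_right_comm, ← map_mul, inv_mul_cancel₀ hb, map_one, one_mul]
    simp only [scalar_fin_two]
    refine Matrix.ext fun i j => ?_
    fin_cases i <;> fin_cases j <;> simp [cyclicMatrix, Matrix.one_fin_two, hbb]
  rw [e]
  have hE' := R.sub_mem R.one_mem hE
  exact R.add_mem (R.add_mem (R.add_mem (R.mul_mem (hs _) hE) (R.mul_mem (hs _) hE'))
    (R.mul_mem (hs _) (R.mul_mem hE' hJ))) (R.mul_mem (hs _) (R.mul_mem hE hJ))

end Representation

/-! ### M_p as a matrix algebra over K, and the splitting criterion. -/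

section Model

variable {p : ℕ} [Fact p.Prime] {c t b : ℚ_[p]}
variable {k : Type*} [Field k] [NumberField k] {F M : Type*}
    [Ring F] [Algebra ℚ F] [Ring M] [Algebra ℚ M] [Algebra k M] [IsScalarTower ℚ k M]

/-- The representation of F is extended k-linearly to M and then ℚ_p-linearly to M_p. It is onto by
`mem_of_scalar_mem`, and both sides have dimension 8. -/
theorem exists_matrix_equiv (hk : Module.finrank ℚ k = 2) (hF : IsQuaternionAlgebra ℚ F)
    (hM : IsQuaternionAlgebra k M) (ι : F →ₐ[ℚ] M) (hb : b ≠ 0) (hD : t ^ 2 + 4 * c ≠ 0)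
    (σ : k →ₐ[ℚ] QuadraticAlgebra ℚ_[p] c t) {w : k} (hw : σ w = omega)
    (f : Comp p F ≃ₐ[ℚ_[p]] QuaternionAlgebra ℚ_[p] c t b) :
    ∃ e : Comp p M ≃ₐ[ℚ_[p]] Matrix (Fin 2) (Fin 2) (QuadraticAlgebra ℚ_[p] c t),
      (∀ a : k, e (1 ⊗ₜ algebraMap k M a) = Matrix.scalar (Fin 2) (σ a)) ∧
      ∀ x, e (compMap p ι x) = cyclicHom c t b (f x) := by
  let : Algebra k (QuadraticAlgebra ℚ_[p] c t) := σ.toRingHom.toAlgebra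
  have : IsScalarTower ℚ k (QuadraticAlgebra ℚ_[p] c t) :=
    IsScalarTower.of_algebraMap_eq fun q => (σ.commutes q).symm
  obtain ⟨Ψ, hΨ⟩ := exists_extension (E' := k) two_ne_zero hF hM ι
    (B := Matrix (Fin 2) (Fin 2) (QuadraticAlgebra ℚ_[p] c t))
    (((cyclicHom c t b).comp f.toAlgHom).restrictScalars ℚ |>.comp
      (Algebra.TensorProduct.includeRight : F →ₐ[ℚ] Comp p F))
  let g : Comp p M →ₐ[ℚ_[p]] Matrix (Fin 2) (Fin 2) (QuadraticAlgebra ℚ_[p] c t) :=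
    Algebra.TensorProduct.lift (Algebra.ofId _ _) (Ψ.restrictScalars ℚ)
      fun q x => Algebra.commutes q _
  have hg : ∀ (q : ℚ_[p]) (x : M), g (q ⊗ₜ x) = q • Ψ x := by
    intro q x
    rw [Algebra.smul_def]
    rfl
  have h1 : ∀ a : k, g (1 ⊗ₜ algebraMap k M a) = Matrix.scalar (Fin 2) (σ a) := by
    intro a
    rw [hg, one_smul, Ψ.commutes]
    rfl
  have h2 : ∀ x, g (compMap p ι x) = cyclicHom c t b (f x) := by
    intro x
    induction x using TensorProduct.induction_on with
    | zero => simp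
    | tmul q x =>
      have e1 : compMap p ι (q ⊗ₜ[ℚ] x) = q ⊗ₜ[ℚ] ι x := rfl
      have e2 : q ⊗ₜ[ℚ] x = q • ((1 : ℚ_[p]) ⊗ₜ[ℚ] x) := by
        rw [TensorProduct.smul_tmul', smul_eq_mul, mul_one]
      rw [e1, hg, hΨ, e2, map_smul, map_smul]
      rfl
    | add x y hx hy => simp only [map_add, hx, hy]
  have hsurj : Function.Surjective g := by
    intro X
    refine mem_of_scalar_mem (R := g.range) hb hD ⟨_, (h1 w).trans (by rw [hw])⟩ ?_ X
    intro α γ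
    obtain ⟨x, hx⟩ := (isCyclicRep_cyclicHom f).surj α γ
    exact ⟨compMap p ι x, (h2 x).trans hx⟩
  have hM4 := finrank_of_isQuaternionAlgebra hM
  have : FiniteDimensional k M := Module.finite_of_finrank_pos (by omega)
  have : FiniteDimensional ℚ M := Module.Finite.trans k M
  have hdim : Module.finrank ℚ_[p] (Comp p M) =
      Module.finrank ℚ_[p] (Matrix (Fin 2) (Fin 2) (QuadraticAlgebra ℚ_[p] c t)) := by
    rw [Module.finrank_baseChange, ← Module.finrank_mul_finrank ℚ k M, hk, hM4,
      Module.finrank_matrix, QuadraticAlgebra.finrank_eq_two]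
    simp
  have hinj := (LinearMap.injective_iff_surjective_of_finrank_eq_finrank (f := g.toLinearMap)
    hdim).2 hsurj
  exact ⟨AlgEquiv.ofBijective g ⟨hinj, hsurj⟩, h1, h2⟩

theorem isOrderOver_comap_iff {B : Type*} [Ring B] [Algebra ℚ_[p] B] [Algebra ℤ_[p] B]
    [IsScalarTower ℤ_[p] ℚ_[p] B] (e : Comp p M ≃ₐ[ℤ_[p]] B) {w : NumberField.RingOfIntegers k}
    (hw : ∀ a : NumberField.RingOfIntegers k, ∃ x y : ℤ, a = x + y * w)
    {N : Subalgebra ℤ_[p] B} : IsOrderOver p k (N.comap e.toAlgHom) ↔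
      IsLatticeOrder N ∧ e (1 ⊗ₜ algebraMap k M w) ∈ N := by
  have hmap : ∀ a : k, compMap p (IsScalarTower.toAlgHom ℚ k M) (1 ⊗ₜ a) =
      (1 : ℚ_[p]) ⊗ₜ[ℚ] algebraMap k M a := fun a => rfl
  rw [← isLatticeOrder_comap_iff e, ← isOrder_iff_isLatticeOrder]
  constructor
  · rintro ⟨h1, h2⟩
    refine ⟨h1, ?_⟩
    have h3 : (1 : ℚ_[p]) ⊗ₜ[ℚ] (w : k) ∈ integersAt p k := Algebra.subset_adjoin ⟨w, rfl⟩
    exact h2 ⟨_, h3, hmap w⟩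
  · rintro ⟨h1, h2⟩
    refine ⟨h1, ?_⟩
    rw [integersAt, AlgHom.map_adjoin, Algebra.adjoin_le_iff]
    rintro _ ⟨_, ⟨a, rfl⟩, rfl⟩
    obtain ⟨x, y, rfl⟩ := hw a
    have e1 : (1 : ℚ_[p]) ⊗ₜ[ℚ] algebraMap k M (x + y * w) =
        (x : Comp p M) + (y : Comp p M) * ((1 : ℚ_[p]) ⊗ₜ[ℚ] algebraMap k M w) := by
      have e2 : ∀ z : M, (1 : ℚ_[p]) ⊗ₜ[ℚ] z =
          (Algebra.TensorProduct.includeRight : M →ₐ[ℚ] Comp p M) z := fun z => rfl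
      rw [e2, e2, ← map_intCast (Algebra.TensorProduct.includeRight : M →ₐ[ℚ] Comp p M) x,
        ← map_intCast (Algebra.TensorProduct.includeRight : M →ₐ[ℚ] Comp p M) y, ← map_mul,
        ← map_add, map_add, map_mul, map_intCast, map_intCast]
    have e3 : (((x + y * w : NumberField.RingOfIntegers k)) : k) = x + y * w := by push_cast; rfl
    change compMap p (IsScalarTower.toAlgHom ℚ k M) (1 ⊗ₜ _) ∈ N.comap e.toAlgHom
    rw [hmap, e3, e1]
    exact Subalgebra.add_mem _ (intCast_mem _ x) (Subalgebra.mul_mem _ (intCast_mem _ y) h2)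

theorem isMatrixOrder_iff {hc : ‖c‖ ≤ 1} {ht : ‖t‖ ≤ 1}
    [hf : Fact (∀ r : ℚ_[p], r ^ 2 ≠ c + t * r)]
    {N : Subalgebra ℤ_[p] (Matrix (Fin 2) (Fin 2) (QuadraticAlgebra ℚ_[p] c t))} :
    IsMatrixOrder (quadInt hc ht) N ↔
      IsLatticeOrder N ∧ Matrix.scalar (Fin 2) (omega : QuadraticAlgebra ℚ_[p] c t) ∈ N := by
  constructor
  · rintro ⟨h1, h2⟩
    exact ⟨h1, h2 _ ⟨by simp, by simp⟩⟩
  · rintro ⟨h1, h2⟩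
    refine ⟨h1, fun a ha => ?_⟩
    let x : ℤ_[p] := ⟨a.re, ha.1⟩
    let y : ℤ_[p] := ⟨a.im, ha.2⟩
    have e : Matrix.scalar (Fin 2) a =
        x • (1 : Matrix (Fin 2) (Fin 2) (QuadraticAlgebra ℚ_[p] c t)) +
          y • Matrix.scalar (Fin 2) omega := by
      have e1 : ∀ (z : ℤ_[p]) (X : Matrix (Fin 2) (Fin 2) (QuadraticAlgebra ℚ_[p] c t)),
          z • X = (z : ℚ_[p]) • X := fun z X => (algebraMap_smul ℚ_[p] z X).symm
      rw [e1, e1]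
      refine Matrix.ext fun i j => ?_
      fin_cases i <;> fin_cases j <;> ext <;> simp [x, y]
    rw [e]
    exact N.add_mem (N.smul_mem N.one_mem _) (N.smul_mem h2 _)

/-- A nonzero nilpotent element has determinant N(α) - βN(γ) = 0, so β = N(α/γ). Conversely a norm β
can be scaled to 1, and the companion matrix of ω together with a reflection realizes that algebra.
-/
theorem nonempty_equiv_matrix_iff {A : Type*} [Ring A] [Algebra ℚ_[p] A]
    [hf : Fact (∀ r : ℚ_[p], r ^ 2 ≠ c + t * r)] (hD : t ^ 2 + 4 * c ≠ 0) {β : ℚ_[p]} (hβ : β ≠ 0)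
    (hA : ∀ z : QuadraticAlgebra ℚ_[p] c t, z.norm ≠ 0 →
      Nonempty (A ≃ₐ[ℚ_[p]] QuaternionAlgebra ℚ_[p] c t (β * z.norm))) :
    Nonempty (A ≃ₐ[ℚ_[p]] Matrix (Fin 2) (Fin 2) ℚ_[p]) ↔
      ∃ z : QuadraticAlgebra ℚ_[p] c t, z.norm = β := by
  constructor
  · rintro ⟨g⟩
    obtain ⟨f⟩ := hA 1 (by simp)
    rw [map_one, mul_one] at f
    set x := g.symm !![0, 1; 0, 0] with hx
    have hx0 : x ≠ 0 := by
      intro h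
      rw [hx, map_eq_zero_iff _ g.symm.injective] at h
      have := congrFun (congrFun h 0) 1
      simp at this
    have hxx : x * x = 0 := by
      have : (!![0, 1; 0, 0] : Matrix (Fin 2) (Fin 2) ℚ_[p]) * !![0, 1; 0, 0] = 0 := by
        refine Matrix.ext fun i j => ?_
        fin_cases i <;> fin_cases j <;> simp
      rw [hx, ← map_mul, this, map_zero]
    let y := f x
    have hyy : cyclicHom c t β y * cyclicHom c t β y = 0 := by
      rw [← map_mul, ← map_mul, hxx, map_zero, map_zero]
    have hdet := congrArg Matrix.det hyy
    obtain ⟨α, γ, hy⟩ : ∃ α γ, cyclicHom c t β y = cyclicMatrix β α γ := ⟨_, _, cyclicHom_apply y⟩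
    rw [Matrix.det_mul, Matrix.det_zero, mul_self_eq_zero, hy, cyclicMatrix, Matrix.det_fin_two_of,
      mul_assoc, mul_comm (star γ), ← algebraMap_norm_eq_mul_star, ← algebraMap_norm_eq_mul_star,
      ← map_mul, ← map_sub, map_eq_zero_iff _ (algebraMap ℚ_[p] _).injective, sub_eq_zero] at hdet
    have hγ : γ ≠ 0 := by
      rintro rfl
      rw [QuadraticAlgebra.norm_zero, mul_zero] at hdet
      have hα : α = 0 := by
        by_contra h
        exact quadNorm_ne_zero h hdet
      rw [hα] at hy
      have h0 : cyclicHom c t β y = 0 := by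
        rw [hy]
        refine Matrix.ext fun i j => ?_
        fin_cases i <;> fin_cases j <;> simp [cyclicMatrix]
      rw [map_eq_zero_iff _ (quaternionHom_injective two_ne_zero hD hβ _),
        map_eq_zero_iff _ f.injective] at h0
      exact hx0 h0
    refine ⟨α * γ⁻¹, ?_⟩
    rw [map_mul, quadNorm_inv, hdet, mul_inv_cancel_right₀ (quadNorm_ne_zero hγ)]
  · rintro ⟨z, rfl⟩
    obtain ⟨f⟩ := hA z⁻¹ (quadNorm_ne_zero (inv_ne_zero (by rintro rfl; simp at hβ)))
    rw [quadNorm_inv, mul_inv_cancel₀ hβ] at f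
    let q : QuaternionAlgebra.Basis (Matrix (Fin 2) (Fin 2) ℚ_[p]) c t (1 : ℚ_[p]) :=
      { i := !![0, c; 1, t]
        j := !![1, t; 0, -1]
        k := !![0, c; 1, t] * !![1, t; 0, -1]
        i_mul_i := by
          refine Matrix.ext fun i j => ?_
          fin_cases i <;> fin_cases j <;> simp
          all_goals ring
        j_mul_j := by
          refine Matrix.ext fun i j => ?_
          fin_cases i <;> fin_cases j <;> simp
        i_mul_j := rfl
        j_mul_i := by
          refine Matrix.ext fun i j => ?_
          fin_cases i <;> fin_cases j <;> simp
          all_goals ring }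
    exact ⟨f.trans (basisEquiv two_ne_zero hD one_ne_zero (by simp [Module.finrank_matrix]) q)⟩

end Model

end LocalOrders

namespace LocalOrders

open QuadraticAlgebra hiding norm_neg norm_one norm_natCast norm_star norm_zero norm_algebraMap
open QuatEmb
open scoped Matrix

/-! ### From orders of F_p to the counting of stabilizers. -/

section CyclicModel

variable {p : ℕ} [Fact p.Prime] {c t b : ℚ_[p]} {hc : ‖c‖ ≤ 1} {ht : ‖t‖ ≤ 1}
  [hf : Fact (∀ r : ℚ_[p], r ^ 2 ≠ c + t * r)]
variable {k : Type*} [Field k] [NumberField k] {F M : Type*}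
    [Ring F] [Algebra ℚ F] [Ring M] [Algebra ℚ M] [Algebra k M] [IsScalarTower ℚ k M]
    {ι : F →ₐ[ℚ] M} {θ : Comp p F}
    {φ : Comp p F →ₐ[ℤ_[p]] Matrix (Fin 2) (Fin 2) (QuadraticAlgebra ℚ_[p] c t)}
    {ϖ : QuadraticAlgebra ℚ_[p] c t}

/-- A cyclic representation of `F_p` in which `θ` is the standard generator, and which is induced by
an isomorphism of `M_p` with a matrix algebra respecting the integers of the centres. -/
structure CyclicModel (k : Type*) [Field k] [NumberField k] {F M : Type*}
    [Ring F] [Algebra ℚ F] [Ring M] [Algebra ℚ M] [Algebra k M] [IsScalarTower ℚ k M]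
    (hc : ‖c‖ ≤ 1) (ht : ‖t‖ ≤ 1) (ι : F →ₐ[ℚ] M) (θ : Comp p F) (b : ℚ_[p])
    (φ : Comp p F →ₐ[ℤ_[p]] Matrix (Fin 2) (Fin 2) (QuadraticAlgebra ℚ_[p] c t)) : Prop where
  rep : IsCyclicRep φ b
  map_theta : φ θ = cyclicMatrix b omega 0
  count : ∀ (ϖ : QuadraticAlgebra ℚ_[p] c t) (U : IsUniformizer (quadInt hc ht) ϖ)
    (G : Subalgebra ℤ_[p] (Comp p F)),
    embeddingCount p k ι G = vertexCount (quadInt hc ht) ϖ U.ne_zero φ G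

theorem exists_cyclicModel (hk : Module.finrank ℚ k = 2) (hF : IsQuaternionAlgebra ℚ F)
    (hM : IsQuaternionAlgebra k M) (ι : F →ₐ[ℚ] M) (hD : t ^ 2 + 4 * c ≠ 0)
    (hc : ‖c‖ ≤ 1) (ht : ‖t‖ ≤ 1)
    (σ : k →ₐ[ℚ] QuadraticAlgebra ℚ_[p] c t) {w : NumberField.RingOfIntegers k}
    (hσ : σ w = omega) (hw : ∀ a : NumberField.RingOfIntegers k, ∃ x y : ℤ, a = x + y * w)
    (hθ : θ * θ = c • 1 + t • θ) :
    ∃ β : ℚ_[p], β ≠ 0 ∧ (SplitsAt p F ↔ ∃ z : QuadraticAlgebra ℚ_[p] c t, z.norm = β) ∧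
      ∀ z : QuadraticAlgebra ℚ_[p] c t, z.norm ≠ 0 →
        ∃ φ, CyclicModel k hc ht ι θ (β * z.norm) φ := by
  have hA := isQuaternionAlgebra_comp p hF
  have : Nontrivial (Comp p F) :=
    Module.nontrivial_of_finrank_pos (R := ℚ_[p]) (by rw [finrank_of_isQuaternionAlgebra hA]; omega)
  obtain ⟨β, hβ, h⟩ := exists_cyclic_equiv two_ne_zero hA hθ (by
    rintro r rfl
    refine hf.out r ?_
    apply (algebraMap ℚ_[p] (Comp p F)).injective
    rw [pow_two, map_mul, hθ, map_add, map_mul, Algebra.smul_def, Algebra.smul_def, mul_one]) hD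
  refine ⟨β, hβ, nonempty_equiv_matrix_iff hD hβ fun z hz => ⟨(h z hz).choose⟩, fun z hz => ?_⟩
  obtain ⟨f, hfθ⟩ := h z hz
  obtain ⟨e, he1, he2⟩ := exists_matrix_equiv hk hF hM ι (mul_ne_zero hβ hz) hD σ hσ f
  refine ⟨((cyclicHom c t _).comp f.toAlgHom).restrictScalars ℤ_[p], isCyclicRep_cyclicHom f, ?_,
    fun ϖ U G => ?_⟩
  · change cyclicHom c t _ (f θ) = _
    rw [hfθ, cyclicHom_apply]
    refine Matrix.ext fun i j => ?_
    fin_cases i <;> fin_cases j <;> ext <;> simp [cyclicMatrix]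
  · let e' := e.restrictScalars ℤ_[p]
    have hcomp : e'.toAlgHom.comp (compMap p ι) =
        ((cyclicHom c t _).comp f.toAlgHom).restrictScalars ℤ_[p] := AlgHom.ext he2
    rw [embeddingCount_eq_encard k ι e' (Q := IsMatrixOrder (quadInt hc ht)) (fun N => ?_) G,
      vertexCount]
    · simp only [U.maximal_iff, hcomp]
    · rw [isOrderOver_comap_iff e' hw, isMatrixOrder_iff]
      have : e' (1 ⊗ₜ algebraMap k M w) = Matrix.scalar (Fin 2) omega := by
        rw [← hσ]; exact he1 w
      rw [this]

namespace CyclicModel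

variable (C : CyclicModel k hc ht ι θ b φ)

include C

theorem isOrder_comap (U : IsUniformizer (quadInt hc ht) ϖ) (n : ℤ)
    (u : QuadraticAlgebra ℚ_[p] c t) :
    IsOrder p ((vertexOrder (quadInt hc ht) ϖ U.ne_zero n u).comap φ) := by
  rw [isOrder_iff_isLatticeOrder]
  exact (U.isMatrixOrder_vertexOrder n u).isLatticeOrder.comap φ C.rep.injective

/-- ℤ_p + ℤ_p θ is the copy of O, and a p-power multiple of j lies in G because G spans. -/
theorem isCyclicOrder {G : Subalgebra ℤ_[p] (Comp p F)} (hG : IsOrder p G) (hθ : θ ∈ G) :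
    IsCyclicOrder (quadInt hc ht) φ b G := by
  refine ⟨hG.fg, fun a ha => ?_, ?_⟩
  · let x : ℤ_[p] := ⟨a.re, ha.1⟩
    let y : ℤ_[p] := ⟨a.im, ha.2⟩
    refine ⟨x • 1 + y • θ, G.add_mem (G.smul_mem G.one_mem _) (G.smul_mem hθ _), ?_⟩
    rw [map_add, map_smul, map_smul, map_one, C.map_theta]
    have e1 : ∀ (z : ℤ_[p]) (X : Matrix (Fin 2) (Fin 2) (QuadraticAlgebra ℚ_[p] c t)),
        z • X = (z : ℚ_[p]) • X := fun z X => (algebraMap_smul ℚ_[p] z X).symm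
    rw [e1, e1]
    refine Matrix.ext fun i j => ?_
    fin_cases i <;> fin_cases j <;> ext <;> simp [cyclicMatrix, x, y, mul_comm]
  · obtain ⟨x, hx⟩ := C.rep.surj 0 1
    obtain ⟨N, hN⟩ := span_eq_top_iff.1 hG.span_eq_top x
    refine ⟨0, algebraMap ℚ_[p] _ ((p : ℚ_[p]) ^ N), ?_, _, hN, ?_⟩
    · rw [Ne, map_eq_zero_iff _ (algebraMap ℚ_[p] _).injective]
      exact pow_ne_zero _ (by exact_mod_cast (Fact.out : p.Prime).ne_zero)
    · have e1 : ∀ (z : ℤ_[p]) (X : Matrix (Fin 2) (Fin 2) (QuadraticAlgebra ℚ_[p] c t)),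
          z • X = (z : ℚ_[p]) • X := fun z X => (algebraMap_smul ℚ_[p] z X).symm
      rw [map_smul, hx, e1]
      refine Matrix.ext fun i j => ?_
      fin_cases i <;> fin_cases j <;> simp [cyclicMatrix, Algebra.smul_def, mul_comm]

theorem eq_of_maximal (U : IsUniformizer (quadInt hc ht) ϖ) {G : Subalgebra ℤ_[p] (Comp p F)}
    (hG : IsMaximalOrder p G) (n : ℤ) (u : QuadraticAlgebra ℚ_[p] c t)
    (hle : G ≤ (vertexOrder (quadInt hc ht) ϖ U.ne_zero n u).comap φ) :
    G = (vertexOrder (quadInt hc ht) ϖ U.ne_zero n u).comap φ :=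
  le_antisymm hle (hG.2 (C.isOrder_comap U n u) hle)

theorem embeddingCount_of_ramified {m₀ : ℤ} {d : ℕ} (D : RamifiedData hc ht ϖ b d m₀)
    (hq : (fracIdeal (quadInt hc ht) ϖ 1).toAddSubgroup.relIndex
      (fracIdeal (quadInt hc ht) ϖ 0).toAddSubgroup = p)
    {G H : Subalgebra ℤ_[p] (Comp p F)} (hH : IsMaximalOrder p H) (hG : IsOrder p G)
    (hθ : θ ∈ G) (hGH : G ≤ H) : (G = H → embeddingCount p k ι G = 1) ∧
      (G ≠ H → ∃ r : ℕ, 1 ≤ r ∧ orderIndex p H G = p ^ r ∧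
        embeddingCount p k ι G = totalCount hc ht ϖ D.unif.ne_zero b d (m₀ + r)) := by
  have hGc := C.isCyclicOrder hG hθ
  have hHc := C.isCyclicOrder hH.1 (hGH hθ)
  have hfg := fun n u => (C.isOrder_comap D.unif n u).fg
  constructor
  · rintro rfl
    rw [C.count ϖ D.unif]
    exact D.vertexCount_maximal C.rep hfg hGc (C.eq_of_maximal D.unif hH)
  · intro hne
    obtain ⟨m, hm⟩ := hGc.exists_hasLevel D.unif D.mem_iff
    have hle := D.minLevel_le C.rep hGc hm
    have hHm := D.hasLevel_of_maximal C.rep hfg hHc (C.eq_of_maximal D.unif hH)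
    -- The exponent of the index is the distance r of the level of G from the minimal level m₀,
    -- which is the level of the maximal order.
    obtain ⟨r, rfl⟩ := Int.le.dest hle
    have hidx : orderIndex p H G = p ^ r := by
      rw [orderIndex, relIndex_of_hasLevel C.rep D.unif D.mem_iff hGc hHc hGH hm hHm,
        D.unif.relIndex_fracIdeal hq]
    have hr : 1 ≤ r := by
      by_contra hr
      obtain rfl : r = 0 := by omega
      rw [orderIndex, pow_zero, AddSubgroup.relIndex_eq_one] at hidx
      exact hne (le_antisymm hGH hidx)
    refine ⟨r, hr, hidx, ?_⟩
    rw [C.count ϖ D.unif]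
    exact D.vertexCount_eq_totalCount C.rep hfg hGc hm (by omega)

theorem embeddingCount_of_unramified {v : ℤ} (D : UnramifiedData hc ht ϖ b v)
    {G H : Subalgebra ℤ_[p] (Comp p F)} (hH : IsMaximalOrder p H) (hG : IsOrder p G)
    (hθ : θ ∈ G) (hGH : G ≤ H) : (v = 0 → G = H → embeddingCount p k ι G = 1) ∧
      ((∀ m, v ≠ 2 * m) ∨ G ≠ H → embeddingCount p k ι G = 2) := by
  have hGc := C.isCyclicOrder hG hθ
  have hHc := C.isCyclicOrder hH.1 (hGH hθ)
  rw [C.count ϖ D.unif]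
  refine ⟨?_, ?_⟩
  · rintro hv rfl
    exact D.vertexCount_of_maximal C.rep hGc hv (C.eq_of_maximal D.unif hH)
  · rintro (hv | hne)
    · exact D.vertexCount_of_odd C.rep hGc hv
    · exact D.vertexCount_of_lt C.rep hGc hHc (lt_of_le_of_ne hGH hne)

end CyclicModel

end CyclicModel

/-! ### The local theorem for inert and ramified p. -/

section Cases

variable {p : ℕ} [Fact p.Prime] {c t : ℚ_[p]}
variable {k : Type*} [Field k] [NumberField k] {F M : Type*}
    [Ring F] [Algebra ℚ F] [Ring M] [Algebra ℚ M] [Algebra k M] [IsScalarTower ℚ k M]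
    {θ : Comp p F}

theorem embeddingCount_inert (hk : Module.finrank ℚ k = 2) (hF : IsQuaternionAlgebra ℚ F)
    (hM : IsQuaternionAlgebra k M) (ι : F →ₐ[ℚ] M) (hc : ‖c‖ ≤ 1) (ht : ‖t‖ ≤ 1)
    (hroot : ∀ r : ℚ_[p], ‖r‖ ≤ 1 → ‖r ^ 2 - t * r - c‖ = 1)
    (σ : k →ₐ[ℚ] QuadraticAlgebra ℚ_[p] c t) {w : NumberField.RingOfIntegers k}
    (hσ : σ w = omega) (hw : ∀ a : NumberField.RingOfIntegers k, ∃ x y : ℤ, a = x + y * w)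
    (hθ : θ * θ = c • 1 + t • θ) {G H : Subalgebra ℤ_[p] (Comp p F)} (hH : IsMaximalOrder p H)
    (hG : IsOrder p G) (hθG : θ ∈ G) (hGH : G ≤ H) :
    (SplitsAt p F → G = H → embeddingCount p k ι G = 1) ∧
      (¬ SplitsAt p F ∨ G ≠ H → embeddingCount p k ι G = 2) := by
  have hf : Fact (∀ r : ℚ_[p], r ^ 2 ≠ c + t * r) := ⟨no_root_of_inert hc ht hroot⟩
  have hD : t ^ 2 + 4 * c ≠ 0 := by
    rw [← norm_ne_zero_iff, norm_disc_of_inert hc ht hroot]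
    exact one_ne_zero
  obtain ⟨β, hβ, hsplit, hmodel⟩ := exists_cyclicModel hk hF hM ι hD hc ht σ hσ hw hθ
  by_cases hs : SplitsAt p F
  · obtain ⟨z, hz⟩ := hsplit.1 hs
    have hz0 : z ≠ 0 := by
      rintro rfl
      rw [QuadraticAlgebra.norm_zero] at hz
      exact hβ hz.symm
    obtain ⟨φ, C⟩ := hmodel z⁻¹ (quadNorm_ne_zero (inv_ne_zero hz0))
    rw [quadNorm_inv, hz, mul_inv_cancel₀ hβ] at C
    have D : UnramifiedData hc ht (p : QuadraticAlgebra ℚ_[p] c t) 1 0 :=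
      unramifiedData_of_inert hroot (by simp)
    have h := C.embeddingCount_of_unramified D hH hG hθG hGH
    exact ⟨fun _ => h.1 rfl, fun h' => h.2 (Or.inr (h'.resolve_left (not_not.2 hs)))⟩
  · have hb' : ∀ z : QuadraticAlgebra ℚ_[p] c t, z.norm ≠ β := fun z hz => hs (hsplit.2 ⟨z, hz⟩)
    obtain ⟨z, hz0, hz⟩ := exists_norm_mul_eq_of_inert hc ht hroot hβ hb'
    obtain ⟨φ, C⟩ := hmodel z (quadNorm_ne_zero hz0)
    have D : UnramifiedData hc ht (p : QuadraticAlgebra ℚ_[p] c t) (β * z.norm) 1 :=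
      unramifiedData_of_inert hroot hz
    have h := C.embeddingCount_of_unramified D hH hG hθG hGH
    exact ⟨fun h' => absurd h' hs, fun _ => h.2 (Or.inl fun m => by omega)⟩

theorem mul_norm_not_norm [hf : Fact (∀ r : ℚ_[p], r ^ 2 ≠ c + t * r)] {β : ℚ_[p]}
    (hb : ∀ z : QuadraticAlgebra ℚ_[p] c t, z.norm ≠ β) {z : QuadraticAlgebra ℚ_[p] c t}
    (hz : z ≠ 0) (y : QuadraticAlgebra ℚ_[p] c t) : y.norm ≠ β * z.norm := by
  intro h
  refine hb (y * z⁻¹) ?_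
  rw [map_mul, quadNorm_inv, h, mul_inv_cancel_right₀ (quadNorm_ne_zero hz)]

theorem embeddingCount_eisenstein (hk : Module.finrank ℚ k = 2) (hF : IsQuaternionAlgebra ℚ F)
    (hM : IsQuaternionAlgebra k M) (ι : F →ₐ[ℚ] M) (hc' : ‖c‖ = (p : ℝ)⁻¹) (ht' : ‖t‖ ≤ (p : ℝ)⁻¹)
    (σ : k →ₐ[ℚ] QuadraticAlgebra ℚ_[p] c t) {w : NumberField.RingOfIntegers k}
    (hσ : σ w = omega) (hw : ∀ a : NumberField.RingOfIntegers k, ∃ x y : ℤ, a = x + y * w)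
    (hθ : θ * θ = c • 1 + t • θ) {G H : Subalgebra ℤ_[p] (Comp p F)} (hH : IsMaximalOrder p H)
    (hG : IsOrder p G) (hθG : θ ∈ G) (hGH : G ≤ H) :
    (G = H → embeddingCount p k ι G = 1) ∧
    (G ≠ H → ∃ r : ℕ, 1 ≤ r ∧ orderIndex p H G = p ^ r ∧
      (p ≠ 2 → SplitsAt p F → embeddingCount p k ι G = (tableOddSplit p r : ℕ∞)) ∧
      (p ≠ 2 → ¬ SplitsAt p F → embeddingCount p k ι G = (tableOddRamified p r : ℕ∞)) ∧
      (p = 2 → ‖t‖ = (2 : ℝ)⁻¹ → SplitsAt p F →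
        embeddingCount p k ι G = (tableTwoOneSplit r : ℕ∞)) ∧
      (p = 2 → ‖t‖ = (2 : ℝ)⁻¹ → ¬ SplitsAt p F →
        embeddingCount p k ι G = (tableTwoOneRamified r : ℕ∞)) ∧
      (p = 2 → ‖t‖ ≤ (4 : ℝ)⁻¹ → SplitsAt p F →
        embeddingCount p k ι G = (tableTwoTwoSplit r : ℕ∞)) ∧
      (p = 2 → ‖t‖ ≤ (4 : ℝ)⁻¹ → ¬ SplitsAt p F →
        embeddingCount p k ι G = (tableTwoTwoRamified r : ℕ∞))) := by
  have hp1 : (1 : ℝ) < p := by exact_mod_cast (Fact.out : p.Prime).one_lt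
  have hpi := (inv_lt_one_of_one_lt₀ hp1).le
  have hc : ‖c‖ ≤ 1 := hc'.le.trans hpi
  have ht : ‖t‖ ≤ 1 := ht'.trans hpi
  have hf : Fact (∀ r : ℚ_[p], r ^ 2 ≠ c + t * r) := ⟨no_root_of_eisenstein hc' ht'⟩
  have hq := relIndex_of_eisenstein (hc1 := hc) (ht1 := ht) hc' ht'
  have hD : t ^ 2 + 4 * c ≠ 0 := by
    intro h
    refine hf.out (t / 2) ?_
    linear_combination (-1 / 4) * h
  obtain ⟨β, hβ, hsplit, hmodel⟩ := exists_cyclicModel hk hF hM ι hD hc ht σ hσ hw hθ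
  -- In the split case β is a norm, and scaling by the inverse of a preimage normalizes b to 1.
  have hs1 : SplitsAt p F → ∃ φ, CyclicModel k hc ht ι θ 1 φ := by
    intro hs
    obtain ⟨z, hz⟩ := hsplit.1 hs
    have hz0 : z ≠ 0 := by
      rintro rfl
      rw [QuadraticAlgebra.norm_zero] at hz
      exact hβ hz.symm
    obtain ⟨φ, C⟩ := hmodel z⁻¹ (quadNorm_ne_zero (inv_ne_zero hz0))
    rw [quadNorm_inv, hz, mul_inv_cancel₀ hβ] at C
    exact ⟨φ, C⟩
  rcases ne_or_eq p 2 with hp | rfl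
  · by_cases hs : SplitsAt p F
    · obtain ⟨φ, C⟩ := hs1 hs
      have D := ramifiedData_odd_split (hc1 := hc) (ht1 := ht) hp hc' ht'
      obtain ⟨h1, h2⟩ := C.embeddingCount_of_ramified D hq hH hG hθG hGH
      refine ⟨h1, fun hne => ?_⟩
      obtain ⟨r, hr, hidx, hcount⟩ := h2 hne
      refine ⟨r, hr, hidx, fun _ _ => ?_, fun _ h => absurd hs h, fun h => absurd h hp,
        fun h => absurd h hp, fun h => absurd h hp, fun h => absurd h hp⟩
      rw [hcount]
      exact tableOddSplit_eq D hq hp (levelCount_odd_split hp hc' ht' D.unif.ne_zero) hr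
    · have hb' : ∀ z : QuadraticAlgebra ℚ_[p] c t, z.norm ≠ β := fun z hz => hs (hsplit.2 ⟨z, hz⟩)
      obtain ⟨z, hz0, hz⟩ := exists_zpow_norm_eq_one (t := t) hc' hβ
      obtain ⟨φ, C⟩ := hmodel z (quadNorm_ne_zero hz0)
      obtain ⟨D, hns⟩ := ramifiedData_odd_nonsplit (hc1 := hc) (ht1 := ht) hp hc' ht' hz
        (mul_norm_not_norm hb' hz0)
      obtain ⟨h1, h2⟩ := C.embeddingCount_of_ramified D hq hH hG hθG hGH
      refine ⟨h1, fun hne => ?_⟩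
      obtain ⟨r, hr, hidx, hcount⟩ := h2 hne
      refine ⟨r, hr, hidx, fun _ h => absurd h hs, fun _ _ => ?_, fun h => absurd h hp,
        fun h => absurd h hp, fun h => absurd h hp, fun h => absurd h hp⟩
      rw [hcount]
      exact tableOddRamified_eq D hq hns hr
  · have hcc : ‖c‖ = (2 : ℝ)⁻¹ := by exact_mod_cast hc'
    have htt : ‖t‖ ≤ (2 : ℝ)⁻¹ := by exact_mod_cast ht'
    rcases htt.lt_or_eq with hlt | heq
    · have htq : ‖t‖ ≤ (4 : ℝ)⁻¹ := by
        rw [padic_two_norm_lt_iff (n := -1) (by norm_num)] at hlt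
        exact hlt.trans (by norm_num)
      by_cases hs : SplitsAt 2 F
      · obtain ⟨φ, C⟩ := hs1 hs
        obtain ⟨D, hsp⟩ := ramifiedData_quarter_split (hc1 := hc) (ht1 := ht) hcc htq
        obtain ⟨h1, h2⟩ := C.embeddingCount_of_ramified D hq hH hG hθG hGH
        refine ⟨h1, fun hne => ?_⟩
        obtain ⟨r, hr, hidx, hcount⟩ := h2 hne
        refine ⟨r, hr, hidx, fun h => absurd rfl h, fun h => absurd rfl h,
          fun _ h => absurd h hlt.ne, fun _ h => absurd h hlt.ne, fun _ _ _ => ?_,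
          fun _ _ h => absurd hs h⟩
        rw [hcount]
        exact tableTwoTwoSplit_eq D hq hsp hr
      · have hb' : ∀ z : QuadraticAlgebra ℚ_[2] c t, z.norm ≠ β :=
          fun z hz => hs (hsplit.2 ⟨z, hz⟩)
        obtain ⟨z, hz0, hz⟩ := exists_norm_mul_sub_one_le hcc htq hβ
        obtain ⟨φ, C⟩ := hmodel z (quadNorm_ne_zero hz0)
        obtain ⟨D, hns⟩ := ramifiedData_quarter_nonsplit (hc1 := hc) (ht1 := ht) hcc htq hz
          (mul_norm_not_norm hb' hz0)
        obtain ⟨h1, h2⟩ := C.embeddingCount_of_ramified D hq hH hG hθG hGH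
        refine ⟨h1, fun hne => ?_⟩
        obtain ⟨r, hr, hidx, hcount⟩ := h2 hne
        refine ⟨r, hr, hidx, fun h => absurd rfl h, fun h => absurd rfl h,
          fun _ h => absurd h hlt.ne, fun _ h => absurd h hlt.ne, fun _ _ h => absurd h hs,
          fun _ _ _ => ?_⟩
        rw [hcount]
        exact tableTwoTwoRamified_eq D hq hns hr
    · have hgt : ¬ ‖t‖ ≤ (4 : ℝ)⁻¹ := by rw [heq]; norm_num
      by_cases hs : SplitsAt 2 F
      · obtain ⟨φ, C⟩ := hs1 hs
        obtain ⟨D, hsp⟩ := ramifiedData_half_split (hc1 := hc) (ht1 := ht) hcc heq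
        obtain ⟨h1, h2⟩ := C.embeddingCount_of_ramified D hq hH hG hθG hGH
        refine ⟨h1, fun hne => ?_⟩
        obtain ⟨r, hr, hidx, hcount⟩ := h2 hne
        refine ⟨r, hr, hidx, fun h => absurd rfl h, fun h => absurd rfl h, fun _ _ _ => ?_,
          fun _ _ h => absurd hs h, fun _ h => absurd h hgt, fun _ h => absurd h hgt⟩
        rw [hcount]
        exact tableTwoOneSplit_eq D hq hsp hr
      · have hb' : ∀ z : QuadraticAlgebra ℚ_[2] c t, z.norm ≠ β :=
          fun z hz => hs (hsplit.2 ⟨z, hz⟩)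
        obtain ⟨z, hz0, hz⟩ := exists_zpow_norm_eq_one (t := t) hc' hβ
        obtain ⟨φ, C⟩ := hmodel z (quadNorm_ne_zero hz0)
        obtain ⟨D, hns⟩ := ramifiedData_half_nonsplit (hc1 := hc) (ht1 := ht) hcc heq hz
          (mul_norm_not_norm hb' hz0)
        obtain ⟨h1, h2⟩ := C.embeddingCount_of_ramified D hq hH hG hθG hGH
        refine ⟨h1, fun hne => ?_⟩
        obtain ⟨r, hr, hidx, hcount⟩ := h2 hne
        refine ⟨r, hr, hidx, fun h => absurd rfl h, fun h => absurd rfl h,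
          fun _ _ h => absurd h hs, fun _ _ _ => ?_, fun _ h => absurd h hgt,
          fun _ h => absurd h hgt⟩
        rw [hcount]
        exact tableTwoOneRamified_eq D hq hns hr

end Cases

end LocalOrders

namespace LocalOrders

open QuadraticAlgebra hiding norm_neg norm_one norm_natCast norm_star norm_zero norm_algebraMap
open QuatEmb
open scoped Matrix

/-! ### Stabilizers of lattices over ℤ_p. -/

section PadicIntegers

variable {p : ℕ} [Fact p.Prime]

theorem mem_bot_iff_norm_le_one {x : ℚ_[p]} : x ∈ (⊥ : Subalgebra ℤ_[p] ℚ_[p]) ↔ ‖x‖ ≤ 1 := by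
  rw [Algebra.mem_bot]
  constructor
  · rintro ⟨y, rfl⟩
    exact y.2
  · intro h
    exact ⟨⟨x, h⟩, rfl⟩

theorem isUniformizer_bot : IsUniformizer (⊥ : Subalgebra ℤ_[p] ℚ_[p]) (p : ℚ_[p]) := by
  have hp0 : (p : ℚ_[p]) ≠ 0 := by exact_mod_cast (Fact.out : p.Prime).ne_zero
  have hp1 : (1 : ℝ) < p := by exact_mod_cast (Fact.out : p.Prime).one_lt
  refine ⟨natCast_mem _ p, ?_, fun x hx => ?_, Subalgebra.fg_bot_toSubmodule, ?_⟩
  · rw [mem_bot_iff_norm_le_one, norm_inv, Padic.norm_p, inv_inv, not_le]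
    exact hp1
  · have h1 : ‖x * (p : ℚ_[p]) ^ (-x.valuation)‖ = 1 := by
      rw [norm_mul, Padic.norm_p_zpow, Padic.norm_eq_zpow_neg_valuation hx,
        ← zpow_add₀ (by positivity)]
      simp
    refine ⟨x.valuation, ?_, ?_⟩
    · rw [mem_bot_iff_norm_le_one, h1]
    · rw [mem_bot_iff_norm_le_one, norm_inv, h1, inv_one]
  · rw [mul_inv_cancel₀ hp0]
    exact Subalgebra.one_mem _

/-- The vertex orders of `M₂(ℚ_p)`. -/
noncomputable abbrev padicVertex (p : ℕ) [Fact p.Prime] (n : ℤ) (u : ℚ_[p]) :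
    Subalgebra ℤ_[p] (Matrix (Fin 2) (Fin 2) ℚ_[p]) :=
  vertexOrder ⊥ (p : ℚ_[p]) isUniformizer_bot.ne_zero n u

/-- The fractional ideals of `ℤ_p`. -/
noncomputable abbrev padicIdeal (p : ℕ) [Fact p.Prime] (n : ℤ) : Submodule ℤ_[p] ℚ_[p] :=
  fracIdeal ⊥ (p : ℚ_[p]) n

theorem exists_eq_padicIdeal {V : Submodule ℤ_[p] ℚ_[p]} (hne : ∃ x ∈ V, x ≠ 0) {t : ℤ}
    (hb : ∀ x ∈ V, x ∈ padicIdeal p t) : ∃ s, ∀ x, x ∈ V ↔ x ∈ padicIdeal p s := by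
  refine isUniformizer_bot.exists_eq_fracIdeal V.toAddSubgroup (fun a ha x hx => ?_) hne hb
  obtain ⟨z, rfl⟩ := Algebra.mem_bot.1 ha
  rw [← Algebra.smul_def]
  exact V.smul_mem z hx

theorem isMatrixOrder_bot_iff {N : Subalgebra ℤ_[p] (Matrix (Fin 2) (Fin 2) ℚ_[p])} :
    IsMatrixOrder (⊥ : Subalgebra ℤ_[p] ℚ_[p]) N ↔ IsLatticeOrder N := by
  refine ⟨fun h => h.1, fun h => ⟨h, fun a ha => ?_⟩⟩
  obtain ⟨z, rfl⟩ := Algebra.mem_bot.1 ha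
  exact N.algebraMap_mem z

theorem maximal_isLatticeOrder_iff {N : Subalgebra ℤ_[p] (Matrix (Fin 2) (Fin 2) ℚ_[p])} :
    Maximal IsLatticeOrder N ↔
      ∃ n u, N = padicVertex p n u := by
  rw [← isUniformizer_bot.maximal_iff]
  simp only [Maximal, isMatrixOrder_bot_iff]

end PadicIntegers

/-! ### Orders in products of algebras. -/

section Product

variable {p : ℕ} [Fact p.Prime]
variable {A B : Type*} [Ring A] [Algebra ℚ_[p] A] [Algebra ℤ_[p] A] [IsScalarTower ℤ_[p] ℚ_[p] A]
  [Ring B] [Algebra ℚ_[p] B] [Algebra ℤ_[p] B] [IsScalarTower ℤ_[p] ℚ_[p] B]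

theorem isLatticeOrder_prod {N₁ : Subalgebra ℤ_[p] A} {N₂ : Subalgebra ℤ_[p] B}
    (h1 : IsLatticeOrder N₁) (h2 : IsLatticeOrder N₂) : IsLatticeOrder (N₁.prod N₂) := by
  refine ⟨?_, span_eq_top_iff.2 fun x => ?_⟩
  · rw [Subalgebra.prod_toSubmodule]
    exact h1.fg.prod h2.fg
  · obtain ⟨a, ha⟩ := span_eq_top_iff.1 h1.span_eq_top x.1
    obtain ⟨b, hb⟩ := span_eq_top_iff.1 h2.span_eq_top x.2
    exact ⟨a + b, p_pow_smul_mem_of_le (Nat.le_add_right a b) ha,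
      p_pow_smul_mem_of_le (Nat.le_add_left b a) hb⟩

theorem isLatticeOrder_map {N : Subalgebra ℤ_[p] A} (hN : IsLatticeOrder N)
    (f : A →ₐ[ℤ_[p]] B) (hf : Function.Surjective f) : IsLatticeOrder (N.map f) := by
  refine ⟨?_, span_eq_top_iff.2 fun x => ?_⟩
  · rw [Subalgebra.map_toSubmodule]
    exact hN.fg.map _
  · obtain ⟨y, rfl⟩ := hf x
    obtain ⟨a, ha⟩ := span_eq_top_iff.1 hN.span_eq_top y
    exact ⟨a, _, ha, by simp⟩

/-- Orders of a product that contain an element separating the factors are products. -/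
theorem isLatticeOrder_prod_iff {a a' : ℤ_[p]} (haa : IsUnit (a - a'))
    {N : Subalgebra ℤ_[p] (A × B)} :
    (IsLatticeOrder N ∧ ((algebraMap ℤ_[p] A a, algebraMap ℤ_[p] B a') : A × B) ∈ N) ↔
      ∃ (N₁ : Subalgebra ℤ_[p] A) (N₂ : Subalgebra ℤ_[p] B),
        IsLatticeOrder N₁ ∧ IsLatticeOrder N₂ ∧ N = N₁.prod N₂ := by
  constructor
  · rintro ⟨h, hmem⟩
    refine ⟨N.map (AlgHom.fst _ _ _), N.map (AlgHom.snd _ _ _), isLatticeOrder_map h _ fun x => ⟨(x, 0), rfl⟩,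
      isLatticeOrder_map h _ fun x => ⟨(0, x), rfl⟩, le_antisymm ?_ ?_⟩
    · exact fun x hx => ⟨⟨x, hx, rfl⟩, ⟨x, hx, rfl⟩⟩
    · obtain ⟨v, hv⟩ := haa
      have hE : ((1, 0) : A × B) ∈ N := by
        have e : ((1, 0) : A × B) = (↑v⁻¹ : ℤ_[p]) •
            ((algebraMap ℤ_[p] A a, algebraMap ℤ_[p] B a') - algebraMap ℤ_[p] (A × B) a') := by
          refine Prod.ext ?_ ?_
          · change (1 : A) = (↑v⁻¹ : ℤ_[p]) • (algebraMap ℤ_[p] A a - algebraMap ℤ_[p] A a')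
            rw [← map_sub, ← hv, Algebra.smul_def, ← map_mul, Units.inv_mul, map_one]
          · change (0 : B) = (↑v⁻¹ : ℤ_[p]) • (algebraMap ℤ_[p] B a' - algebraMap ℤ_[p] B a')
            rw [sub_self, smul_zero]
        rw [e]
        exact N.smul_mem (N.sub_mem hmem (N.algebraMap_mem _)) _
      rintro ⟨_, _⟩ ⟨⟨x, hx, rfl⟩, ⟨y, hy, rfl⟩⟩
      have e : ((x.1, y.2) : A × B) = (1, 0) * x + (1 - (1, 0)) * y := by
        refine Prod.ext ?_ ?_ <;> simp
      change ((x.1, y.2) : A × B) ∈ N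
      rw [e]
      exact N.add_mem (N.mul_mem hE hx) (N.mul_mem (N.sub_mem N.one_mem hE) hy)
  · rintro ⟨N₁, N₂, h1, h2, rfl⟩
    exact ⟨isLatticeOrder_prod h1 h2, N₁.algebraMap_mem a, N₂.algebraMap_mem a'⟩

theorem prod_le_prod_iff {R : Type*} [CommRing R] {A B : Type*} [Ring A] [Algebra R A] [Ring B]
    [Algebra R B] {N₁ N₁' : Subalgebra R A} {N₂ N₂' : Subalgebra R B} :
    N₁.prod N₂ ≤ N₁'.prod N₂' ↔ N₁ ≤ N₁' ∧ N₂ ≤ N₂' := by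
  refine ⟨fun h => ⟨fun x hx => ?_, fun x hx => ?_⟩, fun h x hx => ⟨h.1 hx.1, h.2 hx.2⟩⟩
  · exact (h (show (x, (0 : B)) ∈ N₁.prod N₂ from ⟨hx, N₂.zero_mem⟩)).1
  · exact (h (show ((0 : A), x) ∈ N₁.prod N₂ from ⟨N₁.zero_mem, hx⟩)).2

theorem maximal_prod_iff {a a' : ℤ_[p]} (haa : IsUnit (a - a')) {N : Subalgebra ℤ_[p] (A × B)} :
    Maximal (fun N : Subalgebra ℤ_[p] (A × B) => IsLatticeOrder N ∧
      ((algebraMap ℤ_[p] A a, algebraMap ℤ_[p] B a') : A × B) ∈ N) N ↔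
      ∃ (N₁ : Subalgebra ℤ_[p] A) (N₂ : Subalgebra ℤ_[p] B),
        Maximal IsLatticeOrder N₁ ∧ Maximal IsLatticeOrder N₂ ∧ N = N₁.prod N₂ := by
  simp only [isLatticeOrder_prod_iff haa]
  constructor
  · rintro ⟨⟨N₁, N₂, h1, h2, rfl⟩, hmax⟩
    refine ⟨N₁, N₂, ⟨h1, fun N' h' hle => ?_⟩, ⟨h2, fun N' h' hle => ?_⟩, rfl⟩
    · exact (prod_le_prod_iff.1 (hmax ⟨N', N₂, h', h2, rfl⟩ (prod_le_prod_iff.2 ⟨hle, le_rfl⟩))).1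
    · exact (prod_le_prod_iff.1 (hmax ⟨N₁, N', h1, h', rfl⟩ (prod_le_prod_iff.2 ⟨le_rfl, hle⟩))).2
  · rintro ⟨N₁, N₂, h1, h2, rfl⟩
    refine ⟨⟨N₁, N₂, h1.1, h2.1, rfl⟩, ?_⟩
    rintro _ ⟨N₁', N₂', h1', h2', rfl⟩ hle
    obtain ⟨hle1, hle2⟩ := prod_le_prod_iff.1 hle
    exact prod_le_prod_iff.2 ⟨h1.2 h1' hle1, h2.2 h2' hle2⟩

end Product

/-! ### Pairs of maximal orders of M₂(ℚ_p) with a given intersection. -/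

section SplitCount

variable {p : ℕ} [Fact p.Prime] {G : Subalgebra ℤ_[p] (Matrix (Fin 2) (Fin 2) ℚ_[p])}
  {a a' : ℤ_[p]}

/-- E₁₁ = (diag(a, a') - a')/(a - a'), and the denominator is a unit. -/
theorem idempotent_mem (haa : IsUnit (a - a'))
    (hmem : !![(a : ℚ_[p]), 0; 0, (a' : ℚ_[p])] ∈ G) : !![1, 0; 0, 0] ∈ G := by
  obtain ⟨v, hv⟩ := haa
  have e : (!![1, 0; 0, 0] : Matrix (Fin 2) (Fin 2) ℚ_[p]) = (↑v⁻¹ : ℤ_[p]) •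
      (!![(a : ℚ_[p]), 0; 0, (a' : ℚ_[p])] - algebraMap ℤ_[p] _ a') := by
    have h1 : (((v⁻¹ : ℤ_[p]ˣ) : ℤ_[p]) : ℚ_[p]) * ((a : ℚ_[p]) - a') = 1 := by
      rw [← PadicInt.coe_sub, ← hv, ← PadicInt.coe_mul, Units.inv_mul, PadicInt.coe_one]
    have h2 : algebraMap ℤ_[p] (Matrix (Fin 2) (Fin 2) ℚ_[p]) a' =
        !![(a' : ℚ_[p]), 0; 0, (a' : ℚ_[p])] := scalar_fin_two _
    have h3 : ∀ X : Matrix (Fin 2) (Fin 2) ℚ_[p], (↑v⁻¹ : ℤ_[p]) • X =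
        (((v⁻¹ : ℤ_[p]ˣ) : ℤ_[p]) : ℚ_[p]) • X := fun X => (algebraMap_smul ℚ_[p] _ X).symm
    rw [h2, h3]
    refine Matrix.ext fun i j => ?_
    fin_cases i <;> fin_cases j <;> simp [h1]
  rw [e]
  exact G.smul_mem (G.sub_mem hmem (G.algebraMap_mem _)) _

theorem padicVertex_eq_zero {n : ℤ} {u : ℚ_[p]} (h : !![1, 0; 0, 0] ∈ padicVertex p n u) :
    padicVertex p n u = padicVertex p n 0 := by
  rw [isUniformizer_bot.vertexOrder_eq_iff]
  rw [mem_vertexOrder] at h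
  simpa using h.2.2.2

theorem mem_padicVertex_zero {n : ℤ} {x y z w : ℚ_[p]} : !![x, y; z, w] ∈ padicVertex p n 0 ↔
    x ∈ padicIdeal p 0 ∧ w ∈ padicIdeal p 0 ∧ z ∈ padicIdeal p (-n) ∧ y ∈ padicIdeal p n := by
  rw [mem_vertexOrder]
  simp

/-- An order containing the diagonal idempotents is determined by two fractional ideals. -/
theorem exists_mem_iff_of_idempotent_mem (hG : IsLatticeOrder G) (hE : !![1, 0; 0, 0] ∈ G) :
    ∃ r s : ℤ, -r ≤ s ∧ ∀ x y z w : ℚ_[p], !![x, y; z, w] ∈ G ↔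
      x ∈ padicIdeal p 0 ∧ w ∈ padicIdeal p 0 ∧ z ∈ padicIdeal p r ∧ y ∈ padicIdeal p s := by
  have U := isUniformizer_bot (p := p)
  obtain ⟨n, u, hle⟩ := U.exists_le_vertexOrder_of_fg (AlgHom.id _ _) hG.fg
  have hle' : ∀ x y z w : ℚ_[p], !![x, y; z, w] ∈ G → x ∈ padicIdeal p 0 ∧ w ∈ padicIdeal p 0 ∧
      z ∈ padicIdeal p (-n) ∧ y ∈ padicIdeal p n := by
    intro x y z w h
    have h1 : !![x, y; z, w] ∈ padicVertex p n u := hle h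
    rwa [padicVertex_eq_zero (hle hE), mem_padicVertex_zero] at h1
  have hE' : !![0, 0; 0, 1] ∈ G := by
    have e : (!![0, 0; 0, 1] : Matrix (Fin 2) (Fin 2) ℚ_[p]) = 1 - !![1, 0; 0, 0] := by
      rw [Matrix.one_fin_two]
      refine Matrix.ext fun i j => ?_
      fin_cases i <;> fin_cases j <;> simp
    rw [e]
    exact G.sub_mem G.one_mem hE
  have e1 : ∀ (z : ℤ_[p]) (X : Matrix (Fin 2) (Fin 2) ℚ_[p]), z • X = (z : ℚ_[p]) • X :=
    fun z X => (algebraMap_smul ℚ_[p] z X).symm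
  have hx : ∀ x y z w : ℚ_[p], !![x, y; z, w] ∈ G → !![0, 0; z, 0] ∈ G ∧ !![0, y; 0, 0] ∈ G := by
    intro x y z w h
    have h1 := G.mul_mem (G.mul_mem hE' h) hE
    have h2 := G.mul_mem (G.mul_mem hE h) hE'
    simp only [Matrix.mul_fin_two] at h1 h2
    simpa using And.intro h1 h2
  have hpN : ∀ N : ℕ, (p : ℚ_[p]) ^ N ≠ 0 := fun N =>
    pow_ne_zero _ (by exact_mod_cast (Fact.out : p.Prime).ne_zero)
  have hent : ∀ i j : Fin 2, (∃ t, ∀ x, Matrix.single i j x ∈ G → x ∈ padicIdeal p t) →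
      ∃ s : ℤ, ∀ x : ℚ_[p], Matrix.single i j x ∈ G ↔ x ∈ padicIdeal p s := by
    rintro i j ⟨t, ht⟩
    refine exists_eq_padicIdeal
      (V := (Subalgebra.toSubmodule G).comap (Matrix.singleLinearMap ℤ_[p] i j)) ?_ ht
    obtain ⟨N, hN⟩ := span_eq_top_iff.1 hG.span_eq_top (Matrix.single i j 1)
    refine ⟨(p : ℚ_[p]) ^ N, ?_, hpN N⟩
    change Matrix.single i j _ ∈ G
    rw [e1, Matrix.smul_single] at hN
    simpa using hN
  have s10 : ∀ z : ℚ_[p], Matrix.single 1 0 z = !![0, 0; z, 0] := by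
    intro z
    refine Matrix.ext fun i j => ?_
    fin_cases i <;> fin_cases j <;> simp
  have s01 : ∀ z : ℚ_[p], Matrix.single 0 1 z = !![0, z; 0, 0] := by
    intro z
    refine Matrix.ext fun i j => ?_
    fin_cases i <;> fin_cases j <;> simp
  obtain ⟨r, hr⟩ := hent 1 0 ⟨-n, fun x h => (hle' 0 0 x 0 (by rwa [s10] at h)).2.2.1⟩
  obtain ⟨s, hs⟩ := hent 0 1 ⟨n, fun x h => (hle' 0 x 0 0 (by rwa [s01] at h)).2.2.2⟩
  simp only [s10] at hr
  simp only [s01] at hs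
  refine ⟨r, s, ?_, fun x y z w => ⟨fun h => ?_, fun ⟨h1, h2, h3, h4⟩ => ?_⟩⟩
  · have h1 := (hle' _ _ _ _ ((hr _).2 (U.zpow_mem_fracIdeal.2 le_rfl))).2.2.1
    have h2 := (hle' _ _ _ _ ((hs _).2 (U.zpow_mem_fracIdeal.2 le_rfl))).2.2.2
    rw [U.zpow_mem_fracIdeal] at h1 h2
    omega
  · obtain ⟨h1, h2, -, -⟩ := hle' _ _ _ _ h
    obtain ⟨h3, h4⟩ := hx _ _ _ _ h
    exact ⟨h1, h2, (hr _).1 h3, (hs _).1 h4⟩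
  · obtain ⟨x', rfl⟩ := Algebra.mem_bot.1 (mem_fracIdeal_zero.1 h1)
    obtain ⟨w', rfl⟩ := Algebra.mem_bot.1 (mem_fracIdeal_zero.1 h2)
    have e : (!![algebraMap ℤ_[p] ℚ_[p] x', y; z, algebraMap ℤ_[p] ℚ_[p] w'] :
        Matrix (Fin 2) (Fin 2) ℚ_[p]) = x' • !![1, 0; 0, 0] + w' • !![0, 0; 0, 1] +
          (!![0, 0; z, 0] + !![0, y; 0, 0]) := by
      rw [e1, e1]
      refine Matrix.ext fun i j => ?_
      fin_cases i <;> fin_cases j <;> simp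
    rw [e]
    exact G.add_mem (G.add_mem (G.smul_mem hE _) (G.smul_mem hE' _))
      (G.add_mem ((hr _).2 h3) ((hs _).2 h4))

theorem forall_mem_iff {r s r' s' : ℤ}
    (h : ∀ z y : ℚ_[p], (z ∈ padicIdeal p r ∧ y ∈ padicIdeal p s) ↔
      (z ∈ padicIdeal p r' ∧ y ∈ padicIdeal p s')) : r = r' ∧ s = s' := by
  have U := isUniformizer_bot (p := p)
  have h1 := (h ((p : ℚ_[p]) ^ r) ((p : ℚ_[p]) ^ s)).1
    ⟨U.zpow_mem_fracIdeal.2 le_rfl, U.zpow_mem_fracIdeal.2 le_rfl⟩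
  have h2 := (h ((p : ℚ_[p]) ^ r') ((p : ℚ_[p]) ^ s')).2
    ⟨U.zpow_mem_fracIdeal.2 le_rfl, U.zpow_mem_fracIdeal.2 le_rfl⟩
  simp only [U.zpow_mem_fracIdeal] at h1 h2
  omega

/-- Since G contains E₁₁, both members of a pair have u = 0, with parameters n and m say. Their
intersection has exponents max(-n, -m) and max(n, m), so {n, m} = {-r, s}; the two orderings
coincide exactly when s = -r, that is, when G is maximal. -/
theorem encard_pairs (haa : IsUnit (a - a')) (hG : IsLatticeOrder G)
    (hmem : !![(a : ℚ_[p]), 0; 0, (a' : ℚ_[p])] ∈ G) :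
    (Maximal IsLatticeOrder G → Set.encard {N : Subalgebra ℤ_[p]
      (Matrix (Fin 2) (Fin 2) ℚ_[p] × Matrix (Fin 2) (Fin 2) ℚ_[p]) |
      (∃ N₁ N₂, Maximal IsLatticeOrder N₁ ∧ Maximal IsLatticeOrder N₂ ∧ N = N₁.prod N₂) ∧
        N.comap ((AlgHom.id _ _).prod (AlgHom.id _ _)) = G} = 1) ∧
    (¬ Maximal IsLatticeOrder G → Set.encard {N : Subalgebra ℤ_[p]
      (Matrix (Fin 2) (Fin 2) ℚ_[p] × Matrix (Fin 2) (Fin 2) ℚ_[p]) |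
      (∃ N₁ N₂, Maximal IsLatticeOrder N₁ ∧ Maximal IsLatticeOrder N₂ ∧ N = N₁.prod N₂) ∧
        N.comap ((AlgHom.id _ _).prod (AlgHom.id _ _)) = G} = 2) := by
  have U := isUniformizer_bot (p := p)
  have hE := idempotent_mem haa hmem
  obtain ⟨r, s, hrs, hiff⟩ := exists_mem_iff_of_idempotent_mem hG hE
  have hcomap : ∀ n m : ℤ, ((padicVertex p n 0).prod (padicVertex p m 0)).comap
      ((AlgHom.id _ _).prod (AlgHom.id _ _)) = G ↔ r = max (-n) (-m) ∧ s = max n m := by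
    intro n m
    have hmax : ∀ (i j : ℤ) (x : ℚ_[p]), x ∈ padicIdeal p (max i j) ↔
        x ∈ padicIdeal p i ∧ x ∈ padicIdeal p j := by
      intro i j x
      rcases le_total i j with h | h
      · rw [max_eq_right h]
        exact ⟨fun hx => ⟨U.anti h hx, hx⟩, fun hx => hx.2⟩
      · rw [max_eq_left h]
        exact ⟨fun hx => ⟨hx, U.anti h hx⟩, fun hx => hx.1⟩
    have hc : ∀ x y z w : ℚ_[p], !![x, y; z, w] ∈ ((padicVertex p n 0).prod
        (padicVertex p m 0)).comap ((AlgHom.id _ _).prod (AlgHom.id _ _)) ↔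
        x ∈ padicIdeal p 0 ∧ w ∈ padicIdeal p 0 ∧ z ∈ padicIdeal p (max (-n) (-m)) ∧
          y ∈ padicIdeal p (max n m) := by
      intro x y z w
      change !![x, y; z, w] ∈ padicVertex p n 0 ∧ !![x, y; z, w] ∈ padicVertex p m 0 ↔ _
      rw [mem_padicVertex_zero, mem_padicVertex_zero, hmax, hmax]
      tauto
    constructor
    · intro h
      rw [h] at hc
      refine forall_mem_iff (p := p) fun z y => ?_
      have h0 := (hiff 0 y z 0).symm.trans (hc 0 y z 0)
      simpa using h0
    · rintro ⟨h1, h2⟩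
      refine SetLike.ext fun X => ?_
      rw [Matrix.eta_fin_two X, hc, hiff, h1, h2]
  have hset : {N : Subalgebra ℤ_[p]
      (Matrix (Fin 2) (Fin 2) ℚ_[p] × Matrix (Fin 2) (Fin 2) ℚ_[p]) |
      (∃ N₁ N₂, Maximal IsLatticeOrder N₁ ∧ Maximal IsLatticeOrder N₂ ∧ N = N₁.prod N₂) ∧
        N.comap ((AlgHom.id _ _).prod (AlgHom.id _ _)) = G} =
      {(padicVertex p (-r) 0).prod (padicVertex p s 0),
        (padicVertex p s 0).prod (padicVertex p (-r) 0)} := by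
    ext N
    simp only [Set.mem_ofPred_eq, Set.mem_insert_iff, Set.mem_singleton_iff,
      maximal_isLatticeOrder_iff]
    constructor
    · rintro ⟨⟨_, _, ⟨n, u, rfl⟩, ⟨m, v, rfl⟩, rfl⟩, h⟩
      have hE2 := hE
      rw [← h] at hE2
      have hE2 : !![1, 0; 0, 0] ∈ padicVertex p n u ∧ !![1, 0; 0, 0] ∈ padicVertex p m v := hE2
      rw [padicVertex_eq_zero hE2.1, padicVertex_eq_zero hE2.2, hcomap] at h
      rw [padicVertex_eq_zero hE2.1, padicVertex_eq_zero hE2.2]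
      rcases le_total n m with hnm | hnm
      · obtain rfl : n = -r := by omega
        obtain rfl : m = s := by omega
        exact Or.inl rfl
      · obtain rfl : m = -r := by omega
        obtain rfl : n = s := by omega
        exact Or.inr rfl
    · rintro (rfl | rfl)
      · exact ⟨⟨_, _, ⟨_, _, rfl⟩, ⟨_, _, rfl⟩, rfl⟩, (hcomap _ _).2 (by omega)⟩
      · exact ⟨⟨_, _, ⟨_, _, rfl⟩, ⟨_, _, rfl⟩, rfl⟩, (hcomap _ _).2 (by omega)⟩
  have hmaxG : Maximal IsLatticeOrder G ↔ s = -r := by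
    rw [maximal_isLatticeOrder_iff]
    constructor
    · rintro ⟨n, u, h⟩
      have h0 : G = padicVertex p n 0 := by rw [h, padicVertex_eq_zero (h ▸ hE)]
      have h1 := forall_mem_iff (p := p) (r := r) (s := s) (r' := -n) (s' := n) fun z y => by
        have h2 := hiff 0 y z 0
        rw [h0, mem_padicVertex_zero] at h2
        simpa using h2.symm
      omega
    · rintro rfl
      refine ⟨-r, 0, SetLike.ext fun X => ?_⟩
      rw [Matrix.eta_fin_two X, mem_padicVertex_zero, hiff, neg_neg]
  rw [hset, hmaxG]
  refine ⟨?_, fun hne => Set.encard_pair fun h => hne ?_⟩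
  · rintro rfl
    rw [Set.pair_eq_singleton, Set.encard_singleton]
  · have h1 := (prod_le_prod_iff.1 h.le).1
    rw [U.vertexOrder_le_iff] at h1
    exact h1.1.symm

end SplitCount

end LocalOrders

namespace LocalOrders

open QuadraticAlgebra hiding norm_neg norm_one norm_natCast norm_star norm_zero norm_algebraMap
open QuatEmb
open scoped Matrix TensorProduct

/-! ### The local theorem for split p. -/

section SplitCase

variable {p : ℕ} [Fact p.Prime]
variable {k : Type*} [Field k] [NumberField k] {F M : Type*}
    [Ring F] [Algebra ℚ F] [Ring M] [Algebra ℚ M] [Algebra k M] [IsScalarTower ℚ k M]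

/-- A nonscalar θ with distinct eigenvalues in ℚ_p is diagonalizable; in particular it forces the
quaternion algebra to be M₂(ℚ_p). -/
theorem exists_diagonal_equiv {A : Type*} [Ring A] [Algebra ℚ_[p] A]
    (hA : IsQuaternionAlgebra ℚ_[p] A) {a a' : ℚ_[p]} (haa : a ≠ a') {θ : A}
    (hθ : θ * θ = (-(a * a')) • 1 + (a + a') • θ) (hns : ∀ r : ℚ_[p], θ ≠ algebraMap ℚ_[p] A r) :
    ∃ f : A ≃ₐ[ℚ_[p]] Matrix (Fin 2) (Fin 2) ℚ_[p], f θ = !![a, 0; 0, a'] := by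
  have hD : (a + a') ^ 2 + 4 * (-(a * a')) ≠ 0 := by
    have : (a + a') ^ 2 + 4 * (-(a * a')) = (a - a') ^ 2 := by ring
    rw [this]
    exact pow_ne_zero _ (sub_ne_zero.2 haa)
  obtain ⟨β, hβ, h⟩ := exists_cyclic_equiv two_ne_zero hA hθ hns hD
  obtain ⟨ε, hε⟩ := h 1 (by simp)
  have hb : β * (1 : QuadraticAlgebra ℚ_[p] (-(a * a')) (a + a')).norm ≠ 0 := by simpa
  generalize β * (1 : QuadraticAlgebra ℚ_[p] (-(a * a')) (a + a')).norm = b at ε hε hb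
  let q : QuaternionAlgebra.Basis (Matrix (Fin 2) (Fin 2) ℚ_[p]) (-(a * a')) (a + a') b :=
    { i := !![a, 0; 0, a']
      j := !![0, b; 1, 0]
      k := !![a, 0; 0, a'] * !![0, b; 1, 0]
      i_mul_i := by
        refine Matrix.ext fun i j => ?_
        fin_cases i <;> fin_cases j <;> simp
        all_goals ring
      j_mul_j := by
        refine Matrix.ext fun i j => ?_
        fin_cases i <;> fin_cases j <;> simp
      i_mul_j := rfl
      j_mul_i := by
        refine Matrix.ext fun i j => ?_
        fin_cases i <;> fin_cases j <;> simp
        all_goals ring }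
  refine ⟨ε.trans (basisEquiv two_ne_zero hD hb (by simp [Module.finrank_matrix]) q), ?_⟩
  rw [AlgEquiv.trans_apply, hε, basisEquiv_apply, lift_self_i]

theorem exists_extension_comp (hF : IsQuaternionAlgebra ℚ F)
    (hM : IsQuaternionAlgebra k M) (ι : F →ₐ[ℚ] M) (σ : k →ₐ[ℚ] ℚ_[p])
    (f : Comp p F →ₐ[ℚ_[p]] Matrix (Fin 2) (Fin 2) ℚ_[p]) :
    ∃ g : Comp p M →ₐ[ℚ_[p]] Matrix (Fin 2) (Fin 2) ℚ_[p],
      (∀ a : k, g (1 ⊗ₜ algebraMap k M a) = algebraMap ℚ_[p] _ (σ a)) ∧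
      ∀ x, g (compMap p ι x) = f x := by
  let : Algebra k ℚ_[p] := σ.toRingHom.toAlgebra
  have : IsScalarTower ℚ k ℚ_[p] := IsScalarTower.of_algebraMap_eq fun q => (σ.commutes q).symm
  obtain ⟨Ψ, hΨ⟩ := exists_extension (E' := k) two_ne_zero hF hM ι
    (B := Matrix (Fin 2) (Fin 2) ℚ_[p]) ((f.restrictScalars ℚ).comp
      (Algebra.TensorProduct.includeRight : F →ₐ[ℚ] Comp p F))
  let g : Comp p M →ₐ[ℚ_[p]] Matrix (Fin 2) (Fin 2) ℚ_[p] :=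
    Algebra.TensorProduct.lift (Algebra.ofId _ _) (Ψ.restrictScalars ℚ)
      fun q x => Algebra.commutes q _
  have hg : ∀ (q : ℚ_[p]) (x : M), g (q ⊗ₜ x) = q • Ψ x := by
    intro q x
    rw [Algebra.smul_def]
    rfl
  refine ⟨g, fun a => ?_, fun x => ?_⟩
  · rw [hg, one_smul, Ψ.commutes]
    rfl
  · induction x using TensorProduct.induction_on with
    | zero => simp
    | tmul q x =>
      have e1 : compMap p ι (q ⊗ₜ[ℚ] x) = q ⊗ₜ[ℚ] ι x := rfl
      have e2 : q ⊗ₜ[ℚ] x = q • ((1 : ℚ_[p]) ⊗ₜ[ℚ] x) := by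
        rw [TensorProduct.smul_tmul', smul_eq_mul, mul_one]
      rw [e1, hg, hΨ, e2, map_smul]
      rfl
    | add x y hx hy => simp only [map_add, hx, hy]

/-- The two embeddings of k extend the same representation of F to M in two ways. Their product is
onto because w separates the embeddings and so produces the idempotent (1, 0). -/
theorem exists_prod_equiv (hk : Module.finrank ℚ k = 2) (hF : IsQuaternionAlgebra ℚ F)
    (hM : IsQuaternionAlgebra k M) (ι : F →ₐ[ℚ] M) {σ σ' : k →ₐ[ℚ] ℚ_[p]} {w : k}
    (hw : σ w ≠ σ' w) (f : Comp p F ≃ₐ[ℚ_[p]] Matrix (Fin 2) (Fin 2) ℚ_[p]) :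
    ∃ e : Comp p M ≃ₐ[ℚ_[p]] Matrix (Fin 2) (Fin 2) ℚ_[p] × Matrix (Fin 2) (Fin 2) ℚ_[p],
      (∀ a : k, e (1 ⊗ₜ algebraMap k M a) = (algebraMap ℚ_[p] _ (σ a), algebraMap ℚ_[p] _ (σ' a))) ∧
      ∀ x, e (compMap p ι x) = (f x, f x) := by
  obtain ⟨g, hg, hgι⟩ := exists_extension_comp hF hM ι σ f.toAlgHom
  obtain ⟨g', hg', hgι'⟩ := exists_extension_comp hF hM ι σ' f.toAlgHom
  have h1 : ∀ a : k, g.prod g' (1 ⊗ₜ algebraMap k M a) =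
    (algebraMap ℚ_[p] _ (σ a), algebraMap ℚ_[p] _ (σ' a)) := fun a => Prod.ext (hg a) (hg' a)
  have h2 : ∀ x, g.prod g' (compMap p ι x) = (f x, f x) := fun x => Prod.ext (hgι x) (hgι' x)
  have hE : ((1, 0) : Matrix (Fin 2) (Fin 2) ℚ_[p] × Matrix (Fin 2) (Fin 2) ℚ_[p]) ∈
      (g.prod g').range := by
    have e : ((1, 0) : Matrix (Fin 2) (Fin 2) ℚ_[p] × Matrix (Fin 2) (Fin 2) ℚ_[p]) =
        (σ w - σ' w)⁻¹ • ((algebraMap ℚ_[p] _ (σ w), algebraMap ℚ_[p] _ (σ' w)) -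
          algebraMap ℚ_[p] _ (σ' w)) := by
      rw [eq_inv_smul_iff₀ (sub_ne_zero.2 hw)]
      refine Prod.ext ?_ ?_
      · change (σ w - σ' w) • (1 : Matrix (Fin 2) (Fin 2) ℚ_[p]) =
          algebraMap ℚ_[p] _ (σ w) - algebraMap ℚ_[p] _ (σ' w)
        rw [← map_sub, Algebra.algebraMap_eq_smul_one]
      · change (σ w - σ' w) • (0 : Matrix (Fin 2) (Fin 2) ℚ_[p]) =
          algebraMap ℚ_[p] _ (σ' w) - algebraMap ℚ_[p] _ (σ' w)
        rw [sub_self, smul_zero]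
    rw [e]
    exact Subalgebra.smul_mem _ (Subalgebra.sub_mem _ (AlgHom.mem_range _ |>.2 ⟨_, h1 w⟩)
      (Subalgebra.algebraMap_mem _ _)) _
  have hsurj : Function.Surjective (g.prod g') := by
    rintro ⟨X, Y⟩
    have hd : ∀ Z, ((Z, Z) : Matrix (Fin 2) (Fin 2) ℚ_[p] × Matrix (Fin 2) (Fin 2) ℚ_[p]) ∈
        (g.prod g').range := fun Z => ⟨_, (h2 (f.symm Z)).trans (by rw [f.apply_symm_apply])⟩
    have e : (X, Y) = (1, 0) * (X, X) + (1 - (1, 0)) * (Y, Y) := by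
      refine Prod.ext ?_ ?_ <;> simp
    change (X, Y) ∈ (g.prod g').range
    rw [e]
    exact Subalgebra.add_mem _ (Subalgebra.mul_mem _ hE (hd X))
      (Subalgebra.mul_mem _ (Subalgebra.sub_mem _ (Subalgebra.one_mem _) hE) (hd Y))
  have hM4 := finrank_of_isQuaternionAlgebra hM
  have : FiniteDimensional k M := Module.finite_of_finrank_pos (by omega)
  have : FiniteDimensional ℚ M := Module.Finite.trans k M
  have hdim : Module.finrank ℚ_[p] (Comp p M) = Module.finrank ℚ_[p]
      (Matrix (Fin 2) (Fin 2) ℚ_[p] × Matrix (Fin 2) (Fin 2) ℚ_[p]) := by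
    rw [Module.finrank_baseChange, ← Module.finrank_mul_finrank ℚ k M, hk, hM4,
      Module.finrank_prod, Module.finrank_matrix]
    simp
  have hinj := (LinearMap.injective_iff_surjective_of_finrank_eq_finrank
    (f := (g.prod g').toLinearMap) hdim).2 hsurj
  exact ⟨AlgEquiv.ofBijective (g.prod g') ⟨hinj, hsurj⟩, h1, h2⟩

theorem embeddingCount_split (hk : Module.finrank ℚ k = 2) (hF : IsQuaternionAlgebra ℚ F)
    (hM : IsQuaternionAlgebra k M) (ι : F →ₐ[ℚ] M) {a a' : ℤ_[p]} (haa : IsUnit (a - a'))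
    {σ σ' : k →ₐ[ℚ] ℚ_[p]} {w : NumberField.RingOfIntegers k} (hσ : σ w = a) (hσ' : σ' w = a')
    (hw : ∀ a : NumberField.RingOfIntegers k, ∃ x y : ℤ, a = x + y * w) {θ : Comp p F}
    (hθ : θ * θ = (-(a * a') : ℚ_[p]) • 1 + (a + a' : ℚ_[p]) • θ)
    (hns : ∀ r : ℚ_[p], θ ≠ algebraMap ℚ_[p] _ r)
    {G H : Subalgebra ℤ_[p] (Comp p F)} (hH : IsMaximalOrder p H)
    (hG : IsOrder p G) (hθG : θ ∈ G) (hGH : G ≤ H) :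
    (G = H → embeddingCount p k ι G = 1) ∧ (G ≠ H → embeddingCount p k ι G = 2) := by
  have hne : (a : ℚ_[p]) ≠ a' := by
    intro h
    rw [Subtype.ext h, sub_self] at haa
    exact not_isUnit_zero haa
  obtain ⟨f, hf⟩ := exists_diagonal_equiv (isQuaternionAlgebra_comp p hF) hne hθ hns
  obtain ⟨e, he1, he2⟩ := exists_prod_equiv hk hF hM ι (σ := σ) (σ' := σ') (w := (w : k)) (by rwa [hσ, hσ']) f
  let e' := e.restrictScalars ℤ_[p]
  let f' := f.restrictScalars ℤ_[p]
  have hew : e' (1 ⊗ₜ algebraMap k M w) = (algebraMap ℤ_[p] _ a, algebraMap ℤ_[p] _ a') := by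
    refine (he1 w).trans ?_
    rw [hσ, hσ']
    rfl
  have hpull : ∀ N : Subalgebra ℤ_[p] (Comp p F), N = (N.comap f'.symm.toAlgHom).comap f'.toAlgHom := by
    intro N
    ext x
    simp
  set G' := G.comap f'.symm.toAlgHom with hG'
  have hGG : G = G'.comap f'.toAlgHom := hpull G
  have hcount : embeddingCount p k ι G = Set.encard {N : Subalgebra ℤ_[p]
      (Matrix (Fin 2) (Fin 2) ℚ_[p] × Matrix (Fin 2) (Fin 2) ℚ_[p]) |
      (∃ N₁ N₂, Maximal IsLatticeOrder N₁ ∧ Maximal IsLatticeOrder N₂ ∧ N = N₁.prod N₂) ∧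
        N.comap ((AlgHom.id _ _).prod (AlgHom.id _ _)) = G'} := by
    rw [embeddingCount_eq_encard k ι e' (Q := fun N => IsLatticeOrder N ∧
      ((algebraMap ℤ_[p] _ a, algebraMap ℤ_[p] _ a') :
        Matrix (Fin 2) (Fin 2) ℚ_[p] × Matrix (Fin 2) (Fin 2) ℚ_[p]) ∈ N) (fun N => ?_) G]
    · congr 1
      ext N
      simp only [Set.mem_ofPred_eq]
      rw [maximal_prod_iff haa]
      refine and_congr_right fun _ => ?_
      have hcomp : e'.toAlgHom.comp (compMap p ι) =
        ((AlgHom.id ℤ_[p] _).prod (AlgHom.id ℤ_[p] _)).comp f'.toAlgHom := AlgHom.ext he2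
      rw [hcomp, hG']
      constructor
      · rintro h
        rw [← h]
        ext x
        simp
      · intro h
        change (N.comap ((AlgHom.id ℤ_[p] _).prod (AlgHom.id ℤ_[p] _))).comap f'.toAlgHom = G
        rw [h, ← hpull]
    · rw [isOrderOver_comap_iff e' hw, hew]
  have hiff : ∀ N, IsOrder p (N.comap f'.toAlgHom) ↔ IsLatticeOrder N := fun N => by
    rw [isOrder_iff_isLatticeOrder, isLatticeOrder_comap_iff]
  have hmax : Maximal IsLatticeOrder G' ↔ G = H := by
    rw [← maximal_comap_iff f' hiff, ← hGG]
    exact ⟨fun h => le_antisymm hGH (h.2 hH.1 hGH), fun h => h ▸ hH⟩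
  have hmem : !![(a : ℚ_[p]), 0; 0, (a' : ℚ_[p])] ∈ G' := by
    rw [← hf]
    change f.symm (f θ) ∈ G
    rwa [f.symm_apply_apply]
  have hG'o : IsLatticeOrder G' := (hiff G').1 (hGG ▸ hG)
  rw [hcount]
  obtain ⟨h1, h2⟩ := encard_pairs haa hG'o hmem
  exact ⟨fun h => h1 (hmax.2 h), fun h => h2 fun h' => h (hmax.1 h')⟩

end SplitCase

end LocalOrders

namespace LocalOrders

open QuadraticAlgebra hiding norm_neg norm_one norm_natCast norm_star norm_zero norm_algebraMap
open QuatEmb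
open scoped Matrix TensorProduct

/-! ### Factorization of p in a quadratic order, expressed by congruences. -/

section IntegralBasis

variable {R : Type*} [CommRing R] {w : R}

/-- `1, w` is a `ℤ`-basis of `R`. -/
structure IsIntegralBasis (w : R) : Prop where
  exists_eq : ∀ a : R, ∃ x y : ℤ, a = x + y * w
  eq_zero : ∀ x y : ℤ, (x + y * w : R) = 0 → x = 0 ∧ y = 0

namespace IsIntegralBasis

variable (h : IsIntegralBasis w)

include h

theorem eq_iff {x y x' y' : ℤ} : (x + y * w : R) = x' + y' * w ↔ x = x' ∧ y = y' := by
  refine ⟨fun e => ?_, fun e => by rw [e.1, e.2]⟩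
  have := h.eq_zero (x - x') (y - y') (by push_cast; linear_combination e)
  omega

theorem dvd_iff {n x y : ℤ} : (n : R) ∣ x + y * w ↔ n ∣ x ∧ n ∣ y := by
  constructor
  · rintro ⟨z, hz⟩
    obtain ⟨a, b, rfl⟩ := h.exists_eq z
    have e : (x + y * w : R) = (n * a : ℤ) + (n * b : ℤ) * w := by push_cast; rw [hz]; ring
    obtain ⟨rfl, rfl⟩ := h.eq_iff.1 e
    exact ⟨dvd_mul_right _ _, dvd_mul_right _ _⟩
  · rintro ⟨⟨a, rfl⟩, ⟨b, rfl⟩⟩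
    exact ⟨a + b * w, by push_cast; ring⟩

theorem sub_intCast (n : ℤ) : IsIntegralBasis (w - n) := by
  refine ⟨fun a => ?_, fun x y hxy => ?_⟩
  · obtain ⟨x, y, rfl⟩ := h.exists_eq a
    exact ⟨x + y * n, y, by push_cast; ring⟩
  · have := h.eq_zero (x - y * n) y (by push_cast; linear_combination hxy)
    obtain ⟨h1, rfl⟩ := this
    exact ⟨by simpa using h1, rfl⟩

theorem eq_zero_of_mul_eq_zero {p : ℕ} (hp : p.Prime) {z : R} (hz : (p : R) * z = 0) : z = 0 := by
  obtain ⟨x, y, rfl⟩ := h.exists_eq z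
  have := h.eq_zero (p * x) (p * y) (by push_cast; linear_combination hz)
  have hp0 : (p : ℤ) ≠ 0 := by exact_mod_cast hp.ne_zero
  rw [(mul_eq_zero.1 this.1).resolve_left hp0, (mul_eq_zero.1 this.2).resolve_left hp0]
  simp

/-- Otherwise (p) = PQ lies in pQ, and cancelling p gives 1 ∈ Q. -/
theorem not_le_span {p : ℕ} (hp : p.Prime) {P Q : Ideal R} (hQ : Q.IsPrime)
    (hPQ : Ideal.span {(p : R)} = P * Q) : ¬ P ≤ Ideal.span {(p : R)} := by
  intro hle
  have h1 : (p : R) ∈ Ideal.span {(p : R)} * Q := by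
    refine Ideal.mul_mono_left hle ?_
    rw [← hPQ]
    exact Ideal.mem_span_singleton_self _
  rw [Ideal.mem_span_singleton_mul] at h1
  obtain ⟨z, hz, hzp⟩ := h1
  refine hQ.ne_top (Q.eq_top_iff_one.2 ?_)
  have := h.eq_zero_of_mul_eq_zero hp (z := z - 1) (by linear_combination hzp)
  rwa [← sub_eq_zero.1 this]

/-- An element x + yw of P outside (p) has y prime to p, so w is congruent to an integer n modulo P.
Thus P has residue field of p elements and is the kernel of w ↦ n. -/
theorem exists_mem_iff {p : ℕ} (hp : p.Prime) {P : Ideal R} (hP : P.IsPrime) (hpP : (p : R) ∈ P)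
    (hne : ¬ P ≤ Ideal.span {(p : R)}) :
    ∃ n : ℤ, ∀ x y : ℤ, (x + y * w : R) ∈ P ↔ (p : ℤ) ∣ x + y * n := by
  have hpp : Prime (p : ℤ) := Nat.prime_iff_prime_int.1 hp
  have hint : ∀ x : ℤ, (x : R) ∈ P ↔ (p : ℤ) ∣ x := by
    intro x
    refine ⟨fun hx => ?_, ?_⟩
    · by_contra hndvd
      obtain ⟨a, b, hab⟩ := (hpp.coprime_iff_not_dvd).2 hndvd
      refine hP.ne_top (P.eq_top_iff_one.2 ?_)
      have e : (1 : R) = a * p + b * x := by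
        have := congrArg (Int.cast : ℤ → R) hab
        push_cast at this
        exact this.symm
      rw [e]
      exact P.add_mem (P.mul_mem_left _ hpP) (P.mul_mem_left _ hx)
    · rintro ⟨y, rfl⟩
      push_cast
      exact P.mul_mem_right _ hpP
  obtain ⟨z, hzP, hz⟩ := Set.not_subset.1 hne
  obtain ⟨x, y, rfl⟩ := h.exists_eq z
  have hy : ¬ (p : ℤ) ∣ y := by
    rintro ⟨b, rfl⟩
    apply hz
    have hx : (x : R) ∈ P := by
      have e : (x : R) = (x + (p * b : ℤ) * w) - p * (b * w) := by push_cast; ring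
      rw [e]
      exact P.sub_mem hzP (P.mul_mem_right _ hpP)
    rw [SetLike.mem_coe, Ideal.mem_span_singleton]
    have := h.dvd_iff (n := p) (x := x) (y := p * b)
    push_cast at this
    push_cast
    exact this.2 ⟨(hint x).1 hx, dvd_mul_right _ _⟩
  obtain ⟨a, b, hab⟩ := (hpp.coprime_iff_not_dvd).2 hy
  have hw : w - (-(b * x) : ℤ) ∈ P := by
    have hab' : (a * p + b * y : R) = 1 := by exact_mod_cast congrArg (Int.cast : ℤ → R) hab
    have e : w - (-(b * x) : ℤ) = b * (x + y * w) + (a * w) * p := by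
      push_cast
      linear_combination -w * hab'
    rw [e]
    exact P.add_mem (P.mul_mem_left _ hzP) (P.mul_mem_left _ hpP)
  refine ⟨-(b * x), fun x' y' => ?_⟩
  rw [← hint]
  have e : (x' + y' * w : R) = y' * (w - (-(b * x) : ℤ)) + (x' + y' * (-(b * x)) : ℤ) := by
    push_cast
    ring
  rw [e]
  exact P.add_mem_iff_right (P.mul_mem_left _ hw)

variable {c t : ℤ} (hw : w * w = c + t * w)

include hw

theorem sub_mul_sub (n m : ℤ) :
    (w - n) * (w - m) = ((c + n * m : ℤ) : R) + ((t - n - m : ℤ) : R) * w := by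
  push_cast
  linear_combination hw

/-- A root n modulo p would put (w - n)(w - (t - n)) into the prime ideal (p), which contains
neither factor. -/
theorem not_dvd_of_inert {p : ℕ} (hp : p.Prime) (hP : (Ideal.span {(p : R)}).IsPrime) (n : ℤ) :
    ¬ (p : ℤ) ∣ n ^ 2 - t * n - c := by
  intro hdvd
  have hmem : ∀ m : ℤ, w - m ∉ Ideal.span {(p : R)} := by
    intro m hm
    rw [Ideal.mem_span_singleton] at hm
    have := h.dvd_iff (n := p) (x := -m) (y := 1)
    push_cast at this
    rw [show (-m + 1 * w : R) = w - m by ring] at this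
    exact (Nat.prime_iff_prime_int.1 hp).not_dvd_one (this.1 hm).2
  have h1 : (w - n) * (w - (t - n : ℤ)) ∈ Ideal.span {(p : R)} := by
    rw [h.sub_mul_sub hw, Ideal.mem_span_singleton]
    have := h.dvd_iff (n := p) (x := c + n * (t - n)) (y := t - n - (t - n))
    push_cast at this
    push_cast
    refine this.2 ⟨?_, by simp⟩
    rw [show c + n * (t - n) = -(n ^ 2 - t * n - c) by ring]
    exact (dvd_neg).2 hdvd
  rcases hP.mem_or_mem h1 with h2 | h2
  · exact hmem _ h2
  · exact hmem _ h2

/-- With n the residue of w modulo P, (w - n)² ∈ P² = (p), so the polynomial of w - n is X² modulo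
p. If p² divided its constant term, (w - n)/p would be integral, which `hcl` turns into p ∣ w - n.
-/
theorem exists_eisenstein {p : ℕ} (hp : p.Prime) {P : Ideal R} (hP : P.IsPrime)
    (hPp : Ideal.span {(p : R)} = P ^ 2)
    (hcl : ∀ (z : R) (a b : ℤ), z * z = (p : R) * p * a + p * b * z → (p : R) ∣ z) :
    ∃ n : ℤ, (p : ℤ) ∣ c + t * n - n ^ 2 ∧ ¬ (p : ℤ) ^ 2 ∣ c + t * n - n ^ 2 ∧
      (p : ℤ) ∣ t - 2 * n := by
  have hpP : (p : R) ∈ P := by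
    have : (p : R) ∈ P ^ 2 := by rw [← hPp]; exact Ideal.mem_span_singleton_self _
    exact Ideal.pow_le_self two_ne_zero this
  obtain ⟨n, hn⟩ := h.exists_mem_iff hp hP hpP (h.not_le_span hp hP (by rw [hPp, pow_two]))
  have hmem : w - n ∈ P := by
    have := (hn (-n) 1).2 (by simp)
    push_cast at this
    rwa [show (-n + 1 * w : R) = w - n by ring] at this
  have h2 : (w - n) * (w - n) ∈ Ideal.span {(p : R)} := by
    rw [hPp, pow_two]
    exact Ideal.mul_mem_mul hmem hmem
  have hW := h.sub_intCast n
  have hsq : (w - n) * (w - n) = ((c + t * n - n ^ 2 : ℤ) : R) + ((t - 2 * n : ℤ) : R) * (w - n) := by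
    push_cast
    linear_combination hw
  rw [hsq, Ideal.mem_span_singleton] at h2
  have h3 := (hW.dvd_iff (n := p)).1 (by exact_mod_cast h2)
  refine ⟨n, h3.1, ?_, h3.2⟩
  rintro ⟨a, ha⟩
  obtain ⟨b, hb⟩ := h3.2
  have h4 := hcl (w - n) a b (by
    rw [hsq, ha, hb]
    push_cast
    ring)
  have := hW.dvd_iff (n := p) (x := 0) (y := 1)
  push_cast at this
  rw [zero_add, one_mul] at this
  exact (Nat.prime_iff_prime_int.1 hp).not_dvd_one (this.1 h4).2

theorem exists_split {p : ℕ} (hp : p.Prime) {P Q : Ideal R} (hP : P.IsPrime) (hQ : Q.IsPrime)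
    (hPQ : P ≠ Q) (hp' : Ideal.span {(p : R)} = P * Q) :
    ∃ n m : ℤ, (p : ℤ) ∣ c + n * m ∧ (p : ℤ) ∣ t - n - m ∧ ¬ (p : ℤ) ∣ n - m := by
  have hpPQ : (p : R) ∈ P * Q := by rw [← hp']; exact Ideal.mem_span_singleton_self _
  have hpP : (p : R) ∈ P := Ideal.mul_le_left hpPQ
  have hpQ : (p : R) ∈ Q := Ideal.mul_le_right hpPQ
  obtain ⟨n, hn⟩ := h.exists_mem_iff hp hP hpP (h.not_le_span hp hQ hp')
  obtain ⟨m, hm⟩ := h.exists_mem_iff hp hQ hpQ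
    (h.not_le_span hp hP (by rw [hp', mul_comm]))
  have hmem : ∀ {P : Ideal R} {n : ℤ}, (∀ x y : ℤ, (x + y * w : R) ∈ P ↔ (p : ℤ) ∣ x + y * n) →
      w - n ∈ P := by
    intro P n hn
    have := (hn (-n) 1).2 (by simp)
    push_cast at this
    rwa [show (-n + 1 * w : R) = w - n by ring] at this
  have h1 := Ideal.mul_mem_mul (hmem hn) (hmem hm)
  rw [← hp', h.sub_mul_sub hw, Ideal.mem_span_singleton] at h1
  have h2 := (h.dvd_iff (n := p)).1 (by exact_mod_cast h1)
  refine ⟨n, m, h2.1, h2.2, fun hnm => hPQ (Ideal.ext fun z => ?_)⟩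
  obtain ⟨x, y, rfl⟩ := h.exists_eq z
  rw [hn, hm]
  have e : x + y * n = x + y * m + y * (n - m) := by ring
  rw [e]
  exact dvd_add_left (hnm.mul_left y)

end IsIntegralBasis

end IntegralBasis

end LocalOrders

namespace LocalOrders

open QuadraticAlgebra hiding norm_neg norm_one norm_natCast norm_star norm_zero norm_algebraMap
open QuatEmb
open scoped Matrix TensorProduct NumberField

/-! ### Existence of an integral basis containing 1. -/

section Rank

/-- By `hpure` the quotient R/ℤ is torsion-free, hence free, and it has rank 1; w lifts a generator.
-/
theorem exists_isIntegralBasis_of_finrank {R : Type*} [CommRing R] [IsDomain R] [CharZero R]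
    [Module.Finite ℤ R] (hR : Module.finrank ℤ R = 2)
    (hpure : ∀ (n m : ℤ) (z : R), n ≠ 0 → n * z = m → ∃ r : ℤ, z = r) :
    ∃ w : R, IsIntegralBasis w := by
  let S : Submodule ℤ R := Submodule.span ℤ {1}
  have hS : ∀ x : R, S.mkQ x = 0 ↔ ∃ r : ℤ, x = r := by
    intro x
    rw [← LinearMap.mem_ker, Submodule.ker_mkQ, Submodule.mem_span_singleton]
    simp only [zsmul_eq_mul, mul_one, eq_comm]
  have hsurj := S.mkQ_surjective
  have htf : Module.IsTorsionFree ℤ (R ⧸ S) := by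
    refine Module.IsTorsionFree.of_smul_eq_zero fun n v h => ?_
    obtain ⟨z, rfl⟩ := hsurj v
    rw [← map_smul, hS] at h
    obtain ⟨m, hm⟩ := h
    rw [or_iff_not_imp_left]
    intro hn
    rw [hS]
    exact hpure n m z hn (by rw [← hm, zsmul_eq_mul])
  have hrk : Module.finrank ℤ (R ⧸ S) = 1 := by
    have h1 := Submodule.finrank_quotient_add_finrank S
    have h2 : Module.finrank ℤ S = 1 := by
      rw [← (LinearEquiv.toSpanNonzeroSingleton ℤ R 1 one_ne_zero).finrank_eq, Module.finrank_self]
    rw [hR, h2] at h1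
    omega
  have : Module.Free ℤ (R ⧸ S) := Module.free_of_finite_type_torsion_free'
  obtain ⟨v, hv, hv'⟩ := finrank_eq_one_iff'.1 hrk
  obtain ⟨w, rfl⟩ := hsurj v
  refine ⟨w, fun a => ?_, fun x y hxy => ?_⟩
  · obtain ⟨y, hy⟩ := hv' (S.mkQ a)
    rw [← map_smul, eq_comm, ← sub_eq_zero, ← map_sub, hS] at hy
    obtain ⟨x, hx⟩ := hy
    refine ⟨x, y, ?_⟩
    rw [← hx, zsmul_eq_mul]
    ring
  · have hy : y = 0 := by
      by_contra hy
      exact hv ((hS w).2 (hpure y (-x) w hy (by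
        push_cast
        linear_combination hxy)))
    subst hy
    refine ⟨?_, rfl⟩
    simpa using hxy

end Rank

/-! ### Integers and embeddings of the quadratic field. -/

section QuadraticField

variable {k : Type*} [Field k] [NumberField k]

theorem exists_intCast_of_mul_eq {n m : ℤ} (hn : n ≠ 0) {z : 𝓞 k} (h : (n : 𝓞 k) * z = m) :
    ∃ r : ℤ, z = r := by
  have hz : (z : k) = algebraMap ℚ k (m / n) := by
    have h1 := congrArg (algebraMap (𝓞 k) k) h
    simp only [map_mul, map_intCast] at h1
    have h2 : (n : k) ≠ 0 := by exact_mod_cast hn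
    rw [map_div₀, map_intCast, map_intCast, eq_div_iff h2, mul_comm]
    exact h1
  have hint : IsIntegral ℤ (m / n : ℚ) := by
    rw [← isIntegral_algebraMap_iff (algebraMap ℚ k).injective, ← hz]
    exact z.2
  obtain ⟨r, hr⟩ := IsIntegrallyClosed.isIntegral_iff.1 hint
  refine ⟨r, ?_⟩
  apply NumberField.RingOfIntegers.ext
  rw [hz, ← hr]
  simp

theorem exists_isIntegralBasis (hk : Module.finrank ℚ k = 2) :
    ∃ w : 𝓞 k, IsIntegralBasis w :=
  exists_isIntegralBasis_of_finrank ((NumberField.RingOfIntegers.rank k).trans hk)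
    fun _ _ _ hn h => exists_intCast_of_mul_eq hn h

/-- z/p is a root of X² - bX - a, hence integral. -/
theorem dvd_of_mul_self_eq {p : ℕ} (hp : p ≠ 0) (z : 𝓞 k) (a b : ℤ)
    (h : z * z = (p : 𝓞 k) * p * a + p * b * z) : (p : 𝓞 k) ∣ z := by
  have hp' : (p : k) ≠ 0 := by exact_mod_cast hp
  have h1 : (z : k) * z = p * p * a + p * b * z := by
    simpa using congrArg (algebraMap (𝓞 k) k) h
  have hint : IsIntegral ℤ ((z : k) / p) := by
    refine ⟨Polynomial.X ^ 2 - (Polynomial.C b * Polynomial.X + Polynomial.C a), ?_, ?_⟩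
    · exact Polynomial.monic_X_pow_sub (by compute_degree!)
    · simp only [Polynomial.eval₂_sub, Polynomial.eval₂_add, Polynomial.eval₂_mul,
        Polynomial.eval₂_pow, Polynomial.eval₂_X, Polynomial.eval₂_C]
      simp only [eq_intCast]
      field_simp
      linear_combination h1
  obtain ⟨y, hy⟩ : ∃ y : 𝓞 k, (y : k) = z / p := ⟨⟨_, hint⟩, rfl⟩
  refine ⟨y, NumberField.RingOfIntegers.ext ?_⟩
  have e : ((p * y : 𝓞 k) : k) = p * (y : k) := by simp
  rw [e, hy, mul_div_cancel₀ _ hp']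

theorem IsIntegralBasis.eq_zero_of_rat {w : 𝓞 k} (hW : IsIntegralBasis w) {x y : ℚ}
    (h : algebraMap ℚ k x + algebraMap ℚ k y * w = 0) : x = 0 ∧ y = 0 := by
  have hx : (x.den : k) ≠ 0 := by exact_mod_cast x.den_nz
  have hy : (y.den : k) ≠ 0 := by exact_mod_cast y.den_nz
  rw [← Rat.num_div_den x, ← Rat.num_div_den y] at h
  simp only [map_div₀, map_intCast, map_natCast] at h
  field_simp at h
  have h2 : ((x.num * y.den : ℤ) + (y.num * x.den : ℤ) * w : 𝓞 k) = 0 := by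
    apply NumberField.RingOfIntegers.ext
    simp only [map_add, map_mul, map_intCast, map_zero]
    push_cast
    linear_combination h
  have h3 := hW.eq_zero _ _ h2
  have hx' : (x.den : ℤ) ≠ 0 := by exact_mod_cast x.den_nz
  have hy' : (y.den : ℤ) ≠ 0 := by exact_mod_cast y.den_nz
  exact ⟨Rat.num_eq_zero.1 ((mul_eq_zero.1 h3.1).resolve_right hy'),
    Rat.num_eq_zero.1 ((mul_eq_zero.1 h3.2).resolve_right hx')⟩

theorem exists_algHom (hk : Module.finrank ℚ k = 2) {w : 𝓞 k} (hW : IsIntegralBasis w) {c t : ℤ}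
    (hw : w * w = c + t * w) {A : Type*} [CommRing A] [Algebra ℚ A] {v : A}
    (hv : v * v = c + t * v) : ∃ σ : k →ₐ[ℚ] A, σ w = v := by
  have hwk : (w : k) * w = c + t * w := by
    simpa using congrArg (algebraMap (𝓞 k) k) hw
  let g : QuadraticAlgebra ℚ c t →ₐ[ℚ] k := QuadraticAlgebra.lift ⟨(w : k), by
    rw [hwk]
    simp [Algebra.smul_def]⟩
  let g' : QuadraticAlgebra ℚ c t →ₐ[ℚ] A := QuadraticAlgebra.lift ⟨v, by
    rw [hv]
    simp [Algebra.smul_def]⟩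
  have hg : g omega = w := by simp [g]
  have hg' : g' omega = v := by simp [g']
  have hinj : Function.Injective g := by
    rw [injective_iff_map_eq_zero]
    intro x hx
    have hx' : algebraMap ℚ k x.re + algebraMap ℚ k x.im * w = 0 := by
      simpa [g, Algebra.smul_def] using hx
    obtain ⟨h1, h2⟩ := hW.eq_zero_of_rat hx'
    exact QuadraticAlgebra.ext h1 h2
  have hsurj : Function.Surjective g :=
    (LinearMap.injective_iff_surjective_of_finrank_eq_finrank (f := g.toLinearMap)
      (by rw [hk, QuadraticAlgebra.finrank_eq_two])).1 hinj
  let e := AlgEquiv.ofBijective g ⟨hinj, hsurj⟩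
  refine ⟨g'.comp e.symm.toAlgHom, ?_⟩
  have : e.symm (w : k) = omega := by
    rw [AlgEquiv.symm_apply_eq]
    exact hg.symm
  change g' (e.symm (w : k)) = v
  rw [this, hg']

end QuadraticField

end LocalOrders

namespace LocalOrders

open QuadraticAlgebra hiding norm_neg norm_one norm_natCast norm_star norm_zero norm_algebraMap
open QuatEmb
open scoped Matrix TensorProduct NumberField

/-! ### Degree and discriminant of k. -/

section Discriminant

variable {k : Type*} [Field k] [NumberField k]

theorem finrank_eq_two_of_sq_eq {d : ℕ} (hd : d ≠ 0) {s : k} (hs : s ^ 2 = -(d : k))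
    (hk : IntermediateField.adjoin ℚ {s} = ⊤) : Module.finrank ℚ k = 2 := by
  have hint : IsIntegral ℚ s := Algebra.IsIntegral.isIntegral s
  have h1 : Module.finrank ℚ k = (minpoly ℚ s).natDegree := by
    rw [← IntermediateField.adjoin.finrank hint, hk, IntermediateField.finrank_top']
  have h2 : (minpoly ℚ s).natDegree ≤ 2 := by
    have hm : (Polynomial.X ^ 2 + Polynomial.C (d : ℚ)).Monic :=
      Polynomial.monic_X_pow_add_C _ two_ne_zero
    have := Polynomial.natDegree_le_natDegree (minpoly.min ℚ s hm (by simp [hs]))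
    rwa [Polynomial.natDegree_X_pow_add_C] at this
  have h3 := minpoly.natDegree_pos hint
  have h4 : (minpoly ℚ s).natDegree ≠ 1 := by
    intro h
    obtain ⟨q, rfl⟩ := minpoly.natDegree_eq_one_iff.1 h
    have h5 : q ^ 2 = -(d : ℚ) := by
      apply (algebraMap ℚ k).injective
      rw [map_pow, hs, map_neg, map_natCast]
    have h6 : (0 : ℚ) < d := by exact_mod_cast Nat.pos_of_ne_zero hd
    nlinarith [sq_nonneg q]
  omega

theorem disc_eq {R : Type*} [CommRing R] {w s : R} (h : IsIntegralBasis w) {c t : ℤ}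
    (hw : w * w = c + t * w) {d : ℕ} (hd : Squarefree d) (hd4 : d % 4 = 1 ∨ d % 4 = 2)
    (hs : s ^ 2 = -(d : R)) : t ^ 2 + 4 * c = -4 * d := by
  obtain ⟨x, y, rfl⟩ := h.exists_eq s
  have h1 := h.eq_zero (x ^ 2 + y ^ 2 * c + d) (2 * x * y + y ^ 2 * t) (by
    push_cast
    linear_combination hs - (y : R) ^ 2 * hw)
  obtain ⟨h2, h3⟩ := h1
  have hd0 : (0 : ℤ) < d := by exact_mod_cast Nat.pos_of_ne_zero hd.ne_zero
  have hy : y ≠ 0 := by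
    rintro rfl
    nlinarith [sq_nonneg x]
  have h4 : 2 * x + y * t = 0 := by
    have : y * (2 * x + y * t) = 0 := by linear_combination h3
    exact (mul_eq_zero.1 this).resolve_left hy
  have h5 : y ^ 2 * (t ^ 2 + 4 * c) = -4 * d := by
    linear_combination 4 * h2 + (y * t - 2 * x) * h4
  have hsq : Squarefree (d : ℤ) := Int.squarefree_natCast.2 hd
  have hunit : ∀ z : ℤ, z * z ∣ d → z ^ 2 = 1 := by
    intro z hz
    have := hsq z hz
    rcases Int.isUnit_iff.1 this with rfl | rfl <;> norm_num
  rcases Int.even_or_odd' y with ⟨z, rfl | rfl⟩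
  -- For even y, squarefreeness gives z² = 1, and -d = t² + 4c would be 0 or 1 modulo 4. The
  -- hypothesis `hd4` excludes this.
  · have h6 : z ^ 2 * (t ^ 2 + 4 * c) = -d := by linarith
    have h7 := hunit z ⟨-(t ^ 2 + 4 * c), by linear_combination h6⟩
    rw [h7, one_mul] at h6
    rcases Int.even_or_odd' t with ⟨u, rfl | rfl⟩
    · ring_nf at h6
      omega
    · ring_nf at h6
      omega
  · have hcop : IsCoprime ((2 * z + 1) * (2 * z + 1)) (4 : ℤ) :=
      ⟨1, -(z ^ 2 + z), by ring⟩
    have h7 := hunit (2 * z + 1) (hcop.dvd_of_dvd_mul_left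
      ⟨-(t ^ 2 + 4 * c), by linear_combination h5⟩)
    rw [h7, one_mul] at h5
    exact h5

end Discriminant

/-! ### Passage from integer congruences to p-adic statements. -/

section Padic

variable {p : ℕ} [Fact p.Prime]

theorem norm_intCast_eq_one {n : ℤ} (h : ¬ (p : ℤ) ∣ n) : ‖(n : ℚ_[p])‖ = 1 :=
  le_antisymm (Padic.norm_int_le_one n) (not_lt.1 fun h' => h (Padic.norm_intCast_lt_one_iff.1 h'))

theorem norm_root_of_inert {c t : ℤ} (h : ∀ n : ℤ, ¬ (p : ℤ) ∣ n ^ 2 - t * n - c) (r : ℚ_[p])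
    (hr : ‖r‖ ≤ 1) : ‖r ^ 2 - t * r - c‖ = 1 := by
  let r' : ℤ_[p] := ⟨r, hr⟩
  obtain ⟨n, hn⟩ := PadicInt.denseRange_intCast.exists_dist_lt r' one_pos
  have hn' : ‖r - n‖ < 1 := by
    rw [dist_eq_norm] at hn
    exact hn
  have h1 := norm_intCast_eq_one (h n)
  push_cast at h1
  have h2 : ‖(r ^ 2 - t * r - c) - (n ^ 2 - t * n - c : ℚ_[p])‖ < 1 := by
    have e : (r ^ 2 - t * r - c) - (n ^ 2 - t * n - c : ℚ_[p]) = (r - n) * (r + n - t) := by ring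
    rw [e, norm_mul]
    have h3 : ‖r + n - (t : ℚ_[p])‖ ≤ 1 :=
      padic_norm_sub_le (padic_norm_add_le hr (Padic.norm_int_le_one n)) (Padic.norm_int_le_one t)
    nlinarith [norm_nonneg (r - n), norm_nonneg (r + n - (t : ℚ_[p]))]
  by_contra hne
  have h4 := Padic.add_eq_max_of_ne (p := p) (q := r ^ 2 - t * r - c - (n ^ 2 - t * n - c : ℚ_[p]))
    (r := (n ^ 2 - t * n - c : ℚ_[p])) (by rw [h1]; exact h2.ne)
  rw [sub_add_cancel, h1, max_eq_right h2.le] at h4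
  exact hne h4

theorem norm_eq_inv_of_dvd {n : ℤ} (h : (p : ℤ) ∣ n) (h2 : ¬ (p : ℤ) ^ 2 ∣ n) :
    ‖(n : ℚ_[p])‖ = (p : ℝ)⁻¹ := by
  obtain ⟨m, rfl⟩ := h
  have hm : ¬ (p : ℤ) ∣ m := by
    rintro ⟨l, rfl⟩
    exact h2 ⟨l, by ring⟩
  push_cast
  rw [norm_mul, norm_intCast_eq_one hm, mul_one, Padic.norm_p]

theorem norm_le_inv_of_dvd {n : ℤ} (h : (p : ℤ) ∣ n) : ‖(n : ℚ_[p])‖ ≤ (p : ℝ)⁻¹ := by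
  obtain ⟨m, rfl⟩ := h
  push_cast
  rw [norm_mul, Padic.norm_p]
  exact mul_le_of_le_one_right (by positivity) (Padic.norm_int_le_one m)

/-- n is a root of X² - tX - c modulo p, with derivative 2n - t ≡ n - m a unit. Hensel's lemma lifts
it to a, and the other root is t - a. -/
theorem exists_roots {c t n m : ℤ} (h1 : (p : ℤ) ∣ c + n * m) (h2 : (p : ℤ) ∣ t - n - m)
    (h3 : ¬ (p : ℤ) ∣ n - m) :
    ∃ a a' : ℤ_[p], IsUnit (a - a') ∧ a + a' = t ∧ a * a' = -c := by
  let f : Polynomial ℤ_[p] := Polynomial.X ^ 2 - Polynomial.C (t : ℤ_[p]) * Polynomial.X -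
    Polynomial.C (c : ℤ_[p])
  have hf : ∀ a : ℤ_[p], Polynomial.aeval a f = a ^ 2 - t * a - c := fun a => by simp [f]
  have hf' : ∀ a : ℤ_[p], Polynomial.aeval a f.derivative = 2 * a - t := fun a => by
    simp [f, one_add_one_eq_two]
  have hd : ¬ (p : ℤ) ∣ 2 * n - t := by
    intro h
    apply h3
    have := dvd_add h h2
    rwa [show 2 * n - t + (t - n - m) = n - m by ring] at this
  have hv : (p : ℤ) ∣ n ^ 2 - t * n - c := by
    have := dvd_add (h1.mul_left (-1)) (h2.mul_left (-n))
    rwa [show -1 * (c + n * m) + -n * (t - n - m) = n ^ 2 - t * n - c by ring] at this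
  have hunit : ∀ l : ℤ, ¬ (p : ℤ) ∣ l → ‖(l : ℤ_[p])‖ = 1 := by
    intro l hl
    rw [PadicInt.norm_def, PadicInt.coe_intCast]
    exact norm_intCast_eq_one hl
  have hlt : ∀ l : ℤ, (p : ℤ) ∣ l → ‖(l : ℤ_[p])‖ < 1 := by
    intro l hl
    rw [PadicInt.norm_def, PadicInt.coe_intCast]
    exact Padic.norm_intCast_lt_one_iff.2 hl
  have e1 : ‖Polynomial.aeval (n : ℤ_[p]) f.derivative‖ = 1 := by
    rw [hf']
    exact_mod_cast hunit _ hd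
  obtain ⟨a, ha, han, -, -⟩ := hensels_lemma (F := f) (a := (n : ℤ_[p])) (by
    rw [e1, hf, one_pow]
    exact_mod_cast hlt _ hv)
  rw [e1] at han
  rw [hf] at ha
  refine ⟨a, t - a, ?_, by ring, by linear_combination -ha⟩
  rw [PadicInt.isUnit_iff]
  by_contra hne
  have h5 : ‖a - (t - a)‖ < 1 := lt_of_le_of_ne (PadicInt.norm_le_one _) hne
  have h6 : ‖(-2 : ℤ_[p]) * (a - n)‖ < 1 := by
    rw [norm_mul]
    exact mul_lt_one_of_nonneg_of_lt_one_right (PadicInt.norm_le_one _) (norm_nonneg _) han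
  have h7 := (PadicInt.nonarchimedean _ _).trans_lt (max_lt h5 h6)
  rw [show a - (t - a) + -2 * (a - n) = ((2 * n - t : ℤ) : ℤ_[p]) by push_cast; ring,
    hunit _ hd] at h7
  exact lt_irrefl _ h7

end Padic

/-! ### A generator of 𝔒_p. -/

section Generator

variable {p : ℕ} [Fact p.Prime] {k : Type*} [Field k] [NumberField k] {F : Type*} [Ring F]
  [Algebra ℚ F]

/-- θ is the image of w under 𝔬_p ≅ 𝔒_p. If θ were a scalar r, then a p-power multiple of w would be
a scalar in k_p, and all embeddings of k into ℚ_p would agree on w. -/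
theorem exists_generator {Op : Subalgebra ℤ_[p] (Comp p F)}
    (hOp : Nonempty (Op ≃ₐ[ℤ_[p]] integersAt p k)) {w : 𝓞 k} {c t : ℤ} (hw : w * w = c + t * w) :
    ∃ θ ∈ Op, θ * θ = (c : ℚ_[p]) • 1 + (t : ℚ_[p]) • θ ∧
      ∀ σ σ' : k →ₐ[ℚ] ℚ_[p], σ w ≠ σ' w → ∀ r : ℚ_[p], θ ≠ algebraMap ℚ_[p] _ r := by
  obtain ⟨e⟩ := hOp
  let v : integersAt p k := ⟨(1 : ℚ_[p]) ⊗ₜ[ℚ] (w : k), Algebra.subset_adjoin ⟨w, rfl⟩⟩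
  have hv : v * v = c + t * v := by
    apply Subtype.ext
    have hwk : (w : k) * w = c + t * w := by simpa using congrArg (algebraMap (𝓞 k) k) hw
    have e1 := congrArg (Algebra.TensorProduct.includeRight : k →ₐ[ℚ] Comp p k) hwk
    simp only [map_add, map_mul, map_intCast] at e1
    push_cast
    exact e1
  have hθ : e.symm v * e.symm v = c + t * e.symm v := by
    rw [← map_mul, hv, map_add, map_mul, map_intCast, map_intCast]
  refine ⟨e.symm v, (e.symm v).2, ?_, fun σ σ' hne r hr => hne ?_⟩
  · have := congrArg Subtype.val hθ
    push_cast at this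
    rw [this, Algebra.smul_def, Algebra.smul_def, map_intCast, map_intCast, mul_one]
  · obtain ⟨N, z, hz⟩ := exists_p_pow_mul_eq r
    have h1 : (p : ℤ_[p]) ^ N • e.symm v = algebraMap ℤ_[p] Op z := by
      apply Subtype.ext
      change (p : ℤ_[p]) ^ N • (e.symm v : Comp p F) = algebraMap ℤ_[p] (Comp p F) z
      rw [hr, Algebra.smul_def, IsScalarTower.algebraMap_apply ℤ_[p] ℚ_[p],
        IsScalarTower.algebraMap_apply ℤ_[p] ℚ_[p] (Comp p F) z, ← map_mul, map_pow, map_natCast, hz]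
      rfl
    have h2 : (p : ℤ_[p]) ^ N • v = algebraMap ℤ_[p] _ z := by
      rw [← e.apply_symm_apply v, ← map_smul, h1, AlgEquiv.commutes]
    have h3 : (p : ℤ_[p]) ^ N • ((1 : ℚ_[p]) ⊗ₜ[ℚ] (w : k)) = algebraMap ℤ_[p] (Comp p k) z :=
      congrArg Subtype.val h2
    have h4 : ∀ τ : k →ₐ[ℚ] ℚ_[p], (p : ℚ_[p]) ^ N * τ w = z := by
      intro τ
      let g : Comp p k →ₐ[ℚ_[p]] ℚ_[p] :=
        Algebra.TensorProduct.lift (Algebra.ofId _ _) τ fun _ _ => Commute.all _ _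
      have h5 := congrArg (g.restrictScalars ℤ_[p]) h3
      rw [map_smul, AlgHom.commutes, Algebra.smul_def, map_pow, map_natCast] at h5
      have h6 : g ((1 : ℚ_[p]) ⊗ₜ[ℚ] (w : k)) = τ w := by simp [g]
      rw [← h6]
      exact h5
    exact mul_left_cancel₀ (pow_ne_zero N (by exact_mod_cast (Fact.out : p.Prime).ne_zero))
      ((h4 σ).trans (h4 σ').symm)

end Generator

end LocalOrders

namespace LocalOrders

open QuadraticAlgebra hiding norm_neg norm_one norm_natCast norm_star norm_zero norm_algebraMap
open QuatEmb
open scoped Matrix TensorProduct NumberField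

/-! ### The three cases for the quadratic field k. -/

section Global

variable {p : ℕ} [Fact p.Prime] {k : Type*} [Field k] [NumberField k] {F M : Type*}
    [Ring F] [Algebra ℚ F] [Ring M] [Algebra ℚ M] [Algebra k M] [IsScalarTower ℚ k M]
    {w : 𝓞 k} {c t : ℤ} {Fp Op Gp : Subalgebra ℤ_[p] (Comp p F)}

theorem embeddingCount_of_isSplitPrime (hk : Module.finrank ℚ k = 2) (hF : IsQuaternionAlgebra ℚ F)
    (hM : IsQuaternionAlgebra k M) (ι : F →ₐ[ℚ] M) (hW : IsIntegralBasis w)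
    (hw : w * w = c + t * w) (hFp : IsMaximalOrder p Fp) (hGp : IsOrder p Gp)
    (hOp : Nonempty (Op ≃ₐ[ℤ_[p]] integersAt p k)) (hOG : Op ≤ Gp) (hGF : Gp ≤ Fp)
    (hsplit : IsSplitPrime p k) :
    (Gp = Fp → embeddingCount p k ι Gp = 1) ∧ (Gp ≠ Fp → embeddingCount p k ι Gp = 2) := by
  obtain ⟨P, Q, hP, hQ, hPQ, hp⟩ := hsplit
  obtain ⟨n, m, h1, h2, h3⟩ := hW.exists_split hw Fact.out hP hQ hPQ hp
  obtain ⟨a, a', haa, hadd, hmul⟩ := exists_roots h1 h2 h3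
  have hadd' : (a + a' : ℚ_[p]) = t := by exact_mod_cast congrArg ((↑) : ℤ_[p] → ℚ_[p]) hadd
  have hmul' : (a * a' : ℚ_[p]) = -c := by exact_mod_cast congrArg ((↑) : ℤ_[p] → ℚ_[p]) hmul
  obtain ⟨σ, hσ⟩ := exists_algHom hk hW hw (v := (a : ℚ_[p]))
    (by linear_combination (a : ℚ_[p]) * hadd' - hmul')
  obtain ⟨σ', hσ'⟩ := exists_algHom hk hW hw (v := (a' : ℚ_[p]))
    (by linear_combination (a' : ℚ_[p]) * hadd' - hmul')
  obtain ⟨θ, hθO, hθ, hns⟩ := exists_generator hOp hw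
  refine embeddingCount_split hk hF hM ι haa hσ hσ' hW.exists_eq
    (by rw [hθ, hadd', hmul', neg_neg]) (hns σ σ' ?_) hFp hGp (hOG hθO) hGF
  rw [hσ, hσ']
  intro h
  rw [Subtype.ext h, sub_self] at haa
  exact not_isUnit_zero haa

theorem exists_algHom_quadraticAlgebra (hk : Module.finrank ℚ k = 2) (hW : IsIntegralBasis w)
    (hw : w * w = c + t * w) :
    ∃ σ : k →ₐ[ℚ] QuadraticAlgebra ℚ_[p] c t, σ w = omega := by
  refine exists_algHom hk hW hw ?_
  ext <;> simp

theorem embeddingCount_of_isInertPrime (hk : Module.finrank ℚ k = 2) (hF : IsQuaternionAlgebra ℚ F)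
    (hM : IsQuaternionAlgebra k M) (ι : F →ₐ[ℚ] M) (hW : IsIntegralBasis w)
    (hw : w * w = c + t * w) (hFp : IsMaximalOrder p Fp) (hGp : IsOrder p Gp)
    (hOp : Nonempty (Op ≃ₐ[ℤ_[p]] integersAt p k)) (hOG : Op ≤ Gp) (hGF : Gp ≤ Fp)
    (hinert : IsInertPrime p k) :
    (SplitsAt p F → Gp = Fp → embeddingCount p k ι Gp = 1) ∧
      (¬ SplitsAt p F ∨ Gp ≠ Fp → embeddingCount p k ι Gp = 2) := by
  obtain ⟨σ, hσ⟩ := exists_algHom_quadraticAlgebra (p := p) hk hW hw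
  obtain ⟨θ, hθO, hθ, -⟩ := exists_generator hOp hw
  exact embeddingCount_inert hk hF hM ι (Padic.norm_int_le_one c) (Padic.norm_int_le_one t)
    (norm_root_of_inert (hW.not_dvd_of_inert hw Fact.out hinert)) σ hσ hW.exists_eq hθ hFp hGp
    (hOG hθO) hGF

theorem embeddingCount_of_isRamifiedPrime {d : ℕ} (hd : Squarefree d) {s : k}
    (hs : s ^ 2 = -(d : k)) (hk : Module.finrank ℚ k = 2) (hF : IsQuaternionAlgebra ℚ F)
    (hM : IsQuaternionAlgebra k M) (ι : F →ₐ[ℚ] M) (hW : IsIntegralBasis w)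
    (hw : w * w = c + t * w) (hFp : IsMaximalOrder p Fp) (hGp : IsOrder p Gp)
    (hOp : Nonempty (Op ≃ₐ[ℤ_[p]] integersAt p k)) (hOG : Op ≤ Gp) (hGF : Gp ≤ Fp)
    (hram : IsRamifiedPrime p k) :
    (Gp = Fp → embeddingCount p k ι Gp = 1) ∧
    (Gp ≠ Fp → ∃ r : ℕ, 1 ≤ r ∧ orderIndex p Fp Gp = p ^ r ∧
      (p ≠ 2 → SplitsAt p F → embeddingCount p k ι Gp = (tableOddSplit p r : ℕ∞)) ∧
      (p ≠ 2 → ¬ SplitsAt p F → embeddingCount p k ι Gp = (tableOddRamified p r : ℕ∞)) ∧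
      (p = 2 → d % 4 = 1 → SplitsAt p F →
        embeddingCount p k ι Gp = (tableTwoOneSplit r : ℕ∞)) ∧
      (p = 2 → d % 4 = 1 → ¬ SplitsAt p F →
        embeddingCount p k ι Gp = (tableTwoOneRamified r : ℕ∞)) ∧
      (p = 2 → d % 4 = 2 → SplitsAt p F →
        embeddingCount p k ι Gp = (tableTwoTwoSplit r : ℕ∞)) ∧
      (p = 2 → d % 4 = 2 → ¬ SplitsAt p F →
        embeddingCount p k ι Gp = (tableTwoTwoRamified r : ℕ∞))) := by
  have hp : p.Prime := Fact.out
  obtain ⟨P, hP, hPp⟩ := hram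
  -- w is replaced by w - n, whose polynomial is Eisenstein at p; the discriminant does not change.
  obtain ⟨n, h1, h2, h3⟩ := hW.exists_eisenstein hw hp hP hPp (dvd_of_mul_self_eq hp.ne_zero)
  have hW' := hW.sub_intCast n
  have hw' : (w - n) * (w - n) = ((c + t * n - n ^ 2 : ℤ) : 𝓞 k) + ((t - 2 * n : ℤ) : 𝓞 k) * (w - n) := by
    push_cast
    linear_combination hw
  have hdisc : d % 4 = 1 ∨ d % 4 = 2 → (t - 2 * n) ^ 2 + 4 * (c + t * n - n ^ 2) = -4 * d := by
    intro hd4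
    have hint : IsIntegral ℤ s := by
      refine ⟨Polynomial.X ^ 2 + Polynomial.C (d : ℤ), Polynomial.monic_X_pow_add_C _ two_ne_zero, ?_⟩
      simp [hs]
    obtain ⟨s', rfl⟩ : ∃ s' : 𝓞 k, (s' : k) = s := ⟨⟨s, hint⟩, rfl⟩
    refine disc_eq (s := s') hW' hw' hd hd4 (NumberField.RingOfIntegers.ext ?_)
    simpa using hs
  generalize w - n = w' at hW' hw'
  generalize c + t * n - n ^ 2 = c' at *
  generalize t - 2 * n = t' at *
  obtain ⟨σ, hσ⟩ := exists_algHom_quadraticAlgebra (p := p) hk hW' hw'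
  obtain ⟨θ, hθO, hθ, -⟩ := exists_generator hOp hw'
  obtain ⟨hmax, hlt⟩ := embeddingCount_eisenstein hk hF hM ι (norm_eq_inv_of_dvd h1 h2)
    (norm_le_inv_of_dvd h3) σ hσ hW'.exists_eq hθ hFp hGp (hOG hθO) hGF
  -- With t'² + 4c' = -4d and c' even, 4 ∣ t' would make d even.
  have hone : p = 2 → d % 4 = 1 → ‖(t' : ℚ_[p])‖ = (2 : ℝ)⁻¹ := by
    rintro rfl hd1
    have h4 : ¬ ((2 : ℕ) : ℤ) ^ 2 ∣ t' := by
      rintro ⟨u, rfl⟩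
      obtain ⟨v, rfl⟩ := h1
      have h5 : 4 * (u * u) + 2 * v = -d := by
        have := hdisc (Or.inl hd1)
        push_cast at this
        linarith
      generalize u * u = x at h5
      omega
    exact_mod_cast norm_eq_inv_of_dvd h3 h4
  -- Writing t' = 2u and c' = 2v gives u² + 2v = -d, so an even d makes u even.
  have htwo : p = 2 → d % 4 = 2 → ‖(t' : ℚ_[p])‖ ≤ (4 : ℝ)⁻¹ := by
    rintro rfl hd2
    obtain ⟨u, rfl⟩ := h3
    obtain ⟨v, rfl⟩ := h1
    have h5 : u ^ 2 + 2 * v = -d := by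
      have := hdisc (Or.inr hd2)
      push_cast at this
      linarith
    have h6 : Even (u ^ 2) := ⟨-v - (d / 2 : ℕ), by omega⟩
    rw [Int.even_pow' two_ne_zero] at h6
    obtain ⟨x, rfl⟩ := h6
    have h7 := (Padic.norm_int_le_pow_iff_dvd (p := 2) ((2 : ℕ) * (x + x)) 2).2
      ⟨x, by push_cast; ring⟩
    refine h7.trans (le_of_eq ?_)
    norm_num
  refine ⟨hmax, fun hne => ?_⟩
  obtain ⟨r, hr, hidx, r1, r2, r3, r4, r5, r6⟩ := hlt hne
  exact ⟨r, hr, hidx, r1, r2, fun hp2 hd1 => r3 hp2 (hone hp2 hd1),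
    fun hp2 hd1 => r4 hp2 (hone hp2 hd1), fun hp2 hd2 => r5 hp2 (htwo hp2 hd2),
    fun hp2 hd2 => r6 hp2 (htwo hp2 hd2)⟩

end Global

end LocalOrders

theorem mainTheorem7
    -- the imaginary quadratic field `k = ℚ(√-d)`
    (d : ℕ) (hd : Squarefree d)
    (k : Type*) [Field k] [NumberField k]
    (s : k) (hs : s ^ 2 = -(d : k)) (hk : IntermediateField.adjoin ℚ {s} = ⊤)
    -- the quaternion algebra `F` over `ℚ` and its extension `M` to a quaternion algebra over `k`
    (F : Type*) [Ring F] [Algebra ℚ F] (hF : QuatEmb.IsQuaternionAlgebra ℚ F)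
    (M : Type*) [Ring M] [Algebra ℚ M] [Algebra k M] [IsScalarTower ℚ k M]
    (hM : QuatEmb.IsQuaternionAlgebra k M) (ι : F →ₐ[ℚ] M)
    (p : ℕ) [Fact p.Prime] (hp : ¬ QuatEmb.DvdSigma p k F)
    -- the orders `𝔒_p ⊆ 𝔊_p ⊆ 𝔉_p`
    (Fp Op Gp : Subalgebra ℤ_[p] (QuatEmb.Comp p F))
    (hFp : QuatEmb.IsMaximalOrder p Fp) (hGp : QuatEmb.IsOrder p Gp)
    (hOp : Nonempty (Op ≃ₐ[ℤ_[p]] QuatEmb.integersAt p k))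
    (hOG : Op ≤ Gp) (hGF : Gp ≤ Fp) :
    -- `p` split in `k`
    (QuatEmb.IsSplitPrime p k →
      (Gp = Fp → QuatEmb.embeddingCount p k ι Gp = 1) ∧
      (Gp ≠ Fp → QuatEmb.embeddingCount p k ι Gp = 2)) ∧
    -- `p` inert in `k`
    (QuatEmb.IsInertPrime p k →
      (QuatEmb.SplitsAt p F → Gp = Fp → QuatEmb.embeddingCount p k ι Gp = 1) ∧
      (¬ QuatEmb.SplitsAt p F ∨ Gp ≠ Fp → QuatEmb.embeddingCount p k ι Gp = 2)) ∧
    -- `p` ramified in `k`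
    (QuatEmb.IsRamifiedPrime p k →
      (Gp = Fp → QuatEmb.embeddingCount p k ι Gp = 1) ∧
      (Gp ≠ Fp → ∃ r : ℕ, 1 ≤ r ∧ QuatEmb.orderIndex p Fp Gp = p ^ r ∧
        (p ≠ 2 → QuatEmb.SplitsAt p F →
          QuatEmb.embeddingCount p k ι Gp = (QuatEmb.tableOddSplit p r : ℕ∞)) ∧
        (p ≠ 2 → ¬ QuatEmb.SplitsAt p F →
          QuatEmb.embeddingCount p k ι Gp = (QuatEmb.tableOddRamified p r : ℕ∞)) ∧
        (p = 2 → d % 4 = 1 → QuatEmb.SplitsAt p F →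
          QuatEmb.embeddingCount p k ι Gp = (QuatEmb.tableTwoOneSplit r : ℕ∞)) ∧
        (p = 2 → d % 4 = 1 → ¬ QuatEmb.SplitsAt p F →
          QuatEmb.embeddingCount p k ι Gp = (QuatEmb.tableTwoOneRamified r : ℕ∞)) ∧
        (p = 2 → d % 4 = 2 → QuatEmb.SplitsAt p F →
          QuatEmb.embeddingCount p k ι Gp = (QuatEmb.tableTwoTwoSplit r : ℕ∞)) ∧
        (p = 2 → d % 4 = 2 → ¬ QuatEmb.SplitsAt p F →
          QuatEmb.embeddingCount p k ι Gp = (QuatEmb.tableTwoTwoRamified r : ℕ∞)))) := by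
  have hk2 := LocalOrders.finrank_eq_two_of_sq_eq hd.ne_zero hs hk
  obtain ⟨w, hW⟩ := LocalOrders.exists_isIntegralBasis hk2
  obtain ⟨c, t, hw⟩ := hW.exists_eq (w * w)
  refine ⟨fun hsplit => ?_, fun hinert => ?_, fun hram => ?_⟩
  · exact LocalOrders.embeddingCount_of_isSplitPrime hk2 hF hM ι hW hw hFp hGp hOp hOG hGF hsplit
  · exact LocalOrders.embeddingCount_of_isInertPrime hk2 hF hM ι hW hw hFp hGp hOp hOG hGF hinert
  · exact LocalOrders.embeddingCount_of_isRamifiedPrime hd hs hk2 hF hM ι hW hw hFp hGp hOp hOG hGF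
      hram
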